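/- For complex sequences $\alpha=(\alpha_n)_{n\ge 0}$ with $\sum_n (n+1)^2|\alpha_n|^2<\infty$ let $S_{njkm}=\min(n,j,k,m)+1$ and $$H(\alpha)=\sum_{n,j\ge 0}\sum_{k=0}^{n+j}S_{n,j,k,n+j-k}\,\bar\alpha_n\bar\alpha_j\alpha_k\alpha_{n+j-k},\quad Q(\alpha)=\sum_n (n+1)|\alpha_n|^2,\quad E(\alpha)=\sum_n (n+1)^2|\alpha_n|^2,$$ and use the distance $\sqrt{E(\alpha-\beta)}$. For real $\omega$ consider real finite-energy sequences $A$ solving the stationary equations with $\lambda=1$, $$(n+1)(\lambda-n\omega)A_n=\sum_{j\ge 0}\sum_{k=0}^{n+j}S_{n,j,k,n+j-k}A_jA_kA_{n+j-k},\qquad n\ge 0,$$ at distance less than $r$ from $(\delta_{n0})_n$. The branches bifurcating from this state at $\omega_*=1/6$ are: (i) $A_2=0$, $A_3\ne0$; (ii) $A_2\neq0$, $A_3=0$; (iii) $A_2\ne0$, $A_3\neq0$. For such $A$ define in $\ell^2(\mathbb N)$, on maximal domains, the operators $$(L_\pm a)_n=\sum_{j\ge0}\sum_{k=0}^{n+j}S_{n,j,k,n+j-k}\bigl[2A_jA_{n+j-k}a_k\pm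 A_kA_{n+j-k}a_j\bigr]-(n+1)(\lambda-n\omega)a_n .$$ Let $n(\cdot)$ and $z(\cdot)$ be the numbers of negative and of zero eigenvalues, with multiplicity. Let $M=\mathrm{diag}(1,2,3,\dots)$, and let $n_c(L_+)$, $z_c(L_+)$ be the same numbers for $PL_+P$ on $\{MA,M^2A\}^\perp$, where $P$ is the orthogonal projection of $\ell^2(\mathbb{N})$ onto this subspace. "Subject to fixed $Q$ and $E$" refers to the finite-energy complex sequences with the same $Q$ and $E$ as $A$. A critical point there is a point at which the derivative of $H$ vanishes in all directions in which those of $Q$ and $E$ vanish. A minimizer is a critical point that is a local minimizer. A saddle point is a critical point with both smaller and larger values of $H$ arbitrarily near it. There is $r_0>0$ such that for each $r\in(0,r_0]$ there is $\delta>0$ with the following properties. * For each $\omega\in(\frac16,\frac16+\delta)$ all three branches contain a state $A$; branch (ii) contains one with $A_2>0$ and one with $A_2<0$. * For all sufficiently small $p>0$ there is $c<0$ with $\lambda_+=1$, $0<|\omega_+-\frac16|<\delta$, such that the explicit pair state with the upper sign $$A_n=c\Bigl[(1-p^2)n-\tfrac12\bigl(1+5p^2+\sqrt{1-14p^2+p^4}\bigr)\Bigr]p^n,$$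 $$\lambda_+=\frac{c^2}{6}\Bigl(\frac{3-4p^2}{1-p^2}+\frac{(3+4p^2)\sqrt{1-14p^2+p^4}}{(1-p^2)^2}\Bigr),\qquad \omega_+=\frac{c^2}{12}\,\frac{1+p^2+\sqrt{1-14p^2+p^4}}{1-p^2},$$ belongs to branch (iii) with $\omega=\omega_+$. * For every $\omega\ne\frac16$ with $|\omega-\frac16|<\delta$: (i) every $A$ in branch (i) is a saddle point of $H$ subject to fixed $Q$ and $E$, with $n_c(L_+)=1$, $n(L_-)=1$; (ii) every $A$ in branch (ii) is a saddle point of $H$ subject to fixed $Q$ and $E$, with $n_c(L_+)=0$, $n(L_-)=1$ if $A_2>0$, and $n_c(L_+)=1$, $n(L_-)=0$ if $A_2<0$ (the two signs of $A_2$ are exchanged by the phase rotation $A_n\mapsto i^nA_n$, which swaps the real and imaginary parts of the odd modes of a perturbation, up to sign); (iii) every $A$ in branch (iii) is a minimizer of $H$ subject to fixed $Q$ and $E$, with $n_c(L_+)=0$, $n(L_-)=0$. In all three cases $A$ is degenerate only with respect to the two phase rotations $\alpha_n\mapsto e^{i\theta}\alpha_n$ and $\alpha_n\mapsto e^{in\phi}\alpha_n$: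 $z(L_+)=0$, $z_c(L_+)=0$, $z(L_-)=2$, and $\ker L_-=\mathrm{span}\{A,MA\}$. -/

import Mathlib

open scoped ComplexConjugate

namespace ConformalFlow

noncomputable section

/-- The interaction coefficients `S_{njkm} = min(n,j,k,m) + 1`. -/
def coupling (n j k m : ℕ) : ℕ := min (min n j) (min k m) + 1

/-! ### Conserved quantities on complex sequences -/

/-- The space of complex sequences on which `E` (hence also `Q` and `H`) is finite:
`((n+1) α_n)` is square summable. -/
def FiniteEnergy (α : ℕ → ℂ) : Prop :=
  Memℓp (fun n : ℕ => ((n : ℂ) + 1) * α n) 2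

/-- `Q(α) = ∑ (n+1) |α_n|²`. -/
def charge (α : ℕ → ℂ) : ℝ := ∑' n : ℕ, ((n : ℝ) + 1) * ‖α n‖ ^ 2

/-- `E(α) = ∑ (n+1)² |α_n|²`. -/
def linEnergy (α : ℕ → ℂ) : ℝ := ∑' n : ℕ, ((n : ℝ) + 1) ^ 2 * ‖α n‖ ^ 2

/-- `H(α) = ∑_n ∑_j ∑_{k ≤ n+j} S_{njk,n+j-k} ᾱ_n ᾱ_j α_k α_{n+j-k}`.
The sum is real; the real part only fixes the type. -/
def hamiltonian (α : ℕ → ℂ) : ℝ :=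
  (∑' n : ℕ, ∑' j : ℕ, ∑ k ∈ Finset.range (n + j + 1),
    (coupling n j k (n + j - k) : ℂ) * conj (α n) * conj (α j) * α k * α (n + j - k)).re

/-- The complex sequence with the given real amplitudes. -/
def cplx (A : ℕ → ℝ) : ℕ → ℂ := fun n => (A n : ℂ)

/-- Distance in the energy space: `dist(α, β)² = E(α - β)`. -/
def energyDist (α β : ℕ → ℂ) : ℝ := Real.sqrt (linEnergy (fun n => α n - β n))

/-! ### Stationary states -/

/-- The stationary equations for real amplitudes. -/
def IsStationary (lam ω : ℝ) (A : ℕ → ℝ) : Prop :=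
  ∀ n : ℕ, ((n : ℝ) + 1) * (lam - n * ω) * A n =
    ∑' j : ℕ, ∑ k ∈ Finset.range (n + j + 1),
      (coupling n j k (n + j - k) : ℝ) * A j * A k * A (n + j - k)

/-- The lowest single-mode state `A_n = δ_{n0}`. -/
def lowestMode : ℕ → ℝ := fun n => if n = 0 then 1 else 0

/-- Real finite-energy stationary states with `λ = 1` and frequency `ω` at distance less than `r`
from the lowest single-mode state. -/
def localStates (r ω : ℝ) : Set (ℕ → ℝ) :=
  {A | FiniteEnergy (cplx A) ∧ IsStationary 1 ω A ∧ energyDist (cplx A) (cplx lowestMode) < r}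

/-- Branch (i): `ε = A₂ = 0`, `μ = A₃ ≠ 0`. -/
def branchOne (r ω : ℝ) : Set (ℕ → ℝ) := {A | A ∈ localStates r ω ∧ A 2 = 0 ∧ A 3 ≠ 0}

/-- Branch (ii): `ε = A₂ ≠ 0`, `μ = A₃ = 0`. -/
def branchTwo (r ω : ℝ) : Set (ℕ → ℝ) := {A | A ∈ localStates r ω ∧ A 2 ≠ 0 ∧ A 3 = 0}

/-- Branch (iii): `ε = A₂ ≠ 0`, `μ = A₃ ≠ 0`. -/
def branchThree (r ω : ℝ) : Set (ℕ → ℝ) := {A | A ∈ localStates r ω ∧ A 2 ≠ 0 ∧ A 3 ≠ 0}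

/-! ### The explicit pair state with the upper sign -/

/-- `√(1 - 14 p² + p⁴)`. -/
def pairRoot (p : ℝ) : ℝ := Real.sqrt (1 - 14 * p ^ 2 + p ^ 4)

def pairState (c p : ℝ) : ℕ → ℝ := fun n =>
  c * ((1 - p ^ 2) * n - 1 / 2 * (1 + 5 * p ^ 2 + pairRoot p)) * p ^ n

def pairLambda (c p : ℝ) : ℝ :=
  c ^ 2 / 6 * ((3 - 4 * p ^ 2) / (1 - p ^ 2)
    + (3 + 4 * p ^ 2) * pairRoot p / (1 - p ^ 2) ^ 2)

def pairOmega (c p : ℝ) : ℝ :=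
  c ^ 2 / 12 * ((1 + p ^ 2 + pairRoot p) / (1 - p ^ 2))

/-! ### The Hessian operators and their indices -/

/-- The action of `L_s` (`s = 1` for `L₊`, `s = -1` for `L₋`) at the real state `A`. -/
def hessian (s : ℝ) (A : ℕ → ℝ) (lam ω : ℝ) (a : ℕ → ℝ) : ℕ → ℝ := fun n =>
  (∑' j : ℕ, ∑ k ∈ Finset.range (n + j + 1),
    (coupling n j k (n + j - k) : ℝ) *
      (2 * A j * A (n + j - k) * a k + s * (A k * A (n + j - k) * a j)))
  - ((n : ℝ) + 1) * (lam - n * ω) * a n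

/-- The eigenspace in `ℓ²(ℕ)` of `L_s`, on its maximal domain, for the real number `ν`. -/
def eigenvectors (s : ℝ) (A : ℕ → ℝ) (lam ω ν : ℝ) : Set (ℕ → ℝ) :=
  {a | Memℓp a 2 ∧ ∀ n, hessian s A lam ω a n = ν * a n}

/-- The number of negative eigenvalues of `L_s`, with multiplicity: the dimension of the span of
all the eigenvectors with a negative eigenvalue. -/
def negIndex (s : ℝ) (A : ℕ → ℝ) (lam ω : ℝ) : Cardinal :=
  Module.rank ℝ (Submodule.span ℝ (⋃ ν ∈ Set.Iio (0 : ℝ), eigenvectors s A lam ω ν))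

/-- The multiplicity of the zero eigenvalue of `L_s`. -/
def nullity (s : ℝ) (A : ℕ → ℝ) (lam ω : ℝ) : Cardinal :=
  Module.rank ℝ (Submodule.span ℝ (eigenvectors s A lam ω 0))

/-- `M A` with `M = diag(1,2,3,…)`. -/
def weighted (A : ℕ → ℝ) : ℕ → ℝ := fun n => ((n : ℝ) + 1) * A n

/-- The subspace of `ℓ²(ℕ)` orthogonal to `M A` and `M² A`. -/
def constraintSpace (A : ℕ → ℝ) : Set (ℕ → ℝ) :=
  {a | Memℓp a 2 ∧ ∑' n, weighted A n * a n = 0 ∧ ∑' n, weighted (weighted A) n * a n = 0}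

/-- The eigenspace for `ν` of `P L₊ P` on the constraint space, `P` being the orthogonal
projection of `ℓ²(ℕ)` onto this space. -/
def constrainedEigenvectors (A : ℕ → ℝ) (lam ω ν : ℝ) : Set (ℕ → ℝ) :=
  {a | a ∈ constraintSpace A ∧ Memℓp (hessian 1 A lam ω a) 2 ∧
    ∀ c ∈ constraintSpace A, ∑' n, (hessian 1 A lam ω a n - ν * a n) * c n = 0}

/-- `n_c(L₊)`: the number of negative eigenvalues of `L₊` constrained to the constraint space,
with multiplicity. -/
def constrainedNegIndex (A : ℕ → ℝ) (lam ω : ℝ) : Cardinal :=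
  Module.rank ℝ (Submodule.span ℝ (⋃ ν ∈ Set.Iio (0 : ℝ), constrainedEigenvectors A lam ω ν))

/-- `z_c(L₊)`: the multiplicity of the zero eigenvalue of the constrained `L₊`. -/
def constrainedNullity (A : ℕ → ℝ) (lam ω : ℝ) : Cardinal :=
  Module.rank ℝ (Submodule.span ℝ (constrainedEigenvectors A lam ω 0))

/-- The state is degenerate only with respect to the two phase rotations, whose generators at `A`
are `i A` and `i n A_n`: `L₊`, constrained or not, has trivial kernel, and the kernel of `L₋` is
the two-dimensional space spanned by `A` and `M A`. -/
def DegenerateOnlyByPhases (A : ℕ → ℝ) (lam ω : ℝ) : Prop :=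
  nullity 1 A lam ω = 0 ∧ constrainedNullity A lam ω = 0 ∧ nullity (-1) A lam ω = 2 ∧
    eigenvectors (-1) A lam ω 0 = (Submodule.span ℝ {A, weighted A} : Set (ℕ → ℝ))

/-! ### Critical points of `H` subject to fixed `Q` and `E` -/

/-- The sequences of finite energy with the same `Q` and `E` as `α`. -/
def levelSet (α : ℕ → ℂ) : Set (ℕ → ℂ) :=
  {β | FiniteEnergy β ∧ charge β = charge α ∧ linEnergy β = linEnergy α}

/-- `α` is a critical point of `H` subject to fixed `Q` and `E`: the derivative of `H` vanishes in
every direction in which the derivatives of `Q` and `E` vanish. -/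
def IsConstrainedCritical (α : ℕ → ℂ) : Prop :=
  ∀ h : ℕ → ℂ, FiniteEnergy h →
    HasDerivAt (fun t : ℝ => charge (fun n => α n + t * h n)) 0 0 →
    HasDerivAt (fun t : ℝ => linEnergy (fun n => α n + t * h n)) 0 0 →
    HasDerivAt (fun t : ℝ => hamiltonian (fun n => α n + t * h n)) 0 0

/-- A (local) minimizer of `H` subject to fixed `Q` and `E`. -/
def IsConstrainedMinimizer (α : ℕ → ℂ) : Prop :=
  IsConstrainedCritical α ∧
    ∃ ρ > 0, ∀ β ∈ levelSet α, energyDist β α < ρ → hamiltonian α ≤ hamiltonian β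

/-- A saddle point of `H` subject to fixed `Q` and `E`: a constrained critical point near which
`H` takes smaller and larger values under the constraints. -/
def IsConstrainedSaddle (α : ℕ → ℂ) : Prop :=
  IsConstrainedCritical α ∧ ∀ ρ > 0,
    (∃ β ∈ levelSet α, energyDist β α < ρ ∧ hamiltonian β < hamiltonian α) ∧
    (∃ β ∈ levelSet α, energyDist β α < ρ ∧ hamiltonian α < hamiltonian β)

end

end ConformalFlow

/-! At ω = 1/6 the stationary equations, linearized at the lowest mode, have the eigenvalue 2 in
mode 0 and (n-2)(n-3)/6 in mode n ≥ 1, so exactly the modes 2 and 3 are critical. For prescribed ε =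
A₂ and μ = A₃ a contraction solves all other equations (`exists_reduced`), and `reduced_lipschitz`
shows that every nearby state is obtained in this way. With Ω = ω - 1/6, inserting A₁ ≈ -6εμ, A₄ ≈
-3ε², A₅ ≈ -2εμ, A₆ ≈ 3ε³ - μ²/2 in the rows 2 and 3 leaves the bifurcation equations
(`ox_reduced_two`, `ox_reduced_three`) ε (6Ω - 7ε² - 14μ²) ≈ 0 and μ (12Ω - 14ε² - μ² + 108ε³) ≈ 0.
So Ω ≈ μ²/12 on (i), Ω ≈ 7ε²/6 on (ii), and on (iii) the two brackets together force μ² ≈ -4ε³. The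
last relation dictates the scaling ε ~ s², μ ~ s³ in which everything is expanded (`GaugedState`).
Divisibility by three (for ε = 0) and parity (for μ = 0) are preserved by the resonant interaction;
the factors x and y record this, so that the error in row 2 is proportional to ε and that in row 3
to μ, and both can be divided by the amplitude, uniformly over the branches.

The forms of L₊ and L₋ are coercive away from the modes 2 and 3 (for L₋ also away from mode 0).
Their signs are therefore decided on two approximate kernel vectors, by `os_matTwo`, `os_matThree`
and `os_matMixed`. For L₊ the reduced matrix is, to leading order, the Jacobian of the bifurcation
equations: diag(-27μ²/2, -2μ²) on (i), diag(-14ε², 108ε³) on (ii), and entries -14ε², -28εμ, -2μ² on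
(iii). Fixing Q and E imposes 6ε x + 12μ y ≈ 0 on the critical components, which removes one
negative direction; what remains is -27μ²/2, 108ε³ and 54μ². For L₋ the kernel vectors A and MA
account for mode 0 and one critical mode; what remains is -27μ²/2 on (i), -108ε³ on (ii), and -216ε³
> 0 on (iii). These signs are the asserted indices.

Two transfers complete the argument. Signs of forms become eigenvalue counts without compactness:
`NegOn.exists_neg_eigen` produces the negative eigenvalue by Lax–Milgram and the intermediate value
theorem, and ℓ² eigenvectors have finite energy. Signs also become statements on H through the
expansion `hamiltonian_expand`, which is exact: saddles by curves inside the level set, minimizers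
by rotating a competitor to maximal overlap with A, which makes its imaginary part orthogonal to A
and MA.

Branches (i) and (ii) exist by the intermediate value theorem in a symmetric subspace
(`exists_pure_states`). Branch (iii) is the explicit pair state, whose frequencies fill an interval
to the right of 1/6 (`exists_pair_states`). -/

namespace ConformalFlow

noncomputable section

/-! ### Sums over resonant quadruples -/

/-- Resonant quadruples `n + j = k + m`. -/
@[ext] structure Quad where
  n : ℕ
  j : ℕ
  k : ℕ
  m : ℕ
  res : n + j = k + m

/-- Resonant quadruples are parametrized by `n`, `j` and `k ≤ n + j`. -/
def quadEquiv : (Σ p : ℕ × ℕ, Fin (p.1 + p.2 + 1)) ≃ Quad where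
  toFun p := ⟨p.1.1, p.1.2, p.2, p.1.1 + p.1.2 - p.2, by have := p.2.2; omega⟩
  invFun q := ⟨(q.n, q.j), ⟨q.k, by have := q.res; simp only; omega⟩⟩
  left_inv p := by rcases p with ⟨⟨n, j⟩, k⟩; rfl
  right_inv q := by
    have := q.res
    ext <;> simp only
    omega

/-- Fubini along `quadEquiv`, whose fibres in k are finite: summability over quadruples yields the
iterated sums in which H, the stationary equations and L± are written. -/
theorem quad_rows {𝕜 : Type*} [NormedAddCommGroup 𝕜] [CompleteSpace 𝕜] {G : ℕ → ℕ → ℕ → ℕ → 𝕜}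
    (h : Summable fun q : Quad => G q.n q.j q.k q.m) :
    (∀ n, Summable fun j => ∑ k ∈ Finset.range (n + j + 1), G n j k (n + j - k)) ∧
    (Summable fun n => ∑' j, ∑ k ∈ Finset.range (n + j + 1), G n j k (n + j - k)) ∧
    ∑' n, ∑' j, ∑ k ∈ Finset.range (n + j + 1), G n j k (n + j - k) =
      ∑' q : Quad, G q.n q.j q.k q.m := by
  have h1 : Summable fun p : (Σ p : ℕ × ℕ, Fin (p.1 + p.2 + 1)) =>
      G p.1.1 p.1.2 p.2 (p.1.1 + p.1.2 - p.2) := (quadEquiv.summable_iff).2 h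
  have e1 : ∑' q : Quad, G q.n q.j q.k q.m = ∑' p : (Σ p : ℕ × ℕ, Fin (p.1 + p.2 + 1)),
      G p.1.1 p.1.2 p.2 (p.1.1 + p.1.2 - p.2) := (quadEquiv.tsum_eq
        (fun q : Quad => G q.n q.j q.k q.m)).symm
  have e2 : ∀ p : ℕ × ℕ, ∑' k : Fin (p.1 + p.2 + 1), G p.1 p.2 k (p.1 + p.2 - k) =
      ∑ k ∈ Finset.range (p.1 + p.2 + 1), G p.1 p.2 k (p.1 + p.2 - k) := by
    intro p
    rw [tsum_fintype, Finset.sum_range]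
  have h2 : Summable fun p : ℕ × ℕ =>
      ∑ k ∈ Finset.range (p.1 + p.2 + 1), G p.1 p.2 k (p.1 + p.2 - k) := by
    have := h1.sigma
    simpa only [e2] using this
  refine ⟨fun n => h2.prod_factor n, h2.prod, ?_⟩
  rw [e1, h1.tsum_sigma, ← h2.tsum_prod]
  exact tsum_congr fun p => (e2 p).symm

/-- Three indices determine a resonant quadruple, so a sum over quadruples is part of a full triple
sum, and that factors. The map φ selects which index is left out. -/
theorem summable_of_three {ι : Type*} {f g h : ℕ → ℝ} (f0 : ∀ n, 0 ≤ f n) (g0 : ∀ n, 0 ≤ g n)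
    (h0 : ∀ n, 0 ≤ h n) (sf : Summable f) (sg : Summable g) (sh : Summable h)
    (φ : ι → ℕ × ℕ × ℕ) (hφ : Function.Injective φ) :
    Summable (fun q => f (φ q).1 * (g (φ q).2.1 * h (φ q).2.2)) ∧
    ∑' q, f (φ q).1 * (g (φ q).2.1 * h (φ q).2.2) ≤ (∑' n, f n) * ((∑' n, g n) * ∑' n, h n) := by
  have s1 : Summable fun p : ℕ × ℕ => g p.1 * h p.2 := sg.mul_of_nonneg sh g0 h0
  have s2 : Summable fun p : ℕ × ℕ × ℕ => f p.1 * (g p.2.1 * h p.2.2) :=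
    sf.mul_of_nonneg s1 f0 fun p => mul_nonneg (g0 _) (h0 _)
  have e : ∑' p : ℕ × ℕ × ℕ, f p.1 * (g p.2.1 * h p.2.2) =
      (∑' n, f n) * ((∑' n, g n) * ∑' n, h n) := by
    rw [sg.tsum_mul_tsum sh s1, sf.tsum_mul_tsum s1 s2]
  refine ⟨s2.comp_injective hφ, ?_⟩
  rw [← e]
  exact tsum_comp_le_tsum_of_inj s2
    (fun p => mul_nonneg (f0 _) (mul_nonneg (g0 _) (h0 _))) hφ

namespace Quad

theorem inj_jkm : Function.Injective fun q : Quad => (q.j, q.k, q.m) := by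
  intro p q h
  have := p.res; have := q.res
  simp only [Prod.mk.injEq] at h
  ext <;> omega

theorem inj_nkm : Function.Injective fun q : Quad => (q.n, q.k, q.m) := by
  intro p q h
  have := p.res; have := q.res
  simp only [Prod.mk.injEq] at h
  ext <;> omega

theorem inj_njm : Function.Injective fun q : Quad => (q.n, q.j, q.m) := by
  intro p q h
  have := p.res; have := q.res
  simp only [Prod.mk.injEq] at h
  ext <;> omega

/-- Exchange of the first two indices. -/
def swapNJ : Quad ≃ Quad where
  toFun q := ⟨q.j, q.n, q.k, q.m, by have := q.res; omega⟩
  invFun q := ⟨q.j, q.n, q.k, q.m, by have := q.res; omega⟩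
  left_inv _ := rfl
  right_inv _ := rfl

/-- Exchange of the last two indices. -/
def swapKM : Quad ≃ Quad where
  toFun q := ⟨q.n, q.j, q.m, q.k, by have := q.res; omega⟩
  invFun q := ⟨q.n, q.j, q.m, q.k, by have := q.res; omega⟩
  left_inv _ := rfl
  right_inv _ := rfl

/-- Exchange of the first pair with the second pair. -/
def swapPairs : Quad ≃ Quad where
  toFun q := ⟨q.k, q.m, q.n, q.j, q.res.symm⟩
  invFun q := ⟨q.k, q.m, q.n, q.j, q.res.symm⟩
  left_inv _ := rfl
  right_inv _ := rfl

end Quad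

theorem coupling_swap_left (n j k m : ℕ) : coupling j n k m = coupling n j k m := by
  simp only [coupling]; omega

theorem coupling_swap_right (n j k m : ℕ) : coupling n j m k = coupling n j k m := by
  simp only [coupling]; omega

theorem coupling_swap_pairs (n j k m : ℕ) : coupling k m n j = coupling n j k m := by
  simp only [coupling]; omega

theorem coupling_le_fst (n j k m : ℕ) : (coupling n j k m : ℝ) ≤ n + 1 := by
  have : coupling n j k m ≤ n + 1 := by simp only [coupling]; omega
  exact_mod_cast this

theorem coupling_le_snd (n j k m : ℕ) : (coupling n j k m : ℝ) ≤ j + 1 := by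
  have : coupling n j k m ≤ j + 1 := by simp only [coupling]; omega
  exact_mod_cast this

/-- The term of the quadrilinear form at a resonant quadruple. -/
def quadTerm (a b c d : ℕ → ℝ) (q : Quad) : ℝ :=
  (coupling q.n q.j q.k q.m : ℝ) * a q.n * b q.j * c q.k * d q.m

/-- The real quadrilinear form `∑ S a_n b_j c_k d_m` over resonant quadruples. -/
def quadForm (a b c d : ℕ → ℝ) : ℝ := ∑' q, quadTerm a b c d q

theorem quadForm_swap_left (a b c d : ℕ → ℝ) : quadForm b a c d = quadForm a b c d := by
  rw [quadForm, quadForm, ← Quad.swapNJ.tsum_eq]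
  refine tsum_congr fun q => ?_
  simp only [quadTerm, Quad.swapNJ, Equiv.coe_fn_mk]
  rw [coupling_swap_left]
  ring

theorem quadForm_swap_right (a b c d : ℕ → ℝ) : quadForm a b d c = quadForm a b c d := by
  rw [quadForm, quadForm, ← Quad.swapKM.tsum_eq]
  refine tsum_congr fun q => ?_
  simp only [quadTerm, Quad.swapKM, Equiv.coe_fn_mk]
  rw [coupling_swap_right]
  ring

theorem quadForm_swap_pairs (a b c d : ℕ → ℝ) : quadForm c d a b = quadForm a b c d := by
  rw [quadForm, quadForm, ← Quad.swapPairs.tsum_eq]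
  refine tsum_congr fun q => ?_
  simp only [quadTerm, Quad.swapPairs, Equiv.coe_fn_mk]
  rw [coupling_swap_pairs]
  ring

/-- The trilinear interaction `∑_j ∑_{k ≤ n+j} S b_j c_k d_{n+j-k}`. -/
def interaction (b c d : ℕ → ℝ) (n : ℕ) : ℝ :=
  ∑' j, ∑ k ∈ Finset.range (n + j + 1),
    (coupling n j k (n + j - k) : ℝ) * b j * c k * d (n + j - k)

theorem quadForm_eq_tsum_interaction {a b c d : ℕ → ℝ} (h : Summable (quadTerm a b c d)) :
    (Summable fun n => a n * interaction b c d n) ∧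
    quadForm a b c d = ∑' n, a n * interaction b c d n := by
  have := quad_rows (G := fun n j k m => (coupling n j k m : ℝ) * a n * b j * c k * d m) h
  have e : ∀ n, ∑' j, ∑ k ∈ Finset.range (n + j + 1),
      (coupling n j k (n + j - k) : ℝ) * a n * b j * c k * d (n + j - k) =
      a n * interaction b c d n := by
    intro n
    rw [interaction, ← tsum_mul_left]
    refine tsum_congr fun j => ?_
    rw [Finset.mul_sum]
    exact Finset.sum_congr rfl fun k _ => by ring
  simp only [e] at this
  exact ⟨this.2.1, this.2.2.symm⟩

/-- The unit sequence at `i`. -/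
def unitSeq (i : ℕ) : ℕ → ℝ := fun n => if n = i then 1 else 0

theorem interaction_eq_quadForm {b c d : ℕ → ℝ} {i : ℕ}
    (h : Summable (quadTerm (unitSeq i) b c d)) :
    (Summable fun j => ∑ k ∈ Finset.range (i + j + 1),
      (coupling i j k (i + j - k) : ℝ) * b j * c k * d (i + j - k)) ∧
    interaction b c d i = quadForm (unitSeq i) b c d := by
  refine ⟨?_, ?_⟩
  · have := (quad_rows
      (G := fun n j k m => (coupling n j k m : ℝ) * unitSeq i n * b j * c k * d m) h).1 i
    simpa [unitSeq] using this
  · rw [(quadForm_eq_tsum_interaction h).2, tsum_eq_single i]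
    · simp [unitSeq]
    · intro n hn
      simp [unitSeq, hn]

/-- Absolute convergence of the quadrilinear form from a bound by three summable factors. -/
theorem quadTerm_summable_of_le {a b c d : ℕ → ℝ} {f g h : ℕ → ℝ} (f0 : ∀ n, 0 ≤ f n)
    (g0 : ∀ n, 0 ≤ g n) (h0 : ∀ n, 0 ≤ h n) (sf : Summable f) (sg : Summable g) (sh : Summable h)
    {φ : Quad → ℕ × ℕ × ℕ} (hφ : Function.Injective φ)
    (hle : ∀ q, |quadTerm a b c d q| ≤ f (φ q).1 * (g (φ q).2.1 * h (φ q).2.2)) :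
    Summable (quadTerm a b c d) ∧
    |quadForm a b c d| ≤ (∑' n, f n) * ((∑' n, g n) * ∑' n, h n) := by
  obtain ⟨s, t⟩ := summable_of_three f0 g0 h0 sf sg sh φ hφ
  have s' : Summable fun q => |quadTerm a b c d q| :=
    Summable.of_nonneg_of_le (fun q => abs_nonneg _) hle s
  refine ⟨s'.of_abs, le_trans ?_ t⟩
  calc |quadForm a b c d| ≤ ∑' q, |quadTerm a b c d q| := by
        simpa [quadForm] using norm_tsum_le_tsum_norm (f := quadTerm a b c d) s'
    _ ≤ _ := s'.tsum_le_tsum hle s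

theorem abs_quadTerm (a b c d : ℕ → ℝ) (q : Quad) : |quadTerm a b c d q| =
    (coupling q.n q.j q.k q.m : ℝ) * |a q.n| * |b q.j| * |c q.k| * |d q.m| := by
  simp [quadTerm, abs_mul]

/-- The bound used on finite-energy sequences. -/
theorem quadForm_bound {a b c d : ℕ → ℝ} {C : ℝ} (ha : ∀ n : ℕ, |((n : ℝ) + 1) * a n| ≤ C)
    (hb : Summable fun n => |b n|) (hc : Summable fun n => |c n|) (hd : Summable fun n => |d n|) :
    Summable (quadTerm a b c d) ∧
    |quadForm a b c d| ≤ C * (∑' n, |b n|) * ((∑' n, |c n|) * ∑' n, |d n|) := by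
  have C0 : 0 ≤ C := (abs_nonneg _).trans (ha 0)
  have := quadTerm_summable_of_le (a := a) (b := b) (c := c) (d := d) (f := fun n => C * |b n|)
    (g := fun n => |c n|) (h := fun n => |d n|)
    (fun n => by positivity) (fun n => abs_nonneg _) (fun n => abs_nonneg _) (hb.mul_left C) hc hd
    Quad.inj_jkm (fun q => by
      rw [abs_quadTerm]
      have h1 := ha q.n
      rw [abs_mul, abs_of_nonneg (by positivity : (0 : ℝ) ≤ (q.n : ℝ) + 1)] at h1
      have h2 : (coupling q.n q.j q.k q.m : ℝ) * |a q.n| ≤ C :=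
        (mul_le_mul_of_nonneg_right (coupling_le_fst _ _ _ _) (abs_nonneg _)).trans h1
      calc _ ≤ C * |b q.j| * |c q.k| * |d q.m| := by gcongr
        _ = _ := by ring)
  rwa [tsum_mul_left] at this

theorem unitSeq_nonneg (i n : ℕ) : 0 ≤ unitSeq i n := by
  unfold unitSeq; split_ifs <;> norm_num

theorem summable_unitSeq (i : ℕ) : Summable (unitSeq i) :=
  summable_of_ne_finset_zero (s := {i}) fun n hn => by simp at hn; simp [unitSeq, hn]

theorem tsum_unitSeq (i : ℕ) : ∑' n, unitSeq i n = 1 := by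
  rw [tsum_eq_single i] <;> simp +contextual [unitSeq]

/-- The bound on the row of `L_s` against a bounded sequence in the third place. -/
theorem quadForm_unit_bound_third {A a : ℕ → ℝ} {C : ℝ} (i : ℕ) (ha : ∀ n, |a n| ≤ C)
    (hA : Summable fun n : ℕ => ((n : ℝ) + 1) * |A n|) :
    Summable (quadTerm (unitSeq i) A a A) ∧
    |quadForm (unitSeq i) A a A| ≤ C * (∑' n : ℕ, ((n : ℝ) + 1) * |A n|) * (∑' n, |A n|) := by
  have C0 : 0 ≤ C := (abs_nonneg _).trans (ha 0)
  have hA' : Summable fun n => |A n| := Summable.of_nonneg_of_le (fun n => abs_nonneg _)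
    (fun n => le_mul_of_one_le_left (abs_nonneg _) (by linarith [n.cast_nonneg (α := ℝ)])) hA
  -- The merely bounded sequence sits at the omitted index k; the factor S ≤ j + 1 is paid by the
  -- weighted summability of A at j.
  have := quadTerm_summable_of_le (a := unitSeq i) (b := A) (c := a) (d := A)
    (f := unitSeq i) (g := fun n => C * (((n : ℝ) + 1) * |A n|)) (h := fun n => |A n|)
    (unitSeq_nonneg i) (fun n => by positivity) (fun n => abs_nonneg _) (summable_unitSeq i)
    (hA.mul_left C) hA' Quad.inj_njm (fun q => by
      rw [abs_quadTerm, abs_of_nonneg (unitSeq_nonneg i q.n)]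
      have := ha q.k
      have := coupling_le_snd q.n q.j q.k q.m
      have := unitSeq_nonneg i q.n
      calc _ ≤ ((q.j : ℝ) + 1) * unitSeq i q.n * |A q.j| * C * |A q.m| := by gcongr
        _ = _ := by ring)
  rw [tsum_unitSeq, tsum_mul_left, one_mul] at this
  exact this

/-- The bound on the row of `L_s` against a bounded sequence in the second place. -/
theorem quadForm_unit_bound_second {A a : ℕ → ℝ} {C : ℝ} (i : ℕ) (ha : ∀ n, |a n| ≤ C)
    (hA : Summable fun n : ℕ => ((n : ℝ) + 1) * |A n|) :
    Summable (quadTerm (unitSeq i) a A A) ∧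
    |quadForm (unitSeq i) a A A| ≤ C * (∑' n : ℕ, ((n : ℝ) + 1) * |A n|) * (∑' n, |A n|) := by
  have C0 : 0 ≤ C := (abs_nonneg _).trans (ha 0)
  have hA' : Summable fun n => |A n| := Summable.of_nonneg_of_le (fun n => abs_nonneg _)
    (fun n => le_mul_of_one_le_left (abs_nonneg _) (by linarith [n.cast_nonneg (α := ℝ)])) hA
  have := quadTerm_summable_of_le (a := unitSeq i) (b := a) (c := A) (d := A)
    (f := unitSeq i) (g := fun n => C * (((n : ℝ) + 1) * |A n|)) (h := fun n => |A n|)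
    (unitSeq_nonneg i) (fun n => by positivity) (fun n => abs_nonneg _) (summable_unitSeq i)
    (hA.mul_left C) hA' Quad.inj_nkm (fun q => by
      rw [abs_quadTerm, abs_of_nonneg (unitSeq_nonneg i q.n)]
      have := ha q.j
      have h2 : (coupling q.n q.j q.k q.m : ℝ) ≤ q.k + 1 := by
        rw [← coupling_swap_pairs]; exact coupling_le_fst _ _ _ _
      have := unitSeq_nonneg i q.n
      calc _ ≤ ((q.k : ℝ) + 1) * unitSeq i q.n * C * |A q.k| * |A q.m| := by gcongr
        _ = _ := by ring)
  rw [tsum_unitSeq, tsum_mul_left, one_mul] at this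
  exact this

theorem hessian_eq_quadForm {A a : ℕ → ℝ} {C : ℝ} (s lam ω : ℝ) (ha : ∀ n, |a n| ≤ C)
    (hA : Summable fun n : ℕ => ((n : ℝ) + 1) * |A n|) (n : ℕ) :
    hessian s A lam ω a n = 2 * quadForm (unitSeq n) A a A + s * quadForm (unitSeq n) a A A
      - ((n : ℝ) + 1) * (lam - n * ω) * a n := by
  obtain ⟨s1, e1⟩ := interaction_eq_quadForm (quadForm_unit_bound_third n ha hA).1
  obtain ⟨s2, e2⟩ := interaction_eq_quadForm (quadForm_unit_bound_second n ha hA).1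
  rw [← e1, ← e2, hessian, interaction, interaction, ← tsum_mul_left, ← tsum_mul_left,
    ← (s1.mul_left 2).tsum_add (s2.mul_left s)]
  congr 1
  refine tsum_congr fun j => ?_
  rw [Finset.mul_sum, Finset.mul_sum, ← Finset.sum_add_distrib]
  exact Finset.sum_congr rfl fun k _ => by ring

end

end ConformalFlow

namespace ConformalFlow

noncomputable section

/-! ### The energy space as a Hilbert space -/

/-- The real energy space; `b` stands for the sequence `b_n / (n+1)`. -/
abbrev EnergySpace := lp (fun _ : ℕ => ℝ) 2

/-- The sequence represented by an element of the energy space. -/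
def seq (b : EnergySpace) : ℕ → ℝ := fun n => b n / ((n : ℝ) + 1)

theorem seq_apply (b : EnergySpace) (n : ℕ) : seq b n = b n / ((n : ℝ) + 1) := rfl

theorem succ_mul_seq (b : EnergySpace) (n : ℕ) : ((n : ℝ) + 1) * seq b n = b n := by
  have : (n : ℝ) + 1 ≠ 0 := by positivity
  rw [seq_apply]; field_simp

theorem seq_add (a b : EnergySpace) : seq (a + b) = seq a + seq b := by
  ext n; simp [seq, add_div]

theorem seq_smul (t : ℝ) (a : EnergySpace) : seq (t • a) = t • seq a := by
  ext n; simp [seq, mul_div_assoc]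

theorem seq_sub (a b : EnergySpace) : seq (a - b) = seq a - seq b := by
  ext n; simp [seq, sub_div]

theorem seq_zero : seq 0 = 0 := by
  ext n; simp [seq]

theorem seq_injective : Function.Injective seq := by
  intro a b h
  ext n
  rw [← succ_mul_seq a, ← succ_mul_seq b, h]

/-- The element of the energy space given by a sequence. -/
def ofSeq (a : ℕ → ℝ) (h : Memℓp (fun n : ℕ => ((n : ℝ) + 1) * a n) 2) : EnergySpace :=
  ⟨fun n => ((n : ℝ) + 1) * a n, h⟩

theorem seq_ofSeq (a : ℕ → ℝ) (h : Memℓp (fun n : ℕ => ((n : ℝ) + 1) * a n) 2) :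
    seq (ofSeq a h) = a := by
  ext n
  have : (n : ℝ) + 1 ≠ 0 := by positivity
  simp only [seq, ofSeq]
  field_simp

theorem memlp_two_iff (a : ℕ → ℝ) : Memℓp a 2 ↔ Summable fun n => a n ^ 2 := by
  rw [memℓp_gen_iff (by norm_num)]
  simp

theorem memlp_energy_iff (a : ℕ → ℝ) : Memℓp (fun n : ℕ => ((n : ℝ) + 1) * a n) 2 ↔
    Summable fun n : ℕ => (((n : ℝ) + 1) * a n) ^ 2 := memlp_two_iff _

theorem memlp_of_finite {a : ℕ → ℝ} {N : ℕ} (h : ∀ n, N ≤ n → a n = 0) :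
    Memℓp (fun n : ℕ => ((n : ℝ) + 1) * a n) 2 := by
  rw [memlp_energy_iff]
  refine summable_of_ne_finset_zero (s := Finset.range N) fun n hn => ?_
  rw [h n (by simpa using hn)]; simp

/-- The unit sequence at `i` in the energy space. -/
def unitVec (i : ℕ) : EnergySpace := ofSeq (unitSeq i)
  (memlp_of_finite (N := i + 1) fun n hn => by
    have : n ≠ i := by omega
    simp [unitSeq, this])

theorem seq_unitVec (i : ℕ) : seq (unitVec i) = unitSeq i := seq_ofSeq _ _

theorem norm_sq_eq_tsum (b : EnergySpace) :
    (Summable fun n => b n ^ 2) ∧ ‖b‖ ^ 2 = ∑' n, b n ^ 2 := by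
  refine ⟨(memlp_two_iff _).1 (lp.memℓp b), ?_⟩
  rw [← real_inner_self_eq_norm_sq, lp.inner_eq_tsum]
  exact tsum_congr fun n => by simp [sq]

theorem norm_sq_eq_energy (b : EnergySpace) :
    (Summable fun n : ℕ => ((n : ℝ) + 1) ^ 2 * seq b n ^ 2) ∧
    ‖b‖ ^ 2 = ∑' n : ℕ, ((n : ℝ) + 1) ^ 2 * seq b n ^ 2 := by
  have : (fun n : ℕ => ((n : ℝ) + 1) ^ 2 * seq b n ^ 2) = fun n => b n ^ 2 := by
    ext n; rw [← mul_pow, succ_mul_seq]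
  rw [this]
  exact norm_sq_eq_tsum b

theorem abs_succ_mul_seq_le (b : EnergySpace) (n : ℕ) : |((n : ℝ) + 1) * seq b n| ≤ ‖b‖ := by
  rw [succ_mul_seq]
  exact lp.norm_apply_le_norm (by norm_num) b n

theorem abs_seq_le (b : EnergySpace) (n : ℕ) : |seq b n| ≤ ‖b‖ := by
  refine le_trans ?_ (abs_succ_mul_seq_le b n)
  rw [abs_mul, abs_of_nonneg (by positivity : (0 : ℝ) ≤ (n : ℝ) + 1)]
  exact le_mul_of_one_le_left (abs_nonneg _) (by linarith [n.cast_nonneg (α := ℝ)])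

theorem summable_inv_succ_sq : (Summable fun n : ℕ => 1 / ((n : ℝ) + 1) ^ 2) ∧
    ∑' n : ℕ, 1 / ((n : ℝ) + 1) ^ 2 ≤ 4 := by
  have h := hasSum_zeta_two
  have h' : HasSum (fun n : ℕ => 1 / ((n : ℝ) + 1) ^ 2) (Real.pi ^ 2 / 6) := by
    have := (hasSum_nat_add_iff' 1).2 h
    simpa using this
  refine ⟨h'.summable, ?_⟩
  rw [h'.tsum_eq]
  nlinarith [Real.pi_pos, Real.pi_le_four]

/-- Cauchy–Schwarz against 1/(n+1), in the form of Young's inequality with a parameter t, finally t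
= 2/‖b‖. The constant 2 is the square root of the bound 4 on ∑ 1/(n+1)². -/
theorem summable_abs_seq (b : EnergySpace) :
    (Summable fun n => |seq b n|) ∧ ∑' n, |seq b n| ≤ 2 * ‖b‖ := by
  obtain ⟨s2, e2⟩ := norm_sq_eq_tsum b
  obtain ⟨s1, e1⟩ := summable_inv_succ_sq
  have key : ∀ t : ℝ, 0 < t → ∀ n : ℕ,
      |seq b n| ≤ t / 2 * b n ^ 2 + 1 / (2 * t) * (1 / ((n : ℝ) + 1) ^ 2) := by
    intro t ht n
    have hn : (0 : ℝ) < (n : ℝ) + 1 := by positivity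
    rw [seq_apply, abs_div, abs_of_pos hn, ← sq_abs (b n)]
    have : t / 2 * |b n| ^ 2 + 1 / (2 * t) * (1 / ((n : ℝ) + 1) ^ 2) - |b n| / ((n : ℝ) + 1) =
        (t * |b n| - 1 / ((n : ℝ) + 1)) ^ 2 / (2 * t) := by
      field_simp; ring
    have : 0 ≤ (t * |b n| - 1 / ((n : ℝ) + 1)) ^ 2 / (2 * t) := by positivity
    linarith
  have hs : Summable fun n => |seq b n| := Summable.of_nonneg_of_le (fun n => abs_nonneg _)
    (key 1 one_pos) ((s2.mul_left _).add (s1.mul_left _))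
  refine ⟨hs, ?_⟩
  rcases eq_or_lt_of_le (norm_nonneg b) with h0 | h0
  · have : b = 0 := norm_eq_zero.1 h0.symm
    subst this
    simp [seq_zero]
  · have hb := hs.tsum_le_tsum (key (2 / ‖b‖) (by positivity)) ((s2.mul_left _).add (s1.mul_left _))
    rw [(s2.mul_left _).tsum_add (s1.mul_left _), tsum_mul_left, tsum_mul_left, ← e2] at hb
    have h3 : 1 / (2 * (2 / ‖b‖)) * ∑' n : ℕ, 1 / ((n : ℝ) + 1) ^ 2 ≤ 1 / (2 * (2 / ‖b‖)) * 4 :=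
      mul_le_mul_of_nonneg_left e1 (by positivity)
    have h4 : 2 / ‖b‖ / 2 * ‖b‖ ^ 2 + 1 / (2 * (2 / ‖b‖)) * 4 = 2 * ‖b‖ := by
      field_simp; norm_num
    linarith

/-! ### The quadrilinear form on the energy space -/

/-- The quadrilinear form on the energy space. -/
def quadE (a b c d : EnergySpace) : ℝ := quadForm (seq a) (seq b) (seq c) (seq d)

theorem quadE_summable (a b c d : EnergySpace) :
    Summable (quadTerm (seq a) (seq b) (seq c) (seq d)) :=
  (quadForm_bound (abs_succ_mul_seq_le a) (summable_abs_seq b).1 (summable_abs_seq c).1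
    (summable_abs_seq d).1).1

theorem abs_quadE_le_of_l1 (a b c d : EnergySpace) :
    |quadE a b c d| ≤ ‖a‖ * (∑' n, |seq b n|) * ((∑' n, |seq c n|) * ∑' n, |seq d n|) :=
  (quadForm_bound (abs_succ_mul_seq_le a) (summable_abs_seq b).1 (summable_abs_seq c).1
    (summable_abs_seq d).1).2

theorem abs_quadE_le (a b c d : EnergySpace) :
    |quadE a b c d| ≤ 8 * (‖a‖ * ‖b‖ * ‖c‖ * ‖d‖) := by
  refine (abs_quadE_le_of_l1 a b c d).trans ?_
  have hb := (summable_abs_seq b).2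
  have hc := (summable_abs_seq c).2
  have hd := (summable_abs_seq d).2
  have hc0 : 0 ≤ ∑' n, |seq c n| := tsum_nonneg fun n => abs_nonneg _
  have hd0 : 0 ≤ ∑' n, |seq d n| := tsum_nonneg fun n => abs_nonneg _
  calc _ ≤ ‖a‖ * (2 * ‖b‖) * ((2 * ‖c‖) * (2 * ‖d‖)) := by gcongr
    _ = _ := by ring

theorem quadE_swap_left (a b c d : EnergySpace) : quadE b a c d = quadE a b c d :=
  quadForm_swap_left _ _ _ _

theorem quadE_swap_right (a b c d : EnergySpace) : quadE a b d c = quadE a b c d :=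
  quadForm_swap_right _ _ _ _

theorem quadE_swap_pairs (a b c d : EnergySpace) : quadE c d a b = quadE a b c d :=
  quadForm_swap_pairs _ _ _ _

theorem quadE_add₁ (a a' b c d : EnergySpace) :
    quadE (a + a') b c d = quadE a b c d + quadE a' b c d := by
  rw [quadE, quadE, quadE, quadForm, quadForm, quadForm,
    ← (quadE_summable a b c d).tsum_add (quadE_summable a' b c d)]
  refine tsum_congr fun q => ?_
  simp only [quadTerm, seq_add, Pi.add_apply]; ring

theorem quadE_smul₁ (t : ℝ) (a b c d : EnergySpace) :
    quadE (t • a) b c d = t * quadE a b c d := by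
  rw [quadE, quadE, quadForm, quadForm, ← tsum_mul_left]
  refine tsum_congr fun q => ?_
  simp only [quadTerm, seq_smul, Pi.smul_apply, smul_eq_mul]; ring

theorem quadE_add₂ (a b b' c d : EnergySpace) :
    quadE a (b + b') c d = quadE a b c d + quadE a b' c d := by
  rw [quadE_swap_left, quadE_add₁, quadE_swap_left, quadE_swap_left a b']

theorem quadE_smul₂ (t : ℝ) (a b c d : EnergySpace) :
    quadE a (t • b) c d = t * quadE a b c d := by
  rw [quadE_swap_left, quadE_smul₁, quadE_swap_left]

theorem quadE_add₃ (a b c c' d : EnergySpace) :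
    quadE a b (c + c') d = quadE a b c d + quadE a b c' d := by
  rw [quadE_swap_pairs, quadE_add₁, quadE_swap_pairs, quadE_swap_pairs a b c' d]

theorem quadE_smul₃ (t : ℝ) (a b c d : EnergySpace) :
    quadE a b (t • c) d = t * quadE a b c d := by
  rw [quadE_swap_pairs, quadE_smul₁, quadE_swap_pairs]

theorem quadE_add₄ (a b c d d' : EnergySpace) :
    quadE a b c (d + d') = quadE a b c d + quadE a b c d' := by
  rw [quadE_swap_right, quadE_add₃, quadE_swap_right, quadE_swap_right a b c d']

theorem quadE_smul₄ (t : ℝ) (a b c d : EnergySpace) :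
    quadE a b c (t • d) = t * quadE a b c d := by
  rw [quadE_swap_right, quadE_smul₃, quadE_swap_right]

/-! ### Diagonal forms -/

/-- The weight `w` is dominated by the energy weight. -/
def EnergyWeight (w : ℕ → ℝ) (C : ℝ) : Prop := ∀ n : ℕ, |w n| ≤ C * ((n : ℝ) + 1) ^ 2

/-- The diagonal bilinear form `∑ w_n a_n b_n`. -/
def diagE (w : ℕ → ℝ) (a b : EnergySpace) : ℝ := ∑' n, w n * (seq a n * seq b n)

theorem diagE_bound {w : ℕ → ℝ} {C : ℝ} (hw : EnergyWeight w C) (a b : EnergySpace) :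
    (Summable fun n => w n * (seq a n * seq b n)) ∧ |diagE w a b| ≤ C * ‖a‖ * ‖b‖ := by
  have C0 : 0 ≤ C := by
    have := (abs_nonneg _).trans (hw 0); simpa using this
  have hs : Summable fun n => ‖a n‖ * ‖b n‖ := by
    have := lp.summable_mul (p := 2) (q := 2)
      (by rw [show (2 : ENNReal).toReal = 2 by norm_num]; exact Real.HolderConjugate.two_two) a b
    exact this
  have hn : ∑' n, ‖a n‖ * ‖b n‖ ≤ ‖a‖ * ‖b‖ :=
    lp.tsum_mul_le_mul_norm
      (by rw [show (2 : ENNReal).toReal = 2 by norm_num]; exact Real.HolderConjugate.two_two) a b |>.2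
  have hle : ∀ n, |w n * (seq a n * seq b n)| ≤ C * (‖a n‖ * ‖b n‖) := by
    intro n
    rw [abs_mul, ← succ_mul_seq a, ← succ_mul_seq b, Real.norm_eq_abs, Real.norm_eq_abs, abs_mul,
      abs_mul, abs_mul, abs_of_nonneg (by positivity : (0 : ℝ) ≤ (n : ℝ) + 1)]
    calc _ ≤ C * ((n : ℝ) + 1) ^ 2 * (|seq a n| * |seq b n|) := by gcongr; exact hw n
      _ = _ := by ring
  have hs' : Summable fun n => |w n * (seq a n * seq b n)| :=
    Summable.of_nonneg_of_le (fun n => abs_nonneg _) hle (hs.mul_left C)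
  refine ⟨hs'.of_abs, ?_⟩
  calc |diagE w a b| ≤ ∑' n, |w n * (seq a n * seq b n)| := by
        simpa [diagE] using norm_tsum_le_tsum_norm (f := fun n => w n * (seq a n * seq b n)) hs'
    _ ≤ ∑' n, C * (‖a n‖ * ‖b n‖) := hs'.tsum_le_tsum hle (hs.mul_left C)
    _ ≤ C * (‖a‖ * ‖b‖) := by rw [tsum_mul_left]; gcongr
    _ = _ := by ring

theorem diagE_symm (w : ℕ → ℝ) (a b : EnergySpace) : diagE w a b = diagE w b a :=
  tsum_congr fun n => by ring

theorem diagE_add {w : ℕ → ℝ} {C : ℝ} (hw : EnergyWeight w C) (a a' b : EnergySpace) :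
    diagE w (a + a') b = diagE w a b + diagE w a' b := by
  rw [diagE, diagE, diagE, ← (diagE_bound hw a b).1.tsum_add (diagE_bound hw a' b).1]
  exact tsum_congr fun n => by simp only [seq_add, Pi.add_apply]; ring

theorem diagE_smul (w : ℕ → ℝ) (t : ℝ) (a b : EnergySpace) :
    diagE w (t • a) b = t * diagE w a b := by
  rw [diagE, diagE, ← tsum_mul_left]
  exact tsum_congr fun n => by simp only [seq_smul, Pi.smul_apply, smul_eq_mul]; ring

theorem diagE_unitVec (w : ℕ → ℝ) (a : EnergySpace) (i : ℕ) :
    diagE w a (unitVec i) = w i * seq a i := by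
  rw [diagE, tsum_eq_single i] <;> simp +contextual [seq_unitVec, unitSeq]

/-- A diagonal form as a bounded bilinear form. -/
def diagL {w : ℕ → ℝ} {C : ℝ} (hw : EnergyWeight w C) :
    EnergySpace →L[ℝ] EnergySpace →L[ℝ] ℝ :=
  LinearMap.mkContinuous₂ (LinearMap.mk₂ ℝ (diagE w) (diagE_add hw) (diagE_smul w)
    (fun a b b' => by rw [diagE_symm, diagE_add hw, diagE_symm, diagE_symm w b'])
    (fun t a b => by rw [diagE_symm, diagE_smul, diagE_symm]; rfl)) C
    (fun a b => (diagE_bound hw a b).2)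

theorem diagL_apply {w : ℕ → ℝ} {C : ℝ} (hw : EnergyWeight w C) (a b : EnergySpace) :
    diagL hw a b = diagE w a b := rfl

theorem energyWeight_one : EnergyWeight (fun _ => 1) 1 := fun n => by
  have : (0 : ℝ) ≤ n := n.cast_nonneg
  simp only [abs_one, one_mul]
  nlinarith

theorem energyWeight_charge : EnergyWeight (fun n => (n : ℝ) + 1) 1 := fun n => by
  have : (0 : ℝ) ≤ n := n.cast_nonneg
  rw [abs_of_nonneg (by positivity)]
  nlinarith

theorem energyWeight_energy : EnergyWeight (fun n => ((n : ℝ) + 1) ^ 2) 1 := fun n => by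
  rw [abs_of_nonneg (by positivity), one_mul]

theorem energyWeight_linear (ω : ℝ) :
    EnergyWeight (fun n => ((n : ℝ) + 1) * (1 - n * ω)) (1 + |ω|) := fun n => by
  have : (0 : ℝ) ≤ n := n.cast_nonneg
  rw [abs_mul, abs_of_nonneg (by positivity : (0 : ℝ) ≤ (n : ℝ) + 1)]
  have h : |1 - n * ω| ≤ 1 + n * |ω| := by
    refine (abs_sub _ _).trans ?_
    rw [abs_one, abs_mul, Nat.abs_cast]
  have h2 : 1 + n * |ω| ≤ (1 + |ω|) * (n + 1) := by nlinarith [abs_nonneg ω]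
  nlinarith [abs_nonneg ω]

/-! ### The quadratic forms of `L₊` and `L₋` -/

/-- The bilinear form of `L_s` at the state `A`. -/
def hessE (s : ℝ) (A : EnergySpace) (ω : ℝ) (a b : EnergySpace) : ℝ :=
  2 * quadE b A a A + s * quadE b a A A - diagE (fun n => ((n : ℝ) + 1) * (1 - n * ω)) a b

theorem hessE_symm (s : ℝ) (A : EnergySpace) (ω : ℝ) (a b : EnergySpace) :
    hessE s A ω a b = hessE s A ω b a := by
  rw [hessE, hessE, diagE_symm, quadE_swap_left b a A A, quadE_swap_pairs b A a A]

theorem hessE_add (s : ℝ) (A : EnergySpace) (ω : ℝ) (a a' b : EnergySpace) :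
    hessE s A ω (a + a') b = hessE s A ω a b + hessE s A ω a' b := by
  simp only [hessE, quadE_add₃, quadE_add₂, diagE_add (energyWeight_linear ω)]; ring

theorem hessE_smul (s : ℝ) (A : EnergySpace) (ω t : ℝ) (a b : EnergySpace) :
    hessE s A ω (t • a) b = t * hessE s A ω a b := by
  simp only [hessE, quadE_smul₃, quadE_smul₂, diagE_smul]; ring

theorem hessE_bound (s : ℝ) (A : EnergySpace) (ω : ℝ) (a b : EnergySpace) :
    |hessE s A ω a b| ≤ ((16 + 8 * |s|) * ‖A‖ ^ 2 + (1 + |ω|)) * ‖a‖ * ‖b‖ := by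
  have h1 := abs_quadE_le b A a A
  have h2 := abs_quadE_le b a A A
  have h3 := (diagE_bound (energyWeight_linear ω) a b).2
  calc |hessE s A ω a b| ≤ |2 * quadE b A a A| + |s * quadE b a A A| + |diagE _ a b| := by
        rw [hessE]
        exact (abs_sub _ _).trans (add_le_add_left (abs_add_le _ _) _)
    _ ≤ 2 * (8 * (‖b‖ * ‖A‖ * ‖a‖ * ‖A‖)) + |s| * (8 * (‖b‖ * ‖a‖ * ‖A‖ * ‖A‖))
        + (1 + |ω|) * ‖a‖ * ‖b‖ := by
        rw [abs_mul, abs_mul, abs_two]; gcongr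
    _ = _ := by ring

/-- The bilinear form of `L_s` as a bounded form. -/
def hessL (s : ℝ) (A : EnergySpace) (ω : ℝ) : EnergySpace →L[ℝ] EnergySpace →L[ℝ] ℝ :=
  LinearMap.mkContinuous₂ (LinearMap.mk₂ ℝ (hessE s A ω) (hessE_add s A ω)
    (fun t a b => hessE_smul s A ω t a b)
    (fun a b b' => by
      rw [hessE_symm, hessE_add, hessE_symm, hessE_symm s A ω b'])
    (fun t a b => by rw [hessE_symm, hessE_smul, hessE_symm]; rfl))
    ((16 + 8 * |s|) * ‖A‖ ^ 2 + (1 + |ω|)) (hessE_bound s A ω)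

theorem hessL_apply (s : ℝ) (A : EnergySpace) (ω : ℝ) (a b : EnergySpace) :
    hessL s A ω a b = hessE s A ω a b := rfl

theorem hessian_seq {A : EnergySpace} (hA : Summable fun n : ℕ => ((n : ℝ) + 1) * |seq A n|)
    (s ω : ℝ) (a : EnergySpace) (n : ℕ) :
    hessian s (seq A) 1 ω (seq a) n = hessE s A ω a (unitVec n) := by
  rw [hessian_eq_quadForm s 1 ω (abs_seq_le a) hA, hessE, quadE, quadE, seq_unitVec, diagE_unitVec]

theorem hessE_eq_tsum {A : EnergySpace} (hA : Summable fun n : ℕ => ((n : ℝ) + 1) * |seq A n|)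
    (s ω : ℝ) (a b : EnergySpace) :
    (Summable fun n => hessian s (seq A) 1 ω (seq a) n * seq b n) ∧
    hessE s A ω a b = ∑' n, hessian s (seq A) 1 ω (seq a) n * seq b n := by
  obtain ⟨s1, e1⟩ := quadForm_eq_tsum_interaction (quadE_summable b A a A)
  obtain ⟨s2, e2⟩ := quadForm_eq_tsum_interaction (quadE_summable b a A A)
  have s3 := (diagE_bound (energyWeight_linear ω) a b).1
  have e : ∀ n, hessian s (seq A) 1 ω (seq a) n * seq b n =
      2 * (seq b n * interaction (seq A) (seq a) (seq A) n) +
      s * (seq b n * interaction (seq a) (seq A) (seq A) n) -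
      ((n : ℝ) + 1) * (1 - n * ω) * (seq a n * seq b n) := by
    intro n
    rw [hessian_eq_quadForm s 1 ω (abs_seq_le a) hA,
      (interaction_eq_quadForm (quadForm_unit_bound_third n (abs_seq_le a) hA).1).2,
      (interaction_eq_quadForm (quadForm_unit_bound_second n (abs_seq_le a) hA).1).2]
    ring
  simp only [e]
  refine ⟨((s1.mul_left 2).add (s2.mul_left s)).sub s3, ?_⟩
  rw [((s1.mul_left 2).add (s2.mul_left s)).tsum_sub s3, (s1.mul_left 2).tsum_add (s2.mul_left s),
    tsum_mul_left, tsum_mul_left, ← e1, ← e2]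
  rfl

/-- Bounded sequences on which `L_s` is bounded have finite energy. -/
theorem memlp_energy_of_hessian_bounded {A a : ℕ → ℝ} {C C' : ℝ} (s : ℝ) {ω : ℝ} (hω : 1 / 7 < ω)
    (hA : Summable fun n : ℕ => ((n : ℝ) + 1) * |A n|) (ha : ∀ n, |a n| ≤ C)
    (hL : ∀ n, |hessian s A 1 ω a n| ≤ C') :
    Memℓp (fun n : ℕ => ((n : ℝ) + 1) * a n) 2 := by
  set K := C' + 2 * (C * (∑' n : ℕ, ((n : ℝ) + 1) * |A n|) * (∑' n, |A n|)) +
    |s| * (C * (∑' n : ℕ, ((n : ℝ) + 1) * |A n|) * (∑' n, |A n|)) with hK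
  have key : ∀ n : ℕ, |((n : ℝ) + 1) * (1 - n * ω) * a n| ≤ K := by
    intro n
    have h1 := (quadForm_unit_bound_third n ha hA).2
    have h2 := (quadForm_unit_bound_second n ha hA).2
    have e : ((n : ℝ) + 1) * (1 - n * ω) * a n = 2 * quadForm (unitSeq n) A a A +
        s * quadForm (unitSeq n) a A A - hessian s A 1 ω a n := by
      rw [hessian_eq_quadForm s 1 ω ha hA]; ring
    rw [e]
    calc _ ≤ |2 * quadForm (unitSeq n) A a A| + |s * quadForm (unitSeq n) a A A| +
          |hessian s A 1 ω a n| := (abs_sub _ _).trans (add_le_add_left (abs_add_le _ _) _)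
      _ ≤ K := by
          rw [abs_mul, abs_mul, abs_two, hK]
          have := mul_le_mul_of_nonneg_left h2 (abs_nonneg s)
          have := hL n
          linarith
  rw [memlp_energy_iff]
  -- From n = 7 on, nω - 1 ≥ g (n+1)/8, with equality at n = 7. A bounded row thus gives (n+1) a_n =
  -- O(1/(n+1)), which is square summable.
  set g := 7 * ω - 1 with hg
  have g0 : 0 < g := by rw [hg]; linarith
  refine Summable.of_norm_bounded_eventually_nat
    (g := fun n : ℕ => (8 * K / g) ^ 2 * (1 / ((n : ℝ) + 1) ^ 2))
    (summable_inv_succ_sq.1.mul_left _) ?_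
  filter_upwards [Filter.eventually_ge_atTop 7] with n hn
  have hn' : (7 : ℝ) ≤ n := by exact_mod_cast hn
  have h1 : g * ((n : ℝ) + 1) / 8 ≤ n * ω - 1 := by
    rw [hg]; nlinarith
  have h2 := key n
  rw [abs_mul, abs_mul, abs_of_nonneg (by positivity : (0 : ℝ) ≤ (n : ℝ) + 1), abs_sub_comm,
    abs_of_nonneg (by nlinarith : (0 : ℝ) ≤ n * ω - 1)] at h2
  have h3 : ((n : ℝ) + 1) * (g * ((n : ℝ) + 1) / 8) * |a n| ≤ K := by
    refine le_trans ?_ h2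
    gcongr
  have h4 : ((n : ℝ) + 1) * |a n| ≤ 8 * K / g * (1 / ((n : ℝ) + 1)) := by
    rw [mul_one_div, le_div_iff₀ (by positivity), le_div_iff₀ g0]
    linarith
  rw [Real.norm_eq_abs, abs_pow, abs_mul, abs_of_nonneg (by positivity : (0 : ℝ) ≤ (n : ℝ) + 1)]
  calc (((n : ℝ) + 1) * |a n|) ^ 2 ≤ (8 * K / g * (1 / ((n : ℝ) + 1))) ^ 2 := by gcongr
    _ = _ := by field_simp

end

end ConformalFlow

namespace ConformalFlow

noncomputable section

/-! ### Forms with at most one negative direction -/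

section Abstract

variable {E : Type*} [NormedAddCommGroup E] [InnerProductSpace ℝ E]

/-- The form `q` is coercive on `G`. -/
def PosOn (q : E →L[ℝ] E →L[ℝ] ℝ) (G : Submodule ℝ E) : Prop :=
  ∃ κ > 0, ∀ a ∈ G, κ * ‖a‖ ^ 2 ≤ q a a

/-- The form `q` has a negative direction in `G` and is coercive on a hyperplane of `G` which is
closed for the seminorm of `c`. -/
def NegOn (q c : E →L[ℝ] E →L[ℝ] ℝ) (G : Submodule ℝ E) : Prop :=
  ∃ f : E →L[ℝ] ℝ, (∃ C > 0, ∀ a, f a ^ 2 ≤ C * c a a) ∧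
    (∃ κ > 0, ∀ a ∈ G, f a = 0 → κ * ‖a‖ ^ 2 ≤ q a a) ∧ ∃ v ∈ G, q v v < 0

/-- The eigenvectors for `ν` of the form `q` relative to `c` on `G`. -/
def formEigenvectors (q c : E →L[ℝ] E →L[ℝ] ℝ) (G : Submodule ℝ E) (ν : ℝ) : Set E :=
  {b | b ∈ G ∧ ∀ g ∈ G, q b g = ν * c b g}

theorem eq_zero_of_coercive_nonpos {E : Type*} [NormedAddCommGroup E] {κ x : ℝ} {a : E} (hκ : 0 < κ) (h : κ * ‖a‖ ^ 2 ≤ x)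
    (hx : x ≤ 0) : a = 0 := by
  have : ‖a‖ ^ 2 ≤ 0 := by nlinarith
  exact norm_eq_zero.1 (by nlinarith [norm_nonneg a, sq_nonneg ‖a‖])

theorem PosOn.eq_zero {q c : E →L[ℝ] E →L[ℝ] ℝ} {G : Submodule ℝ E} (h : PosOn q G)
    (hc : ∀ a, 0 ≤ c a a) {ν : ℝ} (hν : ν ≤ 0) {b : E} (hb : b ∈ formEigenvectors q c G ν) :
    b = 0 := by
  obtain ⟨κ, hκ, h⟩ := h
  refine eq_zero_of_coercive_nonpos hκ (h b hb.1) ?_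
  rw [hb.2 b hb.1]
  exact mul_nonpos_of_nonpos_of_nonneg hν (hc b)

/-- A kernel vector off ker f could be used to move the negative direction v into ker f without
changing q v v, against coercivity there. -/
theorem NegOn.nondegenerate {q c : E →L[ℝ] E →L[ℝ] ℝ} {G : Submodule ℝ E}
    (hq : ∀ a b, q a b = q b a) (h : NegOn q c G) {b : E}
    (hb : b ∈ formEigenvectors q c G 0) : b = 0 := by
  obtain ⟨f, -, ⟨κ, hκ, hco⟩, v, hvG, hv⟩ := h
  have hb0 : ∀ g ∈ G, q b g = 0 := fun g hg => by rw [hb.2 g hg, zero_mul]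
  by_cases hf : f b = 0
  · exact eq_zero_of_coercive_nonpos hκ (hco b hb.1 hf) (hb0 b hb.1).le
  · exfalso
    set w := v - (f v / f b) • b with hw
    have hwG : w ∈ G := G.sub_mem hvG (G.smul_mem _ hb.1)
    have h1 := hco w hwG (by rw [hw]; simp [hf])
    have h2 : q w w = q v v := by
      rw [hw]
      simp [hb0 _ hvG, hb0 _ hb.1, hq v b]
    have : 0 ≤ κ * ‖w‖ ^ 2 := by positivity
    linarith

/-- Some combination b' - t b lies in ker f, where q is coercive. But q is nonpositive on the span
of two negative eigenvectors: for equal eigenvalues q = ν c there, for different ones they are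
c-orthogonal and the cross terms vanish. So the combination is zero. -/
theorem NegOn.dependent {q c : E →L[ℝ] E →L[ℝ] ℝ} {G : Submodule ℝ E}
    (hq : ∀ a b, q a b = q b a) (hc : ∀ a b, c a b = c b a) (h : NegOn q c G)
    {ν ν' : ℝ} (hν : ν < 0) (hν' : ν' < 0) {b b' : E} (hb : b ∈ formEigenvectors q c G ν)
    (hb' : b' ∈ formEigenvectors q c G ν') (h0 : b ≠ 0) : ∃ t : ℝ, b' = t • b := by
  obtain ⟨f, ⟨C, hC, hf⟩, ⟨κ, hκ, hco⟩, -⟩ := h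
  have hc0 : ∀ a, 0 ≤ c a a := fun a => by nlinarith [hf a, sq_nonneg (f a)]
  have hfb : f b ≠ 0 := fun hfb => h0 (eq_zero_of_coercive_nonpos hκ (hco b hb.1 hfb) (by
    rw [hb.2 b hb.1]; nlinarith [hc0 b]))
  refine ⟨f b' / f b, ?_⟩
  set t := f b' / f b with ht
  have hwG : b' - t • b ∈ G := G.sub_mem hb'.1 (G.smul_mem _ hb.1)
  have hfw : f (b' - t • b) = 0 := by simp [ht, hfb]
  refine sub_eq_zero.1 (eq_zero_of_coercive_nonpos hκ (hco _ hwG hfw) ?_)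
  have e1 := hb.2 b hb.1
  have e2 := hb.2 b' hb'.1
  have e3 := hb'.2 b' hb'.1
  have e4 := hb'.2 b hb.1
  have e : q (b' - t • b) (b' - t • b) = q b' b' - t * q b' b - t * q b b' + t ^ 2 * q b b := by
    simp; ring
  have ec : 0 ≤ c (b' - t • b) (b' - t • b) := hc0 _
  rw [e]
  by_cases hνν : ν = ν'
  · have ec' : c (b' - t • b) (b' - t • b) =
        c b' b' - t * c b' b - t * c b b' + t ^ 2 * c b b := by simp; ring
    rw [ec'] at ec
    rw [e1, e2, e3, e4, ← hνν]
    nlinarith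
  · have h1 : (ν - ν') * c b b' = 0 := by
      rw [sub_mul, ← e2, hc b b', ← e4, hq]; ring
    have h2 : c b b' = 0 := (mul_eq_zero.1 h1).resolve_left (sub_ne_zero.2 hνν)
    rw [e1, e2, e3, e4, hc b' b, h2]
    nlinarith [hc0 b, hc0 b', sq_nonneg t, mul_nonneg (sq_nonneg t) (hc0 b)]

/-- For ν ≤ 0 the form q - ν c is coercive on ker f, so Lax–Milgram gives w(ν) in ker f such that v
+ w(ν) is (q - ν c)-orthogonal to ker f. The value F(ν) of q - ν c at v + w(ν) is continuous,
negative at 0 and nonnegative for ν very negative. At a zero of F the vector v + w(ν) is orthogonal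
to itself as well as to ker f, hence to the whole space, which makes it an eigenvector. -/
theorem exists_neg_eigen_aux [CompleteSpace E] {q c : E →L[ℝ] E →L[ℝ] ℝ}
    (hq : ∀ a b, q a b = q b a)
    {f : E →L[ℝ] ℝ} {C κ : ℝ} (hC : 0 < C) (hf : ∀ a, f a ^ 2 ≤ C * c a a) (hκ : 0 < κ)
    (hco : ∀ a, f a = 0 → κ * ‖a‖ ^ 2 ≤ q a a) {v : E} (hv : q v v < 0) :
    ∃ ν < 0, ∃ b, b ≠ 0 ∧ ∀ g, q b g = ν * c b g := by
  have hc0 : ∀ a, 0 ≤ c a a := fun a => by nlinarith [hf a, sq_nonneg (f a)]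
  have hfv : f v ≠ 0 := fun h => by
    have := hco v h
    have : 0 ≤ κ * ‖v‖ ^ 2 := by positivity
    linarith
  -- Split a into a part in ker f and a multiple of v. Only the latter can make q negative, and its
  -- size is f a / f v, which c controls.
  have hgarding : ∃ N > 0, ∀ a, 0 ≤ q a a + N * c a a := by
    set M := ‖q‖ * ‖v‖ with hM
    refine ⟨C * ((M ^ 2 / κ - q v v) / f v ^ 2), by
      have : 0 < f v ^ 2 := by positivity
      have : 0 ≤ M ^ 2 / κ := by positivity
      have : 0 < M ^ 2 / κ - q v v := by linarith
      positivity, fun a => ?_⟩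
    set t := f a / f v with ht
    set k := a - t • v with hk
    have ha : a = k + t • v := by rw [hk]; abel
    have hfk : f k = 0 := by rw [hk]; simp [ht, hfv]
    have h1 := hco k hfk
    have e : q a a = q k k + 2 * t * q k v + t ^ 2 * q v v := by
      rw [ha]; simp [hq v k]; ring
    have h2 : |q k v| ≤ M * ‖k‖ := by
      have := q.le_opNorm₂ k v
      rw [Real.norm_eq_abs] at this
      rw [hM]; linarith
    have h3 : -(|t| * (M * ‖k‖)) ≤ t * q k v := by
      have := mul_le_mul_of_nonneg_left h2 (abs_nonneg t)
      rw [← abs_mul] at this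
      linarith [neg_abs_le (t * q k v)]
    have h4 : 0 ≤ κ * ‖k‖ ^ 2 - 2 * (|t| * (M * ‖k‖)) + M ^ 2 / κ * t ^ 2 := by
      have : κ * ‖k‖ ^ 2 - 2 * (|t| * (M * ‖k‖)) + M ^ 2 / κ * t ^ 2 =
          (κ * ‖k‖ - M * |t|) ^ 2 / κ := by
        rw [← sq_abs t]; field_simp; ring
      rw [this]; positivity
    have h5 : (M ^ 2 / κ - q v v) * t ^ 2 ≤
        C * ((M ^ 2 / κ - q v v) / f v ^ 2) * c a a := by
      have h6 : 0 ≤ (M ^ 2 / κ - q v v) / f v ^ 2 := by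
        have : 0 ≤ M ^ 2 / κ := by positivity
        have : 0 ≤ M ^ 2 / κ - q v v := by linarith
        positivity
      calc (M ^ 2 / κ - q v v) * t ^ 2 = (M ^ 2 / κ - q v v) / f v ^ 2 * f a ^ 2 := by
            rw [ht]; field_simp
        _ ≤ (M ^ 2 / κ - q v v) / f v ^ 2 * (C * c a a) :=
            mul_le_mul_of_nonneg_left (hf a) h6
        _ = _ := by ring
    rw [e]; linarith
  obtain ⟨N, hN, hNq⟩ := hgarding
  let K : Submodule ℝ E := LinearMap.ker f.toLinearMap
  have : CompleteSpace K := f.isClosed_ker.completeSpace_coe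
  have hK : ∀ k : K, f k = 0 := fun k => k.2
  have hsolve : ∀ ν : ℝ, ν ≤ 0 → ∃ w : K, ∀ g : K, q (v + w) g - ν * c (v + w) g = 0 := by
    intro ν hν
    let B : K →L[ℝ] K →L[ℝ] ℝ := (q - ν • c).bilinearComp K.subtypeL K.subtypeL
    have hB : IsCoercive B := ⟨κ, hκ, fun u => by
      have := hco u (hK u)
      have h2 := hc0 (u : E)
      simp only [B, ContinuousLinearMap.bilinearComp_apply, Submodule.subtypeL_apply,
        sub_apply, smul_apply, smul_eq_mul]
      rw [Submodule.coe_norm]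
      nlinarith⟩
    let φ : K →L[ℝ] ℝ := -((q - ν • c) v).comp K.subtypeL
    have hφ : ∀ g : K, φ g = -(q v g - ν * c v g) := fun g => rfl
    refine ⟨hB.continuousLinearEquivOfBilin.symm ((InnerProductSpace.toDual ℝ K).symm φ),
      fun g => ?_⟩
    have h1 := hB.continuousLinearEquivOfBilin_apply
      (hB.continuousLinearEquivOfBilin.symm ((InnerProductSpace.toDual ℝ K).symm φ)) g
    rw [ContinuousLinearEquiv.apply_symm_apply, InnerProductSpace.toDual_symm_apply, hφ] at h1
    simp only [B, ContinuousLinearMap.bilinearComp_apply, Submodule.subtypeL_apply,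
      sub_apply, smul_apply, smul_eq_mul] at h1
    simp only [map_add, add_apply]
    linarith
  choose! w hw using hsolve
  set F : ℝ → ℝ := fun ν => q (v + w ν) (v + w ν) - ν * c (v + w ν) (v + w ν) with hF
  have hwc : ContinuousOn w (Set.Icc (-N) 0) := by
    intro ν' hν'
    have hb : ∀ ν ∈ Set.Icc (-N) 0,
        ‖w ν - w ν'‖ ≤ ‖c‖ * ‖v + w ν'‖ / κ * |ν - ν'| := by
      intro ν hν
      set Δ : K := w ν - w ν' with hΔ
      have h1 := hw ν hν.2 Δ
      have h2 := hw ν' hν'.2 Δ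
      have h3 := hco Δ (hK Δ)
      have h4 := hc0 (Δ : E)
      have e : ((Δ : K) : E) = (v + w ν) - (v + w ν') := by rw [hΔ]; push_cast; abel
      have e5 : q Δ Δ - ν * c Δ Δ = (ν - ν') * c (v + w ν') Δ := by
        have e6 : q Δ Δ = q (v + w ν) Δ - q (v + w ν') Δ := by
          rw [← sub_apply, ← map_sub, ← e]
        have e7 : c Δ Δ = c (v + w ν) Δ - c (v + w ν') Δ := by
          rw [← sub_apply, ← map_sub, ← e]
        rw [e6, e7]; linarith
      have h6 : (ν - ν') * c (v + w ν') Δ ≤ |ν - ν'| * (‖c‖ * ‖v + w ν'‖ * ‖(Δ : E)‖) := by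
        refine (le_abs_self _).trans ?_
        rw [abs_mul]
        exact mul_le_mul_of_nonneg_left (c.le_opNorm₂ _ _) (abs_nonneg _)
      have h7 : κ * ‖(Δ : E)‖ ^ 2 ≤ |ν - ν'| * (‖c‖ * ‖v + w ν'‖ * ‖(Δ : E)‖) := by
        nlinarith [hν.2]
      rw [Submodule.coe_norm]
      rcases eq_or_lt_of_le (norm_nonneg (Δ : E)) with h0 | h0
      · rw [← h0]; positivity
      · rw [div_mul_eq_mul_div, le_div_iff₀ hκ]
        refine le_of_mul_le_mul_right ?_ h0
        nlinarith
    rw [ContinuousWithinAt, tendsto_iff_norm_sub_tendsto_zero]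
    refine squeeze_zero' (Filter.Eventually.of_forall fun _ => norm_nonneg _)
      (Filter.eventually_of_mem self_mem_nhdsWithin hb) ?_
    have : Filter.Tendsto (fun ν => ‖c‖ * ‖v + w ν'‖ / κ * |ν - ν'|)
        (nhdsWithin ν' (Set.Icc (-N) 0))
        (nhds (‖c‖ * ‖v + w ν'‖ / κ * |ν' - ν'|)) :=
      ((continuous_const.mul ((continuous_id.sub continuous_const).abs)).tendsto ν').mono_left
        nhdsWithin_le_nhds
    simpa using this
  have hFc : ContinuousOn F (Set.Icc (-N) 0) := by
    have h1 : ContinuousOn (fun ν => v + (w ν : E)) (Set.Icc (-N) 0) :=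
      continuousOn_const.add (continuous_subtype_val.comp_continuousOn hwc)
    exact ((q.continuous.comp_continuousOn h1).clm_apply h1).sub
      (continuousOn_id.mul ((c.continuous.comp_continuousOn h1).clm_apply h1))
  have hF0 : F 0 < 0 := by
    have h1 := hw 0 le_rfl (w 0)
    have h3 := hco (w 0) (hK _)
    have h4 : 0 ≤ κ * ‖((w 0 : K) : E)‖ ^ 2 := by positivity
    -- Orthogonality at ν = 0 gives q v (w 0) = -q (w 0) (w 0), so the correction only lowers the
    -- value.
    have h5 : F 0 = q v v - q (w 0) (w 0) := by
      simp only [hF, map_add, add_apply] at h1 ⊢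
      rw [hq v (w 0)] at *
      linarith
    rw [h5]; linarith
  have hFN : 0 ≤ F (-N) := by
    have := hNq (v + w (-N))
    simp only [hF]; linarith
  obtain ⟨ν, hν, hFν⟩ := intermediate_value_Icc' (by linarith : -N ≤ 0) hFc
    (show (0 : ℝ) ∈ Set.Icc (F 0) (F (-N)) from ⟨hF0.le, hFN⟩)
  have hν0 : ν < 0 := lt_of_le_of_ne hν.2 (fun h => by rw [h] at hFν; exact hF0.ne hFν)
  have hfb : f (v + w ν) = f v := by rw [map_add, hK, add_zero]
  refine ⟨ν, hν0, v + w ν, fun h => hfv (by rw [← hfb, h, map_zero]), fun g => ?_⟩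
  set b := v + (w ν : E) with hb
  set t := f g / f v with ht
  have hg : f (g - t • b) = 0 := by rw [map_sub, map_smul, hfb, ht]; simp [hfv]
  have h1 := hw ν hν.2 ⟨g - t • b, hg⟩
  have h2 : q b b - ν * c b b = 0 := hFν
  simp only [map_sub, map_smul, smul_eq_mul] at h1
  rw [← hb] at h1
  have : q b g - ν * c b g = t * (q b b - ν * c b b) := by linarith
  rw [h2] at this
  linarith

theorem NegOn.exists_neg_eigen {q c : E →L[ℝ] E →L[ℝ] ℝ} {G : Submodule ℝ E} [CompleteSpace G]
    (hq : ∀ a b, q a b = q b a) (hc : ∀ a b, c a b = c b a) (h : NegOn q c G) :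
    ∃ ν < 0, ∃ b ∈ formEigenvectors q c G ν, b ≠ 0 := by
  obtain ⟨f, ⟨C, hC, hf⟩, ⟨κ, hκ, hco⟩, v, hvG, hv⟩ := h
  obtain ⟨ν, hν, b, hb0, hb⟩ := exists_neg_eigen_aux
    (q := q.bilinearComp G.subtypeL G.subtypeL) (c := c.bilinearComp G.subtypeL G.subtypeL)
    (fun a b => hq _ _) (f := f.comp G.subtypeL) hC (fun a => hf a) hκ
    (fun a ha => hco a a.2 ha) (v := ⟨v, hvG⟩) hv
  exact ⟨ν, hν, b, ⟨b.2, fun g hg => hb ⟨g, hg⟩⟩, fun h => hb0 (Subtype.ext h)⟩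

end Abstract

theorem rank_span_eq_zero {S : Set (ℕ → ℝ)} (h : ∀ x ∈ S, x = 0) :
    Module.rank ℝ (Submodule.span ℝ S) = 0 := by
  rw [(Submodule.span_eq_bot).2 h]
  exact rank_bot ℝ _

theorem rank_span_eq_one {S : Set (ℕ → ℝ)} {b : ℕ → ℝ} (hb : b ∈ S) (h0 : b ≠ 0)
    (h : ∀ x ∈ S, ∃ t : ℝ, x = t • b) : Module.rank ℝ (Submodule.span ℝ S) = 1 := by
  have : Submodule.span ℝ S = Submodule.span ℝ {b} := by
    apply le_antisymm
    · rw [Submodule.span_le]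
      intro x hx
      obtain ⟨t, rfl⟩ := h x hx
      exact Submodule.smul_mem _ _ (Submodule.mem_span_singleton_self b)
    · exact Submodule.span_mono (by simpa using hb)
  rw [this, rank_submodule_eq_one_iff]
  exact ⟨b, Submodule.mem_span_singleton_self b, h0, le_rfl⟩

end

end ConformalFlow

namespace ConformalFlow

noncomputable section

/-! ### Weighted bounds for the interaction -/

/-- Gauges compatible with the resonance condition. -/
structure Gauge (W : ℕ → ℝ) : Prop where
  nonneg : ∀ n, 0 ≤ W n
  zero : W 0 = 1
  mul_le : ∀ {n j k m : ℕ}, n + j = k + m → W j * W k * W m ≤ W n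

/-- The resonance 0 + n = n + 0 gives W n ^ 2 ≤ 1. -/
theorem Gauge.le_one {W : ℕ → ℝ} (hW : Gauge W) (n : ℕ) : W n ≤ 1 := by
  have := hW.mul_le (show 0 + n = n + 0 by omega)
  rw [hW.zero, mul_one] at this
  nlinarith [hW.nonneg n]

theorem gauge_one : Gauge fun _ => 1 :=
  ⟨fun _ => zero_le_one, rfl, fun _ => by norm_num⟩

/-- The trilinear resonant convolution. -/
def resConv (α β γ : ℕ → ℝ) (n : ℕ) : ℝ :=
  ∑' j, ∑ k ∈ Finset.range (n + j + 1), α j * β k * γ (n + j - k)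

/-- Nonnegative summable sequences. -/
def Majorant (α : ℕ → ℝ) : Prop := (∀ n, 0 ≤ α n) ∧ Summable α

theorem Majorant.add {α β : ℕ → ℝ} (ha : Majorant α) (hb : Majorant β) :
    Majorant (fun n => α n + β n) :=
  ⟨fun n => add_nonneg (ha.1 n) (hb.1 n), ha.2.add hb.2⟩

theorem resConv_summable {α β γ : ℕ → ℝ} (ha : Majorant α) (hb : Majorant β) (hc : Majorant γ) :
    (∀ n, Summable fun j => ∑ k ∈ Finset.range (n + j + 1), α j * β k * γ (n + j - k)) ∧
    Majorant (resConv α β γ) ∧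
    ∑' n, resConv α β γ n ≤ (∑' n, α n) * (∑' n, β n) * ∑' n, γ n := by
  obtain ⟨s, t⟩ := summable_of_three ha.1 hb.1 hc.1 ha.2 hb.2 hc.2 _ Quad.inj_jkm
  have s' : Summable fun q : Quad => α q.j * β q.k * γ q.m := by
    simpa only [mul_assoc] using s
  obtain ⟨r1, r2, r3⟩ := quad_rows (G := fun _ j k m => α j * β k * γ m) s'
  refine ⟨r1, ⟨fun n => tsum_nonneg fun j => Finset.sum_nonneg fun k _ =>
    mul_nonneg (mul_nonneg (ha.1 _) (hb.1 _)) (hc.1 _), r2⟩, ?_⟩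
  calc _ = ∑' q : Quad, α q.j * β q.k * γ q.m := r3
    _ ≤ _ := by simpa only [mul_assoc] using t

/-- Sequences dominated by a gauge times a majorant. -/
def DomBy (W α a : ℕ → ℝ) : Prop := ∀ n, |a n| ≤ W n * α n

theorem mul4_le {c N x y z X Y Z : ℝ} (hc0 : 0 ≤ c) (hc : c ≤ N) (hx0 : 0 ≤ x) (hx : x ≤ X)
    (hy0 : 0 ≤ y) (hy : y ≤ Y) (hz0 : 0 ≤ z) (hz : z ≤ Z) : c * x * y * z ≤ N * X * Y * Z := by
  have : 0 ≤ N := hc0.trans hc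
  have : 0 ≤ X := hx0.trans hx
  have : 0 ≤ Y := hy0.trans hy
  gcongr

/-- The gauges of the three factors multiply to at most that of the output mode, so the interaction
preserves the decay pattern at the sole cost of the factor n + 1 from the coupling. -/
theorem interaction_term_le {W α β γ a b c : ℕ → ℝ} (hW : Gauge W) (hα : Majorant α)
    (hβ : Majorant β) (hγ : Majorant γ) (ha : DomBy W α a) (hb : DomBy W β b) (hc : DomBy W γ c)
    {n j k m : ℕ} (h : n + j = k + m) :
    |(coupling n j k m : ℝ) * a j * b k * c m| ≤ ((n : ℝ) + 1) * W n * (α j * β k * γ m) := by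
  rw [abs_mul, abs_mul, abs_mul, Nat.abs_cast]
  have h0 := hW.nonneg
  have h1 := ha j; have h2 := hb k; have h3 := hc m
  have := hα.1 j; have := hβ.1 k; have := hγ.1 m
  calc _ ≤ ((n : ℝ) + 1) * (W j * α j) * (W k * β k) * (W m * γ m) :=
        mul4_le (Nat.cast_nonneg _) (coupling_le_fst _ _ _ _) (abs_nonneg _) h1 (abs_nonneg _) h2
          (abs_nonneg _) h3
    _ = ((n : ℝ) + 1) * (W j * W k * W m) * (α j * β k * γ m) := by ring
    _ ≤ _ := by gcongr; exact hW.mul_le h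

theorem interaction_row_le {W α β γ a b c : ℕ → ℝ} (hW : Gauge W) (hα : Majorant α)
    (hβ : Majorant β) (hγ : Majorant γ) (ha : DomBy W α a) (hb : DomBy W β b) (hc : DomBy W γ c)
    (n j : ℕ) :
    |∑ k ∈ Finset.range (n + j + 1), (coupling n j k (n + j - k) : ℝ) * a j * b k * c (n + j - k)|
      ≤ ((n : ℝ) + 1) * W n * ∑ k ∈ Finset.range (n + j + 1), α j * β k * γ (n + j - k) := by
  rw [Finset.mul_sum]
  refine (Finset.abs_sum_le_sum_abs _ _).trans (Finset.sum_le_sum fun k hk => ?_)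
  exact interaction_term_le hW hα hβ hγ ha hb hc (by have := Finset.mem_range.1 hk; omega)

theorem interaction_bound {W α β γ a b c : ℕ → ℝ} (hW : Gauge W) (hα : Majorant α)
    (hβ : Majorant β) (hγ : Majorant γ) (ha : DomBy W α a) (hb : DomBy W β b) (hc : DomBy W γ c)
    (n : ℕ) :
    (Summable fun j => ∑ k ∈ Finset.range (n + j + 1),
      (coupling n j k (n + j - k) : ℝ) * a j * b k * c (n + j - k)) ∧
    |interaction a b c n| ≤ ((n : ℝ) + 1) * W n * resConv α β γ n := by
  have hs := ((resConv_summable hα hβ hγ).1 n).mul_left (((n : ℝ) + 1) * W n)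
  have hle := interaction_row_le hW hα hβ hγ ha hb hc n
  have hs' := Summable.of_nonneg_of_le (fun j => abs_nonneg _) hle hs
  refine ⟨hs'.of_abs, ?_⟩
  have h1 := norm_tsum_le_tsum_norm (f := fun j => ∑ k ∈ Finset.range (n + j + 1),
    (coupling n j k (n + j - k) : ℝ) * a j * b k * c (n + j - k)) hs'
  have h2 := hs'.tsum_le_tsum hle hs
  rw [tsum_mul_left] at h2
  exact h1.trans h2

/-- Absolutely summable sequences. -/
def L1 (a : ℕ → ℝ) : Prop := Summable fun n => |a n|

theorem L1.majorant {a : ℕ → ℝ} (h : L1 a) : Majorant fun n => |a n| := ⟨fun n => abs_nonneg _, h⟩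

theorem domBy_one_abs (a : ℕ → ℝ) : DomBy (fun _ => 1) (fun n => |a n|) a := fun n => by simp

theorem L1.sub {a b : ℕ → ℝ} (ha : L1 a) (hb : L1 b) : L1 (a - b) :=
  Summable.of_nonneg_of_le (fun _ => abs_nonneg _) (fun n => abs_sub (a n) (b n))
    (Summable.add ha hb)

theorem DomBy.l1 {W α a : ℕ → ℝ} (hW : Gauge W) (hα : Majorant α) (h : DomBy W α a) : L1 a :=
  Summable.of_nonneg_of_le (fun n => abs_nonneg _) (fun n => (h n).trans
    (mul_le_of_le_one_left (hα.1 n) (hW.le_one n))) hα.2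

theorem interaction_summable {a b c : ℕ → ℝ} (ha : L1 a) (hb : L1 b) (hc : L1 c) (n : ℕ) :
    Summable fun j => ∑ k ∈ Finset.range (n + j + 1),
      (coupling n j k (n + j - k) : ℝ) * a j * b k * c (n + j - k) :=
  (interaction_bound gauge_one ha.majorant hb.majorant hc.majorant (domBy_one_abs a)
    (domBy_one_abs b) (domBy_one_abs c) n).1

theorem interaction_add₁ {a a' b c : ℕ → ℝ} (ha : L1 a) (ha' : L1 a') (hb : L1 b) (hc : L1 c)
    (n : ℕ) : interaction (a + a') b c n = interaction a b c n + interaction a' b c n := by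
  rw [interaction, interaction, interaction,
    ← (interaction_summable ha hb hc n).tsum_add (interaction_summable ha' hb hc n)]
  refine tsum_congr fun j => ?_
  rw [← Finset.sum_add_distrib]
  exact Finset.sum_congr rfl fun k _ => by simp only [Pi.add_apply]; ring

theorem interaction_add₂ {a b b' c : ℕ → ℝ} (ha : L1 a) (hb : L1 b) (hb' : L1 b') (hc : L1 c)
    (n : ℕ) : interaction a (b + b') c n = interaction a b c n + interaction a b' c n := by
  rw [interaction, interaction, interaction,
    ← (interaction_summable ha hb hc n).tsum_add (interaction_summable ha hb' hc n)]
  refine tsum_congr fun j => ?_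
  rw [← Finset.sum_add_distrib]
  exact Finset.sum_congr rfl fun k _ => by simp only [Pi.add_apply]; ring

theorem interaction_add₃ {a b c c' : ℕ → ℝ} (ha : L1 a) (hb : L1 b) (hc : L1 c) (hc' : L1 c')
    (n : ℕ) : interaction a b (c + c') n = interaction a b c n + interaction a b c' n := by
  rw [interaction, interaction, interaction,
    ← (interaction_summable ha hb hc n).tsum_add (interaction_summable ha hb hc' n)]
  refine tsum_congr fun j => ?_
  rw [← Finset.sum_add_distrib]
  exact Finset.sum_congr rfl fun k _ => by simp only [Pi.add_apply]; ring

/-! ### The nonlinear part at the lowest mode -/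

theorem lowestMode_eq : lowestMode = unitSeq 0 := rfl

theorem l1_lowestMode : L1 lowestMode := by
  have := summable_unitSeq 0
  exact this.abs

theorem lowestMode_dom {W : ℕ → ℝ} (hW : Gauge W) : DomBy W (unitSeq 0) lowestMode := fun n => by
  rcases Nat.eq_zero_or_pos n with rfl | h
  · simp [lowestMode, unitSeq, hW.zero]
  · simp [lowestMode, unitSeq, h.ne']

theorem majorant_unitSeq (i : ℕ) : Majorant (unitSeq i) := ⟨unitSeq_nonneg i, summable_unitSeq i⟩

theorem interaction_low_second (b : ℕ → ℝ) (n : ℕ) :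
    interaction lowestMode b lowestMode n = b n := by
  rw [interaction, tsum_eq_single 0]
  · rw [Finset.sum_eq_single n]
    · simp [lowestMode, coupling]
    · intro k hk hkn
      have : n + 0 - k ≠ 0 := by have := Finset.mem_range.1 hk; omega
      simp [lowestMode]; intro; omega
    · intro h; exact absurd (Finset.mem_range.2 (by omega)) h
  · intro j hj
    exact Finset.sum_eq_zero fun k _ => by simp [lowestMode, hj]

theorem interaction_low_third (c : ℕ → ℝ) (n : ℕ) :
    interaction lowestMode lowestMode c n = c n := by
  rw [interaction, tsum_eq_single 0]
  · rw [Finset.sum_eq_single 0]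
    · simp [lowestMode, coupling]
    · intro k _ hk; simp [lowestMode, hk]
    · simp
  · intro j hj
    exact Finset.sum_eq_zero fun k _ => by simp [lowestMode, hj]

theorem interaction_low_first (a : ℕ → ℝ) (n : ℕ) :
    interaction a lowestMode lowestMode n = if n = 0 then a 0 else 0 := by
  have h : ∀ j, ∑ k ∈ Finset.range (n + j + 1), (coupling n j k (n + j - k) : ℝ) * a j *
      lowestMode k * lowestMode (n + j - k) = if n + j = 0 then a j else 0 := by
    intro j
    rw [Finset.sum_eq_single 0]
    · by_cases h : n + j = 0
      · have h1 : n = 0 := by omega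
        have h2 : j = 0 := by omega
        subst h1; subst h2
        simp [lowestMode, coupling]
      · have : ¬ (n = 0 ∧ j = 0) := by omega
        simp [lowestMode, this]
    · intro k _ hk; simp [lowestMode, hk]
    · simp
  rw [interaction]
  simp only [h]
  split_ifs with h0
  · subst h0
    rw [tsum_eq_single 0]
    · simp
    · intro j hj; simp [hj]
  · have : ∀ j, ¬ (n + j = 0) := fun j => by omega
    simp only [this, if_false, tsum_zero]

/-- The interaction minus its linearization at the lowest mode. -/
def nonlin (A : ℕ → ℝ) (n : ℕ) : ℝ :=
  interaction A A A n - (if n = 0 then 3 * A 0 - 2 else 2 * A n)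

theorem nonlin_lowestMode (n : ℕ) : nonlin lowestMode n = 0 := by
  rw [nonlin, interaction_low_second]
  split_ifs with h
  · subst h; simp [lowestMode]; norm_num
  · simp [lowestMode, h]

/-- Replace A by A' one slot at a time and split the other slots into lowest mode plus perturbation.
The terms with two lowest modes are the linearization and cancel. Six terms remain, each with a
factor of size ρ: three bounded by ρ(1+ρ)∑χ and three by ρ∑χ, in all 6ρ + 3ρ² ≤ 7ρ because ρ ≤ 1/3.
-/
theorem nonlin_diff {W α α' χ A A' : ℕ → ℝ} {ρ : ℝ} (hρ : ρ ≤ 1 / 3) (hW : Gauge W)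
    (hα : Majorant α) (hα' : Majorant α') (hχ : Majorant χ) (sα : ∑' n, α n ≤ ρ)
    (sα' : ∑' n, α' n ≤ ρ) (hA : DomBy W α (A - lowestMode)) (hA' : DomBy W α' (A' - lowestMode))
    (hh : DomBy W χ (A - A')) :
    ∃ θ, Majorant θ ∧ ∑' n, θ n ≤ 7 * ρ * ∑' n, χ n ∧
      ∀ n, |nonlin A n - nonlin A' n| ≤ ((n : ℝ) + 1) * W n * θ n := by
  set δ := lowestMode with hδ
  set a := A - δ with ha
  set a' := A' - δ with ha'
  set h := A - A' with hhd
  have eA : A = δ + a := by rw [ha]; abel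
  have eA' : A' = δ + a' := by rw [ha']; abel
  have hu := majorant_unitSeq 0
  have su := tsum_unitSeq 0
  have hδd := lowestMode_dom hW
  set e := unitSeq 0 with he
  have domA : DomBy W (fun n => e n + α n) A := fun n => by
    rw [eA, mul_add]
    exact (abs_add_le _ _).trans (add_le_add (hδd n) (hA n))
  have domA' : DomBy W (fun n => e n + α' n) A' := fun n => by
    rw [eA', mul_add]
    exact (abs_add_le _ _).trans (add_le_add (hδd n) (hA' n))
  have mA := hu.add hα
  have mA' := hu.add hα'
  have sA : ∑' n, (e n + α n) ≤ 1 + ρ := by rw [hu.2.tsum_add hα.2, su]; linarith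
  have sA' : ∑' n, (e n + α' n) ≤ 1 + ρ := by rw [hu.2.tsum_add hα'.2, su]; linarith
  have lδ : L1 δ := l1_lowestMode
  have la : L1 a := hA.l1 hW hα
  have la' : L1 a' := hA'.l1 hW hα'
  have lh : L1 h := hh.l1 hW hχ
  have lA : L1 A := domA.l1 hW mA
  have lA' : L1 A' := domA'.l1 hW mA'
  have hsplit : ∀ n, nonlin A n - nonlin A' n =
      interaction h a A n + interaction h δ a n + interaction a' h A n + interaction δ h a n +
      interaction a' A' h n + interaction δ a' h n := by
    intro n
    have e1 : interaction A A A n = interaction h A A n + interaction A' A A n := by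
      rw [← interaction_add₁ lh lA' lA lA, hhd, sub_add_cancel]
    have e2 : interaction A' A A n = interaction A' h A n + interaction A' A' A n := by
      rw [← interaction_add₂ lA' lh lA' lA, hhd, sub_add_cancel]
    have e3 : interaction A' A' A n = interaction A' A' h n + interaction A' A' A' n := by
      rw [← interaction_add₃ lA' lA' lh lA', hhd, sub_add_cancel]
    have e4 : interaction h A A n = interaction h δ δ n + interaction h δ a n +
        interaction h a A n := by
      rw [← interaction_add₃ lh lδ lδ la, ← eA, ← interaction_add₂ lh lδ la lA, ← eA]
    have e5 : interaction A' h A n = interaction δ h δ n + interaction δ h a n +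
        interaction a' h A n := by
      rw [← interaction_add₃ lδ lh lδ la, ← eA, ← interaction_add₁ lδ la' lh lA, ← eA']
    have e6 : interaction A' A' h n = interaction δ δ h n + interaction δ a' h n +
        interaction a' A' h n := by
      rw [← interaction_add₂ lδ lδ la' lh, ← eA', ← interaction_add₁ lδ la' lA' lh, ← eA']
    rw [interaction_low_first] at e4
    rw [interaction_low_second] at e5
    rw [interaction_low_third] at e6
    have e7 : ∀ i, h i = A i - A' i := fun i => rfl
    rw [nonlin, nonlin, e1, e2, e3, e4, e5, e6]
    split_ifs with h0
    · subst h0; rw [e7]; ring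
    · rw [e7]; ring
  obtain ⟨-, m1, t1⟩ := resConv_summable hχ hα mA
  obtain ⟨-, m2, t2⟩ := resConv_summable hχ hu hα
  obtain ⟨-, m3, t3⟩ := resConv_summable hα' hχ mA
  obtain ⟨-, m4, t4⟩ := resConv_summable hu hχ hα
  obtain ⟨-, m5, t5⟩ := resConv_summable hα' mA' hχ
  obtain ⟨-, m6, t6⟩ := resConv_summable hu hα' hχ
  refine ⟨fun n => resConv χ α (fun n => e n + α n) n + resConv χ e α n +
    resConv α' χ (fun n => e n + α n) n + resConv e χ α n +
    resConv α' (fun n => e n + α' n) χ n + resConv e α' χ n,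
    ((((m1.add m2).add m3).add m4).add m5).add m6, ?_, fun n => ?_⟩
  · rw [((((m1.add m2).add m3).add m4).add m5).2.tsum_add m6.2,
      (((m1.add m2).add m3).add m4).2.tsum_add m5.2, ((m1.add m2).add m3).2.tsum_add m4.2,
      (m1.add m2).2.tsum_add m3.2, m1.2.tsum_add m2.2]
    have sχ0 : 0 ≤ ∑' n, χ n := tsum_nonneg hχ.1
    have sα0 : 0 ≤ ∑' n, α n := tsum_nonneg hα.1
    have sα0' : 0 ≤ ∑' n, α' n := tsum_nonneg hα'.1
    have ρ0 : 0 ≤ ρ := sα0.trans sα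
    set X := ∑' n, χ n
    set a1 := ∑' n, α n
    set a2 := ∑' n, α' n
    set b1 := ∑' n, (e n + α n)
    set b2 := ∑' n, (e n + α' n)
    have b10 : 0 ≤ b1 := tsum_nonneg mA.1
    have b20 : 0 ≤ b2 := tsum_nonneg mA'.1
    rw [su] at t2 t4 t6
    have u1 : X * a1 * b1 ≤ X * ρ * (1 + ρ) := by gcongr
    have u2 : X * 1 * a1 ≤ X * 1 * ρ := by gcongr
    have u3 : a2 * X * b1 ≤ ρ * X * (1 + ρ) := by gcongr
    have u5 : a2 * b2 * X ≤ ρ * (1 + ρ) * X := by gcongr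
    have u6 : 1 * a2 * X ≤ 1 * ρ * X := by gcongr
    have u7 : 3 * ρ * (ρ * X) ≤ 1 * (ρ * X) :=
      mul_le_mul_of_nonneg_right (by linarith) (mul_nonneg ρ0 sχ0)
    linarith
  · rw [hsplit n]
    have i1 := (interaction_bound hW hχ hα mA hh hA domA n).2
    have i2 := (interaction_bound hW hχ hu hα hh hδd hA n).2
    have i3 := (interaction_bound hW hα' hχ mA hA' hh domA n).2
    have i4 := (interaction_bound hW hu hχ hα hδd hh hA n).2
    have i5 := (interaction_bound hW hα' mA' hχ hA' domA' hh n).2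
    have i6 := (interaction_bound hW hu hα' hχ hδd hA' hh n).2
    refine (abs_add_le _ _).trans ?_
    refine (add_le_add_left ((abs_add_le _ _).trans (add_le_add_left ((abs_add_le _ _).trans
      (add_le_add_left ((abs_add_le _ _).trans (add_le_add_left (abs_add_le _ _) _)) _)) _)) _).trans
      ?_
    simp only [mul_add]
    linarith

/-! ### Lyapunov–Schmidt reduction -/

/-- The eigenvalues of the linearization at the lowest mode. -/
def linEig (ω : ℝ) (n : ℕ) : ℝ := if n = 0 then 2 else 2 - ((n : ℝ) + 1) * (1 - n * ω)

/-- For ω = 1/6 and n ≥ 1 the eigenvalue is (n-2)(n-3)/6, which is positive off the modes 2 and 3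
and grows quadratically. The tightest cases are n = 1 and n = 4, with value 1/3. -/
theorem linEig_lower {ω : ℝ} (hω : |ω - 1 / 6| ≤ 1 / 1000) {n : ℕ} (h2 : n ≠ 2) (h3 : n ≠ 3) :
    ((n : ℝ) + 1) ^ 2 / 100 ≤ linEig ω n := by
  rw [abs_le] at hω
  obtain ⟨l, u⟩ := hω
  rw [linEig]
  split_ifs with h0
  · subst h0; norm_num
  · by_cases h5 : 5 ≤ n
    · have h5' : (5 : ℝ) ≤ n := by exact_mod_cast h5
      have hx : (1 / 6 - 1 / 1000 : ℝ) ≤ ω := by linarith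
      have : (n : ℝ) * (n + 1) * (1 / 6 - 1 / 1000) ≤ n * (n + 1) * ω := by gcongr
      nlinarith
    · have : n = 1 ∨ n = 4 := by omega
      rcases this with rfl | rfl <;> norm_num <;> linarith

/-- The stationary equation in mode `n`. -/
def RowEq (ω : ℝ) (A : ℕ → ℝ) (n : ℕ) : Prop :=
  ((n : ℝ) + 1) * (1 - n * ω) * A n = interaction A A A n

theorem rowEq_iff (ω : ℝ) (A : ℕ → ℝ) (n : ℕ) :
    RowEq ω A n ↔ linEig ω n * (A n - lowestMode n) = -nonlin A n := by
  rw [RowEq, nonlin, linEig]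
  split_ifs with h
  · subst h; simp only [lowestMode, if_true]; constructor <;> intro h <;> push_cast at * <;> linarith
  · simp only [lowestMode, h, if_false]; constructor <;> intro h <;> linarith

theorem rowEq_of_stationary {ω : ℝ} {A : ℕ → ℝ} (h : IsStationary 1 ω A) (n : ℕ) :
    RowEq ω A n := h n

/-- The radius of the neighbourhood of the lowest mode on which the reduction is performed. -/
def rad : ℝ := 1 / 10000

/-- The quadratic growth of the eigenvalue absorbs the factor n + 1 which the coupling costs. -/
theorem abs_le_of_linEig {ω : ℝ} (hω : |ω - 1 / 6| ≤ 1 / 1000) {n : ℕ} (h2 : n ≠ 2) (h3 : n ≠ 3)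
    {x y w θ : ℝ} (hw : 0 ≤ w * θ) (h : linEig ω n * x = y)
    (hy : |y| ≤ ((n : ℝ) + 1) * w * θ) : |x| ≤ 100 * (w * θ) := by
  have hl := linEig_lower hω h2 h3
  have hn : (1 : ℝ) ≤ (n : ℝ) + 1 := by linarith [n.cast_nonneg (α := ℝ)]
  have h1 : 0 < linEig ω n := lt_of_lt_of_le (by positivity) hl
  rw [← h, abs_mul, abs_of_pos h1] at hy
  have h4 : ((n : ℝ) + 1) ^ 2 / 100 * |x| ≤ ((n : ℝ) + 1) * w * θ :=
    (mul_le_mul_of_nonneg_right hl (abs_nonneg x)).trans hy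
  have h5 : ((n : ℝ) + 1) * |x| ≤ 100 * (w * θ) := by
    have : ((n : ℝ) + 1) * (((n : ℝ) + 1) * |x|) ≤ ((n : ℝ) + 1) * (100 * (w * θ)) := by linarith
    exact le_of_mul_le_mul_left this (by linarith)
  nlinarith [abs_nonneg x]

/-- Solutions of the reduced system depend in a Lipschitz way on `A₂` and `A₃`. -/
theorem reduced_lipschitz {ω : ℝ} (hω : |ω - 1 / 6| ≤ 1 / 1000) {A A' : ℕ → ℝ}
    (lA : L1 (A - lowestMode)) (lA' : L1 (A' - lowestMode))
    (sA : ∑' n, |(A - lowestMode) n| ≤ rad) (sA' : ∑' n, |(A' - lowestMode) n| ≤ rad)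
    (hA : ∀ n, n ≠ 2 → n ≠ 3 → RowEq ω A n) (hA' : ∀ n, n ≠ 2 → n ≠ 3 → RowEq ω A' n) :
    ∑' n, |(A - A') n| ≤ 2 * (|A 2 - A' 2| + |A 3 - A' 3|) := by
  have lh : L1 (A - A') := by
    have := lA.sub lA'
    simpa using this
  obtain ⟨θ, mθ, tθ, hθ⟩ := nonlin_diff (by norm_num [rad]) gauge_one lA.majorant lA'.majorant
    lh.majorant sA sA' (domBy_one_abs _) (domBy_one_abs _) (domBy_one_abs _)
  have key : ∀ n, |(A - A') n| ≤
      |A 2 - A' 2| * unitSeq 2 n + |A 3 - A' 3| * unitSeq 3 n + 100 * θ n := by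
    intro n
    have h0 := mθ.1 n
    by_cases h2 : n = 2
    · subst h2; simp [unitSeq]; exact h0
    by_cases h3 : n = 3
    · subst h3; simp [unitSeq]; exact h0
    have e1 := (rowEq_iff ω A n).1 (hA n h2 h3)
    have e2 := (rowEq_iff ω A' n).1 (hA' n h2 h3)
    have e : linEig ω n * ((A - A') n) = -(nonlin A n - nonlin A' n) := by
      simp only [Pi.sub_apply]; linarith
    have := abs_le_of_linEig hω h2 h3 (w := 1) (θ := θ n) (by linarith) e
      (by rw [abs_neg]; exact hθ n)
    simp [unitSeq, h2, h3] at this ⊢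
    exact this
  have s1 := (summable_unitSeq 2).mul_left |A 2 - A' 2|
  have s2 := (summable_unitSeq 3).mul_left |A 3 - A' 3|
  have s3 := mθ.2.mul_left 100
  have := Summable.tsum_le_tsum key lh ((s1.add s2).add s3)
  rw [(s1.add s2).tsum_add s3, s1.tsum_add s2, tsum_mul_left, tsum_mul_left, tsum_mul_left,
    tsum_unitSeq, tsum_unitSeq] at this
  have h0 : 0 ≤ ∑' n, |(A - A') n| := tsum_nonneg fun n => abs_nonneg _
  -- The nonlinear part contributes at most 700 * rad = 0.07 times the left-hand side and is
  -- absorbed.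
  unfold rad at tθ
  linarith

end

end ConformalFlow

/-! ### Solving the reduced system by contraction -/

namespace ConformalFlow

noncomputable section

theorem memlp_one_iff (a : ℕ → ℝ) : Memℓp a 1 ↔ L1 a := by
  rw [memℓp_gen_iff (by norm_num)]
  simp [L1]

theorem norm_lp_one (x : lp (fun _ : ℕ => ℝ) 1) : ‖x‖ = ∑' n, |x n| := by
  rw [lp.norm_eq_tsum_rpow (by norm_num)]
  simp

theorem l1_lp_one (x : lp (fun _ : ℕ => ℝ) 1) : L1 x := (memlp_one_iff _).1 (lp.memℓp x)

/-- The set of sequences of gauge norm at most `ρ`. -/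
def gaugeBall (W : ℕ → ℝ) (ρ : ℝ) : Set (lp (fun _ : ℕ => ℝ) 1) :=
  {x | (∀ n, W n = 0 → x n = 0) ∧ ∀ N, ∑ n ∈ Finset.range N, |x n| / W n ≤ ρ}

theorem continuous_coord_lp_one (n : ℕ) : Continuous fun x : lp (fun _ : ℕ => ℝ) 1 => x n := by
  refine LipschitzWith.continuous (K := 1) (LipschitzWith.of_dist_le_mul fun x y => ?_)
  rw [NNReal.coe_one, one_mul, dist_eq_norm, dist_eq_norm]
  exact lp.norm_apply_le_norm (by norm_num) (x - y) n

theorem isClosed_gaugeBall (W : ℕ → ℝ) (ρ : ℝ) : IsClosed (gaugeBall W ρ) := by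
  have : gaugeBall W ρ = (⋂ n, ⋂ _ : W n = 0, {x | x n = 0}) ∩
      ⋂ N, {x | ∑ n ∈ Finset.range N, |x n| / W n ≤ ρ} := by
    ext x; simp [gaugeBall]
  rw [this]
  refine IsClosed.inter (isClosed_iInter fun n => isClosed_iInter fun _ =>
    isClosed_eq (continuous_coord_lp_one n) continuous_const) (isClosed_iInter fun N => ?_)
  exact isClosed_le (continuous_finsetSum _ fun n _ =>
    (continuous_coord_lp_one n).abs.div_const _) continuous_const

theorem mem_gaugeBall_majorant {W : ℕ → ℝ} (hW : Gauge W) {ρ : ℝ} {x : lp (fun _ : ℕ => ℝ) 1}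
    (hx : x ∈ gaugeBall W ρ) : Majorant (fun n => |x n| / W n) ∧ ∑' n, |x n| / W n ≤ ρ ∧
      DomBy W (fun n => |x n| / W n) x := by
  have h0 : ∀ n, 0 ≤ |x n| / W n := fun n => div_nonneg (abs_nonneg _) (hW.nonneg n)
  refine ⟨⟨h0, summable_of_sum_range_le h0 hx.2⟩, Real.tsum_le_of_sum_range_le h0 hx.2,
    fun n => ?_⟩
  -- Division by zero yields 0, so at zeros of the gauge the quotient controls nothing; there the
  -- vanishing of x is a condition of its own.
  by_cases h : W n = 0
  · rw [hx.1 n h, abs_zero]; exact mul_nonneg (hW.nonneg n) (h0 n)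
  · rw [mul_div_cancel₀ _ h]

theorem mem_gaugeBall_of_dom {W β : ℕ → ℝ} (hW : Gauge W) {ρ : ℝ} {x : lp (fun _ : ℕ => ℝ) 1}
    (hβ : Majorant β) (sβ : ∑' n, β n ≤ ρ) (h : DomBy W β x) : x ∈ gaugeBall W ρ := by
  refine ⟨fun n hn => ?_, fun N => ?_⟩
  · have := h n
    rw [hn, zero_mul] at this
    exact abs_eq_zero.1 (le_antisymm this (abs_nonneg _))
  · refine (Finset.sum_le_sum fun n _ => ?_).trans ((hβ.2.sum_le_tsum _ fun n _ => hβ.1 n).trans sβ)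
    refine div_le_of_le_mul₀ (hW.nonneg n) (hβ.1 n) ?_
    rw [mul_comm]; exact h n

/-- The fixed-point map of the reduced system. -/
def redMap (ω ε μ : ℝ) (a : ℕ → ℝ) (n : ℕ) : ℝ :=
  if n = 2 then ε else if n = 3 then μ else -nonlin (lowestMode + a) n / linEig ω n

theorem linEig_mul_redMap {ω ε μ : ℝ} (hω : |ω - 1 / 6| ≤ 1 / 1000) (a : ℕ → ℝ) {n : ℕ}
    (h2 : n ≠ 2) (h3 : n ≠ 3) :
    linEig ω n * redMap ω ε μ a n = -nonlin (lowestMode + a) n := by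
  have hl := linEig_lower hω h2 h3
  have h1 : 0 < linEig ω n := lt_of_lt_of_le (by positivity) hl
  rw [redMap, if_neg h2, if_neg h3, mul_div_cancel₀ _ h1.ne']

/-- Invariance of the gauge ball: the two prescribed modes cost at most rad/4 each, the nonlinear
part at most 700 * rad² = 0.07 * rad. -/
theorem redMap_dom {ω ε μ : ℝ} (hω : |ω - 1 / 6| ≤ 1 / 1000) {W α a : ℕ → ℝ} (hW : Gauge W)
    (hα : Majorant α) (sα : ∑' n, α n ≤ rad) (ha : DomBy W α a) (hε : |ε| ≤ W 2 * (rad / 4))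
    (hμ : |μ| ≤ W 3 * (rad / 4)) :
    ∃ β, Majorant β ∧ ∑' n, β n ≤ rad ∧ DomBy W β (redMap ω ε μ a) := by
  have hz : Majorant fun _ : ℕ => (0 : ℝ) := ⟨fun _ => le_rfl, summable_zero⟩
  obtain ⟨θ, mθ, tθ, hθ⟩ := nonlin_diff (A := lowestMode + a) (A' := lowestMode) (α := α)
    (α' := fun _ => 0) (χ := α) (ρ := rad) (by norm_num [rad]) hW hα hz hα sα
    (by rw [tsum_zero]; norm_num [rad]) (by rwa [add_sub_cancel_left])
    (fun n => by simp) (by rwa [add_sub_cancel_left])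
  have s2 := (majorant_unitSeq 2)
  have s3 := (majorant_unitSeq 3)
  have r0 : 0 ≤ rad := by norm_num [rad]
  refine ⟨fun n => rad / 4 * unitSeq 2 n + rad / 4 * unitSeq 3 n + 100 * θ n,
    ⟨fun n => add_nonneg (add_nonneg (mul_nonneg (by positivity) (s2.1 n))
      (mul_nonneg (by positivity) (s3.1 n))) (mul_nonneg (by norm_num) (mθ.1 n)),
      ((s2.2.mul_left _).add (s3.2.mul_left _)).add (mθ.2.mul_left _)⟩, ?_, fun n => ?_⟩
  · rw [((s2.2.mul_left _).add (s3.2.mul_left _)).tsum_add (mθ.2.mul_left _),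
      (s2.2.mul_left _).tsum_add (s3.2.mul_left _), tsum_mul_left, tsum_mul_left, tsum_mul_left,
      tsum_unitSeq, tsum_unitSeq]
    have : 7 * rad * ∑' n, α n ≤ 7 * rad * rad := by gcongr
    unfold rad at *
    linarith
  · have hw := hW.nonneg n
    have h0 := mθ.1 n
    by_cases h2 : n = 2
    · subst h2
      have : 0 ≤ W 2 * (100 * θ 2) := by positivity
      simp [redMap, unitSeq, mul_add]
      linarith
    by_cases h3 : n = 3
    · subst h3
      have : 0 ≤ W 3 * (100 * θ 3) := by positivity
      simp [redMap, unitSeq, mul_add]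
      linarith
    have := abs_le_of_linEig hω h2 h3 (w := W n) (θ := θ n) (by positivity)
      (linEig_mul_redMap (ε := ε) (μ := μ) hω a h2 h3)
      (by rw [abs_neg]; simpa [nonlin_lowestMode] using hθ n)
    simp [unitSeq, h2, h3] at this ⊢
    linarith

theorem redMap_contract {ω ε μ : ℝ} (hω : |ω - 1 / 6| ≤ 1 / 1000) {a a' : ℕ → ℝ}
    (la : L1 a) (la' : L1 a') (sa : ∑' n, |a n| ≤ rad) (sa' : ∑' n, |a' n| ≤ rad) :
    L1 (redMap ω ε μ a - redMap ω ε μ a') ∧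
    ∑' n, |(redMap ω ε μ a - redMap ω ε μ a') n| ≤ 1 / 2 * ∑' n, |(a - a') n| := by
  have e0 : lowestMode + a - (lowestMode + a') = a - a' := by abel
  obtain ⟨θ, mθ, tθ, hθ⟩ := nonlin_diff (A := lowestMode + a) (A' := lowestMode + a')
    (ρ := rad) (by norm_num [rad]) gauge_one la.majorant la'.majorant
    (la.sub la').majorant sa sa' (by rw [add_sub_cancel_left]; exact domBy_one_abs _)
    (by rw [add_sub_cancel_left]; exact domBy_one_abs _) (by rw [e0]; exact domBy_one_abs _)
  have key : ∀ n, |(redMap ω ε μ a - redMap ω ε μ a') n| ≤ 100 * θ n := by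
    intro n
    have h0 := mθ.1 n
    by_cases h2 : n = 2
    · subst h2; simp [redMap]; exact h0
    by_cases h3 : n = 3
    · subst h3; simp [redMap]; exact h0
    have e1 := linEig_mul_redMap (ε := ε) (μ := μ) hω a h2 h3
    have e2 := linEig_mul_redMap (ε := ε) (μ := μ) hω a' h2 h3
    have e : linEig ω n * ((redMap ω ε μ a - redMap ω ε μ a') n) =
        -(nonlin (lowestMode + a) n - nonlin (lowestMode + a') n) := by
      simp only [Pi.sub_apply]; linarith
    have := abs_le_of_linEig hω h2 h3 (w := 1) (θ := θ n) (by linarith) e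
      (by rw [abs_neg]; exact hθ n)
    linarith
  have l : L1 (redMap ω ε μ a - redMap ω ε μ a') :=
    Summable.of_nonneg_of_le (fun n => abs_nonneg _) key (mθ.2.mul_left 100)
  refine ⟨l, (l.tsum_le_tsum key (mθ.2.mul_left 100)).trans ?_⟩
  rw [tsum_mul_left]
  have : 0 ≤ ∑' n, |(a - a') n| := tsum_nonneg fun n => abs_nonneg _
  unfold rad at tθ
  linarith

/-- Solutions of the reduced system in a gauge ball. -/
theorem exists_reduced {W : ℕ → ℝ} (hW : Gauge W) {ω ε μ : ℝ} (hω : |ω - 1 / 6| ≤ 1 / 1000)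
    (hε : |ε| ≤ W 2 * (rad / 4)) (hμ : |μ| ≤ W 3 * (rad / 4)) :
    ∃ A β : ℕ → ℝ, Majorant β ∧ ∑' n, β n ≤ rad ∧ DomBy W β (A - lowestMode) ∧
      A 2 = ε ∧ A 3 = μ ∧ ∀ n, n ≠ 2 → n ≠ 3 → RowEq ω A n := by
  have hball : ∀ x ∈ gaugeBall W rad, ∑' n, |x n| ≤ rad := fun x hx => by
    obtain ⟨m, s, d⟩ := mem_gaugeBall_majorant hW hx
    exact ((l1_lp_one x).tsum_le_tsum (fun n => (d n).trans
      (mul_le_of_le_one_left (m.1 n) (hW.le_one n))) m.2).trans s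
  have hdom : ∀ x ∈ gaugeBall W rad,
      ∃ β, Majorant β ∧ ∑' n, β n ≤ rad ∧ DomBy W β (redMap ω ε μ x) := fun x hx => by
    obtain ⟨m, s, d⟩ := mem_gaugeBall_majorant hW hx
    exact redMap_dom hω hW m s d hε hμ
  have hl : ∀ x ∈ gaugeBall W rad, Memℓp (redMap ω ε μ x) 1 := fun x hx => by
    obtain ⟨β, m, s, d⟩ := hdom x hx
    exact (memlp_one_iff _).2 (d.l1 hW m)
  classical
  let Φ : lp (fun _ : ℕ => ℝ) 1 → lp (fun _ : ℕ => ℝ) 1 := fun x =>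
    if hx : x ∈ gaugeBall W rad then ⟨redMap ω ε μ x, hl x hx⟩ else 0
  have hΦ : ∀ x (hx : x ∈ gaugeBall W rad), (Φ x : ℕ → ℝ) = redMap ω ε μ x := fun x hx => by
    simp only [Φ, dif_pos hx]
  have hmaps : Set.MapsTo Φ (gaugeBall W rad) (gaugeBall W rad) := fun x hx => by
    obtain ⟨β, m, s, d⟩ := hdom x hx
    refine mem_gaugeBall_of_dom hW m s ?_
    rw [hΦ x hx]; exact d
  -- The contraction is measured in plain ℓ¹; of the gauge ball only closedness in ℓ¹ and invariance
  -- are used. Hence one fixed-point argument gives the decay bounds of every gauge.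
  have hcontr : ContractingWith (1 / 2) (hmaps.restrict Φ _ _) := by
    refine ⟨by rw [← NNReal.coe_lt_coe]; norm_num, LipschitzWith.of_dist_le_mul fun x y => ?_⟩
    rw [Subtype.dist_eq, Subtype.dist_eq, dist_eq_norm, dist_eq_norm, norm_lp_one, norm_lp_one]
    have := (redMap_contract (ε := ε) (μ := μ) hω (l1_lp_one x) (l1_lp_one y) (hball x x.2)
      (hball y y.2)).2
    simp only [Set.MapsTo.val_restrict_apply, lp.coeFn_sub, hΦ _ x.2, hΦ _ y.2]
    simpa using this
  have h0 : (0 : lp (fun _ : ℕ => ℝ) 1) ∈ gaugeBall W rad :=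
    ⟨fun n _ => rfl, fun N => by simp [rad]⟩
  obtain ⟨x, hx, hfix, -⟩ := hcontr.exists_fixedPoint' (isClosed_gaugeBall W rad).isComplete hmaps
    h0 (edist_ne_top _ _)
  have hx' : (x : ℕ → ℝ) = redMap ω ε μ x := by rw [← hΦ x hx, hfix]
  obtain ⟨m, s, d⟩ := mem_gaugeBall_majorant hW hx
  refine ⟨lowestMode + x, _, m, s, by rwa [add_sub_cancel_left], ?_, ?_, fun n h2 h3 => ?_⟩
  · rw [Pi.add_apply, hx']; simp [lowestMode, redMap]
  · rw [Pi.add_apply, hx']; simp [lowestMode, redMap]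
  · rw [rowEq_iff, Pi.add_apply, add_sub_cancel_left, ← linEig_mul_redMap (ε := ε) (μ := μ) hω _
      h2 h3, ← hx']

/-- Small solutions of the reduced system obey the bounds of every gauge dominating `A₂`, `A₃`. -/
theorem reduced_dom {W : ℕ → ℝ} (hW : Gauge W) {ω : ℝ} (hω : |ω - 1 / 6| ≤ 1 / 1000)
    {A : ℕ → ℝ} (lA : L1 (A - lowestMode)) (sA : ∑' n, |(A - lowestMode) n| ≤ rad)
    (hA : ∀ n, n ≠ 2 → n ≠ 3 → RowEq ω A n) (hε : |A 2| ≤ W 2 * (rad / 4))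
    (hμ : |A 3| ≤ W 3 * (rad / 4)) :
    ∃ β : ℕ → ℝ, Majorant β ∧ ∑' n, β n ≤ rad ∧ DomBy W β (A - lowestMode) := by
  -- Solve again inside the gauge ball with the same A₂ and A₃; the ℓ¹ Lipschitz bound identifies
  -- the two solutions, so A inherits the gauge bounds.
  obtain ⟨A', β, m, s, d, e2, e3, hA'⟩ := exists_reduced hW hω hε hμ
  have lA' : L1 (A' - lowestMode) := d.l1 hW m
  have sA' : ∑' n, |(A' - lowestMode) n| ≤ rad := (lA'.tsum_le_tsum (fun n => (d n).trans
      (mul_le_of_le_one_left (m.1 n) (hW.le_one n))) m.2).trans s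
  have h := reduced_lipschitz hω lA lA' sA sA' hA hA'
  rw [e2, e3, sub_self, sub_self, abs_zero, add_zero, mul_zero] at h
  have lh : L1 (A - A') := by
    have := lA.sub lA'
    simpa using this
  have : A = A' := by
    ext n
    have h1 := lh.le_tsum n fun i _ => abs_nonneg _
    have : |(A - A') n| = 0 := le_antisymm (h1.trans h) (abs_nonneg _)
    exact sub_eq_zero.1 (abs_eq_zero.1 this)
  subst this
  exact ⟨β, m, s, d⟩

end

end ConformalFlow

namespace ConformalFlow

noncomputable section

/-! ### States measured by a gauge -/

/-- The factor which records the divisibility by three and the parity of a mode. -/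
def classWeight (x y : ℝ) (n : ℕ) : ℝ := (if 3 ∣ n then 1 else x) * (if Even n then 1 else y)

theorem classWeight_nonneg {x y : ℝ} (hx : 0 ≤ x) (hy : 0 ≤ y) (n : ℕ) : 0 ≤ classWeight x y n := by
  rw [classWeight]; split_ifs <;> positivity

theorem classWeight_le_one {x y : ℝ} (hx0 : 0 ≤ x) (hx : x ≤ 1) (hy : y ≤ 1) (n : ℕ) :
    classWeight x y n ≤ 1 := by
  rw [classWeight]
  split_ifs
  · norm_num
  · linarith
  · linarith
  · nlinarith

/-- If j, k, m are all divisible by three (all even), so is n = k + m - j. Hence a factor x (or y)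
on the right is matched by at least one on the left, and surplus factors are at most 1. -/
theorem classWeight_mul_le {x y : ℝ} (hx0 : 0 ≤ x) (hx : x ≤ 1) (hy0 : 0 ≤ y) (hy : y ≤ 1)
    {n j k m : ℕ} (h : n + j = k + m) :
    classWeight x y j * classWeight x y k * classWeight x y m ≤ classWeight x y n := by
  have key : ∀ (P : ℕ → Prop) [DecidablePred P] (z : ℝ), 0 ≤ z → z ≤ 1 →
      (P j → P k → P m → P n) →
      (if P j then 1 else z) * (if P k then 1 else z) * (if P m then 1 else z) ≤
        (if P n then 1 else z) := by
    intro P _ z h0 h1 hP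
    have hz2 : z * z ≤ z := by nlinarith
    have hz3 : z * z * z ≤ z := by nlinarith
    by_cases h4 : P n
    · rw [if_pos h4]
      split_ifs <;> nlinarith
    · rw [if_neg h4]
      split_ifs with a b c <;> first | exact absurd (hP ‹_› ‹_› ‹_›) h4 | nlinarith
  have k1 := key (fun i => 3 ∣ i) x hx0 hx (fun a b c => by omega)
  have k2 := key (fun i => Even i) y hy0 hy (fun a b c => by
    rw [Nat.even_iff] at *; omega)
  have n1 : 0 ≤ (if 3 ∣ j then 1 else x) * (if 3 ∣ k then 1 else x) * (if 3 ∣ m then 1 else x) := by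
    split_ifs <;> positivity
  have n2 : (0 : ℝ) ≤ (if Even n then 1 else y) := by split_ifs <;> positivity
  have n3 : 0 ≤ (if Even j then 1 else y) * (if Even k then 1 else y) * (if Even m then 1 else y) := by
    split_ifs <;> positivity
  have n4 : (0 : ℝ) ≤ (if 3 ∣ n then 1 else x) := by split_ifs <;> positivity
  simp only [classWeight]
  calc _ = ((if 3 ∣ j then 1 else x) * (if 3 ∣ k then 1 else x) * (if 3 ∣ m then 1 else x)) *
        ((if Even j then 1 else y) * (if Even k then 1 else y) * (if Even m then 1 else y)) := by ring
    _ ≤ _ := mul_le_mul k1 k2 n3 n4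

/-- The exponent of mode `n` in the gauge. -/
def gaugeExp (n : ℕ) : ℕ := if n = 1 then 5 else n

theorem le_gaugeExp (n : ℕ) : n ≤ gaugeExp n := by
  rw [gaugeExp]; split_ifs <;> omega

/-- In general j + k + m = n + 2j ≥ n. For n = 1 the exponent 5 is the largest admissible one: the
interaction of A₀, A₂, A₃ feeds mode 1 with s² s³. -/
theorem gaugeExp_le {n j k m : ℕ} (h : n + j = k + m) :
    gaugeExp n ≤ gaugeExp j + gaugeExp k + gaugeExp m := by
  simp only [gaugeExp]; split_ifs <;> omega

/-- The gauge of a state with `A₂ ~ s² x` and `A₃ ~ s³ y`. -/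
def stateGauge (s x y : ℝ) (n : ℕ) : ℝ := s ^ gaugeExp n * classWeight x y n

theorem gauge_stateGauge {s x y : ℝ} (hs : 0 ≤ s) (hs1 : s ≤ 1) (hx0 : 0 ≤ x) (hx : x ≤ 1)
    (hy0 : 0 ≤ y) (hy : y ≤ 1) : Gauge (stateGauge s x y) := by
  refine ⟨fun n => mul_nonneg (pow_nonneg hs _) (classWeight_nonneg hx0 hy0 n), ?_, ?_⟩
  · simp [stateGauge, gaugeExp, classWeight]
  · intro n j k m h
    simp only [stateGauge]
    have c := classWeight_mul_le hx0 hx hy0 hy h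
    have c0 : ∀ i, 0 ≤ classWeight x y i := classWeight_nonneg hx0 hy0
    calc _ = s ^ (gaugeExp j + gaugeExp k + gaugeExp m) *
          (classWeight x y j * classWeight x y k * classWeight x y m) := by rw [pow_add, pow_add]; ring
      _ ≤ s ^ gaugeExp n * classWeight x y n :=
        mul_le_mul (pow_le_pow_of_le_one hs hs1 (gaugeExp_le h)) c
          (mul_nonneg (mul_nonneg (c0 _) (c0 _)) (c0 _)) (pow_nonneg hs _)

theorem abs_tsum_sub_sum_le {F R : ℕ → ℝ} {J : ℕ} {c : ℝ} (hc : 0 ≤ c) (sF : Summable F)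
    (sR : Summable R) (R0 : ∀ j, 0 ≤ R j) (hle : ∀ j, J ≤ j → |F j| ≤ c * R j) :
    |∑' j, F j - ∑ j ∈ Finset.range J, F j| ≤ c * ∑' j, R j := by
  have h2 := sF.sum_add_tsum_nat_add J
  have h1 := sR.sum_add_tsum_nat_add J
  have h3 : 0 ≤ ∑ j ∈ Finset.range J, R j := Finset.sum_nonneg fun j _ => R0 j
  have sR' : Summable fun j => c * R (j + J) := ((summable_nat_add_iff J).2 sR).mul_left c
  have hle' : ∀ j, |F (j + J)| ≤ c * R (j + J) := fun j => hle _ (Nat.le_add_left _ _)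
  have sF' : Summable fun j => |F (j + J)| :=
    Summable.of_nonneg_of_le (fun j => abs_nonneg _) hle' sR'
  have e : ∑' j, F j - ∑ j ∈ Finset.range J, F j = ∑' j, F (j + J) := by rw [← h2]; ring
  rw [e]
  have h4 : |∑' j, F (j + J)| ≤ ∑' j, |F (j + J)| :=
    norm_tsum_le_tsum_norm (f := fun j => F (j + J)) sF'
  have h5 := sF'.tsum_le_tsum hle' sR'
  rw [tsum_mul_left] at h5
  have h6 : c * ∑' j, R (j + J) ≤ c * ∑' j, R j := mul_le_mul_of_nonneg_left (by linarith) hc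
  exact h4.trans (h5.trans h6)

/-- Stationary states near the lowest mode, with their size in the gauge. -/
structure GaugedState where
  vec : EnergySpace
  ω : ℝ
  s : ℝ
  x : ℝ
  y : ℝ
  β : ℕ → ℝ
  s_pos : 0 < s
  s_le : s ≤ 1 / 2
  x_nonneg : 0 ≤ x
  x_le : x ≤ 1
  y_nonneg : 0 ≤ y
  y_le : y ≤ 1
  xy : x = 1 ∨ y = 1
  ω_near : |ω - 1 / 6| ≤ 1 / 1000
  stationary : IsStationary 1 ω (seq vec)
  abs_two : |seq vec 2| = rad / 4 * (s ^ 2 * x)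
  abs_three : |seq vec 3| = rad / 4 * (s ^ 3 * y)
  majorant : Majorant β
  sum_le : ∑' n, β n ≤ rad
  dom : DomBy (stateGauge s x y) β (seq vec - lowestMode)

namespace GaugedState

/-- The amplitudes of the state. -/
def A (S : GaugedState) : ℕ → ℝ := seq S.vec

/-- The class factor of the state. -/
def χ (S : GaugedState) : ℕ → ℝ := classWeight S.x S.y

theorem χ_nonneg (S : GaugedState) (n : ℕ) : 0 ≤ S.χ n :=
  classWeight_nonneg S.x_nonneg S.y_nonneg n

theorem χ_le_one (S : GaugedState) (n : ℕ) : S.χ n ≤ 1 :=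
  classWeight_le_one S.x_nonneg S.x_le S.y_le n

theorem χ_mul_le (S : GaugedState) {n j k m : ℕ} (h : n + j = k + m) :
    S.χ j * S.χ k * S.χ m ≤ S.χ n :=
  classWeight_mul_le S.x_nonneg S.x_le S.y_nonneg S.y_le h

theorem χ_zero (S : GaugedState) : S.χ 0 = 1 := by simp [χ, classWeight]

theorem gauge (S : GaugedState) : Gauge (stateGauge S.s S.x S.y) :=
  gauge_stateGauge S.s_pos.le (by linarith [S.s_le]) S.x_nonneg S.x_le S.y_nonneg S.y_le

/-- The majorant of the full state. -/
def maj (S : GaugedState) (n : ℕ) : ℝ := unitSeq 0 n + S.β n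

theorem majorant_maj (S : GaugedState) : Majorant S.maj := (majorant_unitSeq 0).add S.majorant

theorem tsum_maj_le (S : GaugedState) : ∑' n, S.maj n ≤ 1 + rad := by
  rw [show S.maj = fun n => unitSeq 0 n + S.β n from rfl,
    (majorant_unitSeq 0).2.tsum_add S.majorant.2, tsum_unitSeq]
  linarith [S.sum_le]

theorem maj_le (S : GaugedState) (n : ℕ) : S.maj n ≤ 2 :=
  (S.majorant_maj.2.le_tsum n fun i _ => S.majorant_maj.1 i).trans
    (S.tsum_maj_le.trans (by norm_num [rad]))

theorem domBy (S : GaugedState) : DomBy (stateGauge S.s S.x S.y) S.maj S.A := fun n => by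
  have e : S.A n = lowestMode n + (seq S.vec - lowestMode) n := by simp [A]
  rw [e, maj, mul_add]
  exact (abs_add_le _ _).trans (add_le_add (lowestMode_dom S.gauge n) (S.dom n))

theorem abs_A_le (S : GaugedState) (n : ℕ) : |S.A n| ≤ 2 * (S.s ^ gaugeExp n * S.χ n) := by
  have h := S.domBy n
  have := S.maj_le n
  have g := S.gauge.nonneg n
  calc _ ≤ stateGauge S.s S.x S.y n * S.maj n := h
    _ ≤ stateGauge S.s S.x S.y n * 2 := by gcongr
    _ = _ := by rw [stateGauge, χ]; ring

theorem abs_A_le_pow (S : GaugedState) (n : ℕ) : |S.A n| ≤ S.s ^ n * (S.χ n * S.maj n) := by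
  have h := S.domBy n
  have h1 : S.s ^ gaugeExp n ≤ S.s ^ n :=
    pow_le_pow_of_le_one S.s_pos.le (by linarith [S.s_le]) (le_gaugeExp n)
  calc _ ≤ stateGauge S.s S.x S.y n * S.maj n := h
    _ = S.s ^ gaugeExp n * (S.χ n * S.maj n) := by rw [stateGauge, χ]; ring
    _ ≤ _ := mul_le_mul_of_nonneg_right h1 (mul_nonneg (S.χ_nonneg n) (S.majorant_maj.1 n))

theorem abs_sub_one_le (S : GaugedState) : |S.A 0 - 1| ≤ rad := by
  have h := S.dom 0
  have := S.majorant.2.le_tsum 0 fun i _ => S.majorant.1 i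
  have e : stateGauge S.s S.x S.y 0 = 1 := S.gauge.zero
  rw [e, one_mul] at h
  simp only [Pi.sub_apply, lowestMode, if_true] at h
  exact h.trans (this.trans S.sum_le)

theorem A_zero_ge (S : GaugedState) : 1 / 2 ≤ S.A 0 := by
  have := (abs_le.1 S.abs_sub_one_le).1
  unfold rad at this; linarith

/-- The detuning from the bifurcation frequency. -/
def Ω (S : GaugedState) : ℝ := S.ω - 1 / 6

/-- The stationary equation in mode `n` truncated to `j < J`. -/
def rowRem (n J : ℕ) (S : GaugedState) : ℝ :=
  ((n : ℝ) + 1) * (1 - n * S.ω) * S.A n - ∑ j ∈ Finset.range J, ∑ k ∈ Finset.range (n + j + 1),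
    (coupling n j k (n + j - k) : ℝ) * S.A j * S.A k * S.A (n + j - k)

theorem abs_term_le (S : GaugedState) {n j k m : ℕ} (h : n + j = k + m) :
    |(coupling n j k m : ℝ) * S.A j * S.A k * S.A m| ≤
      ((n : ℝ) + 1) * (S.s ^ (n + 2 * j) * S.χ n) * (S.maj j * S.maj k * S.maj m) := by
  rw [abs_mul, abs_mul, abs_mul, Nat.abs_cast]
  have m0 := S.majorant_maj.1
  have x0 := S.χ_nonneg
  have s0 := S.s_pos.le
  calc _ ≤ ((n : ℝ) + 1) * (S.s ^ j * (S.χ j * S.maj j)) * (S.s ^ k * (S.χ k * S.maj k)) *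
        (S.s ^ m * (S.χ m * S.maj m)) :=
        mul4_le (Nat.cast_nonneg _) (coupling_le_fst _ _ _ _) (abs_nonneg _) (S.abs_A_le_pow _)
          (abs_nonneg _) (S.abs_A_le_pow _) (abs_nonneg _) (S.abs_A_le_pow _)
    _ = ((n : ℝ) + 1) * (S.s ^ (n + 2 * j) * (S.χ j * S.χ k * S.χ m)) *
        (S.maj j * S.maj k * S.maj m) := by
        rw [show n + 2 * j = j + k + m by omega, pow_add, pow_add]; ring
    _ ≤ _ := by
        have := S.χ_mul_le h
        have := m0 j; have := m0 k; have := m0 m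
        gcongr

/-- The term of index j has j + k + m = n + 2j, hence size s ^ (n + 2 j): each further j gains s².
Truncation at J leaves s ^ (n + 2 J), still with the class factor of mode n. -/
theorem abs_rowRem_le (S : GaugedState) (n J : ℕ) :
    |rowRem n J S| ≤ 2 * ((n : ℝ) + 1) * (S.s ^ (n + 2 * J) * S.χ n) := by
  have lA : L1 S.A := S.domBy.l1 S.gauge S.majorant_maj
  have hs := interaction_summable lA lA lA n
  obtain ⟨r1, r2, r3⟩ := resConv_summable S.majorant_maj S.majorant_maj S.majorant_maj
  have x0 := S.χ_nonneg n
  have m0 := S.majorant_maj.1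
  have s0 := S.s_pos.le
  have tR : resConv S.maj S.maj S.maj n ≤ 2 := by
    have h3 := r2.2.le_tsum n fun i _ => r2.1 i
    have h5 := S.tsum_maj_le
    have h6 : 0 ≤ ∑' n, S.maj n := tsum_nonneg m0
    have h7 : (∑' n, S.maj n) * (∑' n, S.maj n) * ∑' n, S.maj n ≤
        (1 + rad) * (1 + rad) * (1 + rad) :=
      mul_le_mul (mul_le_mul h5 h5 h6 (h6.trans h5)) h5 h6
        (mul_nonneg (h6.trans h5) (h6.trans h5))
    have h8 : (1 + rad) * (1 + rad) * (1 + rad) ≤ 2 := by norm_num [rad]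
    linarith
  have h1 : ((n : ℝ) + 1) * (1 - n * S.ω) * S.A n = ∑' j, ∑ k ∈ Finset.range (n + j + 1),
    (coupling n j k (n + j - k) : ℝ) * S.A j * S.A k * S.A (n + j - k) := S.stationary n
  rw [rowRem, h1]
  refine (abs_tsum_sub_sum_le (c := ((n : ℝ) + 1) * (S.s ^ (n + 2 * J) * S.χ n)) (by positivity)
    hs (r1 n) (fun j => Finset.sum_nonneg fun k _ => mul_nonneg (mul_nonneg (m0 _) (m0 _)) (m0 _))
    fun j hj => ?_).trans ?_
  · rw [Finset.mul_sum]
    refine (Finset.abs_sum_le_sum_abs _ _).trans (Finset.sum_le_sum fun k hk => ?_)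
    refine (S.abs_term_le (by have := Finset.mem_range.1 hk; omega)).trans ?_
    have : S.s ^ (n + 2 * j) ≤ S.s ^ (n + 2 * J) :=
      pow_le_pow_of_le_one s0 (by linarith [S.s_le]) (by omega)
    have := m0 j; have := m0 k; have := m0 (n + j - k)
    gcongr
  · have h0 : 0 ≤ ((n : ℝ) + 1) * (S.s ^ (n + 2 * J) * S.χ n) := by positivity
    refine (mul_le_mul_of_nonneg_left tR h0).trans (le_of_eq ?_)
    ring

end GaugedState

end

end ConformalFlow

namespace ConformalFlow

noncomputable section

open Asymptotics Filter Topology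

namespace GaugedState

/-! ### Expansions in the size of the state -/

/-- The filter of small states. -/
def small : Filter GaugedState := comap GaugedState.s (𝓝 0)

/-- Functions of order `s^a` on small states. -/
def OS (a : ℕ) (f : GaugedState → ℝ) : Prop := f =O[small] fun S => S.s ^ a

/-- Functions of order `s^a` in the class of mode `n` on small states. -/
def OX (a n : ℕ) (f : GaugedState → ℝ) : Prop := f =O[small] fun S => S.s ^ a * S.χ n

theorem pow_isBigO {a b : ℕ} (h : b ≤ a) :
    (fun S : GaugedState => S.s ^ a) =O[small] fun S => S.s ^ b :=
  IsBigO.of_bound 1 (Eventually.of_forall fun S => by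
    rw [one_mul, Real.norm_of_nonneg (pow_nonneg S.s_pos.le _),
      Real.norm_of_nonneg (pow_nonneg S.s_pos.le _)]
    exact pow_le_pow_of_le_one S.s_pos.le (by linarith [S.s_le]) h)

variable {a b c n j k m : ℕ} {f g h : GaugedState → ℝ}

theorem OS.mono (hf : OS a f) (h : b ≤ a := by decide) : OS b f := hf.trans (pow_isBigO h)

theorem OX.mono (hf : OX a n f) (h : b ≤ a := by decide) : OX b n f :=
  hf.trans ((pow_isBigO h).mul (isBigO_refl _ _))

theorem OS.add (hf : OS a f) (hg : OS a g) : OS a fun S => f S + g S := IsBigO.add hf hg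

theorem OX.add (hf : OX a n f) (hg : OX a n g) : OX a n fun S => f S + g S := IsBigO.add hf hg

theorem OS.cmul (hf : OS a f) (r : ℝ) : OS a fun S => r * f S := hf.const_mul_left r

theorem OX.cmul (hf : OX a n f) (r : ℝ) : OX a n fun S => r * f S := hf.const_mul_left r

theorem OS.of_eq (hf : OS a g) (h : ∀ S, f S = g S) : OS a f := by
  rwa [funext h]

theorem OX.of_eq (hf : OX a n g) (h : ∀ S, f S = g S) : OX a n f := by
  rwa [funext h]

theorem OS.mul (hf : OS a f) (hg : OS b g) : OS (a + b) fun S => f S * g S := by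
  simpa only [OS, pow_add] using IsBigO.mul hf hg

theorem OS.mulX (hf : OS a f) (hg : OX b n g) : OX (a + b) n fun S => f S * g S := by
  simpa only [OX, pow_add, mul_assoc] using IsBigO.mul hf hg

/-- Resonant products respect the classes: the factors χ of the three modes multiply to at most χ n.
-/
theorem OX.mul3 (hf : OX a j f) (hg : OX b k g) (hh : OX c m h) (e : n + j = k + m := by omega) :
    OX (a + b + c) n fun S => f S * g S * h S := by
  refine (IsBigO.mul (IsBigO.mul hf hg) hh).trans (IsBigO.of_bound 1 (Eventually.of_forall
    fun S => ?_))
  have s0 := S.s_pos.le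
  have x0 := S.χ_nonneg
  have h1 := x0 j; have h2 := x0 k; have h3 := x0 m; have h4 := x0 n
  rw [Real.norm_of_nonneg (by positivity), Real.norm_of_nonneg (by positivity), one_mul, pow_add,
    pow_add]
  have := mul_le_mul_of_nonneg_left (S.χ_mul_le e) (show 0 ≤ S.s ^ a * S.s ^ b * S.s ^ c by positivity)
  linarith

theorem OX.toOS (hf : OX a n f) : OS a f :=
  hf.trans (IsBigO.of_bound 1 (Eventually.of_forall fun S => by
    have := S.χ_nonneg n
    have s0 := S.s_pos.le
    rw [Real.norm_of_nonneg (by positivity), Real.norm_of_nonneg (by positivity), one_mul]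
    exact mul_le_of_le_one_right (by positivity) (S.χ_le_one n)))

theorem OS.toOX (hf : OS a f) : OX a 0 f := by
  simpa only [OX, OS, χ_zero, mul_one] using hf

theorem oxA (n : ℕ) : OX (gaugeExp n) n fun S => S.A n :=
  IsBigO.of_bound 2 (Eventually.of_forall fun S => by
    have := S.χ_nonneg n
    have s0 := S.s_pos.le
    refine (S.abs_A_le n).trans_eq ?_
    rw [Real.norm_of_nonneg (by positivity)])

theorem osA (n : ℕ) : OS (gaugeExp n) fun S => S.A n := (oxA n).toOS

theorem oxAAA (n j k m : ℕ) (a : ℕ) (e : n + j = k + m := by decide)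
    (h : a ≤ gaugeExp j + gaugeExp k + gaugeExp m := by decide) :
    OX a n fun S => S.A j * S.A k * S.A m :=
  ((oxA j).mul3 (oxA k) (oxA m) e).mono h

theorem os_const (r : ℝ) : OS 0 fun _ => r := by
  simpa only [OS, pow_zero] using isBigO_const_const r one_ne_zero small

theorem oxRow (n J : ℕ) : OX (n + 2 * J) n (rowRem n J) :=
  IsBigO.of_bound (2 * ((n : ℝ) + 1)) (Eventually.of_forall fun S => by
    have := S.χ_nonneg n
    have s0 := S.s_pos.le
    refine (S.abs_rowRem_le n J).trans_eq ?_
    rw [Real.norm_of_nonneg (by positivity)])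

theorem row_zero_two (S : GaugedState) : rowRem 0 2 S =
    S.A 0 - (S.A 0 ^ 3 + 2 * S.A 0 * S.A 1 ^ 2) := by
  simp [rowRem, Finset.sum_range_succ, coupling, -Nat.cast_min]
  ring

theorem row_zero_four (S : GaugedState) : rowRem 0 4 S =
    S.A 0 - (S.A 0 ^ 3 + 2 * S.A 0 * S.A 1 ^ 2 + 2 * S.A 0 * S.A 2 ^ 2 + 2 * S.A 0 * S.A 3 ^ 2
      + S.A 1 ^ 2 * S.A 2 + 2 * S.A 1 * S.A 2 * S.A 3) := by
  simp [rowRem, Finset.sum_range_succ, coupling, -Nat.cast_min]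
  ring

theorem row_one_four (S : GaugedState) : rowRem 1 4 S =
    (5 / 3 - 2 * S.Ω) * S.A 1 - (2 * S.A 0 ^ 2 * S.A 1 + 2 * S.A 0 * S.A 1 * S.A 2
      + 2 * S.A 0 * S.A 2 * S.A 3 + 2 * S.A 0 * S.A 3 * S.A 4 + 2 * S.A 1 ^ 3
      + 4 * S.A 1 * S.A 2 ^ 2 + 4 * S.A 1 * S.A 3 ^ 2 + 2 * S.A 2 ^ 2 * S.A 3) := by
  simp [rowRem, Finset.sum_range_succ, coupling, Ω, -Nat.cast_min]
  ring

theorem row_two_two (S : GaugedState) : rowRem 2 2 S =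
    (2 - 6 * S.Ω) * S.A 2 - (2 * S.A 0 ^ 2 * S.A 2 + S.A 0 * S.A 1 ^ 2 + 2 * S.A 0 * S.A 1 * S.A 3
      + 4 * S.A 1 ^ 2 * S.A 2) := by
  simp [rowRem, Finset.sum_range_succ, coupling, Ω, -Nat.cast_min]
  ring

theorem row_three_two (S : GaugedState) : rowRem 3 2 S =
    (2 - 12 * S.Ω) * S.A 3 - (2 * S.A 0 ^ 2 * S.A 3 + 2 * S.A 0 * S.A 1 * S.A 2
      + 2 * S.A 0 * S.A 1 * S.A 4 + 4 * S.A 1 ^ 2 * S.A 3 + 2 * S.A 1 * S.A 2 ^ 2) := by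
  simp [rowRem, Finset.sum_range_succ, coupling, Ω, -Nat.cast_min]
  ring

theorem row_four_two (S : GaugedState) : rowRem 4 2 S =
    (5 / 3 - 20 * S.Ω) * S.A 4 - (2 * S.A 0 ^ 2 * S.A 4 + 2 * S.A 0 * S.A 1 * S.A 3
      + 2 * S.A 0 * S.A 1 * S.A 5 + S.A 0 * S.A 2 ^ 2 + 4 * S.A 1 ^ 2 * S.A 4
      + 4 * S.A 1 * S.A 2 * S.A 3) := by
  simp [rowRem, Finset.sum_range_succ, coupling, Ω, -Nat.cast_min]
  ring

theorem row_five_two (S : GaugedState) : rowRem 5 2 S =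
    (1 - 30 * S.Ω) * S.A 5 - (2 * S.A 0 ^ 2 * S.A 5 + 2 * S.A 0 * S.A 1 * S.A 4
      + 2 * S.A 0 * S.A 1 * S.A 6 + 2 * S.A 0 * S.A 2 * S.A 3 + 4 * S.A 1 ^ 2 * S.A 5
      + 4 * S.A 1 * S.A 2 * S.A 4 + 2 * S.A 1 * S.A 3 ^ 2) := by
  simp [rowRem, Finset.sum_range_succ, coupling, Ω, -Nat.cast_min]
  ring

theorem row_six_two (S : GaugedState) : rowRem 6 2 S =
    (-42 * S.Ω) * S.A 6 - (2 * S.A 0 ^ 2 * S.A 6 + 2 * S.A 0 * S.A 1 * S.A 5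
      + 2 * S.A 0 * S.A 1 * S.A 7 + 2 * S.A 0 * S.A 2 * S.A 4 + S.A 0 * S.A 3 ^ 2
      + 4 * S.A 1 ^ 2 * S.A 6 + 4 * S.A 1 * S.A 2 * S.A 5 + 4 * S.A 1 * S.A 3 * S.A 4) := by
  simp [rowRem, Finset.sum_range_succ, coupling, Ω, -Nat.cast_min]
  ring

theorem row_two_four (S : GaugedState) : rowRem 2 4 S =
    (2 - 6 * S.Ω) * S.A 2 - (2 * S.A 0 ^ 2 * S.A 2 + S.A 0 * S.A 1 ^ 2 + 2 * S.A 0 * S.A 1 * S.A 3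
      + 2 * S.A 0 * S.A 2 * S.A 4 + 2 * S.A 0 * S.A 3 * S.A 5 + 4 * S.A 1 ^ 2 * S.A 2
      + 4 * S.A 1 * S.A 2 * S.A 3 + 4 * S.A 1 * S.A 3 * S.A 4 + 3 * S.A 2 ^ 3
      + 6 * S.A 2 * S.A 3 ^ 2) := by
  simp [rowRem, Finset.sum_range_succ, coupling, Ω, -Nat.cast_min]
  ring

theorem row_three_four (S : GaugedState) : rowRem 3 4 S =
    (2 - 12 * S.Ω) * S.A 3 - (2 * S.A 0 ^ 2 * S.A 3 + 2 * S.A 0 * S.A 1 * S.A 2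
      + 2 * S.A 0 * S.A 1 * S.A 4 + 2 * S.A 0 * S.A 2 * S.A 5 + 2 * S.A 0 * S.A 3 * S.A 6
      + 4 * S.A 1 ^ 2 * S.A 3 + 2 * S.A 1 * S.A 2 ^ 2 + 4 * S.A 1 * S.A 2 * S.A 4
      + 4 * S.A 1 * S.A 3 * S.A 5 + 6 * S.A 2 ^ 2 * S.A 3 + 6 * S.A 2 * S.A 3 * S.A 4
      + 4 * S.A 3 ^ 3) := by
  simp [rowRem, Finset.sum_range_succ, coupling, Ω, -Nat.cast_min]
  ring


/-! ### Expansion of the amplitudes and of the detuning -/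

theorem OS.of_bound (C : ℝ) (hg : OS a g) (h : ∀ S, |f S| ≤ C * |g S|) : OS a f :=
  (IsBigO.of_bound C (Eventually.of_forall h)).trans hg

theorem os_zero_sq : OS 4 fun S => S.A 0 ^ 2 - 1 := by
  have h : OS 4 fun S => S.A 0 * (S.A 0 ^ 2 - 1) :=
    (((oxRow 0 2).cmul (-1)).add ((oxAAA 0 1 0 1 4 (by decide)).cmul (-2))).toOS.of_eq
      fun S => by rw [row_zero_two]; ring
  refine h.of_bound 2 fun S => ?_
  have := S.A_zero_ge
  rw [abs_mul, abs_of_pos (show 0 < S.A 0 by linarith)]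
  nlinarith [abs_nonneg (S.A 0 ^ 2 - 1)]

theorem os_zero : OS 4 fun S => S.A 0 - 1 := by
  refine os_zero_sq.of_bound 1 fun S => ?_
  have := S.A_zero_ge
  rw [show S.A 0 ^ 2 - 1 = (S.A 0 + 1) * (S.A 0 - 1) by ring, abs_mul,
    abs_of_pos (show 0 < S.A 0 + 1 by linarith)]
  nlinarith [abs_nonneg (S.A 0 - 1)]

/-- In row 2 the constant 2 cancels against 2 A₀² up to order s⁴, and the remaining terms are of
order s⁶ or smaller; what is left at A₂ is the detuning. -/
theorem ox_detuning_two : OX 6 2 fun S => S.Ω * S.A 2 :=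
  ((((((oxRow 2 2).cmul (-1 / 6)).add ((os_zero_sq.mulX (oxA 2)).cmul (-1 / 3)).mono).add
    ((oxAAA 2 0 1 1 6 (by decide)).cmul (-1 / 6))).add
    ((oxAAA 2 1 0 3 6 (by decide)).cmul (-1 / 3))).add
    ((oxAAA 2 1 1 2 6 (by decide)).cmul (-2 / 3))).of_eq fun S => by rw [row_two_two]; ring


theorem ox_one : OX 0 0 fun _ => 1 := (os_const 1).toOX

/-- Versions of `OX.mul3` with one slot filled by a constant of mode 0: here the output mode is a
difference of modes, in `OX.mulS` a sum. -/
theorem OX.mulD (hf : OX a j f) (hg : OX b m g) (e : n + j = m := by omega) :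
    OX (a + b) n fun S => f S * g S :=
  ((hf.mul3 ox_one hg (by omega)).mono (by omega)).of_eq fun S => by ring

theorem OX.mulS (hf : OX a k f) (hg : OX b m g) (e : n = k + m := by omega) :
    OX (a + b) n fun S => f S * g S :=
  ((ox_one.mul3 hf hg (by omega)).mono (by omega)).of_eq fun S => by ring

theorem ox_detuning_three : OX 7 3 fun S => S.Ω * S.A 3 :=
  (((((((oxRow 3 2).cmul (-1 / 12)).add ((os_zero_sq.mulX (oxA 3)).cmul (-1 / 6)).mono).add
    ((oxAAA 3 0 1 2 7).cmul (-1 / 6))).add ((oxAAA 3 1 0 4 7).cmul (-1 / 6))).add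
    ((oxAAA 3 1 1 3 7).cmul (-1 / 3))).add ((oxAAA 3 1 2 2 7).cmul (-1 / 6))).of_eq
    fun S => by rw [row_three_two]; ring

/-- Since x = 1 or y = 1, at least one of A₂ and A₃ has the full size s² or s³; dividing row 2 or
row 3 by that amplitude bounds Ω. -/
theorem os_detuning : OS 4 fun S => S.Ω := by
  obtain ⟨C, hC, h2⟩ := ox_detuning_two.exists_pos
  obtain ⟨D, hD, h3⟩ := ox_detuning_three.exists_pos
  refine IsBigO.of_bound (C / (rad / 4) + D / (rad / 4)) ?_
  filter_upwards [h2.bound, h3.bound] with S b2 b3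
  have s0 := S.s_pos
  have hr : 0 < rad / 4 := by norm_num [rad]
  have hc := div_pos hC hr
  have hd := div_pos hD hr
  rw [Real.norm_eq_abs, Real.norm_of_nonneg (by positivity)]
  rw [Real.norm_eq_abs, abs_mul, Real.norm_of_nonneg (mul_nonneg (by positivity) (S.χ_nonneg _))]
    at b2 b3
  have p4 : 0 < S.s ^ 4 := by positivity
  rcases S.xy with hx | hy
  · have e : S.χ 2 = 1 := by norm_num [χ, classWeight, hx, Nat.even_iff]
    rw [e, show |S.A 2| = rad / 4 * (S.s ^ 2 * S.x) from S.abs_two, hx] at b2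
    have : |S.Ω| ≤ C / (rad / 4) * S.s ^ 4 := by
      rw [div_mul_eq_mul_div, le_div_iff₀ hr]
      have : S.s ^ 2 * (|S.Ω| * (rad / 4)) ≤ S.s ^ 2 * (C * S.s ^ 4) := by linarith
      exact le_of_mul_le_mul_left this (by positivity)
    nlinarith
  · have e : S.χ 3 = 1 := by
      have : ¬ Even 3 := by decide
      norm_num [χ, classWeight, hy]
    rw [e, show |S.A 3| = rad / 4 * (S.s ^ 3 * S.y) from S.abs_three, hy] at b3
    have : |S.Ω| ≤ D / (rad / 4) * S.s ^ 4 := by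
      rw [div_mul_eq_mul_div, le_div_iff₀ hr]
      have : S.s ^ 3 * (|S.Ω| * (rad / 4)) ≤ S.s ^ 3 * (D * S.s ^ 4) := by linarith
      exact le_of_mul_le_mul_left this (by positivity)
    nlinarith

/-- A noncritical row is solved for its own amplitude: here the eigenvalue 1/3 against the forcing
A₂². In the same way the eigenvalues 1, 2 and 1/3 give the modes 5, 6 and 1 below. -/
theorem ox_four : OX 8 4 fun S => S.A 4 + 3 * S.A 2 ^ 2 :=
  (((((((((oxRow 4 2).cmul (-3)).add ((os_detuning.mulX (oxA 4)).cmul (-60))).add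
    ((os_zero_sq.mulX (oxA 4)).cmul (-6))).add ((oxAAA 4 0 1 3 8).cmul (-6))).add
    ((oxAAA 4 1 0 5 8).cmul (-6))).add ((os_zero.mulX ((oxA 2).mulS (oxA 2))).cmul (-3))).add
    ((oxAAA 4 1 1 4 8).cmul (-12))).add ((oxAAA 4 1 2 3 8).cmul (-12))).of_eq
    fun S => by rw [row_four_two]; ring

theorem ox_five : OX 9 5 fun S => S.A 5 + 2 * S.A 2 * S.A 3 :=
  ((((((((((oxRow 5 2).cmul (-1)).add ((os_detuning.mulX (oxA 5)).cmul (-30))).add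
    ((os_zero_sq.mulX (oxA 5)).cmul (-2))).add ((oxAAA 5 0 1 4 9).cmul (-2))).add
    ((oxAAA 5 1 0 6 9).cmul (-2))).add ((os_zero.mulX ((oxA 2).mulS (oxA 3))).cmul (-2))).add
    ((oxAAA 5 1 1 5 9).cmul (-4))).add ((oxAAA 5 1 2 4 9).cmul (-4))).add
    ((oxAAA 5 1 3 3 9).cmul (-2))).of_eq
    fun S => by rw [row_five_two]; ring

theorem ox_six : OX 10 6 fun S => S.A 6 - 3 * S.A 2 ^ 3 + S.A 3 ^ 2 / 2 :=
  (((((((((((oxRow 6 2).cmul (-1 / 2)).add ((os_detuning.mulX (oxA 6)).cmul (-21))).add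
    ((os_zero_sq.mulX (oxA 6)).cmul (-1))).add ((oxAAA 6 0 1 5 10).cmul (-1))).add
    ((oxAAA 6 1 0 7 10).cmul (-1))).add (((os_zero.mulX ((oxA 2).mulS (oxA 4))).cmul (-1)).add
    (((oxA 2).mulS ox_four).cmul (-1)))).add
    ((os_zero.mulX ((oxA 3).mulS (oxA 3))).cmul (-1 / 2))).add
    ((oxAAA 6 1 1 6 10).cmul (-2))).add ((oxAAA 6 1 2 5 10).cmul (-2))).add
    ((oxAAA 6 1 3 4 10).cmul (-2))).of_eq
    fun S => by rw [row_six_two]; ring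

theorem ox_first : OX 7 1 fun S => S.A 1 + 6 * S.A 2 * S.A 3 :=
  ((((((((((((oxRow 1 4).cmul (-3)).add ((os_detuning.mulX (oxA 1)).cmul (-6))).add
    ((os_zero_sq.mulX (oxA 1)).cmul (-6))).add
    ((os_zero.mulX ((oxA 2).mulD (oxA 3))).cmul (-6))).mono).add
    ((oxAAA 1 1 0 2 7).cmul (-6))).add ((oxAAA 1 3 0 4 7).cmul (-6))).add
    ((oxAAA 1 1 1 1 7).cmul (-6))).add ((oxAAA 1 2 1 2 7).cmul (-12))).add
    ((oxAAA 1 3 1 3 7).cmul (-12))).add ((oxAAA 1 3 2 2 7).cmul (-6))).of_eq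
    fun S => by rw [row_one_four]; ring

/-- The coefficient 48 is 36 + 18 - 6: from -6 A₁A₂ with A₁ ≈ -6 A₂A₃, from -6 A₃A₄ with A₄ ≈ -3
A₂², and from -6 A₂²A₃. This order enters the coefficient 108 in row 3. -/
theorem ox_first' : OX 9 1 fun S => S.A 1 + 6 * S.A 2 * S.A 3 - 48 * S.A 2 ^ 2 * S.A 3 :=
  ((((((((((((oxRow 1 4).cmul (-3)).add ((os_detuning.mulX (oxA 1)).cmul (-6))).add
    ((os_zero_sq.mulX (oxA 1)).cmul (-6))).add
    ((os_zero.mulX ((oxA 2).mulD (oxA 3))).cmul (-6))).add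
    ((os_zero.mulX ((oxA 1).mulD (oxA 2))).cmul (-6)).mono).add
    ((os_zero.mulX ((oxA 3).mulD (oxA 4))).cmul (-6)).mono).add
    ((ox_first.mulD (oxA 2)).cmul (-6))).add (((oxA 3).mulD ox_four).cmul (-6)).mono).add
    ((oxAAA 1 1 1 1 9).cmul (-6))).add ((oxAAA 1 2 1 2 9).cmul (-12))).add
    ((oxAAA 1 3 1 3 9).cmul (-12))).of_eq
    fun S => by rw [row_one_four]; ring

theorem os_zero_sq' : OS 8 fun S => S.A 0 ^ 2 - 1 + 2 * S.A 2 ^ 2 + 2 * S.A 3 ^ 2 := by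
  have h : OS 8 fun S => S.A 0 * (S.A 0 ^ 2 - 1 + 2 * S.A 2 ^ 2 + 2 * S.A 3 ^ 2) :=
    (((((oxRow 0 4).cmul (-1)).add ((oxAAA 0 1 0 1 8).cmul (-2))).add
      ((oxAAA 0 2 1 1 8).cmul (-1))).add ((oxAAA 0 3 1 2 8).cmul (-2))).toOS.of_eq
      fun S => by rw [row_zero_four]; ring
  refine h.of_bound 2 fun S => ?_
  have := S.A_zero_ge
  rw [abs_mul, abs_of_pos (show 0 < S.A 0 by linarith)]
  nlinarith [abs_nonneg (S.A 0 ^ 2 - 1 + 2 * S.A 2 ^ 2 + 2 * S.A 3 ^ 2)]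

/-- The first bifurcation equation. The coefficient 7 is 4 + 6 - 3 (from A₀², from A₄, and the cubic
term), and 14 is 4 + 12 + 4 - 6 (from A₀², A₁, A₅, and the cubic term). -/
theorem ox_reduced_two :
    OX 10 2 fun S => S.A 2 * (6 * S.Ω - 7 * S.A 2 ^ 2 - 14 * S.A 3 ^ 2) :=
  ((((((((((((oxRow 2 4).cmul (-1)).add ((os_zero_sq'.mulX (oxA 2)).cmul (-2))).add
    ((oxAAA 2 0 1 1 10).cmul (-1))).add ((os_zero.mulX ((oxA 1).mulD (oxA 3))).cmul (-2)).mono).add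
    ((ox_first.mulD (oxA 3)).cmul (-2))).add
    (((os_zero.mulX ((oxA 2).mulD (oxA 4))).cmul (-2)).add
    (((oxA 2).mulD ox_four).cmul (-2)))).add
    ((os_zero.mulX ((oxA 3).mulD (oxA 5))).cmul (-2)).mono).add
    (((oxA 3).mulD ox_five).cmul (-2)).mono).add
    ((oxAAA 2 1 1 2 10).cmul (-4))).add ((oxAAA 2 2 1 3 10).cmul (-4))).add
    ((oxAAA 2 3 1 4 10).cmul (-4))).of_eq
    fun S => by rw [row_two_four]; ring

/-- The second bifurcation equation. Its bracket agrees at order s⁴ with twice the bracket of the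
first; only the order s⁶, with A₃² and A₂³, separates the branches, so the expansion must reach it.
-/
theorem ox_reduced_three :
    OX 11 3 fun S => S.A 3 * (12 * S.Ω - 14 * S.A 2 ^ 2 - S.A 3 ^ 2 + 108 * S.A 2 ^ 3) :=
  ((((((((((((((((oxRow 3 4).cmul (-1)).add ((os_zero_sq'.mulX (oxA 3)).cmul (-2))).add
    ((os_zero.mulX ((oxA 1).mulS (oxA 2))).cmul (-2))).add
    ((ox_first'.mulS (oxA 2)).cmul (-2))).add
    ((os_zero.mulX ((oxA 1).mulD (oxA 4))).cmul (-2)).mono).add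
    ((ox_first.mulD (oxA 4)).cmul (-2))).add
    (((oxA 3).mul3 (oxA 2) ox_four).cmul 6).mono).add
    ((os_zero.mulX ((oxA 2).mulD (oxA 5))).cmul (-2))).add
    (((oxA 2).mulD ox_five).cmul (-2))).add
    ((os_zero.mulX ((oxA 3).mulD (oxA 6))).cmul (-2)).mono).add
    (((oxA 3).mulD ox_six).cmul (-2)).mono).add
    ((oxAAA 3 1 1 3 11).cmul (-4))).add ((ox_first.mul3 (oxA 2) (oxA 2)).cmul (-2))).add
    ((oxAAA 3 2 1 4 11).cmul (-4))).add ((oxAAA 3 3 1 5 11).cmul (-4))).of_eq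
    fun S => by rw [row_three_four]; ring

/-- The error in row 2 carries the class factor χ 2 = x and |A₂| is exactly rad/4 * s² * x, so x
drops out on division by A₂, however small it is. -/
theorem reduced_two_isBigO :
    (fun S : GaugedState => 6 * S.Ω - 7 * S.A 2 ^ 2 - 14 * S.A 3 ^ 2) =O[small ⊓ 𝓟 {S | S.A 2 ≠ 0}]
      fun S => S.s ^ 8 := by
  obtain ⟨C, hC, h⟩ := ox_reduced_two.exists_pos
  have hr : 0 < rad / 4 := by norm_num [rad]
  refine IsBigO.of_bound (C / (rad / 4)) ?_
  rw [eventually_inf_principal]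
  filter_upwards [h.bound] with S b h0
  have s0 := S.s_pos
  rw [Real.norm_eq_abs, Real.norm_of_nonneg (by positivity), div_mul_eq_mul_div, le_div_iff₀ hr]
  rw [Real.norm_eq_abs, abs_mul, Real.norm_of_nonneg (mul_nonneg (by positivity) (S.χ_nonneg _))] at b
  have e : S.χ 2 = S.x := by norm_num [χ, classWeight]
  have e2 : |S.A 2| = rad / 4 * (S.s ^ 2 * S.x) := S.abs_two
  have hx : 0 < S.x := lt_of_le_of_ne S.x_nonneg fun hx => h0 (abs_eq_zero.1 (by rw [e2, ← hx]; ring))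
  rw [e, e2] at b
  have : S.s ^ 2 * S.x * (|6 * S.Ω - 7 * S.A 2 ^ 2 - 14 * S.A 3 ^ 2| * (rad / 4)) ≤
    S.s ^ 2 * S.x * (C * S.s ^ 8) := by linarith
  exact le_of_mul_le_mul_left this (by positivity)

theorem reduced_three_isBigO :
    (fun S : GaugedState => 12 * S.Ω - 14 * S.A 2 ^ 2 - S.A 3 ^ 2 + 108 * S.A 2 ^ 3)
      =O[small ⊓ 𝓟 {S | S.A 3 ≠ 0}] fun S => S.s ^ 8 := by
  obtain ⟨C, hC, h⟩ := ox_reduced_three.exists_pos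
  have hr : 0 < rad / 4 := by norm_num [rad]
  refine IsBigO.of_bound (C / (rad / 4)) ?_
  rw [eventually_inf_principal]
  filter_upwards [h.bound] with S b h0
  have s0 := S.s_pos
  rw [Real.norm_eq_abs, Real.norm_of_nonneg (by positivity), div_mul_eq_mul_div, le_div_iff₀ hr]
  rw [Real.norm_eq_abs, abs_mul, Real.norm_of_nonneg (mul_nonneg (by positivity) (S.χ_nonneg _))] at b
  have e : S.χ 3 = S.y := by
    have : ¬ Even 3 := by decide
    norm_num [χ, classWeight, this]
  have e3 : |S.A 3| = rad / 4 * (S.s ^ 3 * S.y) := S.abs_three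
  have hy : 0 < S.y := lt_of_le_of_ne S.y_nonneg fun hy => h0 (abs_eq_zero.1 (by rw [e3, ← hy]; ring))
  rw [e, e3] at b
  have : S.s ^ 3 * S.y * (|12 * S.Ω - 14 * S.A 2 ^ 2 - S.A 3 ^ 2 + 108 * S.A 2 ^ 3| * (rad / 4)) ≤
    S.s ^ 3 * S.y * (C * S.s ^ 8) := by linarith
  exact le_of_mul_le_mul_left this (by positivity)

end GaugedState

end

end ConformalFlow

namespace ConformalFlow

noncomputable section

open Asymptotics Filter Topology

namespace GaugedState

/-! ### Entries of the Hessian -/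

/-- The matrix entries of the Hessian. -/
def ent (σ : ℝ) (n k : ℕ) (S : GaugedState) : ℝ := hessE σ S.vec S.ω (unitVec k) (unitVec n)

theorem ent_symm (σ : ℝ) (n k : ℕ) (S : GaugedState) : ent σ n k S = ent σ k n S :=
  hessE_symm _ _ _ _ _

/-- The truncated part of the entry which comes from `2 A_j A_m a_k`. -/
def entK (n k J : ℕ) (S : GaugedState) : ℝ :=
  ∑ j ∈ Finset.range J, (coupling n j k (n + j - k) : ℝ) * S.A j * S.A (n + j - k)

/-- The part of the entry which comes from `A_k A_m a_j`. -/
def entG (n k : ℕ) (S : GaugedState) : ℝ :=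
  ∑ i ∈ Finset.range (n + k + 1), (coupling n k i (n + k - i) : ℝ) * S.A i * S.A (n + k - i)

theorem quadE_unit_third {n k : ℕ} (h : k ≤ n) (A : EnergySpace) :
    (Summable fun j => (coupling n j k (n + j - k) : ℝ) * seq A j * seq A (n + j - k)) ∧
    quadE (unitVec n) A (unitVec k) A =
      ∑' j, (coupling n j k (n + j - k) : ℝ) * seq A j * seq A (n + j - k) := by
  have hs := quadE_summable (unitVec n) A (unitVec k) A
  rw [seq_unitVec, seq_unitVec] at hs
  obtain ⟨s1, e1⟩ := interaction_eq_quadForm hs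
  have e : ∀ j, ∑ k' ∈ Finset.range (n + j + 1), (coupling n j k' (n + j - k') : ℝ) * seq A j *
      unitSeq k k' * seq A (n + j - k') =
      (coupling n j k (n + j - k) : ℝ) * seq A j * seq A (n + j - k) := by
    intro j
    rw [Finset.sum_eq_single k]
    · simp [unitSeq]
    · intro i _ hi; simp [unitSeq, hi]
    · intro hk; exact absurd (Finset.mem_range.2 (by omega)) hk
  simp only [e] at s1
  refine ⟨s1, ?_⟩
  rw [quadE, seq_unitVec, seq_unitVec, ← e1, interaction]
  exact tsum_congr e

theorem quadE_unit_second (n k : ℕ) (A : EnergySpace) :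
    quadE (unitVec n) (unitVec k) A A = ∑ i ∈ Finset.range (n + k + 1),
      (coupling n k i (n + k - i) : ℝ) * seq A i * seq A (n + k - i) := by
  have hs := quadE_summable (unitVec n) (unitVec k) A A
  rw [seq_unitVec, seq_unitVec] at hs
  obtain ⟨s1, e1⟩ := interaction_eq_quadForm hs
  rw [quadE, seq_unitVec, seq_unitVec, ← e1, interaction, tsum_eq_single k]
  · simp [unitSeq]
  · intro j hj
    exact Finset.sum_eq_zero fun i _ => by simp [unitSeq, hj]

theorem os_entG (n k : ℕ) : OS (n + k) (entG n k) := by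
  have : ∀ i ∈ Finset.range (n + k + 1),
      OS (n + k) fun S => (coupling n k i (n + k - i) : ℝ) * S.A i * S.A (n + k - i) := by
    intro i hi
    have hi' := Finset.mem_range.1 hi
    have g1 := le_gaugeExp i
    have g2 := le_gaugeExp (n + k - i)
    have h := ((osA i).mul (osA (n + k - i))).mono (b := n + k) (by omega)
    exact (h.cmul (coupling n k i (n + k - i) : ℝ)).of_eq fun S => by ring
  have h := IsBigO.sum this
  rwa [Finset.sum_fn] at h

/-- The part of an entry from 2 A_j A_m is a series in A_j A_(n+j-k), whose term j has size s ^ (n -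
k + 2 j), so cutting at J leaves the stated error. The part from A_k A_m is a finite sum and is kept
exactly. -/
theorem os_ent (σ : ℝ) {n k : ℕ} (h : k ≤ n) (J : ℕ) :
    OS (n - k + 2 * J) fun S => ent σ n k S - (2 * entK n k J S + σ * entG n k S -
      if n = k then ((n : ℝ) + 1) * (1 - n * S.ω) else 0) := by
  refine IsBigO.of_bound (8 * ((n : ℝ) + 1)) (Eventually.of_forall fun S => ?_)
  have s0 := S.s_pos.le
  rw [Real.norm_eq_abs, Real.norm_of_nonneg (by positivity)]
  obtain ⟨s1, e1⟩ := quadE_unit_third h S.vec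
  have e3 : diagE (fun n => ((n : ℝ) + 1) * (1 - n * S.ω)) (unitVec k) (unitVec n) =
      if n = k then ((n : ℝ) + 1) * (1 - n * S.ω) else 0 := by
    rw [diagE_unitVec, seq_unitVec, unitSeq]; split_ifs <;> simp
  have m0 := S.majorant_maj.1
  have hb := abs_tsum_sub_sum_le (J := J)
    (c := ((n : ℝ) + 1) * S.s ^ (n - k + 2 * J) * 2) (by positivity) s1 S.majorant_maj.2 m0
    (fun j hj => by
      rw [abs_mul, abs_mul, Nat.abs_cast]
      have h1 := S.abs_A_le_pow j
      have h2 := S.abs_A_le_pow (n + j - k)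
      have c1 := S.χ_le_one j
      have c2 := S.χ_le_one (n + j - k)
      have q1 := S.maj_le (n + j - k)
      have p1 : |seq S.vec j| ≤ S.s ^ j * S.maj j := h1.trans (by
        have := m0 j
        gcongr
        exact mul_le_of_le_one_left this c1)
      have p2 : |seq S.vec (n + j - k)| ≤ S.s ^ (n + j - k) * 2 := h2.trans (by
        have := m0 (n + j - k)
        gcongr
        exact (mul_le_of_le_one_left this c2).trans q1)
      have p3 : S.s ^ j * S.s ^ (n + j - k) ≤ S.s ^ (n - k + 2 * J) := by
        rw [← pow_add]
        exact pow_le_pow_of_le_one s0 (by linarith [S.s_le]) (by omega)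
      have := m0 j
      calc _ ≤ ((n : ℝ) + 1) * (S.s ^ j * S.maj j) * (S.s ^ (n + j - k) * 2) := by
            gcongr
            exact coupling_le_fst _ _ _ _
        _ = ((n : ℝ) + 1) * (S.s ^ j * S.s ^ (n + j - k)) * 2 * S.maj j := by ring
        _ ≤ _ := by gcongr)
  have t : ∑' j, S.maj j ≤ 2 := S.tsum_maj_le.trans (by norm_num [rad])
  rw [ent, hessE, e3, e1, quadE_unit_second]
  change |2 * _ + σ * entG n k S - _ - (2 * entK n k J S + σ * entG n k S - _)| ≤ _
  have e : ∀ X Y Z : ℝ, |2 * X + Y - Z - (2 * entK n k J S + Y - Z)| = 2 * |X - entK n k J S| := by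
    intro X Y Z
    rw [show 2 * X + Y - Z - (2 * entK n k J S + Y - Z) = 2 * (X - entK n k J S) by ring, abs_mul,
      _root_.abs_two]
  rw [e]
  have hc : 0 ≤ ((n : ℝ) + 1) * S.s ^ (n - k + 2 * J) * 2 := by positivity
  have := hb.trans (mul_le_mul_of_nonneg_left t hc)
  change |_ - entK n k J S| ≤ _ at this
  linarith

/-- Coupling the modes k < n takes amplitudes whose indices add up to at least n - k, and each unit
of index costs a factor s. -/
theorem os_ent_gap (σ : ℝ) {n k : ℕ} (h : k < n) : OS (n - k) (ent σ n k) :=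
  ((os_ent σ h.le 0).add (((os_entG n k).cmul σ).mono (b := n - k + 2 * 0) (by omega))).of_eq
    fun S => by simp [entK, h.ne']

/-- The bound on the row `k` against sequences supported beyond `N`. -/
theorem abs_hessE_unitVec_le (S : GaugedState) {σ : ℝ} (hσ : |σ| ≤ 1) {k N : ℕ} (h : k < N)
    {a : EnergySpace} (ha : ∀ n < N, seq a n = 0) :
    |hessE σ S.vec S.ω (unitVec k) a| ≤ 12 * S.s ^ (N - k) * ‖a‖ := by
  have s0 := S.s_pos.le
  have s1 : S.s ≤ 1 := by linarith [S.s_le]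
  have m0 := S.majorant_maj.1
  have t : ∑' j, S.maj j ≤ 2 := S.tsum_maj_le.trans (by norm_num [rad])
  have t0 : 0 ≤ ∑' j, S.maj j := tsum_nonneg m0
  have hA : ∀ n, |seq S.vec n| ≤ S.s ^ n * S.maj n := fun n => (S.abs_A_le_pow n).trans (by
    have := m0 n
    have := S.χ_le_one n
    gcongr
    exact mul_le_of_le_one_left (m0 n) this)
  have key : ∀ n i j p, S.s ^ i * S.s ^ j ≤ S.s ^ (N - k) →
      (coupling n p i j : ℝ) * |seq a n| * |seq S.vec i| * |seq S.vec j| ≤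
      ‖a‖ * S.s ^ (N - k) * (S.maj i * S.maj j) := by
    intro n i j p hp
    have h1 := abs_succ_mul_seq_le a n
    rw [abs_mul, abs_of_nonneg (show (0 : ℝ) ≤ (n : ℝ) + 1 by positivity)] at h1
    have h2 : (coupling n p i j : ℝ) * |seq a n| ≤ ‖a‖ :=
      (mul_le_mul_of_nonneg_right (coupling_le_fst _ _ _ _) (abs_nonneg _)).trans h1
    have := m0 i; have := m0 j
    calc _ ≤ ‖a‖ * (S.s ^ i * S.maj i) * (S.s ^ j * S.maj j) := by
          gcongr
          · exact hA i
          · exact hA j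
      _ = ‖a‖ * (S.s ^ i * S.s ^ j) * (S.maj i * S.maj j) := by ring
      _ ≤ _ := by gcongr
  have q1 : |quadE a S.vec (unitVec k) S.vec| ≤ ‖a‖ * S.s ^ (N - k) * 4 := by
    have := (quadTerm_summable_of_le (a := seq a) (b := seq S.vec) (c := seq (unitVec k))
      (d := seq S.vec) (f := fun n => ‖a‖ * S.s ^ (N - k) * S.maj n) (g := unitSeq k) (h := S.maj)
      (fun n => mul_nonneg (by positivity) (m0 n)) (unitSeq_nonneg k) m0
      (S.majorant_maj.2.mul_left _) (summable_unitSeq k) S.majorant_maj.2 Quad.inj_jkm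
      (fun q => by
        rw [abs_quadTerm, seq_unitVec]
        have := m0 q.j; have := m0 q.m
        by_cases hn : q.n < N
        · rw [ha _ hn]
          simp only [abs_zero, mul_zero, zero_mul]
          have := unitSeq_nonneg k q.k
          positivity
        by_cases hk : q.k = k
        · have hr := q.res
          have h2 := key q.n q.j q.m q.k (by
            rw [← pow_add]
            exact pow_le_pow_of_le_one s0 s1 (by omega))
          rw [show coupling q.n q.k q.j q.m = coupling q.n q.j q.k q.m by
            simp only [coupling]; omega] at h2
          simp only [unitSeq, hk, if_true, abs_one]
          rw [hk] at h2
          linarith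
        · simp [unitSeq, hk])).2
    rw [tsum_mul_left, tsum_unitSeq] at this
    refine this.trans ?_
    calc _ = ‖a‖ * S.s ^ (N - k) * ((∑' n, S.maj n) * ∑' n, S.maj n) := by ring
      _ ≤ ‖a‖ * S.s ^ (N - k) * (2 * 2) := by gcongr
      _ = _ := by ring
  have q2 : |quadE a (unitVec k) S.vec S.vec| ≤ ‖a‖ * S.s ^ (N - k) * 4 := by
    have := (quadTerm_summable_of_le (a := seq a) (b := seq (unitVec k)) (c := seq S.vec)
      (d := seq S.vec) (f := fun n => ‖a‖ * S.s ^ (N - k) * unitSeq k n) (g := S.maj) (h := S.maj)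
      (fun n => mul_nonneg (by positivity) (unitSeq_nonneg k n)) m0 m0
      ((summable_unitSeq k).mul_left _) S.majorant_maj.2 S.majorant_maj.2 Quad.inj_jkm
      (fun q => by
        rw [abs_quadTerm, seq_unitVec]
        have := m0 q.k; have := m0 q.m
        by_cases hn : q.n < N
        · rw [ha _ hn]
          simp only [abs_zero, mul_zero, zero_mul]
          have := unitSeq_nonneg k q.j
          positivity
        by_cases hk : q.j = k
        · have hr := q.res
          have h2 := key q.n q.k q.m q.j (by
            rw [← pow_add]
            exact pow_le_pow_of_le_one s0 s1 (by omega))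
          simp only [unitSeq, hk, if_true, abs_one]
          rw [hk] at h2
          linarith
        · simp [unitSeq, hk])).2
    rw [tsum_mul_left, tsum_unitSeq] at this
    refine this.trans ?_
    calc _ = ‖a‖ * S.s ^ (N - k) * ((∑' n, S.maj n) * ∑' n, S.maj n) := by ring
      _ ≤ ‖a‖ * S.s ^ (N - k) * (2 * 2) := by gcongr
      _ = _ := by ring
  have e3 : diagE (fun n => ((n : ℝ) + 1) * (1 - n * S.ω)) (unitVec k) a = 0 := by
    rw [diagE_symm, diagE_unitVec, ha k h, mul_zero]
  rw [hessE, e3, sub_zero]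
  refine (abs_add_le _ _).trans ?_
  rw [abs_mul, abs_mul, _root_.abs_two]
  have : |σ| * |quadE a (unitVec k) S.vec S.vec| ≤ 1 * (‖a‖ * S.s ^ (N - k) * 4) := by gcongr
  linarith

/-! ### Coercivity away from the resonant modes -/

theorem quadE_low_third (r : EnergySpace) :
    HasSum (fun n => seq r n ^ 2) (quadE r (unitVec 0) r (unitVec 0)) := by
  have hs := quadE_summable r (unitVec 0) r (unitVec 0)
  obtain ⟨s1, e1⟩ := quadForm_eq_tsum_interaction hs
  rw [quadE, e1]
  have e : (fun n => seq r n ^ 2) = fun n => seq r n * interaction (seq (unitVec 0)) (seq r)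
      (seq (unitVec 0)) n := by
    ext n
    rw [seq_unitVec, ← lowestMode_eq, interaction_low_second]; ring
  rw [e]
  exact s1.hasSum

theorem quadE_low_second (r : EnergySpace) :
    quadE r r (unitVec 0) (unitVec 0) = seq r 0 ^ 2 := by
  have hs := quadE_summable r r (unitVec 0) (unitVec 0)
  obtain ⟨s1, e1⟩ := quadForm_eq_tsum_interaction hs
  rw [quadE, e1, tsum_eq_single 0]
  · rw [seq_unitVec, ← lowestMode_eq, interaction_low_first]; simp; ring
  · intro n hn
    rw [seq_unitVec, ← lowestMode_eq, interaction_low_first, if_neg hn, mul_zero]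

/-- At the lowest mode the form is diagonal: the eigenvalues are those of `linEig` for n ≥ 1, and 1
+ σ in mode 0. For σ = -1 the latter vanishes, being the phase direction, so mode 0 has to be
excluded. -/
theorem hessE_low_ge {ω : ℝ} (hω : |ω - 1 / 6| ≤ 1 / 1000) {σ : ℝ} {r : EnergySpace}
    (h2 : seq r 2 = 0) (h3 : seq r 3 = 0) (hσ : σ = 1 ∨ σ = -1 ∧ seq r 0 = 0) :
    ‖r‖ ^ 2 / 100 ≤ hessE σ (unitVec 0) ω r r := by
  have s1 := quadE_low_third r
  obtain ⟨s3, -⟩ := diagE_bound (energyWeight_linear ω) r r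
  have s2 : HasSum (fun n => σ * if n = 0 then seq r 0 ^ 2 else 0)
      (σ * quadE r r (unitVec 0) (unitVec 0)) := by
    rw [quadE_low_second]
    exact (hasSum_ite_eq 0 (seq r 0 ^ 2)).mul_left σ
  obtain ⟨s4, e4⟩ := norm_sq_eq_energy r
  have hs := ((s1.mul_left 2).add s2).sub s3.hasSum
  have hr := s4.hasSum.div_const 100
  rw [← e4] at hr
  refine hasSum_le (fun n => ?_) hr hs
  by_cases n2 : n = 2
  · subst n2; simp [h2]
  by_cases n3 : n = 3
  · subst n3; simp [h3]
  have hl := linEig_lower hω n2 n3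
  have hm := mul_le_mul_of_nonneg_right hl (sq_nonneg (seq r n))
  by_cases n0 : n = 0
  · subst n0
    rcases hσ with rfl | ⟨-, h0⟩
    · simp; nlinarith
    · simp [h0]
  · rw [linEig, if_neg n0] at hm
    simp only [n0, if_false]
    nlinarith

/-- Perturbation of the lowest mode by a state within rad in ℓ¹: the form changes by at most 24 *
rad * ‖r‖², which is less than the available (1/100 - 1/150) ‖r‖². -/
theorem coercive_rest (S : GaugedState) {σ : ℝ} {r : EnergySpace}
    (h2 : seq r 2 = 0) (h3 : seq r 3 = 0) (hσ : σ = 1 ∨ σ = -1 ∧ seq r 0 = 0) :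
    ‖r‖ ^ 2 / 150 ≤ hessE σ S.vec S.ω r r := by
  have hb := hessE_low_ge S.ω_near h2 h3 hσ
  set δ := unitVec 0
  set a := S.vec - δ with ha
  have eA : S.vec = δ + a := by rw [ha]; abel
  have la : ∑' n, |seq a n| ≤ rad := by
    have h1 : ∀ n, |seq a n| ≤ S.β n := fun n => by
      rw [ha, seq_sub, show seq δ = lowestMode from seq_unitVec 0]
      exact (S.dom n).trans (mul_le_of_le_one_left (S.majorant.1 n) (S.gauge.le_one n))
    exact ((summable_abs_seq a).1.tsum_le_tsum h1 S.majorant.2).trans S.sum_le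
  have lA : ∑' n, |seq S.vec n| ≤ 2 := by
    have h1 : ∀ n, |seq S.vec n| ≤ S.maj n := fun n => (S.domBy n).trans
      (mul_le_of_le_one_left (S.majorant_maj.1 n) (S.gauge.le_one n))
    exact ((summable_abs_seq S.vec).1.tsum_le_tsum h1 S.majorant_maj.2).trans
      (S.tsum_maj_le.trans (by norm_num [rad]))
  have lδ : ∑' n, |seq δ n| ≤ 2 := by
    have : ∀ n, |seq δ n| = unitSeq 0 n := fun n => by
      rw [seq_unitVec, abs_of_nonneg (unitSeq_nonneg _ _)]
    rw [tsum_congr this, tsum_unitSeq]; norm_num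
  have lr := (summable_abs_seq r).2
  have n0 : ∀ b : EnergySpace, 0 ≤ ∑' n, |seq b n| := fun b => tsum_nonneg fun n => abs_nonneg _
  have r0 : 0 ≤ rad := by norm_num [rad]
  have b1 : ∀ b c d : EnergySpace, ∀ B C D : ℝ, ∑' n, |seq b n| ≤ B → ∑' n, |seq c n| ≤ C →
      ∑' n, |seq d n| ≤ D → |quadE r b c d| ≤ ‖r‖ * B * (C * D) := fun b c d B C D hB hC hD => by
    have := n0 b; have := n0 c; have := n0 d
    have : 0 ≤ B := by linarith
    have : 0 ≤ C := by linarith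
    refine (abs_quadE_le_of_l1 r b c d).trans ?_
    gcongr
  have e1 : quadE r S.vec r S.vec = quadE r δ r δ + (quadE r a r S.vec + quadE r δ r a) := by
    conv_lhs => rw [eA, quadE_add₂, quadE_add₄ r δ r δ a, ← eA]
    ring
  have e2 : quadE r r S.vec S.vec = quadE r r δ δ + (quadE r r a S.vec + quadE r r δ a) := by
    conv_lhs => rw [eA, quadE_add₃, quadE_add₄ r r δ δ a, ← eA]
    ring
  have t1 := abs_le.1 (b1 a r S.vec _ _ _ la lr lA)
  have t2 := abs_le.1 (b1 δ r a _ _ _ lδ lr la)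
  have t3 := abs_le.1 (b1 r a S.vec _ _ _ lr la lA)
  have t4 := abs_le.1 (b1 r δ a _ _ _ lr lδ la)
  rw [hessE] at hb ⊢
  rw [e1, e2]
  unfold rad at t1 t2 t3 t4
  have hr := sq_nonneg ‖r‖
  rcases hσ with rfl | ⟨rfl, -⟩ <;> nlinarith

end GaugedState

end

end ConformalFlow

/-! ### Asymptotics of the Hessian on the approximate kernel vectors -/

namespace ConformalFlow

noncomputable section

open Asymptotics Filter Topology

namespace GaugedState

variable (σ : ℝ)

theorem os_sq_one : OS 8 fun S => S.A 1 * S.A 1 := ((osA 1).mul (osA 1)).mono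

theorem os_first_second : OS 7 fun S => S.A 1 * S.A 2 := ((osA 1).mul (osA 2)).mono

theorem os_first_third : OS 8 fun S => S.A 1 * S.A 3 := ((osA 1).mul (osA 3)).mono

theorem ent_zero_zero : OS 4 fun S => ent σ 0 0 S - (1 + σ) :=
  (((os_ent σ (le_refl 0) 2).mono.add (os_zero_sq.cmul (2 + σ))).add
    (os_sq_one.cmul 2).mono).of_eq fun S => by
    simp [entK, entG, Finset.sum_range_succ, coupling, -Nat.cast_min]; ring

theorem ent_one_one : OS 4 fun S => ent σ 1 1 S - (1 / 3 + 2 * σ * S.A 2) :=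
  (((((os_ent σ (le_refl 1) 2).mono.add (os_zero_sq.cmul 2)).add
    (os_sq_one.cmul (4 + 2 * σ)).mono).add ((os_zero.mul (osA 2)).cmul (2 * σ)).mono).add
    (os_detuning.cmul 2)).of_eq fun S => by
    simp [entK, entG, Finset.sum_range_succ, coupling, Ω, -Nat.cast_min]; ring

theorem ent_four_four : OS 4 fun S => ent σ 4 4 S - 1 / 3 :=
  (((((os_ent σ (le_refl 4) 2).mono.add (os_zero_sq.cmul 2)).add
    (os_sq_one.cmul 4).mono).add ((os_entG 4 4).cmul σ).mono).add
    (os_detuning.cmul 20)).of_eq fun S => by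
    simp [entK, Finset.sum_range_succ, coupling, Ω, -Nat.cast_min]; ring

theorem ent_five_five : OS 4 fun S => ent σ 5 5 S - 1 :=
  (((((os_ent σ (le_refl 5) 2).mono.add (os_zero_sq.cmul 2)).add
    (os_sq_one.cmul 4).mono).add ((os_entG 5 5).cmul σ).mono).add
    (os_detuning.cmul 30)).of_eq fun S => by
    simp [entK, Finset.sum_range_succ, coupling, Ω, -Nat.cast_min]; ring

theorem ent_six_six : OS 4 fun S => ent σ 6 6 S - 2 :=
  (((((os_ent σ (le_refl 6) 2).mono.add (os_zero_sq.cmul 2)).add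
    (os_sq_one.cmul 4).mono).add ((os_entG 6 6).cmul σ).mono).add
    (os_detuning.cmul 42)).of_eq fun S => by
    simp [entK, Finset.sum_range_succ, coupling, Ω, -Nat.cast_min]; ring

theorem ent_one_zero : OS 5 fun S => ent σ 1 0 S :=
  (((os_ent σ (show 0 ≤ 1 by decide) 2).mono.add
    (((osA 0).mul (osA 1)).cmul (2 + 2 * σ)).mono).add (os_first_second.cmul 2).mono).of_eq
    fun S => by
    simp [entK, entG, Finset.sum_range_succ, coupling, -Nat.cast_min]; ring

theorem ent_two_zero : OS 6 fun S => ent σ 2 0 S - 2 * (1 + σ) * S.A 2 :=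
  ((((os_ent σ (show 0 ≤ 2 by decide) 2).mono.add
    ((os_zero.mul (osA 2)).cmul (2 * (1 + σ)))).add (os_first_third.cmul 2).mono).add
    (os_sq_one.cmul σ).mono).of_eq fun S => by
    simp [entK, entG, Finset.sum_range_succ, coupling, -Nat.cast_min]; ring

theorem ent_three_zero : OS 5 fun S => ent σ 3 0 S - 2 * (1 + σ) * S.A 3 :=
  (((os_ent σ (show 0 ≤ 3 by decide) 1).add
    ((os_zero.mul (osA 3)).cmul (2 * (1 + σ))).mono).add
    (os_first_second.cmul (2 * σ)).mono).of_eq fun S => by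
    simp [entK, entG, Finset.sum_range_succ, coupling, -Nat.cast_min]; ring

theorem ent_two_one : OS 5 fun S => ent σ 2 1 S - 2 * σ * S.A 3 :=
  ((((os_ent σ (show 1 ≤ 2 by decide) 2).mono.add
    (((osA 0).mul (osA 1)).cmul 2).mono).add (os_first_second.cmul (4 + 4 * σ)).mono).add
    ((os_zero.mul (osA 3)).cmul (2 * σ)).mono).of_eq fun S => by
    simp [entK, entG, Finset.sum_range_succ, coupling, -Nat.cast_min]; ring

theorem ent_three_one : OS 6 fun S => ent σ 3 1 S - (2 * S.A 2 - 4 * σ * S.A 2 ^ 2) :=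
  (((((os_ent σ (show 1 ≤ 3 by decide) 2).mono.add ((os_zero.mul (osA 2)).cmul 2)).add
    (os_first_third.cmul (4 + 4 * σ)).mono).add ((os_zero.mul (osA 4)).cmul (2 * σ)).mono).add
    (ox_four.toOS.cmul (2 * σ)).mono).of_eq fun S => by
    simp [entK, entG, Finset.sum_range_succ, coupling, -Nat.cast_min]; ring

theorem ent_three_two : OS 7 fun S => ent σ 3 2 S - (-6 + 2 * σ) * (S.A 2 * S.A 3) :=
  (((((((os_ent σ (show 2 ≤ 3 by decide) 3).add ((os_zero.mul (osA 1)).cmul 2).mono).add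
    (ox_first.toOS.cmul 2)).add (os_first_second.cmul 4)).add
    ((os_zero.mul (osA 5)).cmul (2 * σ)).mono).add (ox_five.toOS.cmul (2 * σ)).mono).add
    (((osA 1).mul (osA 4)).cmul (4 * σ)).mono).of_eq fun S => by
    simp [entK, entG, Finset.sum_range_succ, coupling, -Nat.cast_min]; ring

theorem ent_four_two : OS 6 fun S => ent σ 4 2 S - 2 * S.A 2 :=
  ((((os_ent σ (show 2 ≤ 4 by decide) 2).add ((os_zero.mul (osA 2)).cmul 2)).add
    (os_first_third.cmul 4).mono).add ((os_entG 4 2).cmul σ)).of_eq fun S => by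
    simp [entK, Finset.sum_range_succ, coupling, -Nat.cast_min]; ring

theorem ent_five_two : OS 5 fun S => ent σ 5 2 S - 2 * S.A 3 :=
  (((os_ent σ (show 2 ≤ 5 by decide) 1).add ((os_zero.mul (osA 3)).cmul 2).mono).add
    ((os_entG 5 2).cmul σ).mono).of_eq fun S => by
    simp [entK, Finset.sum_range_succ, coupling, -Nat.cast_min]; ring

theorem ent_five_three : OS 6 fun S => ent σ 5 3 S - 2 * S.A 2 :=
  ((((os_ent σ (show 3 ≤ 5 by decide) 2).add ((os_zero.mul (osA 2)).cmul 2)).add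
    (os_first_third.cmul 4).mono).add ((os_entG 5 3).cmul σ).mono).of_eq fun S => by
    simp [entK, Finset.sum_range_succ, coupling, -Nat.cast_min]; ring

theorem ent_six_three : OS 5 fun S => ent σ 6 3 S - 2 * S.A 3 :=
  (((os_ent σ (show 3 ≤ 6 by decide) 1).add ((os_zero.mul (osA 3)).cmul 2).mono).add
    ((os_entG 6 3).cmul σ).mono).of_eq fun S => by
    simp [entK, Finset.sum_range_succ, coupling, -Nat.cast_min]; ring

theorem ent_four_three : OS 5 fun S => ent σ 4 3 S :=
  ((((os_ent σ (show 3 ≤ 4 by decide) 2).add (((osA 0).mul (osA 1)).cmul 2)).add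
    (os_first_second.cmul 4).mono).add ((os_entG 4 3).cmul σ).mono).of_eq fun S => by
    simp [entK, Finset.sum_range_succ, coupling, -Nat.cast_min]; ring

theorem ent_five_four : OS 5 fun S => ent σ 5 4 S :=
  ((((os_ent σ (show 4 ≤ 5 by decide) 2).add (((osA 0).mul (osA 1)).cmul 2)).add
    (os_first_second.cmul 4).mono).add ((os_entG 5 4).cmul σ).mono).of_eq fun S => by
    simp [entK, Finset.sum_range_succ, coupling, -Nat.cast_min]; ring

theorem ent_six_five : OS 5 fun S => ent σ 6 5 S :=
  ((((os_ent σ (show 5 ≤ 6 by decide) 2).add (((osA 0).mul (osA 1)).cmul 2)).add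
    (os_first_second.cmul 4).mono).add ((os_entG 6 5).cmul σ).mono).of_eq fun S => by
    simp [entK, Finset.sum_range_succ, coupling, -Nat.cast_min]; ring

/-- The critical diagonal entries are needed beyond the order s⁶ at which signs are decided, so here
the second-order value of A₀² and the leading value of A₄ enter. -/
theorem ent_two_two : OS 8 fun S =>
    ent σ 2 2 S - (6 * S.Ω + (2 - 3 * σ) * S.A 2 ^ 2 + 2 * S.A 3 ^ 2) :=
  ((((((os_ent σ (le_refl 2) 4).add (os_zero_sq'.cmul 2)).add (os_sq_one.cmul 4)).add
    ((os_zero.mul (osA 4)).cmul (2 * σ))).add (ox_four.toOS.cmul (2 * σ))).add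
    (os_first_third.cmul (4 * σ))).of_eq fun S => by
    simp [entK, entG, Finset.sum_range_succ, coupling, Ω, -Nat.cast_min]; ring

theorem ent_three_three : OS 8 fun S =>
    ent σ 3 3 S - (12 * S.Ω + 2 * S.A 2 ^ 2 + (4 + 3 * σ) * S.A 3 ^ 2 - 12 * σ * S.A 2 ^ 3) :=
  (((((((os_ent σ (le_refl 3) 4).add (os_zero_sq'.cmul 2)).add (os_sq_one.cmul 4)).add
    ((os_zero.mul (osA 6)).cmul (2 * σ)).mono).add (ox_six.toOS.cmul (2 * σ)).mono).add
    (((osA 1).mul (osA 5)).cmul (4 * σ)).mono).add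
    (((osA 2).mul ox_four.toOS).cmul (6 * σ)).mono).of_eq fun S => by
    simp [entK, entG, Finset.sum_range_succ, coupling, Ω, -Nat.cast_min]; ring

/-! ### Approximate kernel vectors -/

/-- The approximate kernel vector at mode two. -/
def testTwo (S : GaugedState) : EnergySpace :=
  unitVec 2 + (-((1 + σ) * S.A 2)) • unitVec 0 + (-(6 * σ * S.A 3)) • unitVec 1 +
    (-(6 * S.A 2)) • unitVec 4 + (-(2 * S.A 3)) • unitVec 5

/-- The coefficient of mode one in the approximate kernel vector at mode three. -/
def coefOne (S : GaugedState) : ℝ := -6 * S.A 2 + 48 * σ * S.A 2 ^ 2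

/-- The approximate kernel vector at mode three. -/
def testThree (S : GaugedState) : EnergySpace :=
  unitVec 3 + (-((1 + σ) * S.A 3)) • unitVec 0 + coefOne σ S • unitVec 1 +
    (-(2 * S.A 2)) • unitVec 5 + (-S.A 3) • unitVec 6

theorem hessE_testTwo (S : GaugedState) (b : EnergySpace) :
    hessE σ S.vec S.ω (testTwo σ S) b = hessE σ S.vec S.ω (unitVec 2) b +
      -((1 + σ) * S.A 2) * hessE σ S.vec S.ω (unitVec 0) b +
      -(6 * σ * S.A 3) * hessE σ S.vec S.ω (unitVec 1) b +
      -(6 * S.A 2) * hessE σ S.vec S.ω (unitVec 4) b +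
      -(2 * S.A 3) * hessE σ S.vec S.ω (unitVec 5) b := by
  simp only [testTwo, hessE_add, hessE_smul]

theorem hessE_testThree (S : GaugedState) (b : EnergySpace) :
    hessE σ S.vec S.ω (testThree σ S) b = hessE σ S.vec S.ω (unitVec 3) b +
      -((1 + σ) * S.A 3) * hessE σ S.vec S.ω (unitVec 0) b +
      coefOne σ S * hessE σ S.vec S.ω (unitVec 1) b +
      -(2 * S.A 2) * hessE σ S.vec S.ω (unitVec 5) b +
      -S.A 3 * hessE σ S.vec S.ω (unitVec 6) b := by
  simp only [testThree, hessE_add, hessE_smul]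

theorem os_coefOne : OS 2 (coefOne σ) :=
  (((osA 2).cmul (-6)).add (((osA 2).mul (osA 2)).cmul (48 * σ)).mono).of_eq fun S => by
    rw [coefOne]; ring

/-- The matrix of the Hessian on the approximate kernel vectors. -/
def matTwo (S : GaugedState) : ℝ := hessE σ S.vec S.ω (testTwo σ S) (testTwo σ S)

/-- The matrix of the Hessian on the approximate kernel vectors. -/
def matThree (S : GaugedState) : ℝ := hessE σ S.vec S.ω (testThree σ S) (testThree σ S)

/-- The matrix of the Hessian on the approximate kernel vectors. -/
def matMixed (S : GaugedState) : ℝ := hessE σ S.vec S.ω (testTwo σ S) (testThree σ S)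

/-- The value of the Hessian at `testTwo` and a unit vector. -/
def rowTwo (n : ℕ) (S : GaugedState) : ℝ := ent σ n 2 S + -((1 + σ) * S.A 2) * ent σ n 0 S +
  -(6 * σ * S.A 3) * ent σ n 1 S + -(6 * S.A 2) * ent σ n 4 S + -(2 * S.A 3) * ent σ n 5 S

/-- The value of the Hessian at `testThree` and a unit vector. -/
def rowThree (n : ℕ) (S : GaugedState) : ℝ := ent σ n 3 S + -((1 + σ) * S.A 3) * ent σ n 0 S +
  coefOne σ S * ent σ n 1 S + -(2 * S.A 2) * ent σ n 5 S + -S.A 3 * ent σ n 6 S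

theorem rowTwo_eq (n : ℕ) (S : GaugedState) :
    hessE σ S.vec S.ω (testTwo σ S) (unitVec n) = rowTwo σ n S := hessE_testTwo σ S _

theorem rowThree_eq (n : ℕ) (S : GaugedState) :
    hessE σ S.vec S.ω (testThree σ S) (unitVec n) = rowThree σ n S := hessE_testThree σ S _

theorem matTwo_eq (S : GaugedState) : matTwo σ S = rowTwo σ 2 S +
    -((1 + σ) * S.A 2) * rowTwo σ 0 S + -(6 * σ * S.A 3) * rowTwo σ 1 S +
    -(6 * S.A 2) * rowTwo σ 4 S + -(2 * S.A 3) * rowTwo σ 5 S := by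
  rw [matTwo, hessE_testTwo]
  simp only [hessE_symm σ S.vec S.ω (unitVec _) (testTwo σ S), rowTwo_eq]

theorem matThree_eq (S : GaugedState) : matThree σ S = rowThree σ 3 S +
    -((1 + σ) * S.A 3) * rowThree σ 0 S + coefOne σ S * rowThree σ 1 S +
    -(2 * S.A 2) * rowThree σ 5 S + -S.A 3 * rowThree σ 6 S := by
  rw [matThree, hessE_testThree]
  simp only [hessE_symm σ S.vec S.ω (unitVec _) (testThree σ S), rowThree_eq]

theorem matMixed_eq (S : GaugedState) : matMixed σ S = rowThree σ 2 S +
    -((1 + σ) * S.A 2) * rowThree σ 0 S + -(6 * σ * S.A 3) * rowThree σ 1 S +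
    -(6 * S.A 2) * rowThree σ 4 S + -(2 * S.A 3) * rowThree σ 5 S := by
  rw [matMixed, hessE_testTwo]
  simp only [hessE_symm σ S.vec S.ω (unitVec _) (testThree σ S), rowThree_eq]

variable {σ}

/-- The coefficients of `testTwo` are minus entry over eigenvalue: entries 2(1+σ)A₂, 2σA₃, 2A₂, 2A₃
against eigenvalues 1+σ, 1/3, 1/3, 1 in the modes 0, 1, 4, 5. So the leading terms cancel in each
noncritical row. In mode 0 with σ = -1 the entry vanishes at leading order and so does the
coefficient. -/
theorem os_rowTwo_zero (hσ : σ = 1 ∨ σ = -1) : OS 4 (rowTwo σ 0) :=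
  (((((ent_two_zero σ).mono.add (((osA 2).mul (ent_zero_zero σ)).cmul (-(1 + σ))).mono).add
    (((osA 3).mul (ent_one_zero σ)).cmul (-(6 * σ))).mono).add
    (((osA 2).mul (os_ent_gap σ (show 0 < 4 by decide))).cmul (-6)).mono).add
    (((osA 3).mul (os_ent_gap σ (show 0 < 5 by decide))).cmul (-2)).mono).of_eq fun S => by
    simp only [rowTwo, ent_symm σ 0]
    rcases hσ with rfl | rfl <;> ring

theorem os_rowTwo_one (hσ : σ = 1 ∨ σ = -1) : OS 4 (rowTwo σ 1) :=
  ((((((ent_two_one σ).mono.add (((osA 3).mul (ent_one_one σ)).cmul (-(6 * σ))).mono).add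
    (((osA 2).mul (ent_one_zero σ)).cmul (-(1 + σ))).mono).add
    (((osA 2).mul (os_ent_gap σ (show 1 < 4 by decide))).cmul (-6)).mono).add
    (((osA 3).mul (os_ent_gap σ (show 1 < 5 by decide))).cmul (-2)).mono).add
    (((osA 2).mul (osA 3)).cmul (-12)).mono).of_eq fun S => by
    simp only [rowTwo, ent_symm σ 1 2, ent_symm σ 1 4, ent_symm σ 1 5]
    rcases hσ with rfl | rfl <;> ring

theorem os_rowTwo_four : OS 4 (rowTwo σ 4) :=
  (((((ent_four_two σ).mono.add (((osA 2).mul (ent_four_four σ)).cmul (-6)).mono).add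
    (((osA 2).mul (os_ent_gap σ (show 0 < 4 by decide))).cmul (-(1 + σ))).mono).add
    (((osA 3).mul (os_ent_gap σ (show 1 < 4 by decide))).cmul (-(6 * σ))).mono).add
    (((osA 3).mul (ent_five_four σ)).cmul (-2)).mono).of_eq fun S => by
    simp only [rowTwo, ent_symm σ 4 5]
    ring

theorem os_rowTwo_five : OS 4 (rowTwo σ 5) :=
  (((((ent_five_two σ).mono.add (((osA 3).mul (ent_five_five σ)).cmul (-2)).mono).add
    (((osA 2).mul (os_ent_gap σ (show 0 < 5 by decide))).cmul (-(1 + σ))).mono).add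
    (((osA 3).mul (os_ent_gap σ (show 1 < 5 by decide))).cmul (-(6 * σ))).mono).add
    (((osA 2).mul (ent_five_four σ)).cmul (-6)).mono).of_eq fun S => by
    simp only [rowTwo]
    ring

theorem os_rowTwo_six : OS 4 (rowTwo σ 6) :=
  ((((os_ent_gap σ (show 2 < 6 by decide)).add
    (((osA 3).mul (ent_six_five σ)).cmul (-2)).mono).add
    (((osA 2).mul (os_ent_gap σ (show 0 < 6 by decide))).cmul (-(1 + σ))).mono).add
    ((((osA 3).mul (os_ent_gap σ (show 1 < 6 by decide))).cmul (-(6 * σ))).mono.add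
    (((osA 2).mul (os_ent_gap σ (show 4 < 6 by decide))).cmul (-6)))).of_eq fun S => by
    simp only [rowTwo]
    ring

theorem os_rowThree_zero (hσ : σ = 1 ∨ σ = -1) : OS 4 (rowThree σ 0) :=
  (((((ent_three_zero σ).mono.add (((osA 3).mul (ent_zero_zero σ)).cmul (-(1 + σ))).mono).add
    ((os_coefOne σ).mul (ent_one_zero σ)).mono).add
    (((osA 2).mul (os_ent_gap σ (show 0 < 5 by decide))).cmul (-2)).mono).add
    (((osA 3).mul (os_ent_gap σ (show 0 < 6 by decide))).cmul (-1)).mono).of_eq fun S => by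
    simp only [rowThree, ent_symm σ 0]
    rcases hσ with rfl | rfl <;> ring

/-- `coefOne` is the expansion of -(2A₂ - 4σA₂²)/(1/3 + 2σA₂) to second order, the entry over the
eigenvalue in mode 1. -/
theorem os_rowThree_one : OS 4 (rowThree σ 1) :=
  ((((((ent_three_one σ).mono.add ((os_coefOne σ).mul (ent_one_one σ)).mono).add
    (((osA 3).mul (ent_one_zero σ)).cmul (-(1 + σ))).mono).add
    (((osA 2).mul (os_ent_gap σ (show 1 < 5 by decide))).cmul (-2)).mono).add
    (((osA 3).mul (os_ent_gap σ (show 1 < 6 by decide))).cmul (-1)).mono).add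
    (((osA 2).mul ((osA 2).cmul (12 * σ) |>.add ((os_coefOne σ).cmul (2 * σ)))).mono)).of_eq
    fun S => by
    simp only [rowThree, ent_symm σ 1 3, ent_symm σ 1 5, ent_symm σ 1 6, coefOne]
    ring

theorem os_rowThree_four : OS 4 (rowThree σ 4) :=
  (((((ent_four_three σ).mono.add
    (((osA 3).mul (os_ent_gap σ (show 0 < 4 by decide))).cmul (-(1 + σ))).mono).add
    ((os_coefOne σ).mul (os_ent_gap σ (show 1 < 4 by decide))).mono).add
    (((osA 2).mul (ent_five_four σ)).cmul (-2)).mono).add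
    (((osA 3).mul (os_ent_gap σ (show 4 < 6 by decide))).cmul (-1)).mono).of_eq fun S => by
    simp only [rowThree, ent_symm σ 4 5, ent_symm σ 4 6]
    ring

theorem os_rowThree_five : OS 4 (rowThree σ 5) :=
  (((((ent_five_three σ).mono.add (((osA 2).mul (ent_five_five σ)).cmul (-2)).mono).add
    (((osA 3).mul (os_ent_gap σ (show 0 < 5 by decide))).cmul (-(1 + σ))).mono).add
    ((os_coefOne σ).mul (os_ent_gap σ (show 1 < 5 by decide))).mono).add
    (((osA 3).mul (ent_six_five σ)).cmul (-1)).mono).of_eq fun S => by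
    simp only [rowThree, ent_symm σ 5 6]
    ring

theorem os_rowThree_six : OS 4 (rowThree σ 6) :=
  (((((ent_six_three σ).mono.add (((osA 3).mul (ent_six_six σ)).cmul (-1)).mono).add
    (((osA 3).mul (os_ent_gap σ (show 0 < 6 by decide))).cmul (-(1 + σ))).mono).add
    ((os_coefOne σ).mul (os_ent_gap σ (show 1 < 6 by decide))).mono).add
    (((osA 2).mul (ent_six_five σ)).cmul (-2)).mono).of_eq fun S => by
    simp only [rowThree]
    ring


/-- For σ = 1 the leading part is the derivative in A₂ of the first bifurcation equation. For σ = -1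
it is the bracket of that equation itself, small whenever A₂ ≠ 0, as the kernel of L₋ demands. -/
theorem os_matTwo (hσ : σ = 1 ∨ σ = -1) : OS 8 fun S =>
    matTwo σ S - (6 * S.Ω - (14 + 7 * σ) * S.A 2 ^ 2 - 14 * S.A 3 ^ 2) := by
  have e2 := osA 2
  have e3 := osA 3
  have d1 := ((((ent_two_two σ).add
    (((e2.mul e2).mul (ent_zero_zero σ)).cmul ((1 + σ) ^ 2))).add
    (((e3.mul e3).mul (ent_one_one σ)).cmul 36).mono).add
    (((e2.mul e2).mul (ent_four_four σ)).cmul 36)).add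
    (((e3.mul e3).mul (ent_five_five σ)).cmul 4).mono
  have d2 := ((((e2.mul (ent_two_zero σ)).cmul (-2 * (1 + σ))).add
    ((e3.mul (ent_two_one σ)).cmul (-12 * σ))).add
    ((e2.mul (ent_four_two σ)).cmul (-12))).add ((e3.mul (ent_five_two σ)).cmul (-4))
  have d3 := ((((((e2.mul e3).mul (ent_one_zero σ)).cmul (12 * σ * (1 + σ))).mono (b := 8)).add
    (((e2.mul e2).mul (os_ent_gap σ (show 0 < 4 by decide))).cmul (12 * (1 + σ)))).add
    (((e2.mul e3).mul (os_ent_gap σ (show 0 < 5 by decide))).cmul (4 * (1 + σ))).mono).add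
    (((e2.mul e3).mul (os_ent_gap σ (show 1 < 4 by decide))).cmul (72 * σ))
  have d4 := ((((e3.mul e3).mul (os_ent_gap σ (show 1 < 5 by decide))).cmul (24 * σ)).mono (b := 8)).add
    (((e2.mul e3).mul (ent_five_four σ)).cmul 24).mono
  have d5 := (((e3.mul e3).mul e2).cmul (72 * σ))
  refine ((((d1.add d2).add d3).add d4).add d5).of_eq fun S => ?_
  rw [matTwo_eq]
  simp only [rowTwo, ent_symm σ 0 1, ent_symm σ 0 2, ent_symm σ 0 4, ent_symm σ 0 5, ent_symm σ 1 2,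
    ent_symm σ 1 4, ent_symm σ 1 5, ent_symm σ 2 4, ent_symm σ 2 5, ent_symm σ 4 5]
  rcases hσ with rfl | rfl <;> ring

/-- For σ = 1 the leading part is the derivative in A₃ of the second bifurcation equation. For σ =
-1 the term odd in A₂ changes sign, and this is the source of the opposite signs of L₊ and L₋ on
branch (ii). -/
theorem os_matThree (hσ : σ = 1 ∨ σ = -1) : OS 8 fun S =>
    matThree σ S - (12 * S.Ω - 14 * S.A 2 ^ 2 - (2 + σ) * S.A 3 ^ 2 + 108 * σ * S.A 2 ^ 3) := by
  have e2 := osA 2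
  have e3 := osA 3
  have c1 := os_coefOne σ
  have d1 := ((((ent_three_three σ).add
    (((e3.mul e3).mul (ent_zero_zero σ)).cmul ((1 + σ) ^ 2)).mono).add
    ((c1.mul c1).mul (ent_one_one σ))).add
    (((e2.mul e2).mul (ent_five_five σ)).cmul 4)).add
    ((e3.mul e3).mul (ent_six_six σ)).mono
  have d2 := ((((e3.mul (ent_three_zero σ)).cmul (-2 * (1 + σ))).add
    ((c1.mul (ent_three_one σ)).cmul 2)).add
    ((e2.mul (ent_five_three σ)).cmul (-4))).add ((e3.mul (ent_six_three σ)).cmul (-2))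
  have d3 := ((((((c1.mul e3).mul (ent_one_zero σ)).cmul (-2 * (1 + σ))).mono (b := 8)).add
    (((e2.mul e3).mul (os_ent_gap σ (show 0 < 5 by decide))).cmul (4 * (1 + σ))).mono).add
    (((e3.mul e3).mul (os_ent_gap σ (show 0 < 6 by decide))).cmul (2 * (1 + σ))).mono).add
    (((e2.mul c1).mul (os_ent_gap σ (show 1 < 5 by decide))).cmul (-4))
  have d4 := (((e3.mul c1).mul (os_ent_gap σ (show 1 < 6 by decide))).cmul (-2)).mono (b := 8) |>.add
    (((e2.mul e3).mul (ent_six_five σ)).cmul 4).mono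
  have d5 := (((e2.mul e2).mul (e2.mul e2)).cmul (-768)).add
    (((e2.mul e2).mul (e2.mul (e2.mul e2))).cmul (4608 * σ)).mono
  refine ((((d1.add d2).add d3).add d4).add d5).of_eq fun S => ?_
  rw [matThree_eq]
  simp only [rowThree, ent_symm σ 0 1, ent_symm σ 0 3, ent_symm σ 0 5, ent_symm σ 0 6, ent_symm σ 1 3,
    ent_symm σ 1 5, ent_symm σ 1 6, ent_symm σ 3 5, ent_symm σ 3 6, ent_symm σ 5 6, coefOne]
  rcases hσ with rfl | rfl <;> ring

/-- The mixed derivative of the bifurcation equations. It is needed for L₊ only, since the lower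
bounds for L₋ are taken with mode 2 removed. -/
theorem os_matMixed : OS 7 fun S => matMixed 1 S + 28 * (S.A 2 * S.A 3) := by
  have e2 := osA 2
  have e3 := osA 3
  have c1 := os_coefOne 1
  have d1 := ((((ent_three_two 1).add ((e3.mul (ent_two_zero 1)).cmul (-2)).mono).add
    (c1.mul (ent_two_one 1))).add ((e2.mul (ent_five_two 1)).cmul (-2))).add
    ((e3.mul (os_ent_gap 1 (show 2 < 6 by decide))).cmul (-1))
  have d2 := ((((((e2.mul (ent_three_zero 1)).cmul (-2)).mono (b := 7)).add
    (((e2.mul e3).mul (ent_zero_zero 1)).cmul 4).mono).add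
    (((e2.mul c1).mul (ent_one_zero 1)).cmul (-2)).mono).add
    (((e2.mul e2).mul (os_ent_gap 1 (show 0 < 5 by decide))).cmul 4).mono).add
    (((e2.mul e3).mul (os_ent_gap 1 (show 0 < 6 by decide))).cmul 2).mono
  have d3 := ((((((e3.mul (ent_three_one 1)).cmul (-6)).mono (b := 7)).add
    (((e3.mul e3).mul (ent_one_zero 1)).cmul 12).mono).add
    (((e3.mul c1).mul (ent_one_one 1)).cmul (-6)).mono).add
    (((e3.mul e2).mul (os_ent_gap 1 (show 1 < 5 by decide))).cmul 12).mono).add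
    (((e3.mul e3).mul (os_ent_gap 1 (show 1 < 6 by decide))).cmul 6).mono
  have d4 := ((((((e2.mul (ent_four_three 1)).cmul (-6)).mono (b := 7)).add
    (((e2.mul e3).mul (os_ent_gap 1 (show 0 < 4 by decide))).cmul 12).mono).add
    (((e2.mul c1).mul (os_ent_gap 1 (show 1 < 4 by decide))).cmul (-6))).add
    (((e2.mul e2).mul (ent_five_four 1)).cmul 12).mono).add
    (((e2.mul e3).mul (os_ent_gap 1 (show 4 < 6 by decide))).cmul 6)
  have d5 := ((((((e3.mul (ent_five_three 1)).cmul (-2)).mono (b := 7)).add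
    (((e3.mul e3).mul (os_ent_gap 1 (show 0 < 5 by decide))).cmul 4).mono).add
    (((e3.mul c1).mul (os_ent_gap 1 (show 1 < 5 by decide))).cmul (-2)).mono).add
    (((e2.mul e3).mul (ent_five_five 1)).cmul 4).mono).add
    (((e3.mul e3).mul (ent_six_five 1)).cmul 2).mono
  have d6 := (((e2.mul e2).mul e3).cmul 96).add ((e2.mul (e2.mul (e2.mul e3))).cmul (-576)).mono
  refine (((((d1.add d2).add d3).add d4).add d5).add d6).of_eq fun S => ?_
  rw [matMixed_eq]
  simp only [rowThree, ent_symm 1 0 1, ent_symm 1 0 3, ent_symm 1 0 5, ent_symm 1 0 6, ent_symm 1 1 3,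
    ent_symm 1 1 5, ent_symm 1 1 6, ent_symm 1 2 3, ent_symm 1 2 5, ent_symm 1 2 6,
    ent_symm 1 4 5, ent_symm 1 4 6, ent_symm 1 5 6, coefOne]
  ring

end GaugedState

end

end ConformalFlow

/-! ### Coupling of the approximate kernel to its complement, and the constraint functional -/

namespace ConformalFlow

noncomputable section

open Asymptotics Filter Topology

/-- The part of a sequence beyond `N`. -/
def tailVec (r : EnergySpace) (N : ℕ) : EnergySpace :=
  ofSeq (fun n => if n < N then 0 else seq r n) (by
    rw [memlp_energy_iff]
    have h := (norm_sq_eq_energy r).1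
    refine Summable.of_nonneg_of_le (fun n => sq_nonneg _) (fun n => ?_) h
    split_ifs
    · rw [mul_zero, zero_pow two_ne_zero]; positivity
    · rw [mul_pow])

theorem seq_tailVec (r : EnergySpace) (N : ℕ) :
    seq (tailVec r N) = fun n => if n < N then 0 else seq r n := seq_ofSeq _ _

theorem norm_tailVec_le (r : EnergySpace) (N : ℕ) : ‖tailVec r N‖ ≤ ‖r‖ := by
  obtain ⟨s1, e1⟩ := norm_sq_eq_energy (tailVec r N)
  obtain ⟨s2, e2⟩ := norm_sq_eq_energy r
  refine abs_le_of_sq_le_sq' ?_ (norm_nonneg _) |>.2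
  rw [e1, e2]
  refine s1.tsum_le_tsum (fun n => ?_) s2
  rw [seq_tailVec]
  dsimp only
  split_ifs
  · rw [zero_pow two_ne_zero, mul_zero]; positivity
  · exact le_rfl

theorem eq_sum_add_tailVec (r : EnergySpace) (N : ℕ) :
    r = ∑ i ∈ Finset.range N, seq r i • unitVec i + tailVec r N := by
  apply seq_injective
  have hsum : ∀ M : ℕ, seq (∑ i ∈ Finset.range M, seq r i • unitVec i) =
      fun n => if n < M then seq r n else 0 := by
    intro M
    induction M with
    | zero => simp [seq_zero]; rfl
    | succ M ih =>
      rw [Finset.sum_range_succ, seq_add, ih, seq_smul, seq_unitVec]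
      ext n
      simp only [Pi.add_apply, Pi.smul_apply, unitSeq, smul_eq_mul]
      rcases lt_trichotomy n M with h | h | h
      · simp [h, h.ne, h.trans (Nat.lt_succ_self M)]
      · subst h; simp
      · simp [h.not_gt, h.ne', show ¬ n < M + 1 by omega]
  rw [seq_add, hsum, seq_tailVec]
  ext n
  simp only [Pi.add_apply]
  split_ifs <;> simp

/-- The weight `n (n+1)` of the combined constraint. -/
theorem energyWeight_momentum : EnergyWeight (fun n : ℕ => (n : ℝ) * ((n : ℝ) + 1)) 1 := fun n => by
  have : (0 : ℝ) ≤ n := n.cast_nonneg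
  rw [abs_of_nonneg (by positivity)]
  nlinarith

namespace GaugedState

/-- The combined constraint `∑ n (n+1) A_n a_n`. -/
def momentum (S : GaugedState) (a : EnergySpace) : ℝ :=
  diagE (fun n : ℕ => (n : ℝ) * ((n : ℝ) + 1)) S.vec a

theorem momentum_add (S : GaugedState) (a b : EnergySpace) :
    S.momentum (a + b) = S.momentum a + S.momentum b := by
  simp only [momentum, diagE_symm _ S.vec]
  exact diagE_add energyWeight_momentum a b S.vec

theorem momentum_smul (S : GaugedState) (t : ℝ) (a : EnergySpace) :
    S.momentum (t • a) = t * S.momentum a := by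
  simp only [momentum, diagE_symm _ S.vec]
  exact diagE_smul _ t a S.vec

theorem momentum_unitVec (S : GaugedState) (i : ℕ) :
    S.momentum (unitVec i) = (i : ℝ) * ((i : ℝ) + 1) * S.A i := diagE_unitVec _ _ _

theorem OS.exists_bound {a : ℕ} {f : GaugedState → ℝ} (h : OS a f) :
    ∃ C > 0, ∀ᶠ S in small, |f S| ≤ C * S.s ^ a := by
  obtain ⟨C, hC, h⟩ := IsBigO.exists_pos h
  refine ⟨C, hC, h.bound.mono fun S hS => ?_⟩
  rwa [Real.norm_eq_abs, Real.norm_of_nonneg (pow_nonneg S.s_pos.le _)] at hS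

theorem abs_second_le (S : GaugedState) : |S.A 2| ≤ rad / 4 * S.s ^ 2 := by
  have h : |S.A 2| = rad / 4 * (S.s ^ 2 * S.x) := S.abs_two
  rw [h]
  have := S.x_le
  have := S.s_pos
  have : 0 ≤ rad := by norm_num [rad]
  gcongr
  exact mul_le_of_le_one_right (by positivity) S.x_le

theorem abs_third_le (S : GaugedState) : |S.A 3| ≤ rad / 4 * S.s ^ 3 := by
  have h : |S.A 3| = rad / 4 * (S.s ^ 3 * S.y) := S.abs_three
  rw [h]
  have := S.y_le
  have := S.s_pos
  have : 0 ≤ rad := by norm_num [rad]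
  gcongr
  exact mul_le_of_le_one_right (by positivity) S.y_le

theorem abs_mul_le_pow {c x C X : ℝ} (hc : |c| ≤ C) (hx : |x| ≤ X) : |c * x| ≤ C * X := by
  rw [abs_mul]
  have := abs_nonneg c
  have := abs_nonneg x
  have : 0 ≤ C := by linarith
  gcongr

/-- Mode k of the test vector reaches the modes from 7 on with strength s ^ (7 - k) times its
coefficient. The cut at 7 is placed so that this is of order s⁴ at worst, the worst case being mode
3 of `testThree`. -/
theorem testTwo_tail_le (S : GaugedState) {σ : ℝ} (hσ : σ = 1 ∨ σ = -1) (r : EnergySpace) :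
    |hessE σ S.vec S.ω (testTwo σ S) (tailVec r 7)| ≤ 300 * S.s ^ 4 * ‖r‖ := by
  have s0 := S.s_pos
  have s1 := S.s_le
  have hσ1 : |σ| ≤ 1 := by rcases hσ with rfl | rfl <;> norm_num
  have ht := norm_tailVec_le r 7
  have hk : ∀ k, k < 7 → |hessE σ S.vec S.ω (unitVec k) (tailVec r 7)| ≤
      12 * S.s ^ (7 - k) * ‖r‖ := fun k hk =>
    (S.abs_hessE_unitVec_le hσ1 hk fun n hn => by rw [seq_tailVec]; simp [hn]).trans
      (by gcongr)
  have e2 := S.abs_second_le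
  have e3 := S.abs_third_le
  have c0 : |-((1 + σ) * S.A 2)| ≤ 2 * S.s ^ 2 := by
    rw [abs_neg, abs_mul]
    have : |1 + σ| ≤ 2 := by rcases hσ with rfl | rfl <;> norm_num
    have : |S.A 2| ≤ S.s ^ 2 := by unfold rad at e2; nlinarith [pow_pos s0 2]
    gcongr
  have c1 : |-(6 * σ * S.A 3)| ≤ 6 * S.s ^ 3 := by
    rw [abs_neg, abs_mul]
    have : |6 * σ| ≤ 6 := by rcases hσ with rfl | rfl <;> norm_num
    have : |S.A 3| ≤ S.s ^ 3 := by unfold rad at e3; nlinarith [pow_pos s0 3]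
    gcongr
  have c4 : |-(6 * S.A 2)| ≤ 6 * S.s ^ 2 := by
    rw [abs_neg, abs_mul, abs_of_pos (by norm_num : (0 : ℝ) < 6)]
    unfold rad at e2; nlinarith [pow_pos s0 2]
  have c5 : |-(2 * S.A 3)| ≤ 2 * S.s ^ 3 := by
    rw [abs_neg, abs_mul, abs_of_pos (by norm_num : (0 : ℝ) < 2)]
    unfold rad at e3; nlinarith [pow_pos s0 3]
  rw [hessE_testTwo]
  have b0 := abs_le.1 (abs_mul_le_pow c0 (hk 0 (by norm_num)))
  have b1 := abs_le.1 (abs_mul_le_pow c1 (hk 1 (by norm_num)))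
  have b2 := abs_le.1 (hk 2 (by norm_num))
  have b4 := abs_le.1 (abs_mul_le_pow c4 (hk 4 (by norm_num)))
  have b5 := abs_le.1 (abs_mul_le_pow c5 (hk 5 (by norm_num)))
  norm_num at b0 b1 b2 b4 b5
  have p : ∀ j, 0 ≤ S.s ^ 4 * ‖r‖ - S.s ^ (4 + j) * ‖r‖ := fun j => by
    rw [← sub_mul]
    exact mul_nonneg (sub_nonneg.2 (pow_le_pow_of_le_one s0.le (by linarith) (by omega)))
      (norm_nonneg _)
  have p5 := p 1; have p9 := p 5
  rw [abs_le]
  constructor <;> ring_nf at * <;> linarith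

theorem testThree_tail_le (S : GaugedState) {σ : ℝ} (hσ : σ = 1 ∨ σ = -1) (r : EnergySpace) :
    |hessE σ S.vec S.ω (testThree σ S) (tailVec r 7)| ≤ 1000 * S.s ^ 4 * ‖r‖ := by
  have s0 := S.s_pos
  have s1 := S.s_le
  have hσ1 : |σ| ≤ 1 := by rcases hσ with rfl | rfl <;> norm_num
  have ht := norm_tailVec_le r 7
  have hk : ∀ k, k < 7 → |hessE σ S.vec S.ω (unitVec k) (tailVec r 7)| ≤
      12 * S.s ^ (7 - k) * ‖r‖ := fun k hk =>
    (S.abs_hessE_unitVec_le hσ1 hk fun n hn => by rw [seq_tailVec]; simp [hn]).trans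
      (by gcongr)
  have e2 := S.abs_second_le
  have e3 := S.abs_third_le
  have e2' : |S.A 2| ≤ S.s ^ 2 := by unfold rad at e2; nlinarith [pow_pos s0 2]
  have e3' : |S.A 3| ≤ S.s ^ 3 := by unfold rad at e3; nlinarith [pow_pos s0 3]
  have c0 : |-((1 + σ) * S.A 3)| ≤ 2 * S.s ^ 3 := by
    rw [abs_neg, abs_mul]
    have : |1 + σ| ≤ 2 := by rcases hσ with rfl | rfl <;> norm_num
    gcongr
  have c1 : |coefOne σ S| ≤ 54 * S.s ^ 2 := by
    rw [coefOne]
    refine (abs_add_le _ _).trans ?_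
    rw [abs_mul, abs_mul, abs_pow]
    have h6 : |(-6 : ℝ)| = 6 := by norm_num
    have h48 : |48 * σ| ≤ 48 := by rcases hσ with rfl | rfl <;> norm_num
    rw [h6]
    have hs : S.s ^ 2 ≤ 1 := pow_le_one₀ s0.le (by linarith)
    have : |S.A 2| ^ 2 ≤ S.s ^ 2 := by nlinarith [abs_nonneg (S.A 2)]
    have : |48 * σ| * |S.A 2| ^ 2 ≤ 48 * S.s ^ 2 := by gcongr
    linarith
  have c5 : |-(2 * S.A 2)| ≤ 2 * S.s ^ 2 := by
    rw [abs_neg, abs_mul, abs_of_pos (by norm_num : (0 : ℝ) < 2)]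
    linarith
  have c6 : |-S.A 3| ≤ S.s ^ 3 := by rwa [abs_neg]
  rw [hessE_testThree]
  have b0 := abs_le.1 (abs_mul_le_pow c0 (hk 0 (by norm_num)))
  have b1 := abs_le.1 (abs_mul_le_pow c1 (hk 1 (by norm_num)))
  have b3 := abs_le.1 (hk 3 (by norm_num))
  have b5 := abs_le.1 (abs_mul_le_pow c5 (hk 5 (by norm_num)))
  have b6 := abs_le.1 (abs_mul_le_pow c6 (hk 6 (by norm_num)))
  norm_num at b0 b1 b3 b5 b6
  have p : ∀ j, 0 ≤ S.s ^ 4 * ‖r‖ - S.s ^ (4 + j) * ‖r‖ := fun j => by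
    rw [← sub_mul]
    exact mul_nonneg (sub_nonneg.2 (pow_le_pow_of_le_one s0.le (by linarith) (by omega)))
      (norm_nonneg _)
  have p8 := p 4; have p10 := p 6
  rw [abs_le]
  constructor <;> ring_nf at * <;> linarith

theorem head_bound {S : GaugedState} {σ C : ℝ} {e r : EnergySpace} (hC : 0 ≤ C)
    (h2 : seq r 2 = 0) (h3 : seq r 3 = 0)
    (h : ∀ n < 7, n ≠ 2 → n ≠ 3 → |hessE σ S.vec S.ω e (unitVec n)| ≤ C * S.s ^ 4) :
    |hessE σ S.vec S.ω e r| ≤ 7 * C * S.s ^ 4 * ‖r‖ + |hessE σ S.vec S.ω e (tailVec r 7)| := by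
  have s0 := S.s_pos
  have e1 : hessE σ S.vec S.ω e r = ∑ i ∈ Finset.range 7, seq r i * hessE σ S.vec S.ω e (unitVec i) +
      hessE σ S.vec S.ω e (tailVec r 7) := by
    conv_lhs => rw [eq_sum_add_tailVec r 7]
    simp only [← hessL_apply, map_add, map_sum, map_smul, smul_eq_mul]
  rw [e1]
  refine (abs_add_le _ _).trans (add_le_add_left ?_ _)
  refine (Finset.abs_sum_le_sum_abs _ _).trans ?_
  have : ∀ i ∈ Finset.range 7, |seq r i * hessE σ S.vec S.ω e (unitVec i)| ≤ C * S.s ^ 4 * ‖r‖ := by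
    intro i hi
    by_cases i2 : i = 2
    · subst i2; rw [h2, zero_mul, abs_zero]; positivity
    by_cases i3 : i = 3
    · subst i3; rw [h3, zero_mul, abs_zero]; positivity
    rw [abs_mul, mul_comm]
    have := h i (Finset.mem_range.1 hi) i2 i3
    have := abs_seq_le r i
    gcongr
  refine (Finset.sum_le_sum this).trans (le_of_eq ?_)
  simp; ring

/-- The test vectors couple to the complement with strength s⁴ only. Completing the square in the
complement then costs s⁸, negligible against the s⁶ of the reduced matrix. -/
theorem exists_row_bound {σ : ℝ} (hσ : σ = 1 ∨ σ = -1) : ∃ C > 0, ∀ᶠ S in small, ∀ r : EnergySpace,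
    seq r 2 = 0 → seq r 3 = 0 → |hessE σ S.vec S.ω (testTwo σ S) r| ≤ C * S.s ^ 4 * ‖r‖ ∧
      |hessE σ S.vec S.ω (testThree σ S) r| ≤ C * S.s ^ 4 * ‖r‖ := by
  obtain ⟨a0, p0, h0⟩ := OS.exists_bound (os_rowTwo_zero hσ)
  obtain ⟨a1, p1, h1⟩ := OS.exists_bound (os_rowTwo_one hσ)
  obtain ⟨a4, p4, h4⟩ := OS.exists_bound (os_rowTwo_four (σ := σ))
  obtain ⟨a5, p5, h5⟩ := OS.exists_bound (os_rowTwo_five (σ := σ))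
  obtain ⟨a6, p6, h6⟩ := OS.exists_bound (os_rowTwo_six (σ := σ))
  obtain ⟨b0, q0, g0⟩ := OS.exists_bound (os_rowThree_zero hσ)
  obtain ⟨b1, q1, g1⟩ := OS.exists_bound (os_rowThree_one (σ := σ))
  obtain ⟨b4, q4, g4⟩ := OS.exists_bound (os_rowThree_four (σ := σ))
  obtain ⟨b5, q5, g5⟩ := OS.exists_bound (os_rowThree_five (σ := σ))
  obtain ⟨b6, q6, g6⟩ := OS.exists_bound (os_rowThree_six (σ := σ))
  refine ⟨7 * (a0 + a1 + a4 + a5 + a6 + b0 + b1 + b4 + b5 + b6) + 1000, by positivity, ?_⟩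
  filter_upwards [h0, h1, h4, h5, h6, g0, g1, g4, g5, g6] with S h0 h1 h4 h5 h6 g0 g1 g4 g5 g6
  intro r r2 r3
  have s4 : 0 ≤ S.s ^ 4 := pow_nonneg S.s_pos.le _
  have mono : ∀ {x a : ℝ}, |x| ≤ a * S.s ^ 4 → a ≤ a0 + a1 + a4 + a5 + a6 + b0 + b1 + b4 + b5 + b6 →
      |x| ≤ (a0 + a1 + a4 + a5 + a6 + b0 + b1 + b4 + b5 + b6) * S.s ^ 4 := fun h h' =>
    h.trans (mul_le_mul_of_nonneg_right h' s4)
  have t2 := testTwo_tail_le S hσ r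
  have t3 := testThree_tail_le S hσ r
  have k2 := head_bound (S := S) (σ := σ) (e := testTwo σ S)
    (C := a0 + a1 + a4 + a5 + a6 + b0 + b1 + b4 + b5 + b6) (by positivity) r2 r3
    (fun n hn n2 n3 => by
      rw [rowTwo_eq]
      have : n = 0 ∨ n = 1 ∨ n = 4 ∨ n = 5 ∨ n = 6 := by omega
      rcases this with rfl | rfl | rfl | rfl | rfl
      · exact mono h0 (by linarith)
      · exact mono h1 (by linarith)
      · exact mono h4 (by linarith)
      · exact mono h5 (by linarith)
      · exact mono h6 (by linarith))
  have k3 := head_bound (S := S) (σ := σ) (e := testThree σ S)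
    (C := a0 + a1 + a4 + a5 + a6 + b0 + b1 + b4 + b5 + b6) (by positivity) r2 r3
    (fun n hn n2 n3 => by
      rw [rowThree_eq]
      have : n = 0 ∨ n = 1 ∨ n = 4 ∨ n = 5 ∨ n = 6 := by omega
      rcases this with rfl | rfl | rfl | rfl | rfl
      · exact mono g0 (by linarith)
      · exact mono g1 (by linarith)
      · exact mono g4 (by linarith)
      · exact mono g5 (by linarith)
      · exact mono g6 (by linarith))
  have : 0 ≤ S.s ^ 4 * ‖r‖ := by positivity
  constructor <;> nlinarith

/-! ### The constraint -/

/-- Off the critical modes the amplitudes are of order s⁴: A₁ is of order s⁵, and A_n of order s ^ n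
for n ≥ 4. Of the weight n (n+1) the factor n + 1 goes into the energy norm of r, and n is absorbed
by s ≤ 1/2; mode 0 has weight zero. -/
theorem abs_momentum_le (S : GaugedState) {r : EnergySpace} (h2 : seq r 2 = 0) (h3 : seq r 3 = 0) :
    |S.momentum r| ≤ 32 * S.s ^ 4 * ‖r‖ := by
  have s0 := S.s_pos
  have s1 := S.s_le
  have m0 := S.majorant_maj.1
  obtain ⟨hs, -⟩ := diagE_bound energyWeight_momentum S.vec r
  have key : ∀ n : ℕ, |(n : ℝ) * ((n : ℝ) + 1) * (seq S.vec n * seq r n)| ≤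
      16 * S.s ^ 4 * ‖r‖ * S.maj n := by
    intro n
    have hm := m0 n
    have hn := abs_succ_mul_seq_le r n
    by_cases n2 : n = 2
    · subst n2; rw [h2]; simp; positivity
    by_cases n3 : n = 3
    · subst n3; rw [h3]; simp; positivity
    by_cases n0 : n = 0
    · subst n0; simp; positivity
    have hA : (n : ℝ) * |seq S.vec n| ≤ 16 * S.s ^ 4 * S.maj n := by
      have hd : |seq S.vec n| ≤ S.s ^ gaugeExp n * (S.χ n * S.maj n) := by
        rw [← mul_assoc]; exact S.domBy n
      have hd' : |seq S.vec n| ≤ S.s ^ gaugeExp n * S.maj n := hd.trans (by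
        gcongr; exact mul_le_of_le_one_left hm (S.χ_le_one n))
      have hp : (n : ℝ) * S.s ^ gaugeExp n ≤ 16 * S.s ^ 4 := by
        by_cases n1 : n = 1
        · subst n1
          have : S.s ^ 5 ≤ S.s ^ 4 := pow_le_pow_of_le_one s0.le (by linarith) (by norm_num)
          simp only [gaugeExp, if_true]
          push_cast
          nlinarith [pow_pos s0 4]
        · obtain ⟨i, rfl⟩ : ∃ i, n = 4 + i := ⟨n - 4, by omega⟩
          rw [gaugeExp, if_neg n1, pow_add]
          have h1 : S.s ^ i ≤ (1 / 2) ^ i := pow_le_pow_left₀ s0.le s1 i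
          -- From 4 + i ≤ 2 ^ (4 + i); this is the constant 16 of the bound.
          have h2 : ((4 + i : ℕ) : ℝ) * (1 / 2) ^ i ≤ 16 := by
            have h3 : ((4 + i : ℕ) : ℝ) ≤ 2 ^ (4 + i) := by exact_mod_cast Nat.lt_two_pow_self.le
            calc _ ≤ (2 : ℝ) ^ (4 + i) * (1 / 2) ^ i := by gcongr
              _ = 16 := by rw [pow_add, mul_assoc, ← mul_pow]; norm_num
          calc _ = S.s ^ 4 * (((4 + i : ℕ) : ℝ) * S.s ^ i) := by ring
            _ ≤ S.s ^ 4 * (((4 + i : ℕ) : ℝ) * (1 / 2) ^ i) := by gcongr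
            _ ≤ S.s ^ 4 * 16 := by gcongr
            _ = _ := by ring
      calc _ ≤ (n : ℝ) * (S.s ^ gaugeExp n * S.maj n) := by gcongr
        _ = ((n : ℝ) * S.s ^ gaugeExp n) * S.maj n := by ring
        _ ≤ _ := by gcongr
    calc _ = |(n : ℝ) * seq S.vec n| * |((n : ℝ) + 1) * seq r n| := by rw [← abs_mul]; ring_nf
      _ ≤ (16 * S.s ^ 4 * S.maj n) * ‖r‖ := by
        rw [abs_mul, Nat.abs_cast]
        gcongr
      _ = _ := by ring
  have hb := S.majorant_maj.2.mul_left (16 * S.s ^ 4 * ‖r‖)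
  have sa := Summable.of_nonneg_of_le (fun n => abs_nonneg _) key hb
  have h := norm_tsum_le_tsum_norm (f := fun n : ℕ => (n : ℝ) * ((n : ℝ) + 1) *
    (seq S.vec n * seq r n)) sa
  have h' := sa.tsum_le_tsum key hb
  rw [tsum_mul_left] at h'
  have t : ∑' j, S.maj j ≤ 2 := S.tsum_maj_le.trans (by norm_num [rad])
  have : 0 ≤ 16 * S.s ^ 4 * ‖r‖ := by positivity
  have h'' := mul_le_mul_of_nonneg_left t this
  exact h.trans (h'.trans (h''.trans (le_of_eq (by ring))))

theorem os_momentum_two : OS 6 fun S => S.momentum (testTwo 1 S) - 6 * S.A 2 :=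
  (((((osA 3).mul (osA 1)).cmul (-12)).mono.add (((osA 2).mul (osA 4)).cmul (-120))).add
    (((osA 3).mul (osA 5)).cmul (-60)).mono).of_eq fun S => by
    simp only [testTwo, momentum_add, momentum_smul, momentum_unitVec]
    push_cast
    ring

theorem os_momentum_three : OS 7 fun S => S.momentum (testThree 1 S) - 12 * S.A 3 :=
  ((((((os_coefOne 1).mul (osA 1)).cmul 2).add (((osA 2).mul (osA 5)).cmul (-60))).add
    (((osA 3).mul (osA 6)).cmul (-42)).mono)).of_eq fun S => by
    simp only [testThree, momentum_add, momentum_smul, momentum_unitVec]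
    push_cast
    ring

end GaugedState

end

end ConformalFlow

namespace ConformalFlow

noncomputable section

open Asymptotics Filter Topology

namespace GaugedState

/-! ### Uniform estimates for small states -/

/-- The estimates on the Hessian, the constraint and the reduced equations with constant `C`. -/
structure Est (C : ℝ) (S : GaugedState) : Prop where
  one_le : 1 ≤ C
  row : ∀ σ : ℝ, (σ = 1 ∨ σ = -1) → ∀ r : EnergySpace, seq r 2 = 0 → seq r 3 = 0 →
    |hessE σ S.vec S.ω (testTwo σ S) r| ≤ C * S.s ^ 4 * ‖r‖ ∧
      |hessE σ S.vec S.ω (testThree σ S) r| ≤ C * S.s ^ 4 * ‖r‖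
  mom : ∀ r : EnergySpace, seq r 2 = 0 → seq r 3 = 0 → |S.momentum r| ≤ C * S.s ^ 4 * ‖r‖
  mom_two : |S.momentum (testTwo 1 S) - 6 * S.A 2| ≤ C * S.s ^ 6
  mom_three : |S.momentum (testThree 1 S) - 12 * S.A 3| ≤ C * S.s ^ 7
  two : ∀ σ : ℝ, (σ = 1 ∨ σ = -1) →
    |matTwo σ S - (6 * S.Ω - (14 + 7 * σ) * S.A 2 ^ 2 - 14 * S.A 3 ^ 2)| ≤ C * S.s ^ 8
  three : ∀ σ : ℝ, (σ = 1 ∨ σ = -1) → |matThree σ S - (12 * S.Ω - 14 * S.A 2 ^ 2 -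
    (2 + σ) * S.A 3 ^ 2 + 108 * σ * S.A 2 ^ 3)| ≤ C * S.s ^ 8
  mixed : |matMixed 1 S + 28 * (S.A 2 * S.A 3)| ≤ C * S.s ^ 7
  reduced_two : S.A 2 ≠ 0 → |6 * S.Ω - 7 * S.A 2 ^ 2 - 14 * S.A 3 ^ 2| ≤ C * S.s ^ 8
  reduced_three : S.A 3 ≠ 0 →
    |12 * S.Ω - 14 * S.A 2 ^ 2 - S.A 3 ^ 2 + 108 * S.A 2 ^ 3| ≤ C * S.s ^ 8

theorem exists_est : ∃ C : ℝ, 1 ≤ C ∧ ∀ᶠ S in small, Est C S := by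
  obtain ⟨a1, p1, h1⟩ := exists_row_bound (σ := 1) (Or.inl rfl)
  obtain ⟨a2, p2, h2⟩ := exists_row_bound (σ := -1) (Or.inr rfl)
  obtain ⟨a3, p3, h3⟩ := OS.exists_bound os_momentum_two
  obtain ⟨a4, p4, h4⟩ := OS.exists_bound os_momentum_three
  obtain ⟨a5, p5, h5⟩ := OS.exists_bound (os_matTwo (σ := 1) (Or.inl rfl))
  obtain ⟨a6, p6, h6⟩ := OS.exists_bound (os_matTwo (σ := -1) (Or.inr rfl))
  obtain ⟨a7, p7, h7⟩ := OS.exists_bound (os_matThree (σ := 1) (Or.inl rfl))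
  obtain ⟨a8, p8, h8⟩ := OS.exists_bound (os_matThree (σ := -1) (Or.inr rfl))
  obtain ⟨a9, p9, h9⟩ := OS.exists_bound os_matMixed
  obtain ⟨b1, q1, g1⟩ := reduced_two_isBigO.exists_pos
  obtain ⟨b2, q2, g2⟩ := reduced_three_isBigO.exists_pos
  have k1 := eventually_inf_principal.1 g1.bound
  have k2 := eventually_inf_principal.1 g2.bound
  set C := a1 + a2 + a3 + a4 + a5 + a6 + a7 + a8 + a9 + b1 + b2 + 32 with hC
  refine ⟨C, by linarith, ?_⟩
  filter_upwards [h1, h2, h3, h4, h5, h6, h7, h8, h9, k1, k2] with S h1 h2 h3 h4 h5 h6 h7 h8 h9 k1 k2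
  have s0 := S.s_pos
  have le : ∀ {a x : ℝ} {k : ℕ}, |x| ≤ a * S.s ^ k → a ≤ C → |x| ≤ C * S.s ^ k := fun h h' =>
    h.trans (mul_le_mul_of_nonneg_right h' (pow_nonneg s0.le _))
  have le' : ∀ {a x R : ℝ} {k : ℕ}, 0 ≤ R → |x| ≤ a * S.s ^ k * R → a ≤ C → |x| ≤ C * S.s ^ k * R :=
    fun hR h h' => h.trans (mul_le_mul_of_nonneg_right
      (mul_le_mul_of_nonneg_right h' (pow_nonneg s0.le _)) hR)
  refine ⟨by linarith, ?_, ?_, le h3 (by linarith), le h4 (by linarith), ?_, ?_, le h9 (by linarith),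
    ?_, ?_⟩
  · rintro σ (rfl | rfl) r r2 r3
    · exact ⟨le' (norm_nonneg _) (h1 r r2 r3).1 (by linarith),
        le' (norm_nonneg _) (h1 r r2 r3).2 (by linarith)⟩
    · exact ⟨le' (norm_nonneg _) (h2 r r2 r3).1 (by linarith),
        le' (norm_nonneg _) (h2 r r2 r3).2 (by linarith)⟩
  · exact fun r r2 r3 => le' (norm_nonneg _) (S.abs_momentum_le r2 r3) (by linarith)
  · rintro σ (rfl | rfl)
    · exact le h5 (by linarith)
    · exact le h6 (by linarith)
  · rintro σ (rfl | rfl)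
    · exact le h7 (by linarith)
    · exact le h8 (by linarith)
  · intro h
    have := k1 h
    rw [Real.norm_eq_abs, Real.norm_of_nonneg (by positivity)] at this
    exact le this (by linarith)
  · intro h
    have := k2 h
    rw [Real.norm_eq_abs, Real.norm_of_nonneg (by positivity)] at this
    exact le this (by linarith)

/-! ### Decomposition along the approximate kernel -/

/-- The part of a vector complementary to the approximate kernel vectors. -/
def rest (σ : ℝ) (S : GaugedState) (v : EnergySpace) : EnergySpace :=
  v - seq v 2 • testTwo σ S - seq v 3 • testThree σ S

theorem seq_testTwo (σ : ℝ) (S : GaugedState) (n : ℕ) : seq (testTwo σ S) n =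
    unitSeq 2 n + (-((1 + σ) * S.A 2)) * unitSeq 0 n + (-(6 * σ * S.A 3)) * unitSeq 1 n +
      (-(6 * S.A 2)) * unitSeq 4 n + (-(2 * S.A 3)) * unitSeq 5 n := by
  simp only [testTwo, seq_add, seq_smul, seq_unitVec, Pi.add_apply, Pi.smul_apply, smul_eq_mul]

theorem seq_testThree (σ : ℝ) (S : GaugedState) (n : ℕ) : seq (testThree σ S) n =
    unitSeq 3 n + (-((1 + σ) * S.A 3)) * unitSeq 0 n + coefOne σ S * unitSeq 1 n +
      (-(2 * S.A 2)) * unitSeq 5 n + (-S.A 3) * unitSeq 6 n := by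
  simp only [testThree, seq_add, seq_smul, seq_unitVec, Pi.add_apply, Pi.smul_apply, smul_eq_mul]

theorem seq_rest (σ : ℝ) (S : GaugedState) (v : EnergySpace) (n : ℕ) : seq (rest σ S v) n =
    seq v n - seq v 2 * seq (testTwo σ S) n - seq v 3 * seq (testThree σ S) n := by
  simp [rest, seq_sub, seq_smul]

theorem rest_two (σ : ℝ) (S : GaugedState) (v : EnergySpace) : seq (rest σ S v) 2 = 0 := by
  rw [seq_rest, seq_testTwo, seq_testThree]; simp [unitSeq]

theorem rest_three (σ : ℝ) (S : GaugedState) (v : EnergySpace) : seq (rest σ S v) 3 = 0 := by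
  rw [seq_rest, seq_testTwo, seq_testThree]; simp [unitSeq]

theorem rest_zero (S : GaugedState) {v : EnergySpace} (h : seq v 0 = 0) :
    seq (rest (-1) S v) 0 = 0 := by
  rw [seq_rest, seq_testTwo, seq_testThree]; simp [unitSeq, h]

theorem eq_add_rest (σ : ℝ) (S : GaugedState) (v : EnergySpace) :
    v = seq v 2 • testTwo σ S + seq v 3 • testThree σ S + rest σ S v := by
  rw [rest]; abel

theorem hessE_decomp (σ : ℝ) (S : GaugedState) (v : EnergySpace) : hessE σ S.vec S.ω v v =
    seq v 2 ^ 2 * matTwo σ S + 2 * seq v 2 * seq v 3 * matMixed σ S + seq v 3 ^ 2 * matThree σ S +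
    2 * seq v 2 * hessE σ S.vec S.ω (testTwo σ S) (rest σ S v) +
    2 * seq v 3 * hessE σ S.vec S.ω (testThree σ S) (rest σ S v) +
    hessE σ S.vec S.ω (rest σ S v) (rest σ S v) := by
  have hs := hessE_symm σ S.vec S.ω
  have e : ∀ (x y : ℝ) (e f r : EnergySpace), hessE σ S.vec S.ω (x • e + y • f + r) (x • e + y • f + r) =
      x ^ 2 * hessE σ S.vec S.ω e e + 2 * x * y * hessE σ S.vec S.ω e f +
      y ^ 2 * hessE σ S.vec S.ω f f + 2 * x * hessE σ S.vec S.ω e r +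
      2 * y * hessE σ S.vec S.ω f r + hessE σ S.vec S.ω r r := by
    intro x y e f r
    have h1 := hs f e
    have h2 := hs r e
    have h3 := hs r f
    simp only [← hessL_apply] at *
    simp only [map_add, map_smul, add_apply, smul_apply, smul_eq_mul, h1, h2, h3]
    ring
  conv_lhs => rw [eq_add_rest σ S v]
  rw [e]
  rfl

theorem momentum_decomp (S : GaugedState) (v : EnergySpace) : S.momentum v =
    seq v 2 * S.momentum (testTwo 1 S) + seq v 3 * S.momentum (testThree 1 S) +
      S.momentum (rest 1 S v) := by
  conv_lhs => rw [eq_add_rest 1 S v]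
  simp only [momentum_add, momentum_smul]

theorem norm_sq_le_decomp (σ : ℝ) (S : GaugedState) (v : EnergySpace) : ‖v‖ ^ 2 ≤
    3 * (‖testTwo σ S‖ ^ 2 + ‖testThree σ S‖ ^ 2 + 1) *
      (seq v 2 ^ 2 + seq v 3 ^ 2 + ‖rest σ S v‖ ^ 2) := by
  have h : ‖v‖ ≤ |seq v 2| * ‖testTwo σ S‖ + |seq v 3| * ‖testThree σ S‖ + ‖rest σ S v‖ := by
    conv_lhs => rw [eq_add_rest σ S v]
    refine (norm_add₃_le).trans ?_
    rw [norm_smul, norm_smul, Real.norm_eq_abs, Real.norm_eq_abs]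
  have e2 := sq_abs (seq v 2)
  have e3 := sq_abs (seq v 3)
  have hn := norm_nonneg v
  generalize |seq v 2| = x at *
  generalize |seq v 3| = y at *
  rw [← e2, ← e3]
  have h2 : ‖v‖ ^ 2 ≤ (x * ‖testTwo σ S‖ + y * ‖testThree σ S‖ + ‖rest σ S v‖) ^ 2 := by gcongr
  generalize ‖testTwo σ S‖ = p at *
  generalize ‖testThree σ S‖ = q at *
  generalize ‖rest σ S v‖ = r at *
  have h3 : (x * p + y * q + r) ^ 2 ≤ 3 * ((x * p) ^ 2 + (y * q) ^ 2 + r ^ 2) := by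
    nlinarith [sq_nonneg (x * p - y * q), sq_nonneg (x * p - r), sq_nonneg (y * q - r)]
  have h4 : 3 * ((x * p) ^ 2 + (y * q) ^ 2 + r ^ 2) ≤ 3 * (p ^ 2 + q ^ 2 + 1) * (x ^ 2 + y ^ 2 + r ^ 2) := by
    nlinarith [mul_nonneg (sq_nonneg p) (sq_nonneg y), mul_nonneg (sq_nonneg p) (sq_nonneg r),
      mul_nonneg (sq_nonneg q) (sq_nonneg x), mul_nonneg (sq_nonneg q) (sq_nonneg r), sq_nonneg x,
      sq_nonneg y]
  exact h2.trans (h3.trans h4)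

theorem coercive_of_decomp {σ α : ℝ} {S : GaugedState} (hα : 0 < α) {P : EnergySpace → Prop}
    (h : ∀ v, P v → α * (seq v 2 ^ 2 + seq v 3 ^ 2 + ‖rest σ S v‖ ^ 2) ≤ hessE σ S.vec S.ω v v) :
    ∃ κ > 0, ∀ v, P v → κ * ‖v‖ ^ 2 ≤ hessE σ S.vec S.ω v v := by
  have hp : 0 < 3 * (‖testTwo σ S‖ ^ 2 + ‖testThree σ S‖ ^ 2 + 1) := by positivity
  refine ⟨α / (3 * (‖testTwo σ S‖ ^ 2 + ‖testThree σ S‖ ^ 2 + 1)), by positivity, fun v hv => ?_⟩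
  refine le_trans ?_ (h v hv)
  rw [div_mul_eq_mul_div, div_le_iff₀ hp, mul_assoc]
  refine mul_le_mul_of_nonneg_left ?_ hα.le
  rw [mul_comm]
  exact norm_sq_le_decomp σ S v

/-- The lower bound for the Hessian in normalized variables. -/
theorem hessE_ge {C : ℝ} {S : GaugedState} (hE : Est C S) {κ a b d θ : ℝ} (κ0 : 0 < κ) (κ1 : κ ≤ 1)
    (h2 : |matTwo 1 S * κ ^ 2 - a * S.s ^ 6| ≤ θ * S.s ^ 6)
    (hm : |matMixed 1 S * κ - b * S.s ^ 6| ≤ θ * S.s ^ 6)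
    (h3 : |matThree 1 S - d * S.s ^ 6| ≤ θ * S.s ^ 6) (v : EnergySpace) {x y R : ℝ}
    (hx : seq v 2 = κ * x) (hy : seq v 3 = y) (hR : ‖rest 1 S v‖ = S.s ^ 3 * R) :
    S.s ^ 6 * (a * x ^ 2 + 2 * b * x * y + d * y ^ 2 - θ * (|x| + |y|) ^ 2 -
      2 * (C * S.s) * (|x| + |y|) * R + R ^ 2 / 150) ≤ hessE 1 S.vec S.ω v v := by
  obtain ⟨r1, r2⟩ := hE.row 1 (Or.inl rfl) _ (rest_two 1 S v) (rest_three 1 S v)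
  have hc := coercive_rest S (rest_two 1 S v) (rest_three 1 S v) (σ := 1) (Or.inl rfl)
  rw [hessE_decomp, hx, hy]
  rw [hR] at r1 r2 hc
  have s0 := S.s_pos
  have R0 : 0 ≤ R := by
    have := norm_nonneg (rest 1 S v)
    rw [hR] at this
    exact (mul_nonneg_iff_of_pos_left (by positivity)).1 this
  generalize hessE 1 S.vec S.ω (rest 1 S v) (rest 1 S v) = qr at *
  generalize hessE 1 S.vec S.ω (testTwo 1 S) (rest 1 S v) = q2 at *
  generalize hessE 1 S.vec S.ω (testThree 1 S) (rest 1 S v) = q3 at *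
  generalize matTwo 1 S = m2 at *
  generalize matThree 1 S = m3 at *
  generalize matMixed 1 S = mm at *
  have x0 := abs_nonneg x
  have y0 := abs_nonneg y
  have C0 := hE.one_le
  have b1 : |x ^ 2 * (m2 * κ ^ 2 - a * S.s ^ 6)| ≤ |x| ^ 2 * (θ * S.s ^ 6) := by
    rw [abs_mul, abs_pow]; gcongr
  have b2 : |x * y * (mm * κ - b * S.s ^ 6)| ≤ |x| * |y| * (θ * S.s ^ 6) := by
    rw [abs_mul, abs_mul]; gcongr
  have b3 : |y ^ 2 * (m3 - d * S.s ^ 6)| ≤ |y| ^ 2 * (θ * S.s ^ 6) := by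
    rw [abs_mul, abs_pow]; gcongr
  have b4 : |κ * x * q2| ≤ |x| * (C * S.s ^ 4 * (S.s ^ 3 * R)) := by
    rw [abs_mul, abs_mul, abs_of_pos κ0, mul_assoc]
    have : |x| * |q2| ≤ |x| * (C * S.s ^ 4 * (S.s ^ 3 * R)) := by gcongr
    exact (mul_le_of_le_one_left (by positivity) κ1).trans this
  have b5 : |y * q3| ≤ |y| * (C * S.s ^ 4 * (S.s ^ 3 * R)) := by
    rw [abs_mul]; gcongr
  have c1 := (abs_le.1 b1).1
  have c2 := (abs_le.1 b2).1
  have c3 := (abs_le.1 b3).1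
  have c4 := (abs_le.1 b4).1
  have c5 := (abs_le.1 b5).1
  ring_nf at *
  linarith

/-- The modes 0 and 2 are those which a combination of A and MA can remove when A₂ ≠ 0. Mode 0 must
be absent for the complement to be coercive. -/
theorem hessE_ge_neg {C : ℝ} {S : GaugedState} (hE : Est C S) {v : EnergySpace} (h0 : seq v 0 = 0)
    (h2 : seq v 2 = 0) : seq v 3 ^ 2 * matThree (-1) S - 2 * (C * S.s ^ 4) * |seq v 3| *
      ‖rest (-1) S v‖ + ‖rest (-1) S v‖ ^ 2 / 150 ≤ hessE (-1) S.vec S.ω v v := by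
  obtain ⟨-, r2⟩ := hE.row (-1) (Or.inr rfl) _ (rest_two (-1) S v) (rest_three (-1) S v)
  have hc := coercive_rest S (rest_two (-1) S v) (rest_three (-1) S v) (σ := -1)
    (Or.inr ⟨rfl, rest_zero S h0⟩)
  rw [hessE_decomp, h2]
  have b5 : |seq v 3 * hessE (-1) S.vec S.ω (testThree (-1) S) (rest (-1) S v)| ≤
      |seq v 3| * (C * S.s ^ 4 * ‖rest (-1) S v‖) := by
    rw [abs_mul]; gcongr
  have c5 := (abs_le.1 b5).1
  linarith

/-- The combined constraint in normalized variables. -/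
theorem constraint_bound {C : ℝ} {S : GaugedState} (hE : Est C S) {κ : ℝ} (v : EnergySpace)
    {x y R : ℝ} (hx : seq v 2 = κ * x) (hy : seq v 3 = y)
    (hR : ‖rest 1 S v‖ = S.s ^ 3 * R) (hκ : 0 ≤ κ) (hv : S.momentum v = 0) :
    |6 * κ * S.A 2 * x + 12 * S.A 3 * y| ≤
      C * S.s ^ 6 * (κ * |x| + S.s * |y| + S.s * R) := by
  have e := momentum_decomp S v
  have h1 := hE.mom _ (rest_two 1 S v) (rest_three 1 S v)
  have h2 := hE.mom_two
  have h3 := hE.mom_three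
  rw [hv, hx, hy] at e
  rw [hR] at h1
  have b1 : |κ * x * (S.momentum (testTwo 1 S) - 6 * S.A 2)| ≤ κ * |x| * (C * S.s ^ 6) := by
    rw [abs_mul, abs_mul, abs_of_nonneg hκ]; gcongr
  have b2 : |y * (S.momentum (testThree 1 S) - 12 * S.A 3)| ≤ |y| * (C * S.s ^ 7) := by
    rw [abs_mul]; gcongr
  rw [abs_le] at *
  constructor <;> ring_nf at * <;> linarith

/-- Triviality of a kernel in normalized variables. -/
theorem kernel_trivial {C : ℝ} {S : GaugedState} (hE : Est C S) {κ a b d θ : ℝ} (κ0 : 0 < κ)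
    (κ1 : κ ≤ 1) (ha : |a| ≤ 1) (hb : |b| ≤ 1) (hd : |d| ≤ 1)
    (h2 : |matTwo 1 S * κ ^ 2 - a * S.s ^ 6| ≤ θ * S.s ^ 6)
    (hm : |matMixed 1 S * κ - b * S.s ^ 6| ≤ θ * S.s ^ 6)
    (h3 : |matThree 1 S - d * S.s ^ 6| ≤ θ * S.s ^ 6)
    (hdet : 4 * (θ + 150 * (C * S.s) ^ 2) < |a * d - b ^ 2|) {v : EnergySpace}
    (hv : ∀ w, hessE 1 S.vec S.ω v w = 0) : v = 0 := by
  obtain ⟨r1, r2⟩ := hE.row 1 (Or.inl rfl) _ (rest_two 1 S v) (rest_three 1 S v)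
  have hc := coercive_rest S (rest_two 1 S v) (rest_three 1 S v) (σ := 1) (Or.inl rfl)
  have s0 := S.s_pos
  have C0 := hE.one_le
  have s1 : S.s ≤ 1 := by linarith [S.s_le]
  have hexp : ∀ w, hessE 1 S.vec S.ω v w = seq v 2 * hessE 1 S.vec S.ω (testTwo 1 S) w +
      seq v 3 * hessE 1 S.vec S.ω (testThree 1 S) w + hessE 1 S.vec S.ω (rest 1 S v) w := by
    intro w
    conv_lhs => rw [eq_add_rest 1 S v]
    rw [hessE_add, hessE_add, hessE_smul, hessE_smul]
  obtain ⟨x, hx⟩ : ∃ x, seq v 2 = κ * x := ⟨seq v 2 / κ, by field_simp⟩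
  obtain ⟨y, hy⟩ : ∃ y, seq v 3 = y := ⟨_, rfl⟩
  have e1 := hexp (rest 1 S v)
  have e2 := hexp (testTwo 1 S)
  have e3 := hexp (testThree 1 S)
  rw [hv, hessE_symm 1 S.vec S.ω (rest 1 S v) (testTwo 1 S),
    hessE_symm 1 S.vec S.ω (testThree 1 S) (testTwo 1 S)] at e2
  rw [hv, hessE_symm 1 S.vec S.ω (rest 1 S v) (testThree 1 S)] at e3
  rw [hv] at e1
  change 0 = seq v 2 * matTwo 1 S + seq v 3 * matMixed 1 S + _ at e2
  change 0 = seq v 2 * matMixed 1 S + seq v 3 * matThree 1 S + _ at e3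
  rw [hx, hy] at e1 e2 e3
  have hR0 := norm_nonneg (rest 1 S v)
  have hvr : v = (κ * x) • testTwo 1 S + y • testThree 1 S + rest 1 S v := by
    conv_lhs => rw [eq_add_rest 1 S v, hx, hy]
  have hrz : ‖rest 1 S v‖ = 0 → rest 1 S v = 0 := norm_eq_zero.1
  generalize hessE 1 S.vec S.ω (rest 1 S v) (rest 1 S v) = qr at *
  generalize hessE 1 S.vec S.ω (testTwo 1 S) (rest 1 S v) = q2 at *
  generalize hessE 1 S.vec S.ω (testThree 1 S) (rest 1 S v) = q3 at *
  generalize matTwo 1 S = m2 at *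
  generalize matThree 1 S = m3 at *
  generalize matMixed 1 S = mm at *
  generalize ‖rest 1 S v‖ = R at *
  have x0 := abs_nonneg x
  have y0 := abs_nonneg y
  have p4 : 0 < S.s ^ 4 := by positivity
  have p6 : 0 < S.s ^ 6 := by positivity
  have f2 : |κ * q2| ≤ C * S.s ^ 4 * R := by
    rw [abs_mul, abs_of_pos κ0]
    exact (mul_le_of_le_one_left (abs_nonneg _) κ1).trans r1
  -- Testing the kernel equation with the complementary part: coercivity makes it smaller than the
  -- critical components by s⁴, so it enters the two critical equations only through an error s⁸ =
  -- s² s⁶.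
  have R1 : R ≤ 150 * (C * S.s ^ 4) * (|x| + |y|) := by
    have t1 : |x * (κ * q2)| ≤ |x| * (C * S.s ^ 4 * R) := by rw [abs_mul]; gcongr
    have t2 : |y * q3| ≤ |y| * (C * S.s ^ 4 * R) := by rw [abs_mul]; gcongr
    have t3 := (abs_le.1 t1).1
    have t4 := (abs_le.1 t2).1
    have t5 : R ^ 2 / 150 ≤ R * (C * S.s ^ 4 * (|x| + |y|)) := by linarith
    rcases hR0.eq_or_lt with h | h
    · rw [← h]; positivity
    · have : R * (R / 150) ≤ R * (C * S.s ^ 4 * (|x| + |y|)) := by linarith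
      have := le_of_mul_le_mul_left this h
      linarith
  have Rs : C * S.s ^ 4 * R ≤ 150 * (C * S.s) ^ 2 * S.s ^ 6 * (|x| + |y|) := by
    have : C * S.s ^ 4 * R ≤ C * S.s ^ 4 * (150 * (C * S.s ^ 4) * (|x| + |y|)) := by gcongr
    linarith
  set T := |x| + |y| with hT
  set φ := θ + 150 * (C * S.s) ^ 2 with hφ
  have g1 : |a * x + b * y| ≤ φ * T := by
    have t1 : |x * (m2 * κ ^ 2 - a * S.s ^ 6)| ≤ |x| * (θ * S.s ^ 6) := by rw [abs_mul]; gcongr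
    have t2 : |y * (mm * κ - b * S.s ^ 6)| ≤ |y| * (θ * S.s ^ 6) := by rw [abs_mul]; gcongr
    have t3 : (a * x + b * y) * S.s ^ 6 = -(x * (m2 * κ ^ 2 - a * S.s ^ 6)) -
        y * (mm * κ - b * S.s ^ 6) - κ * q2 := by linear_combination -κ * e2
    have t4 : |(a * x + b * y) * S.s ^ 6| ≤ φ * T * S.s ^ 6 := by
      rw [t3, hφ, hT]
      rw [abs_le] at *
      constructor <;> linarith
    rw [abs_mul, abs_of_pos p6] at t4
    exact le_of_mul_le_mul_right t4 p6
  have g2 : |b * x + d * y| ≤ φ * T := by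
    have t1 : |x * (mm * κ - b * S.s ^ 6)| ≤ |x| * (θ * S.s ^ 6) := by rw [abs_mul]; gcongr
    have t2 : |y * (m3 - d * S.s ^ 6)| ≤ |y| * (θ * S.s ^ 6) := by rw [abs_mul]; gcongr
    have t3 : (b * x + d * y) * S.s ^ 6 = -(x * (mm * κ - b * S.s ^ 6)) -
        y * (m3 - d * S.s ^ 6) - q3 := by linear_combination -e3
    have t4 : |(b * x + d * y) * S.s ^ 6| ≤ φ * T * S.s ^ 6 := by
      rw [t3, hφ, hT]
      rw [abs_le] at *
      constructor <;> linarith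
    rw [abs_mul, abs_of_pos p6] at t4
    exact le_of_mul_le_mul_right t4 p6
  have k : ∀ p q u w : ℝ, |p| ≤ 1 → |q| ≤ 1 → |u| ≤ φ * T → |w| ≤ φ * T →
      |p * u - q * w| ≤ 2 * (φ * T) := by
    intro p q u w hp hq hu hw
    have h1 : |p * u| ≤ 1 * (φ * T) := by rw [abs_mul]; gcongr
    have h2 : |q * w| ≤ 1 * (φ * T) := by rw [abs_mul]; gcongr
    rw [abs_le] at *
    constructor <;> linarith
  -- Cramer's rule: both components times the determinant are bounded by a small multiple of |x| +
  -- |y|.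
  have kx := k d b _ _ hd hb g1 g2
  have ky := k a b _ _ ha hb g2 g1
  rw [show d * (a * x + b * y) - b * (b * x + d * y) = (a * d - b ^ 2) * x by ring, abs_mul] at kx
  rw [show a * (b * x + d * y) - b * (a * x + b * y) = (a * d - b ^ 2) * y by ring, abs_mul] at ky
  have hT0 : T = 0 := by
    by_contra hne
    have : 0 < T := lt_of_le_of_ne (by positivity) (Ne.symm hne)
    have h1 : |a * d - b ^ 2| * T ≤ 4 * φ * T := by rw [hT] at *; linarith
    have := le_of_mul_le_mul_right h1 this
    linarith
  have hx0 : x = 0 := abs_eq_zero.1 (by linarith)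
  have hy0 : y = 0 := abs_eq_zero.1 (by linarith)
  rw [hT0, mul_zero] at R1
  have hr := hrz (le_antisymm R1 hR0)
  rw [hvr, hr, hx0, hy0]
  simp

end GaugedState

end

end ConformalFlow

/-! ### Normal forms of the reduced matrix on the three branches -/

namespace ConformalFlow

noncomputable section

/-- With u = e x + 2 m y the quadratic part equals -14 u² + (d + 56 m²) y². The constraint says that
u is negligible, and then x is controlled by y because e is bounded below; so the sign of d + 56 m²
decides. -/
theorem core_pos {e m d x y R t : ℝ} (he : |e| = 1 / 40000) (hd : 1 / 10 ^ 12 ≤ d + 56 * m ^ 2)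
    (hm : |m| ≤ 1 / 40000) (hR : 0 ≤ R) (ht : t ≤ 1 / 10 ^ 26)
    (hc : |6 * e * x + 12 * m * y| ≤ t * (|x| + |y| + R)) :
    1 / 10 ^ 14 * (x ^ 2 + y ^ 2 + R ^ 2) ≤ -14 * e ^ 2 * x ^ 2 + 2 * (-28 * e * m) * x * y + d * y ^ 2
      - 3 * t * (|x| + |y|) ^ 2 - 2 * t * (|x| + |y|) * R + R ^ 2 / 150 := by
  have e2 : e ^ 2 = 1 / 40000 ^ 2 := by rw [← sq_abs, he]; norm_num
  have x0 := abs_nonneg x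
  have y0 := abs_nonneg y
  have hx2 := sq_abs x
  have hy2 := sq_abs y
  obtain ⟨N, hN⟩ : ∃ N, N = x ^ 2 + y ^ 2 + R ^ 2 := ⟨_, rfl⟩
  obtain ⟨u, hu⟩ : ∃ u, u = e * x + 2 * m * y := ⟨_, rfl⟩
  obtain ⟨T, hT⟩ : ∃ T, T = |x| + |y| + R := ⟨_, rfl⟩
  rw [← hN]
  rw [← hT] at hc
  have T0 : 0 ≤ T := by rw [hT]; positivity
  have hT2 : T ^ 2 ≤ 3 * N := by
    rw [hT, hN, ← hx2, ← hy2]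
    nlinarith [sq_nonneg (|x| - |y|), sq_nonneg (|x| - R), sq_nonneg (|y| - R)]
  have hN0 : 0 ≤ N := by rw [hN]; positivity
  have hu1 : |u| ≤ 1 / 10 ^ 26 * T := by
    have h1 : 6 * |u| ≤ t * T := by
      rw [show 6 * |u| = |6 * e * x + 12 * m * y| by
        rw [show 6 * e * x + 12 * m * y = 6 * u by rw [hu]; ring, abs_mul]; norm_num]
      exact hc
    have h2 : t * T ≤ 1 / 10 ^ 26 * T := by gcongr
    have := abs_nonneg u
    linarith
  have hu2 : u ^ 2 ≤ 1 / 10 ^ 50 * N := by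
    have h1 : u ^ 2 ≤ (1 / 10 ^ 26 * T) ^ 2 := sq_le_sq' (by linarith [neg_abs_le u]) ((le_abs_self u).trans hu1)
    rw [mul_pow] at h1
    have h2 : (1 / 10 ^ 26 : ℝ) ^ 2 * T ^ 2 ≤ (1 / 10 ^ 26 : ℝ) ^ 2 * (3 * N) := by gcongr
    norm_num at *
    linarith
  have hx : x ^ 2 ≤ 8 * y ^ 2 + 2 * 40000 ^ 2 * u ^ 2 := by
    have h1 : (e * x) ^ 2 ≤ 2 * u ^ 2 + 2 * (2 * m * y) ^ 2 := by
      rw [show e * x = u - 2 * m * y by rw [hu]; ring]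
      nlinarith [sq_nonneg (u + 2 * m * y)]
    rw [mul_pow, e2] at h1
    have h2 : m ^ 2 ≤ 1 / 40000 ^ 2 := by
      rw [← sq_abs]
      calc |m| ^ 2 ≤ (1 / 40000) ^ 2 := by gcongr
        _ = _ := by norm_num
    have h3 : m ^ 2 * y ^ 2 ≤ 1 / 40000 ^ 2 * y ^ 2 := by gcongr
    have h4 : (2 * m * y) ^ 2 = 4 * (m ^ 2 * y ^ 2) := by ring
    rw [h4] at h1
    linarith
  have hmain : -14 * e ^ 2 * x ^ 2 + 2 * (-28 * e * m) * x * y + d * y ^ 2 =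
      -14 * u ^ 2 + (d + 56 * m ^ 2) * y ^ 2 := by rw [hu]; ring
  have hdy : 1 / 10 ^ 12 * y ^ 2 ≤ (d + 56 * m ^ 2) * y ^ 2 := by gcongr
  have h4 : t * (|x| + |y|) ^ 2 ≤ 1 / 10 ^ 26 * (2 * N) := by
    have : (|x| + |y|) ^ 2 ≤ 2 * N := by
      rw [hN, ← hx2, ← hy2]; nlinarith [sq_nonneg (|x| - |y|), sq_nonneg R]
    gcongr
  have h5 : t * ((|x| + |y|) * R) ≤ 1 / 10 ^ 26 * (2 * N) := by
    have : (|x| + |y|) * R ≤ 2 * N := by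
      rw [hN, ← hx2, ← hy2]; nlinarith [sq_nonneg (|x| - R), sq_nonneg (|y| - R)]
    gcongr
  have hy0 := sq_nonneg y
  have hR0 := sq_nonneg R
  have hNy : N ≤ 10 * (y ^ 2 + R ^ 2) := by norm_num at *; linarith
  rw [hmain, show 3 * t * (|x| + |y|) ^ 2 = 3 * (t * (|x| + |y|) ^ 2) by ring,
    show 2 * t * (|x| + |y|) * R = 2 * (t * ((|x| + |y|) * R)) by ring]
  generalize t * (|x| + |y|) ^ 2 = p at *
  generalize t * ((|x| + |y|) * R) = q at *
  generalize (d + 56 * m ^ 2) * y ^ 2 = z at *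
  norm_num at *
  linarith

/-- When only one critical component is left, the constraint forces it to be far smaller than the
complementary part R. Its coefficient a may then have either sign: R² / 150 dominates. -/
theorem core_small {k a w R t : ℝ} (hk : 1 / 10 ^ 5 ≤ |k|) (ha : |a| ≤ 1) (hR : 0 ≤ R)
    (ht : t ≤ 1 / 10 ^ 26) (hc : |k * w| ≤ t * (|w| + R)) :
    1 / 10 ^ 14 * (w ^ 2 + R ^ 2) ≤ a * w ^ 2 - 3 * t * |w| ^ 2 - 2 * t * |w| * R + R ^ 2 / 150 := by
  have w0 := abs_nonneg w
  have hw2 := sq_abs w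
  rw [abs_mul] at hc
  have h1 : 1 / 10 ^ 5 * |w| ≤ 1 / 10 ^ 26 * (|w| + R) := by
    calc _ ≤ |k| * |w| := by gcongr
      _ ≤ t * (|w| + R) := hc
      _ ≤ _ := by gcongr
  have h2 : |w| ≤ 1 / 10 ^ 20 * R := by linarith
  have h3 : w ^ 2 ≤ 1 / 10 ^ 40 * R ^ 2 := by
    rw [← hw2]
    calc |w| ^ 2 ≤ (1 / 10 ^ 20 * R) ^ 2 := by gcongr
      _ = _ := by ring
  have h4 : -w ^ 2 ≤ a * w ^ 2 := by nlinarith [neg_abs_le a, sq_nonneg w]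
  have h5 : t * |w| ^ 2 ≤ 1 / 10 ^ 26 * R ^ 2 := by
    rw [hw2]
    have : w ^ 2 ≤ R ^ 2 := by nlinarith [sq_nonneg R]
    gcongr
  have h6 : t * (|w| * R) ≤ 1 / 10 ^ 26 * (R * R) := by
    have : |w| ≤ R := by linarith
    gcongr
  nlinarith [sq_nonneg R]

namespace GaugedState

variable {C : ℝ} {S : GaugedState}

theorem abs_scaled_le {f c : ℝ} {k : ℕ} (hE : Est C S) (h : |f| ≤ c * (C * S.s ^ (k + 7))) (hc : 0 ≤ c) :
    |f| ≤ c * (C * S.s) * S.s ^ 6 := by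
  have s0 := S.s_pos
  have C0 := hE.one_le
  refine h.trans ?_
  have : S.s ^ (k + 7) ≤ S.s ^ 7 := pow_le_pow_of_le_one s0.le (by linarith [S.s_le]) (by omega)
  calc c * (C * S.s ^ (k + 7)) ≤ c * (C * S.s ^ 7) := by gcongr
    _ = _ := by ring

theorem decomp_lower {κ x y R c : ℝ} (κ0 : 0 < κ) (κ1 : κ ≤ 1) (hc : 0 ≤ c) {v : EnergySpace}
    (hx : seq v 2 = κ * x) (hy : seq v 3 = y) (hR : ‖rest 1 S v‖ = S.s ^ 3 * R) :
    c * S.s ^ 6 * (seq v 2 ^ 2 + seq v 3 ^ 2 + ‖rest 1 S v‖ ^ 2) ≤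
      S.s ^ 6 * (c * (x ^ 2 + y ^ 2 + R ^ 2)) := by
  have s0 := S.s_pos
  rw [hx, hy, hR, mul_pow, mul_pow]
  have h1 : κ ^ 2 ≤ 1 := pow_le_one₀ κ0.le κ1
  have h2 : (S.s ^ 3) ^ 2 ≤ 1 := by
    rw [← pow_mul]; exact pow_le_one₀ s0.le (by linarith [S.s_le])
  have h3 : κ ^ 2 * x ^ 2 ≤ x ^ 2 := mul_le_of_le_one_left (sq_nonneg _) h1
  have h4 : (S.s ^ 3) ^ 2 * R ^ 2 ≤ R ^ 2 := mul_le_of_le_one_left (sq_nonneg _) h2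
  calc c * S.s ^ 6 * (κ ^ 2 * x ^ 2 + y ^ 2 + (S.s ^ 3) ^ 2 * R ^ 2)
      ≤ c * S.s ^ 6 * (x ^ 2 + y ^ 2 + R ^ 2) := by gcongr
    _ = _ := by ring

/-! ### The first branch -/

structure CaseOne (C : ℝ) (S : GaugedState) (m : ℝ) : Prop where
  est : Est C S
  small : C * S.s ≤ 1 / 10 ^ 26
  second : S.A 2 = 0
  third : S.A 3 = m * S.s ^ 3
  abs_m : |m| = 1 / 40000

theorem caseOne_of (hE : Est C S) (hs : C * S.s ≤ 1 / 10 ^ 26) (h2 : S.A 2 = 0) :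
    CaseOne C S (S.A 3 / S.s ^ 3) := by
  have s0 := S.s_pos
  have hx : S.x = 0 := by
    have h : |S.A 2| = rad / 4 * (S.s ^ 2 * S.x) := S.abs_two
    rw [h2, abs_zero] at h
    have : 0 < rad / 4 * S.s ^ 2 := by have : 0 < rad := by norm_num [rad]
                                       positivity
    nlinarith
  have hy : S.y = 1 := S.xy.resolve_left (by rw [hx]; norm_num)
  refine ⟨hE, hs, h2, by field_simp, ?_⟩
  have h : |S.A 3| = rad / 4 * (S.s ^ 3 * S.y) := S.abs_three
  rw [abs_div, h, hy, abs_of_pos (pow_pos s0 3), rad]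
  field_simp
  norm_num

/-- With A₂ = 0 the second bifurcation equation gives 12Ω ≈ A₃², so 6Ω - 14 A₃² ≈ -27/2 A₃² and 12Ω
- 3 A₃² ≈ -2 A₃². -/
theorem CaseOne.matrix {m : ℝ} (h : CaseOne C S m) :
    (∀ σ : ℝ, (σ = 1 ∨ σ = -1) → |matTwo σ S - (-27 / 2 * m ^ 2) * S.s ^ 6| ≤ 3 * (C * S.s) * S.s ^ 6) ∧
    |matThree 1 S - (-2 * m ^ 2) * S.s ^ 6| ≤ 3 * (C * S.s) * S.s ^ 6 ∧
    |matMixed 1 S| ≤ 3 * (C * S.s) * S.s ^ 6 := by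
  have s0 := S.s_pos
  have C0 := h.est.one_le
  have h3 : S.A 3 ≠ 0 := by
    rw [h.third]
    exact mul_ne_zero (fun h0 => by have := h.abs_m; rw [h0] at this; norm_num at this)
      (pow_pos s0 3).ne'
  have r3 := h.est.reduced_three h3
  have e3 : S.A 3 ^ 2 = m ^ 2 * S.s ^ 6 := by rw [h.third]; ring
  have p8 : 0 ≤ C * S.s ^ 8 := by positivity
  refine ⟨fun σ hσ => ?_, ?_, ?_⟩
  · refine abs_scaled_le (k := 1) h.est ?_ (by norm_num)
    have h1 := h.est.two σ hσ
    rw [h.second, e3] at h1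
    rw [h.second, e3] at r3
    rw [abs_le] at *
    norm_num at *
    constructor <;> linarith
  · refine abs_scaled_le (k := 1) h.est ?_ (by norm_num)
    have h1 := h.est.three 1 (Or.inl rfl)
    rw [h.second, e3] at h1
    rw [h.second, e3] at r3
    rw [abs_le] at *
    norm_num at *
    constructor <;> linarith
  · refine abs_scaled_le (k := 0) h.est ?_ (by norm_num)
    have := h.est.mixed
    rw [h.second, zero_mul, mul_zero, add_zero] at this
    have : 0 ≤ C * S.s ^ 7 := by positivity
    norm_num
    linarith

theorem CaseOne.matTwo_neg {m : ℝ} (h : CaseOne C S m) {σ : ℝ} (hσ : σ = 1 ∨ σ = -1) :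
    matTwo σ S < 0 := by
  have h1 := (abs_le.1 (h.matrix.1 σ hσ)).2
  have hm : m ^ 2 = 1 / 40000 ^ 2 := by rw [← sq_abs, h.abs_m]; norm_num
  rw [hm] at h1
  have := h.small
  have p6 : 0 < S.s ^ 6 := pow_pos S.s_pos 6
  nlinarith

theorem CaseOne.kernel {m : ℝ} (h : CaseOne C S m) {v : EnergySpace}
    (hv : ∀ w, hessE 1 S.vec S.ω v w = 0) : v = 0 := by
  obtain ⟨h2, h3, hm⟩ := h.matrix
  have m2 : m ^ 2 = 1 / 40000 ^ 2 := by rw [← sq_abs, h.abs_m]; norm_num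
  refine kernel_trivial h.est (κ := 1) (a := -27 / 2 * m ^ 2) (b := 0) (d := -2 * m ^ 2)
    (θ := 3 * (C * S.s)) one_pos le_rfl ?_ ?_ ?_ ?_ ?_ h3 ?_ hv
  · rw [m2]; norm_num [abs_le]
  · norm_num
  · rw [m2]; norm_num [abs_le]
  · rw [one_pow, mul_one]; exact h2 1 (Or.inl rfl)
  · rw [zero_mul, sub_zero, mul_one]; exact hm
  · rw [m2]
    have := h.small
    have : 0 ≤ C * S.s := mul_nonneg (by linarith [h.est.one_le]) S.s_pos.le
    norm_num [abs_of_pos]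
    nlinarith

/-- The constraint eliminates the negative direction of mode 3. Mode 2 is excluded by hand and is
the one negative direction left. -/
theorem CaseOne.constrained {m : ℝ} (h : CaseOne C S m) : ∃ κ > 0, ∀ v : EnergySpace,
    (S.momentum v = 0 ∧ seq v 2 = 0) → κ * ‖v‖ ^ 2 ≤ hessE 1 S.vec S.ω v v := by
  obtain ⟨h2, h3, hm⟩ := h.matrix
  have m2 : m ^ 2 = 1 / 40000 ^ 2 := by rw [← sq_abs, h.abs_m]; norm_num
  have s0 := S.s_pos
  have C0 := h.est.one_le
  refine coercive_of_decomp (σ := 1) (α := 1 / 10 ^ 14 * S.s ^ 6) (by positivity) fun v hv => ?_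
  obtain ⟨R, hR⟩ : ∃ R, ‖rest 1 S v‖ = S.s ^ 3 * R := ⟨‖rest 1 S v‖ / S.s ^ 3, by field_simp⟩
  have R0 : 0 ≤ R := by
    have := norm_nonneg (rest 1 S v)
    rw [hR] at this
    exact (mul_nonneg_iff_of_pos_left (by positivity)).1 this
  have hx : seq v 2 = 1 * 0 := by rw [hv.2]; ring
  have hge := hessE_ge h.est (κ := 1) (a := -27 / 2 * m ^ 2) (b := 0) (d := -2 * m ^ 2)
    (θ := 3 * (C * S.s)) one_pos le_rfl
    (by rw [one_pow, mul_one]; exact h2 1 (Or.inl rfl))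
    (by rw [zero_mul, sub_zero, mul_one]; exact hm) h3 v hx rfl hR
  refine (decomp_lower one_pos le_rfl (by norm_num) hx rfl hR).trans (le_trans ?_ hge)
  refine mul_le_mul_of_nonneg_left ?_ (by positivity)
  have hcb := constraint_bound h.est v hx rfl hR zero_le_one hv.1
  have hc : |12 * m * seq v 3| ≤ C * S.s * (|seq v 3| + R) := by
    have p3 : 0 < S.s ^ 3 := by positivity
    have h1 : S.s ^ 3 * |12 * m * seq v 3| ≤ S.s ^ 3 * (C * S.s ^ 4 * (|seq v 3| + R)) := by
      rw [h.third, mul_zero, zero_add, abs_zero, mul_zero, zero_add] at hcb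
      rw [← abs_of_pos p3, ← abs_mul, abs_of_pos p3]
      rw [show S.s ^ 3 * (12 * m * seq v 3) = 12 * (m * S.s ^ 3) * seq v 3 by ring]
      refine hcb.trans (le_of_eq (by ring))
    refine (le_of_mul_le_mul_left h1 p3).trans ?_
    have : S.s ^ 4 ≤ S.s := by
      calc S.s ^ 4 ≤ S.s ^ 1 := pow_le_pow_of_le_one s0.le (by linarith [S.s_le]) (by norm_num)
        _ = S.s := pow_one _
    gcongr
  have := core_small (k := 12 * m) (a := -2 * m ^ 2) (w := seq v 3) (R := R) (t := C * S.s)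
    (by rw [abs_mul, h.abs_m]; norm_num) (by rw [m2]; norm_num [abs_le]) R0 h.small hc
  simp only [abs_zero, zero_add]
  linarith

/-! ### Nonzero second mode -/

/-- The normal form of the matrix of `L₊` with a nonzero second mode. -/
structure CaseTwo (C : ℝ) (S : GaugedState) (e m d : ℝ) : Prop where
  est : Est C S
  small : C * S.s ≤ 1 / 10 ^ 26
  second : S.A 2 = e * S.s ^ 2
  third : S.A 3 = m * S.s ^ 3
  abs_e : |e| = 1 / 40000
  abs_m : |m| ≤ 1 / 40000
  abs_d : |d| ≤ 1
  det : 1 / 10 ^ 12 ≤ |d + 56 * m ^ 2|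
  three : |matThree 1 S - d * S.s ^ 6| ≤ 3 * (C * S.s) * S.s ^ 6

theorem CaseTwo.sq_e {e m d : ℝ} (h : CaseTwo C S e m d) : e ^ 2 = 1 / 40000 ^ 2 := by
  rw [← sq_abs, h.abs_e]; norm_num

theorem CaseTwo.second_ne {e m d : ℝ} (h : CaseTwo C S e m d) : S.A 2 ≠ 0 := by
  rw [h.second]
  exact mul_ne_zero (fun h0 => by have := h.abs_e; rw [h0] at this; norm_num at this)
    (pow_pos S.s_pos 2).ne'

/-- Writing the component of mode 2 as s x brings the entries of orders s⁴, s⁵, s⁶ to the common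
order s⁶. The value -14 e² is the derivative 6Ω - 21 A₂² - 14 A₃² after subtracting the vanishing
bracket. -/
theorem CaseTwo.matrix {e m d : ℝ} (h : CaseTwo C S e m d) :
    |matTwo 1 S * S.s ^ 2 - (-14 * e ^ 2) * S.s ^ 6| ≤ 3 * (C * S.s) * S.s ^ 6 ∧
    |matMixed 1 S * S.s - (-28 * e * m) * S.s ^ 6| ≤ 3 * (C * S.s) * S.s ^ 6 := by
  have s0 := S.s_pos
  have C0 := h.est.one_le
  have r2 := h.est.reduced_two h.second_ne
  constructor
  · refine abs_scaled_le (k := 3) h.est ?_ (by norm_num)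
    have h2 := h.est.two 1 (Or.inl rfl)
    have hb : |matTwo 1 S - -14 * S.A 2 ^ 2| ≤ 3 * (C * S.s ^ 8) := by
      have p8 : 0 ≤ C * S.s ^ 8 := by positivity
      rw [abs_le] at *
      constructor <;> linarith
    rw [show matTwo 1 S * S.s ^ 2 - -14 * e ^ 2 * S.s ^ 6 =
      (matTwo 1 S - -14 * S.A 2 ^ 2) * S.s ^ 2 by rw [h.second]; ring, abs_mul,
      abs_of_pos (pow_pos s0 2)]
    calc _ ≤ 3 * (C * S.s ^ 8) * S.s ^ 2 := by gcongr
      _ = _ := by ring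
  · refine abs_scaled_le (k := 1) h.est ?_ (by norm_num)
    rw [show matMixed 1 S * S.s - -28 * e * m * S.s ^ 6 =
      (matMixed 1 S + 28 * (S.A 2 * S.A 3)) * S.s by rw [h.second, h.third]; ring, abs_mul,
      abs_of_pos s0]
    have p8 : 0 ≤ C * S.s ^ 8 := by positivity
    calc _ ≤ (C * S.s ^ 7) * S.s := by gcongr; exact h.est.mixed
      _ ≤ _ := by norm_num; linarith

theorem CaseTwo.kernel {e m d : ℝ} (h : CaseTwo C S e m d) {v : EnergySpace}
    (hv : ∀ w, hessE 1 S.vec S.ω v w = 0) : v = 0 := by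
  obtain ⟨h2, hm⟩ := h.matrix
  have e2 := h.sq_e
  refine kernel_trivial h.est (κ := S.s) (a := -14 * e ^ 2) (b := -28 * e * m) (d := d)
    (θ := 3 * (C * S.s)) S.s_pos (by linarith [S.s_le]) ?_ ?_ h.abs_d h2 hm h.three ?_ hv
  · rw [e2]; norm_num [abs_le]
  · rw [abs_mul, abs_mul, h.abs_e]
    have := h.abs_m
    norm_num
    linarith
  · rw [show -14 * e ^ 2 * d - (-28 * e * m) ^ 2 = -14 * e ^ 2 * (d + 56 * m ^ 2) by ring, abs_mul, e2]
    have := h.small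
    have := h.det
    have : 0 ≤ C * S.s := mul_nonneg (by linarith [h.est.one_le]) S.s_pos.le
    norm_num [abs_of_pos] at *
    nlinarith

theorem CaseTwo.scaled {e m d : ℝ} (h : CaseTwo C S e m d) {v : EnergySpace}
    (hv : S.momentum v = 0) : ∃ x R : ℝ, 0 ≤ R ∧ seq v 2 = S.s * x ∧ ‖rest 1 S v‖ = S.s ^ 3 * R ∧
      |6 * e * x + 12 * m * seq v 3| ≤ C * S.s * (|x| + |seq v 3| + R) ∧
      S.s ^ 6 * (-14 * e ^ 2 * x ^ 2 + 2 * (-28 * e * m) * x * seq v 3 + d * seq v 3 ^ 2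
        - 3 * (C * S.s) * (|x| + |seq v 3|) ^ 2 - 2 * (C * S.s) * (|x| + |seq v 3|) * R + R ^ 2 / 150)
        ≤ hessE 1 S.vec S.ω v v := by
  obtain ⟨h2, hm⟩ := h.matrix
  have s0 := S.s_pos
  have C0 := h.est.one_le
  obtain ⟨R, hR⟩ : ∃ R, ‖rest 1 S v‖ = S.s ^ 3 * R := ⟨‖rest 1 S v‖ / S.s ^ 3, by field_simp⟩
  obtain ⟨x, hx⟩ : ∃ x, seq v 2 = S.s * x := ⟨seq v 2 / S.s, by field_simp⟩
  have R0 : 0 ≤ R := by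
    have := norm_nonneg (rest 1 S v)
    rw [hR] at this
    exact (mul_nonneg_iff_of_pos_left (by positivity)).1 this
  refine ⟨x, R, R0, hx, hR, ?_, hessE_ge h.est s0 (by linarith [S.s_le]) h2 hm h.three v hx rfl hR⟩
  have hcb := constraint_bound h.est v hx rfl hR s0.le hv
  have p3 : 0 < S.s ^ 3 := by positivity
  have h1 : S.s ^ 3 * |6 * e * x + 12 * m * seq v 3| ≤
      S.s ^ 3 * (C * S.s ^ 4 * (|x| + |seq v 3| + R)) := by
    rw [h.second, h.third] at hcb
    rw [← abs_of_pos p3, ← abs_mul, abs_of_pos p3]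
    rw [show S.s ^ 3 * (6 * e * x + 12 * m * seq v 3) =
      6 * S.s * (e * S.s ^ 2) * x + 12 * (m * S.s ^ 3) * seq v 3 by ring]
    exact hcb.trans (le_of_eq (by ring))
  refine (le_of_mul_le_mul_left h1 p3).trans ?_
  have : S.s ^ 4 ≤ S.s := by
    calc S.s ^ 4 ≤ S.s ^ 1 := pow_le_pow_of_le_one s0.le (by linarith [S.s_le]) (by norm_num)
      _ = S.s := pow_one _
  gcongr

theorem CaseTwo.constrained {e m d : ℝ} (h : CaseTwo C S e m d) (hd : 0 < d + 56 * m ^ 2) :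
    ∃ κ > 0, ∀ v : EnergySpace, S.momentum v = 0 → κ * ‖v‖ ^ 2 ≤ hessE 1 S.vec S.ω v v := by
  have s0 := S.s_pos
  have C0 := h.est.one_le
  refine coercive_of_decomp (σ := 1) (α := 1 / 10 ^ 14 * S.s ^ 6) (by positivity) fun v hv => ?_
  obtain ⟨x, R, R0, hx, hR, hc, hge⟩ := h.scaled hv
  refine (decomp_lower s0 (by linarith [S.s_le]) (by norm_num) hx rfl hR).trans (le_trans ?_ hge)
  refine mul_le_mul_of_nonneg_left ?_ (by positivity)
  have hdet := h.det
  rw [abs_of_pos hd] at hdet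
  exact core_pos h.abs_e hdet h.abs_m R0 h.small hc

/-- Without mode 3 the constraint leaves nothing of mode 2 either, so this holds whatever the sign
of d + 56 m²; it provides the hyperplane for counting a single negative eigenvalue. -/
theorem CaseTwo.constrained_third {e m d : ℝ} (h : CaseTwo C S e m d) : ∃ κ > 0, ∀ v : EnergySpace,
    (S.momentum v = 0 ∧ seq v 3 = 0) → κ * ‖v‖ ^ 2 ≤ hessE 1 S.vec S.ω v v := by
  have s0 := S.s_pos
  have C0 := h.est.one_le
  refine coercive_of_decomp (σ := 1) (α := 1 / 10 ^ 14 * S.s ^ 6) (by positivity) fun v hv => ?_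
  obtain ⟨x, R, R0, hx, hR, hc, hge⟩ := h.scaled hv.1
  refine (decomp_lower s0 (by linarith [S.s_le]) (by norm_num) hx rfl hR).trans (le_trans ?_ hge)
  refine mul_le_mul_of_nonneg_left ?_ (by positivity)
  rw [hv.2] at hc ⊢
  simp only [mul_zero, add_zero, abs_zero] at hc ⊢
  have := core_small (k := 6 * e) (a := -14 * e ^ 2) (w := x) (R := R) (t := C * S.s)
    (by rw [abs_mul, h.abs_e]; norm_num) (by rw [h.sq_e]; norm_num [abs_le]) R0 h.small hc
  linarith

/-! ### The form of `L₋` -/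

theorem coercive_neg (hE : Est C S) : ∃ κ > 0, ∀ v : EnergySpace,
    (seq v 0 = 0 ∧ seq v 2 = 0 ∧ seq v 3 = 0) → κ * ‖v‖ ^ 2 ≤ hessE (-1) S.vec S.ω v v := by
  refine coercive_of_decomp (σ := -1) (α := 1 / 150) (by norm_num) fun v ⟨h0, h2, h3⟩ => ?_
  have := hessE_ge_neg hE h0 h2
  rw [h3] at this
  rw [h2, h3]
  simp only [abs_zero] at this
  linarith

theorem coercive_neg_third (hE : Est C S) (hs : C * S.s ≤ 1 / 10 ^ 26)
    (h3 : 1 / 10 ^ 13 * S.s ^ 6 ≤ matThree (-1) S) : ∃ κ > 0, ∀ v : EnergySpace,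
    (seq v 0 = 0 ∧ seq v 2 = 0) → κ * ‖v‖ ^ 2 ≤ hessE (-1) S.vec S.ω v v := by
  have s0 := S.s_pos
  have C0 := hE.one_le
  refine coercive_of_decomp (σ := -1) (α := 1 / 10 ^ 14 * S.s ^ 6) (by positivity)
    fun v ⟨h0, h2⟩ => ?_
  have h := hessE_ge_neg hE h0 h2
  rw [h2]
  have hy2 := sq_abs (seq v 3)
  have y0 := abs_nonneg (seq v 3)
  have R0 := norm_nonneg (rest (-1) S v)
  refine le_trans ?_ h
  rw [← hy2]
  generalize |seq v 3| = y at *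
  generalize ‖rest (-1) S v‖ = R at *
  have p6 : S.s ^ 6 ≤ 1 := pow_le_one₀ s0.le (by linarith [S.s_le])
  have h1 : 1 / 10 ^ 13 * S.s ^ 6 * y ^ 2 ≤ y ^ 2 * matThree (-1) S := by
    rw [mul_comm]; gcongr
  -- Young's inequality spends half of the coercivity R² / 150 on the coupling term.
  have h4 : 2 * (C * S.s ^ 4) * y * R ≤ 300 * (C * S.s) ^ 2 * (S.s ^ 6 * y ^ 2) + R ^ 2 / 300 := by
    have := sq_nonneg (300 * (C * S.s ^ 4) * y - R)
    nlinarith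
  have h5 : (C * S.s) ^ 2 ≤ 1 / 10 ^ 52 := by
    calc (C * S.s) ^ 2 ≤ (1 / 10 ^ 26) ^ 2 := by gcongr
      _ = _ := by norm_num
  have h6 : (C * S.s) ^ 2 * (S.s ^ 6 * y ^ 2) ≤ 1 / 10 ^ 52 * (S.s ^ 6 * y ^ 2) := by gcongr
  have h7 : S.s ^ 6 * R ^ 2 ≤ 1 * R ^ 2 := by gcongr
  have h8 : 0 ≤ S.s ^ 6 * y ^ 2 := by positivity
  have h9 : 0 ≤ R ^ 2 := by positivity
  linarith

/-! ### The second and the third branch -/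

/-- With A₃ = 0 the scale is set by A₂ alone and 12Ω ≈ 14 A₂², so the entry of mode 3 is 108 σ A₂³:
of opposite signs for L₊ and L₋. -/
theorem caseTwo_of (hE : Est C S) (hs : C * S.s ≤ 1 / 10 ^ 26) (h3 : S.A 3 = 0) :
    CaseTwo C S (S.A 2 / S.s ^ 2) 0 (108 * (S.A 2 / S.s ^ 2) ^ 3) ∧
    |matThree (-1) S - -(108 * (S.A 2 / S.s ^ 2) ^ 3) * S.s ^ 6| ≤ 3 * (C * S.s) * S.s ^ 6 := by
  have s0 := S.s_pos
  have C0 := hE.one_le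
  have hy : S.y = 0 := by
    have h : |S.A 3| = rad / 4 * (S.s ^ 3 * S.y) := S.abs_three
    rw [h3, abs_zero] at h
    have : 0 < rad / 4 * S.s ^ 3 := by have : 0 < rad := by norm_num [rad]
                                       positivity
    nlinarith
  have hx : S.x = 1 := S.xy.resolve_right (by rw [hy]; norm_num)
  have ha : |S.A 2 / S.s ^ 2| = 1 / 40000 := by
    have h : |S.A 2| = rad / 4 * (S.s ^ 2 * S.x) := S.abs_two
    rw [abs_div, h, hx, abs_of_pos (pow_pos s0 2), rad]
    field_simp
    norm_num
  have e2 : S.A 2 = S.A 2 / S.s ^ 2 * S.s ^ 2 := by field_simp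
  generalize S.A 2 / S.s ^ 2 = e at *
  have he3 : |e ^ 3| = 1 / 40000 ^ 3 := by rw [abs_pow, ha]; norm_num
  have hne : S.A 2 ≠ 0 := by
    rw [e2]
    exact mul_ne_zero (fun h0 => by rw [h0] at ha; norm_num at ha) (pow_pos s0 2).ne'
  have r2 := hE.reduced_two hne
  have k1 := hE.three 1 (Or.inl rfl)
  have k2 := hE.three (-1) (Or.inr rfl)
  have e6 : S.A 2 ^ 3 = e ^ 3 * S.s ^ 6 := by rw [e2]; ring
  have p8 : 0 ≤ C * S.s ^ 8 := by positivity
  rw [h3, e6] at k1 k2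
  rw [h3] at r2
  refine ⟨⟨hE, hs, e2, by rw [h3]; ring, ha, by norm_num, ?_, ?_, ?_⟩, ?_⟩
  · rw [abs_mul, he3]; norm_num
  · rw [zero_pow two_ne_zero, mul_zero, add_zero, abs_mul, he3]; norm_num
  · refine abs_scaled_le (k := 1) hE ?_ (by norm_num)
    rw [abs_le] at *
    norm_num at *
    constructor <;> linarith
  · refine abs_scaled_le (k := 1) hE ?_ (by norm_num)
    rw [abs_le] at *
    norm_num at *
    constructor <;> linarith

/-- Both brackets vanish, and eliminating Ω gives 27 (A₃² + 4 A₂³) ≈ 0. Hence A₂ < 0, the entry of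
mode 3 is -2 A₃² for L₊ and -216 A₂³ > 0 for L₋, and d + 56 m² = 54 m² > 0. -/
theorem caseThree_of (hE : Est C S) (hs : C * S.s ≤ 1 / 10 ^ 26) (h2 : S.A 2 ≠ 0) (h3 : S.A 3 ≠ 0) :
    ∃ e m : ℝ, CaseTwo C S e m (-2 * m ^ 2) ∧ 0 < m ^ 2 ∧
      1 / 10 ^ 13 * S.s ^ 6 ≤ matThree (-1) S := by
  have s0 := S.s_pos
  have s1 := S.s_le
  have C0 := hE.one_le
  have k1 := hE.three 1 (Or.inl rfl)
  have k2 := hE.three (-1) (Or.inr rfl)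
  have r2 := hE.reduced_two h2
  have r3 := hE.reduced_three h3
  obtain ⟨e, he⟩ : ∃ e, S.A 2 = e * S.s ^ 2 := ⟨S.A 2 / S.s ^ 2, by field_simp⟩
  obtain ⟨m, hm⟩ : ∃ m, S.A 3 = m * S.s ^ 3 := ⟨S.A 3 / S.s ^ 3, by field_simp⟩
  have ae : |e| = 1 / 40000 * S.x := by
    have h : |S.A 2| = rad / 4 * (S.s ^ 2 * S.x) := S.abs_two
    rw [he, abs_mul, abs_of_pos (pow_pos s0 2), rad] at h
    have : S.s ^ 2 * |e| = S.s ^ 2 * (1 / 40000 * S.x) := by linarith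
    exact mul_left_cancel₀ (pow_pos s0 2).ne' this
  have am : |m| = 1 / 40000 * S.y := by
    have h : |S.A 3| = rad / 4 * (S.s ^ 3 * S.y) := S.abs_three
    rw [hm, abs_mul, abs_of_pos (pow_pos s0 3), rad] at h
    have : S.s ^ 3 * |m| = S.s ^ 3 * (1 / 40000 * S.y) := by linarith
    exact mul_left_cancel₀ (pow_pos s0 3).ne' this
  have e6 : S.A 2 ^ 3 = e ^ 3 * S.s ^ 6 := by rw [he]; ring
  have m6 : S.A 3 ^ 2 = m ^ 2 * S.s ^ 6 := by rw [hm]; ring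
  have p6 : 0 < S.s ^ 6 := by positivity
  have p8 : 0 ≤ C * S.s ^ 8 := by positivity
  have hrel : |m ^ 2 + 4 * e ^ 3| ≤ 1 / 10 ^ 26 := by
    have h1 : |27 * (S.A 3 ^ 2 + 4 * S.A 2 ^ 3)| ≤ 3 * (C * S.s ^ 8) := by
      rw [abs_le] at *
      constructor <;> linarith
    have h4 := abs_scaled_le (k := 1) hE h1 (by norm_num)
    rw [e6, m6, show 27 * (m ^ 2 * S.s ^ 6 + 4 * (e ^ 3 * S.s ^ 6)) =
      27 * (m ^ 2 + 4 * e ^ 3) * S.s ^ 6 by ring, abs_mul, abs_mul, abs_of_pos p6] at h4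
    have h5 := le_of_mul_le_mul_right h4 p6
    rw [abs_of_pos (by norm_num : (0 : ℝ) < 27)] at h5
    have := abs_nonneg (m ^ 2 + 4 * e ^ 3)
    linarith
  have x0 := S.x_nonneg
  have x1 := S.x_le
  have y1 := S.y_le
  have y0 := S.y_nonneg
  have he1 : |e| ≤ 1 / 40000 := by rw [ae]; linarith
  have hm1 : |m| ≤ 1 / 40000 := by rw [am]; linarith
  have he3 : |e ^ 3| ≤ 1 / 40000 ^ 3 := by
    rw [abs_pow]
    calc |e| ^ 3 ≤ (1 / 40000) ^ 3 := by gcongr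
      _ = _ := by norm_num
  obtain ⟨l, u⟩ := abs_le.1 hrel
  obtain ⟨l3, u3⟩ := abs_le.1 he3
  -- If y = 1, then m² = 1/40000² is far larger than 4 |e|³ ≤ 4/40000³, against m² ≈ -4 e³; so A₂
  -- sets the scale.
  have hx : S.x = 1 := by
    rcases S.xy with h | h
    · exact h
    · exfalso
      rw [h, mul_one] at am
      have : m ^ 2 = 1 / 40000 ^ 2 := by rw [← sq_abs, am]; norm_num
      rw [this] at u
      norm_num at *
      linarith
  rw [hx, mul_one] at ae
  -- A positive e would make m² + 4 e³ at least 4/40000³.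
  have he' : e = -(1 / 40000) := by
    rcases abs_eq (by norm_num : (0 : ℝ) ≤ 1 / 40000) |>.1 ae with h | h
    · exfalso
      rw [h] at u
      have := sq_nonneg m
      norm_num at u
      linarith
    · exact h
  have hm2 : 3 / 40000 ^ 3 ≤ m ^ 2 := by rw [he'] at l; norm_num at *; linarith
  have hmu : m ^ 2 ≤ 1 / 40000 ^ 2 := by
    rw [← sq_abs]
    calc |m| ^ 2 ≤ (1 / 40000) ^ 2 := by gcongr
      _ = _ := by norm_num
  refine ⟨e, m, ⟨hE, hs, he, hm, ae, hm1, ?_, ?_, ?_⟩, ?_, ?_⟩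
  · rw [abs_le]; norm_num at *; constructor <;> linarith
  · rw [show -2 * m ^ 2 + 56 * m ^ 2 = 54 * m ^ 2 by ring, abs_of_nonneg (by positivity)]
    norm_num at *
    linarith
  · refine abs_scaled_le (k := 1) hE ?_ (by norm_num)
    rw [show -2 * m ^ 2 * S.s ^ 6 = -2 * S.A 3 ^ 2 by rw [m6]; ring]
    change _ ≤ 3 * (C * S.s ^ 8)
    rw [abs_le] at *
    constructor <;> linarith
  · norm_num at hm2; linarith
  · have h1 : |matThree (-1) S - -216 * S.A 2 ^ 3| ≤ 3 * (C * S.s ^ 8) := by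
      rw [abs_le] at *
      constructor <;> linarith
    have h4 := abs_scaled_le (k := 1) hE h1 (by norm_num)
    rw [e6, he'] at h4
    have h5 := (abs_le.1 h4).1
    have : C * S.s * S.s ^ 6 ≤ 1 / 10 ^ 26 * S.s ^ 6 := by gcongr
    norm_num at *
    linarith

end GaugedState

end

end ConformalFlow

namespace ConformalFlow

noncomputable section

/-! ### Weak and strong eigenvectors -/

theorem memlp_two_of_l1 {a : ℕ → ℝ} (h : L1 a) : Memℓp a 2 :=
  ((memlp_one_iff a).2 h).of_exponent_ge (by norm_num)

theorem memlp_two_of_energy {a : ℕ → ℝ} (h : Memℓp (fun n : ℕ => ((n : ℝ) + 1) * a n) 2) :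
    Memℓp a 2 := by
  rw [memlp_two_iff] at *
  refine Summable.of_nonneg_of_le (fun n => sq_nonneg _) (fun n => ?_) h
  rw [mul_pow]
  refine le_mul_of_one_le_left (sq_nonneg _) (one_le_pow₀ ?_)
  linarith [n.cast_nonneg (α := ℝ)]

theorem abs_le_of_memlp_two {a : ℕ → ℝ} (h : Memℓp a 2) : ∃ C, ∀ n, |a n| ≤ C := by
  obtain ⟨C, hC⟩ := (memℓp_infty_iff.1 (h.of_exponent_ge le_top))
  exact ⟨C, fun n => hC ⟨n, rfl⟩⟩

theorem hessE_eq_zero_of_rows {A : EnergySpace} (hA : Summable fun n : ℕ => ((n : ℝ) + 1) * |seq A n|)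
    {s ω : ℝ} {a : EnergySpace} (h : ∀ n, hessE s A ω a (unitVec n) = 0) (b : EnergySpace) :
    hessE s A ω a b = 0 := by
  rw [(hessE_eq_tsum hA s ω a b).2]
  simp [hessian_seq hA, h]

/-- An ℓ² eigenvector is bounded with bounded rows, and so has finite energy by the growth of the
diagonal of L_s. Conversely, testing the weak equation with unit vectors recovers the rows. -/
theorem mem_eigenvectors_iff {A : EnergySpace} (hA : Summable fun n : ℕ => ((n : ℝ) + 1) * |seq A n|)
    {s ω ν : ℝ} (hω : 1 / 7 < ω) (a : ℕ → ℝ) : a ∈ eigenvectors s (seq A) 1 ω ν ↔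
    ∃ b : EnergySpace, seq b = a ∧ ∀ g, hessE s A ω b g = ν * diagE (fun _ => 1) b g := by
  constructor
  · rintro ⟨h2, h⟩
    obtain ⟨C, hC⟩ := abs_le_of_memlp_two h2
    have hE := memlp_energy_of_hessian_bounded s hω hA hC (C' := |ν| * C) (fun n => by
      rw [h, abs_mul]; gcongr; exact hC n)
    refine ⟨ofSeq a hE, seq_ofSeq a hE, fun g => ?_⟩
    rw [(hessE_eq_tsum hA s ω _ g).2, diagE, ← tsum_mul_left]
    refine tsum_congr fun n => ?_
    rw [seq_ofSeq, h]; ring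
  · rintro ⟨b, rfl, h⟩
    refine ⟨?_, fun n => ?_⟩
    · refine memlp_two_of_energy ?_
      simp only [succ_mul_seq]
      exact lp.memℓp b
    · rw [hessian_seq hA, h, diagE_unitVec, one_mul]

/-- The finite-energy sequences orthogonal to `M A` and `M² A`. -/
def constraintSub (A : EnergySpace) : Submodule ℝ EnergySpace :=
  LinearMap.ker (diagL energyWeight_charge A).toLinearMap ⊓
    LinearMap.ker (diagL energyWeight_energy A).toLinearMap

theorem mem_constraintSub {A b : EnergySpace} : b ∈ constraintSub A ↔
    diagE (fun n => (n : ℝ) + 1) A b = 0 ∧ diagE (fun n => ((n : ℝ) + 1) ^ 2) A b = 0 := Iff.rfl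

theorem isClosed_constraintSub (A : EnergySpace) :
    IsClosed (constraintSub A : Set EnergySpace) :=
  (diagL energyWeight_charge A).isClosed_ker.inter (diagL energyWeight_energy A).isClosed_ker

theorem tsum_weighted (A b : EnergySpace) :
    ∑' n, weighted (seq A) n * seq b n = diagE (fun n => (n : ℝ) + 1) A b :=
  tsum_congr fun n => by rw [weighted]; ring

theorem tsum_weighted_weighted (A b : EnergySpace) :
    ∑' n, weighted (weighted (seq A)) n * seq b n = diagE (fun n => ((n : ℝ) + 1) ^ 2) A b :=
  tsum_congr fun n => by rw [weighted, weighted]; ring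

/-- The finite-energy sequences orthogonal to `A` and `B`. -/
def orthSub (A B : EnergySpace) : Submodule ℝ EnergySpace :=
  LinearMap.ker (diagL energyWeight_one A).toLinearMap ⊓
    LinearMap.ker (diagL energyWeight_one B).toLinearMap

theorem mem_orthSub {A B b : EnergySpace} : b ∈ orthSub A B ↔
    diagE (fun _ => 1) A b = 0 ∧ diagE (fun _ => 1) B b = 0 := Iff.rfl

theorem isClosed_orthSub (A B : EnergySpace) : IsClosed (orthSub A B : Set EnergySpace) :=
  (diagL energyWeight_one A).isClosed_ker.inter (diagL energyWeight_one B).isClosed_ker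

theorem sq_seq_le_diagE (a : EnergySpace) (n : ℕ) : seq a n ^ 2 ≤ diagE (fun _ => 1) a a := by
  have h := (diagE_bound energyWeight_one a a).1.le_tsum n fun i _ => by
    rw [one_mul]; exact mul_self_nonneg _
  rw [diagE]; refine le_trans (le_of_eq ?_) h; ring

theorem diagE_one_nonneg (a : EnergySpace) : 0 ≤ diagE (fun _ => 1) a a :=
  (sq_nonneg _).trans (sq_seq_le_diagE a 0)

theorem diagE_one_pos {a : EnergySpace} (h : a ≠ 0) : 0 < diagE (fun _ => 1) a a := by
  refine lt_of_le_of_ne (diagE_one_nonneg a) fun h0 => h (seq_injective ?_)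
  ext n
  have := sq_seq_le_diagE a n
  rw [← h0] at this
  rw [seq_zero]
  exact pow_eq_zero_iff two_ne_zero |>.1 (le_antisymm this (sq_nonneg _))

/-- The projection along the span of `A` and `B` onto their orthogonal complement. -/
theorem exists_deflation {A B : EnergySpace} (hA : A ≠ 0) (hB : ∀ t : ℝ, B ≠ t • A) :
    ∃ P : EnergySpace →L[ℝ] EnergySpace, (∀ a, P a ∈ orthSub A B) ∧ (∀ a ∈ orthSub A B, P a = a) ∧
      P A = 0 ∧ P B = 0 ∧ ∀ a, ∃ t u : ℝ, a = P a + t • A + u • B := by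
  set c := diagL energyWeight_one with hc
  have hs : ∀ a b, c a b = c b a := fun a b => diagE_symm _ _ _
  set α := c A A with hα
  have α0 : 0 < α := diagE_one_pos hA
  set D := B - (c A B / α) • A with hD
  have D0 : D ≠ 0 := fun h => hB _ (sub_eq_zero.1 h)
  set β := c D D with hβ
  have β0 : 0 < β := diagE_one_pos D0
  have hAD : c A D = 0 := by
    rw [hD, map_sub, map_smul, smul_eq_mul, ← hα]; field_simp; ring
  have hDA : c D A = 0 := by rw [hs, hAD]
  have eB : B = D + (c A B / α) • A := by rw [hD]; abel
  set P : EnergySpace →L[ℝ] EnergySpace := ContinuousLinearMap.id ℝ EnergySpace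
    - (α⁻¹ • c A).smulRight A - (β⁻¹ • c D).smulRight D with hP
  have eP : ∀ a, P a = a - (α⁻¹ * c A a) • A - (β⁻¹ * c D a) • D := fun a => rfl
  have hPA : P A = 0 := by
    rw [eP, hDA, ← hα, inv_mul_cancel₀ α0.ne']; simp
  have hPD : P D = 0 := by
    rw [eP, hAD, ← hβ, inv_mul_cancel₀ β0.ne']; simp
  refine ⟨P, fun a => ?_, fun a ha => ?_, hPA, ?_, fun a => ?_⟩
  · have h1 : c A (P a) = 0 := by
      rw [eP]
      simp only [map_sub, map_smul, smul_eq_mul, hAD, ← hα]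
      field_simp; ring
    have h2 : c D (P a) = 0 := by
      rw [eP]
      simp only [map_sub, map_smul, smul_eq_mul, hDA, ← hβ]
      field_simp; ring
    refine ⟨h1, ?_⟩
    change c B (P a) = 0
    rw [eB, map_add, map_smul, add_apply, smul_apply, h1, h2]; simp
  · have h1 : c A a = 0 := ha.1
    have h2 : c B a = 0 := ha.2
    have h3 : c D a = 0 := by rw [hD, map_sub, map_smul, sub_apply, smul_apply, h1, h2]; simp
    rw [eP, h1, h3]; simp
  · rw [eB, map_add, map_smul, hPA, hPD]; simp
  · refine ⟨α⁻¹ * c A a - β⁻¹ * c D a * (c A B / α), β⁻¹ * c D a, ?_⟩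
    rw [eP, hD]
    module

theorem rank_span_pair {a b : ℕ → ℝ} (h : LinearIndependent ℝ ![a, b]) :
    Module.rank ℝ (Submodule.span ℝ {a, b}) = 2 := by
  have := rank_span h
  rw [Matrix.range_cons, Matrix.range_cons, Matrix.range_empty, Set.union_empty] at this
  have e : ({a} ∪ {b} : Set (ℕ → ℝ)) = {a, b} := rfl
  rw [e] at this
  rw [this, ← e]
  have h2 := Cardinal.mk_range_eq _ h.injective
  rw [Matrix.range_cons, Matrix.range_cons, Matrix.range_empty, Set.union_empty] at h2
  rw [h2]
  simp

namespace GaugedState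

variable (S : GaugedState)

theorem abs_A_le_geometric (n : ℕ) : |S.A n| ≤ 2 * (1 / 2) ^ n := by
  refine (S.abs_A_le n).trans ?_
  have h1 : S.s ^ gaugeExp n ≤ (1 / 2) ^ n :=
    (pow_le_pow_of_le_one S.s_pos.le (by linarith [S.s_le]) (le_gaugeExp n)).trans
      (pow_le_pow_left₀ S.s_pos.le S.s_le n)
  have h2 := S.χ_le_one n
  have h3 := S.χ_nonneg n
  have : S.s ^ gaugeExp n * S.χ n ≤ (1 / 2) ^ n * 1 := by gcongr
  linarith

theorem summable_pow_mul (k : ℕ) : Summable fun n : ℕ => ((n : ℝ) + 1) ^ k * |S.A n| := by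
  have h := (summable_nat_add_iff 1).2
    (summable_pow_mul_geometric_of_norm_lt_one k (r := (1 / 2 : ℝ)) (by norm_num))
  refine Summable.of_nonneg_of_le (fun n => by positivity) (fun n => ?_) (h.mul_left 4)
  calc _ ≤ ((n : ℝ) + 1) ^ k * (2 * (1 / 2) ^ n) := by gcongr; exact S.abs_A_le_geometric n
    _ = _ := by push_cast; ring

theorem summable_succ_mul : Summable fun n : ℕ => ((n : ℝ) + 1) * |seq S.vec n| := by
  exact (S.summable_pow_mul 1).congr fun n => by rw [pow_one, A]

theorem memlp_pow_mul (k : ℕ) : Memℓp (fun n : ℕ => ((n : ℝ) + 1) ^ k * S.A n) 2 := by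
  refine memlp_two_of_l1 ?_
  have h := S.summable_pow_mul k
  refine h.congr fun n => ?_
  rw [abs_mul, abs_of_nonneg (by positivity : (0 : ℝ) ≤ ((n : ℝ) + 1) ^ k)]

/-- The element `M A` of the energy space. -/
def mvec : EnergySpace := ofSeq (weighted S.A) (by
  have := S.memlp_pow_mul 2
  refine (congrArg (fun f => Memℓp f 2) (funext fun n => ?_)).mp this
  rw [weighted]; ring)

theorem seq_mvec : seq S.mvec = weighted S.A := seq_ofSeq _ _

theorem ω_gt : 1 / 7 < S.ω := by
  have := (abs_le.1 S.ω_near).1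
  linarith

theorem interaction_A (n : ℕ) : interaction S.A S.A S.A n = ((n : ℝ) + 1) * (1 - n * S.ω) * S.A n :=
  (S.stationary n).symm

theorem quadE_stationary (b : EnergySpace) : quadE b S.vec S.vec S.vec =
    diagE (fun n => ((n : ℝ) + 1) * (1 - n * S.ω)) S.vec b := by
  rw [quadE, (quadForm_eq_tsum_interaction (quadE_summable b S.vec S.vec S.vec)).2, diagE]
  refine tsum_congr fun n => ?_
  have := S.interaction_A n
  rw [A] at this
  rw [this]; ring

/-- The generator of the first phase rotation: for a = A the two interaction terms combine to 2 - 1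
copies of the interaction in the stationary equation. -/
theorem hessE_neg_vec (b : EnergySpace) : hessE (-1) S.vec S.ω S.vec b = 0 := by
  rw [hessE, quadE_stationary]; ring

/-- The generator of the second phase rotation enters here. On a resonant quadruple n + 1 = (k + 1)
+ (m + 1) - (j + 1), so the weights in the three slots add up to the weight n + 1 of the row, and
the stationary equation in that row applies. -/
theorem hessE_neg_mvec (b : EnergySpace) : hessE (-1) S.vec S.ω S.mvec b = 0 := by
  refine hessE_eq_zero_of_rows S.summable_succ_mul (fun i => ?_) b
  have h1 : 2 * quadE (unitVec i) S.vec S.mvec S.vec - quadE (unitVec i) S.mvec S.vec S.vec =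
      ((i : ℝ) + 1) * quadE (unitVec i) S.vec S.vec S.vec := by
    rw [two_mul, ← quadE_swap_right (unitVec i) S.vec S.mvec S.vec]
    nth_rewrite 2 [← quadE_swap_right (unitVec i) S.vec S.vec S.mvec]
    have s1 := quadE_summable (unitVec i) S.vec S.vec S.mvec
    have s2 := quadE_summable (unitVec i) S.vec S.mvec S.vec
    have s3 := quadE_summable (unitVec i) S.mvec S.vec S.vec
    simp only [quadE, quadForm]
    rw [← s1.tsum_add s2, ← (s1.add s2).tsum_sub s3, ← tsum_mul_left]
    refine tsum_congr fun q => ?_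
    simp only [quadTerm, seq_mvec, seq_unitVec, weighted, unitSeq, A]
    split_ifs with h
    · have hq : (q.n : ℝ) + q.j = q.k + q.m := by exact_mod_cast q.res
      rw [← h]
      have e : (q.n : ℝ) + 1 = (q.m + 1) + (q.k + 1) - (q.j + 1) := by linarith
      rw [e]; ring
    · ring
  have h2 := S.quadE_stationary (unitVec i)
  rw [diagE_unitVec] at h2
  rw [hessE, diagE_unitVec, seq_mvec, weighted]
  rw [h2] at h1
  rw [A]
  linarith

theorem vec_ne_zero : S.vec ≠ 0 := fun h => by
  have h1 := S.A_zero_ge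
  rw [A, h, seq_zero] at h1
  norm_num at h1

variable {S}

theorem eq_zero_of_mvec {ℓ : ℕ} (h0 : ℓ ≠ 0) (hℓ : S.A ℓ ≠ 0) {t u : ℝ}
    (h : t • S.A + u • weighted S.A = 0) : t = 0 ∧ u = 0 := by
  have h1 := congrFun h 0
  have h2 := congrFun h ℓ
  have hA : S.A 0 ≠ 0 := by linarith [S.A_zero_ge]
  simp only [Pi.add_apply, Pi.smul_apply, smul_eq_mul, weighted, Pi.zero_apply, Nat.cast_zero] at h1 h2
  have h3 : t + u = 0 := by
    have : (t + u) * S.A 0 = 0 := by linarith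
    exact (mul_eq_zero.1 this).resolve_right hA
  have h4 : u * ℓ = 0 := by
    have : (u * ℓ) * S.A ℓ = 0 := by
      have e : t = -u := by linarith
      rw [e] at h2; linarith
    exact (mul_eq_zero.1 this).resolve_right hℓ
  have hu : u = 0 := (mul_eq_zero.1 h4).resolve_right (by exact_mod_cast h0)
  exact ⟨by linarith, hu⟩

theorem mvec_ne {ℓ : ℕ} (h0 : ℓ ≠ 0) (hℓ : S.A ℓ ≠ 0) (t : ℝ) : S.mvec ≠ t • S.vec := fun h => by
  have h1 := congrArg seq h
  rw [seq_mvec, seq_smul] at h1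
  have := (eq_zero_of_mvec h0 hℓ (t := -t) (u := 1) (by rw [h1, A]; module)).2
  norm_num at this

/-- A finite-energy sequence minus a combination of `A` and `M A` vanishes at `0` and `ℓ`. -/
theorem exists_reduce {ℓ : ℕ} (h0 : ℓ ≠ 0) (hℓ : S.A ℓ ≠ 0) (b : EnergySpace) : ∃ t u : ℝ,
    seq (b - t • S.vec - u • S.mvec) 0 = 0 ∧ seq (b - t • S.vec - u • S.mvec) ℓ = 0 := by
  have hA : S.A 0 ≠ 0 := by linarith [S.A_zero_ge]
  have hl : (ℓ : ℝ) ≠ 0 := by exact_mod_cast h0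
  refine ⟨seq b 0 / S.A 0 - (seq b ℓ / S.A ℓ - seq b 0 / S.A 0) / ℓ,
    (seq b ℓ / S.A ℓ - seq b 0 / S.A 0) / ℓ, ?_, ?_⟩
  · simp only [seq_sub, seq_smul, seq_mvec, weighted, Pi.sub_apply, Pi.smul_apply, smul_eq_mul]
    rw [← A]; field_simp; push_cast; ring
  · simp only [seq_sub, seq_smul, seq_mvec, weighted, Pi.sub_apply, Pi.smul_apply, smul_eq_mul]
    rw [← A]; field_simp; ring

theorem hessE_sub_span {b : EnergySpace} (t u : ℝ) :
    hessE (-1) S.vec S.ω (b - t • S.vec - u • S.mvec) (b - t • S.vec - u • S.mvec) =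
      hessE (-1) S.vec S.ω b b := by
  have h1 : ∀ g, hessL (-1) S.vec S.ω S.vec g = 0 := S.hessE_neg_vec
  have h2 : ∀ g, hessL (-1) S.vec S.ω S.mvec g = 0 := S.hessE_neg_mvec
  have h3 : ∀ g, hessL (-1) S.vec S.ω g S.vec = 0 := fun g => by
    rw [hessL_apply, hessE_symm]; exact h1 g
  have h4 : ∀ g, hessL (-1) S.vec S.ω g S.mvec = 0 := fun g => by
    rw [hessL_apply, hessE_symm]; exact h2 g
  rw [← hessL_apply, ← hessL_apply]
  simp [h1, h2, h3, h4]

/-! ### The operator `L₋` -/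

/-- The finite-energy sequences orthogonal to the kernel of `L₋`. -/
abbrev negSub (S : GaugedState) : Submodule ℝ EnergySpace := orthSub S.vec S.mvec

theorem mem_negSub_of_eigen {ν : ℝ} (hν : ν ≠ 0) {b : EnergySpace}
    (h : ∀ g, hessE (-1) S.vec S.ω b g = ν * diagE (fun _ => 1) b g) : b ∈ S.negSub := by
  have h1 := h S.vec
  have h2 := h S.mvec
  rw [hessE_symm, S.hessE_neg_vec] at h1
  rw [hessE_symm, S.hessE_neg_mvec] at h2
  refine mem_orthSub.2 ⟨?_, ?_⟩
  · rw [diagE_symm]; exact (mul_eq_zero.1 h1.symm).resolve_left hν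
  · rw [diagE_symm]; exact (mul_eq_zero.1 h2.symm).resolve_left hν

/-- For ν ≠ 0 symmetry makes an eigenvector orthogonal to the kernel vectors A and MA. Conversely,
for b orthogonal to them both sides vanish when tested with A and MA, so testing on the complement
suffices. -/
theorem mem_eigenvectors_neg_iff {ℓ : ℕ} (h0 : ℓ ≠ 0) (hℓ : S.A ℓ ≠ 0) {ν : ℝ} (hν : ν ≠ 0)
    (a : ℕ → ℝ) : a ∈ eigenvectors (-1) S.A 1 S.ω ν ↔
    ∃ b ∈ formEigenvectors (hessL (-1) S.vec S.ω) (diagL energyWeight_one) S.negSub ν, seq b = a := by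
  rw [A, mem_eigenvectors_iff S.summable_succ_mul S.ω_gt]
  constructor
  · rintro ⟨b, rfl, h⟩
    exact ⟨b, ⟨mem_negSub_of_eigen hν h, fun g _ => h g⟩, rfl⟩
  · rintro ⟨b, ⟨hb, h⟩, rfl⟩
    refine ⟨b, rfl, fun g => ?_⟩
    obtain ⟨P, hP, -, -, -, hd⟩ := exists_deflation S.vec_ne_zero (S.mvec_ne h0 hℓ)
    obtain ⟨t, u, e⟩ := hd g
    have h1 := h (P g) (hP g)
    have e1 : hessL (-1) S.vec S.ω b S.vec = 0 := by
      rw [hessL_apply, hessE_symm, S.hessE_neg_vec]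
    have e2 : hessL (-1) S.vec S.ω b S.mvec = 0 := by
      rw [hessL_apply, hessE_symm, S.hessE_neg_mvec]
    have e3 : diagL energyWeight_one b S.vec = 0 := by
      rw [diagL_apply, diagE_symm]; exact (mem_orthSub.1 hb).1
    have e4 : diagL energyWeight_one b S.mvec = 0 := by
      rw [diagL_apply, diagE_symm]; exact (mem_orthSub.1 hb).2
    rw [← hessL_apply, ← diagL_apply energyWeight_one, e]
    simp only [map_add, map_smul, e1, e2, e3, e4, h1, smul_zero, add_zero]

theorem eigenvectors_neg_zero {ℓ : ℕ} (h0 : ℓ ≠ 0) (hℓ : S.A ℓ ≠ 0)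
    (hnd : ∀ b ∈ formEigenvectors (hessL (-1) S.vec S.ω) (diagL energyWeight_one) S.negSub 0, b = 0) :
    eigenvectors (-1) S.A 1 S.ω 0 = (Submodule.span ℝ {S.A, weighted S.A} : Set (ℕ → ℝ)) := by
  ext a
  rw [SetLike.mem_coe, Submodule.mem_span_pair, A, mem_eigenvectors_iff S.summable_succ_mul S.ω_gt]
  constructor
  · rintro ⟨b, rfl, h⟩
    obtain ⟨P, hP, -, -, -, hd⟩ := exists_deflation S.vec_ne_zero (S.mvec_ne h0 hℓ)
    obtain ⟨t, u, e⟩ := hd b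
    have hz : P b = 0 := hnd _ ⟨hP b, fun g _ => by
      rw [show P b = b - t • S.vec - u • S.mvec by nth_rewrite 2 [e]; abel]
      have h1 : hessL (-1) S.vec S.ω S.vec g = 0 := S.hessE_neg_vec g
      have h2 : hessL (-1) S.vec S.ω S.mvec g = 0 := S.hessE_neg_mvec g
      have h3 : hessL (-1) S.vec S.ω b g = 0 := (h g).trans (zero_mul _)
      simp [h1, h2, h3]⟩
    rw [hz, zero_add] at e
    refine ⟨t, u, ?_⟩
    rw [e, seq_add, seq_smul, seq_smul, seq_mvec, A]
  · rintro ⟨t, u, rfl⟩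
    refine ⟨t • S.vec + u • S.mvec, by rw [seq_add, seq_smul, seq_smul, seq_mvec, A], fun g => ?_⟩
    rw [hessE_add, hessE_smul, hessE_smul, S.hessE_neg_vec, S.hessE_neg_mvec]; ring

theorem nullity_neg {ℓ : ℕ} (h0 : ℓ ≠ 0) (hℓ : S.A ℓ ≠ 0)
    (hk : eigenvectors (-1) S.A 1 S.ω 0 = (Submodule.span ℝ {S.A, weighted S.A} : Set (ℕ → ℝ))) :
    nullity (-1) S.A 1 S.ω = 2 := by
  rw [nullity, hk, Submodule.span_coe_eq_restrictScalars, Submodule.restrictScalars_self]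
  exact rank_span_pair (LinearIndependent.pair_iff.2 fun t u h => eq_zero_of_mvec h0 hℓ h)

theorem negIndex_neg_eq_zero {ℓ : ℕ} (h0 : ℓ ≠ 0) (hℓ : S.A ℓ ≠ 0)
    (h : PosOn (hessL (-1) S.vec S.ω) S.negSub) : negIndex (-1) S.A 1 S.ω = 0 := by
  refine rank_span_eq_zero fun a ha => ?_
  obtain ⟨ν, hν, ha⟩ := Set.mem_iUnion₂.1 ha
  obtain ⟨b, hb, rfl⟩ := (mem_eigenvectors_neg_iff h0 hℓ (ne_of_lt hν) a).1 ha
  rw [h.eq_zero diagE_one_nonneg (le_of_lt hν) hb, seq_zero]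

theorem negIndex_neg_eq_one {ℓ : ℕ} (h0 : ℓ ≠ 0) (hℓ : S.A ℓ ≠ 0)
    (h : NegOn (hessL (-1) S.vec S.ω) (diagL energyWeight_one) S.negSub) :
    negIndex (-1) S.A 1 S.ω = 1 := by
  have : CompleteSpace S.negSub := (isClosed_orthSub S.vec S.mvec).completeSpace_coe
  obtain ⟨ν, hν, b, hb, hb0⟩ := h.exists_neg_eigen (fun a b => hessE_symm _ _ _ _ _)
    (fun a b => diagE_symm _ _ _)
  refine rank_span_eq_one (b := seq b) (Set.mem_iUnion₂.2 ⟨ν, hν,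
    (mem_eigenvectors_neg_iff h0 hℓ hν.ne _).2 ⟨b, hb, rfl⟩⟩)
    (fun h => hb0 (seq_injective (h.trans seq_zero.symm))) fun a ha => ?_
  obtain ⟨ν', hν', ha⟩ := Set.mem_iUnion₂.1 ha
  obtain ⟨b', hb', rfl⟩ := (mem_eigenvectors_neg_iff h0 hℓ (ne_of_lt hν') a).1 ha
  obtain ⟨t, rfl⟩ := h.dependent (fun a b => hessE_symm _ _ _ _ _)
    (fun a b => diagE_symm _ _ _) hν hν' hb hb' hb0
  exact ⟨t, seq_smul _ _⟩

/-! ### The operator `L₊` -/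

/-- Lagrange multipliers by interpolation: each unit vector becomes an element of the constraint
space after subtracting multiples of the modes 0 and ℓ, and their weights are affine in n up to the
factor (n+1) A_n. -/
theorem exists_multipliers {ℓ : ℕ} (h0 : ℓ ≠ 0) (hℓ : S.A ℓ ≠ 0) {F : EnergySpace →L[ℝ] ℝ}
    (hF : ∀ g ∈ constraintSub S.vec, F g = 0) :
    ∃ t u : ℝ, ∀ n, F (unitVec n) = t * weighted S.A n + u * weighted (weighted S.A) n := by
  have hA : S.A 0 ≠ 0 := by linarith [S.A_zero_ge]
  have hl : (ℓ : ℝ) ≠ 0 := by exact_mod_cast h0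
  have hl1 : (ℓ : ℝ) + 1 ≠ 0 := by positivity
  have key : ∀ n : ℕ, F (unitVec n) = ((n : ℝ) + 1) * S.A n *
      ((1 - n / ℓ) * (F (unitVec 0) / S.A 0) + n / ℓ * (F (unitVec ℓ) / (((ℓ : ℝ) + 1) * S.A ℓ))) := by
    intro n
    set x := ((n : ℝ) + 1) * S.A n * (1 - n / ℓ) / S.A 0 with hx
    set y := ((n : ℝ) + 1) * S.A n * (n / ℓ) / (((ℓ : ℝ) + 1) * S.A ℓ) with hy
    have hx' : x * S.A 0 = ((n : ℝ) + 1) * S.A n * (1 - n / ℓ) := by rw [hx]; field_simp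
    have hy' : y * (((ℓ : ℝ) + 1) * S.A ℓ) = ((n : ℝ) + 1) * S.A n * (n / ℓ) := by rw [hy]; field_simp
    have hm := hF (unitVec n - x • unitVec 0 - y • unitVec ℓ) (by
      have e : ∀ (w : ℕ → ℝ) (C : ℝ) (hw : EnergyWeight w C),
          diagE w S.vec (unitVec n - x • unitVec 0 - y • unitVec ℓ) =
            w n * S.A n - x * (w 0 * S.A 0) - y * (w ℓ * S.A ℓ) := fun w C hw => by
        rw [← diagL_apply hw]
        simp only [map_sub, map_smul, diagL_apply, diagE_unitVec, smul_eq_mul, A]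
      refine mem_constraintSub.2 ⟨?_, ?_⟩
      · rw [e _ _ energyWeight_charge]
        push_cast
        linear_combination -hx' - hy'
      · rw [e _ _ energyWeight_energy]
        push_cast
        have e3 : y * (((ℓ : ℝ) + 1) ^ 2 * S.A ℓ) =
            ((ℓ : ℝ) + 1) * (((n : ℝ) + 1) * S.A n * (n / ℓ)) := by rw [← hy']; ring
        rw [e3, zero_add, one_pow, one_mul, hx']
        field_simp; ring)
    simp only [map_sub, map_smul, smul_eq_mul] at hm
    have : F (unitVec n) = x * F (unitVec 0) + y * F (unitVec ℓ) := by linarith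
    rw [this, hx, hy]
    ring
  set p := F (unitVec 0) / S.A 0
  set r := F (unitVec ℓ) / (((ℓ : ℝ) + 1) * S.A ℓ)
  refine ⟨p - (r - p) / ℓ, (r - p) / ℓ, fun n => ?_⟩
  simp only [key n, weighted]
  field_simp; ring

/-- The equation for P L₊ P says that L₊ a - ν a is a combination of MA and M²A. These decay
geometrically, so L₊ a is in ℓ² if a is; conversely, a and L₊ a being bounded gives a finite energy.
-/
theorem mem_constrainedEigenvectors_iff {ℓ : ℕ} (h0 : ℓ ≠ 0) (hℓ : S.A ℓ ≠ 0) {ν : ℝ} (a : ℕ → ℝ) :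
    a ∈ constrainedEigenvectors S.A 1 S.ω ν ↔
    ∃ b ∈ formEigenvectors (hessL 1 S.vec S.ω) (diagL energyWeight_one) (constraintSub S.vec) ν,
      seq b = a := by
  have hs := S.summable_succ_mul
  constructor
  · rintro ⟨⟨h2, h3, h4⟩, hm, h⟩
    obtain ⟨C, hC⟩ := abs_le_of_memlp_two h2
    obtain ⟨C', hC'⟩ := abs_le_of_memlp_two hm
    obtain ⟨b, rfl⟩ : ∃ b : EnergySpace, seq b = a :=
      ⟨ofSeq a (memlp_energy_of_hessian_bounded 1 S.ω_gt hs hC hC'), seq_ofSeq _ _⟩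
    rw [A] at h3 h4
    rw [tsum_weighted] at h3
    rw [tsum_weighted_weighted] at h4
    refine ⟨b, ⟨mem_constraintSub.2 ⟨h3, h4⟩, fun g hg => ?_⟩, rfl⟩
    obtain ⟨g1, g2⟩ := mem_constraintSub.1 hg
    have h5 := h (seq g) ⟨memlp_two_of_energy (by simp only [succ_mul_seq]; exact lp.memℓp g),
      by rw [A, tsum_weighted, g1], by rw [A, tsum_weighted_weighted, g2]⟩
    obtain ⟨s1, e1⟩ := hessE_eq_tsum hs 1 S.ω b g
    have s2 := (diagE_bound energyWeight_one b g).1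
    rw [hessL_apply, diagL_apply, e1, diagE, ← tsum_mul_left, ← sub_eq_zero,
      ← s1.tsum_sub (s2.mul_left ν), ← h5]
    exact tsum_congr fun n => by rw [A]; ring
  · rintro ⟨b, ⟨hb, h⟩, rfl⟩
    obtain ⟨b1, b2⟩ := mem_constraintSub.1 hb
    have mb : Memℓp (seq b) 2 :=
      memlp_two_of_energy (by simp only [succ_mul_seq]; exact lp.memℓp b)
    obtain ⟨t, u, htu⟩ := exists_multipliers h0 hℓ
      (F := hessL 1 S.vec S.ω b - ν • diagL energyWeight_one b) (fun g hg => by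
        rw [sub_apply, smul_apply, h g hg]; simp)
    have key : ∀ n, hessian 1 S.A 1 S.ω (seq b) n - ν * seq b n =
        t * weighted S.A n + u * weighted (weighted S.A) n := fun n => by
      rw [← htu, sub_apply, smul_apply, hessL_apply, diagL_apply, diagE_unitVec, A, hessian_seq hs]
      simp
    have m1 : Memℓp (weighted S.A) 2 := by
      refine (congrArg (fun f => Memℓp f 2) (funext fun n => ?_)).mp (S.memlp_pow_mul 1)
      rw [weighted]; ring
    have m2 : Memℓp (weighted (weighted S.A)) 2 := by
      refine (congrArg (fun f => Memℓp f 2) (funext fun n => ?_)).mp (S.memlp_pow_mul 2)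
      rw [weighted, weighted]; ring
    refine ⟨⟨mb, by rw [A, tsum_weighted, b1], by rw [A, tsum_weighted_weighted, b2]⟩, ?_, ?_⟩
    · have := (mb.const_smul ν).add ((m1.const_smul t).add (m2.const_smul u))
      refine (congrArg (fun f => Memℓp f 2) (funext fun n => ?_)).mp this
      simp only [Pi.add_apply, Pi.smul_apply, smul_eq_mul]
      linarith [key n]
    · rintro c ⟨c0, c1, c2⟩
      have hsm : ∀ {f : ℕ → ℝ}, Memℓp f 2 → Summable fun n => f n * c n := fun {f} hf => by
        have h1 := (memlp_two_iff f).1 hf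
        have h2 := (memlp_two_iff c).1 c0
        refine Summable.of_norm_bounded (h1.add h2) fun n => ?_
        rw [Real.norm_eq_abs, abs_mul, ← sq_abs (f n), ← sq_abs (c n)]
        nlinarith [sq_nonneg (|f n| - |c n|), abs_nonneg (f n), abs_nonneg (c n)]
      have e : (fun n => (hessian 1 S.A 1 S.ω (seq b) n - ν * seq b n) * c n) = fun n =>
          t * (weighted S.A n * c n) + u * (weighted (weighted S.A) n * c n) :=
        funext fun n => by rw [key]; ring
      rw [e, ((hsm m1).mul_left t).tsum_add ((hsm m2).mul_left u), tsum_mul_left, tsum_mul_left,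
        c1, c2]
      ring

theorem constrainedNegIndex_eq_zero {ℓ : ℕ} (h0 : ℓ ≠ 0) (hℓ : S.A ℓ ≠ 0)
    (h : PosOn (hessL 1 S.vec S.ω) (constraintSub S.vec)) : constrainedNegIndex S.A 1 S.ω = 0 := by
  refine rank_span_eq_zero fun a ha => ?_
  obtain ⟨ν, hν, ha⟩ := Set.mem_iUnion₂.1 ha
  obtain ⟨b, hb, rfl⟩ := (mem_constrainedEigenvectors_iff h0 hℓ a).1 ha
  rw [h.eq_zero diagE_one_nonneg (le_of_lt hν) hb, seq_zero]

theorem constrainedNegIndex_eq_one {ℓ : ℕ} (h0 : ℓ ≠ 0) (hℓ : S.A ℓ ≠ 0)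
    (h : NegOn (hessL 1 S.vec S.ω) (diagL energyWeight_one) (constraintSub S.vec)) :
    constrainedNegIndex S.A 1 S.ω = 1 := by
  have : CompleteSpace (constraintSub S.vec) := (isClosed_constraintSub S.vec).completeSpace_coe
  obtain ⟨ν, hν, b, hb, hb0⟩ := h.exists_neg_eigen (fun a b => hessE_symm _ _ _ _ _)
    (fun a b => diagE_symm _ _ _)
  refine rank_span_eq_one (b := seq b) (Set.mem_iUnion₂.2 ⟨ν, hν,
    (mem_constrainedEigenvectors_iff h0 hℓ _).2 ⟨b, hb, rfl⟩⟩)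
    (fun h => hb0 (seq_injective (h.trans seq_zero.symm))) fun a ha => ?_
  obtain ⟨ν', hν', ha⟩ := Set.mem_iUnion₂.1 ha
  obtain ⟨b', hb', rfl⟩ := (mem_constrainedEigenvectors_iff h0 hℓ a).1 ha
  obtain ⟨t, rfl⟩ := h.dependent (fun a b => hessE_symm _ _ _ _ _)
    (fun a b => diagE_symm _ _ _) hν hν' hb hb' hb0
  exact ⟨t, seq_smul _ _⟩

theorem constrainedNullity_eq_zero {ℓ : ℕ} (h0 : ℓ ≠ 0) (hℓ : S.A ℓ ≠ 0)
    (hnd : ∀ b ∈ formEigenvectors (hessL 1 S.vec S.ω) (diagL energyWeight_one)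
      (constraintSub S.vec) 0, b = 0) : constrainedNullity S.A 1 S.ω = 0 := by
  refine rank_span_eq_zero fun a ha => ?_
  obtain ⟨b, hb, rfl⟩ := (mem_constrainedEigenvectors_iff h0 hℓ a).1 ha
  rw [hnd b hb, seq_zero]

theorem nullity_pos_eq_zero (hk : ∀ v, (∀ w, hessE 1 S.vec S.ω v w = 0) → v = 0) :
    nullity 1 S.A 1 S.ω = 0 := by
  refine rank_span_eq_zero fun a ha => ?_
  obtain ⟨b, rfl, h⟩ := (mem_eigenvectors_iff S.summable_succ_mul S.ω_gt a).1 ha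
  rw [hk b fun w => by rw [h, zero_mul], seq_zero]

theorem degenerateOnlyByPhases {ℓ : ℕ} (h0 : ℓ ≠ 0) (hℓ : S.A ℓ ≠ 0)
    (hk : ∀ v, (∀ w, hessE 1 S.vec S.ω v w = 0) → v = 0)
    (hp : ∀ b ∈ formEigenvectors (hessL 1 S.vec S.ω) (diagL energyWeight_one)
      (constraintSub S.vec) 0, b = 0)
    (hn : ∀ b ∈ formEigenvectors (hessL (-1) S.vec S.ω) (diagL energyWeight_one) S.negSub 0, b = 0) :
    DegenerateOnlyByPhases S.A 1 S.ω :=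
  ⟨nullity_pos_eq_zero hk, constrainedNullity_eq_zero h0 hℓ hp,
    nullity_neg h0 hℓ (eigenvectors_neg_zero h0 hℓ hn), eigenvectors_neg_zero h0 hℓ hn⟩

end GaugedState

end

end ConformalFlow

/-! ### Indices of L₊ and L₋, and directions of increase and decrease -/

namespace ConformalFlow

noncomputable section

/-- The coordinate functional of mode `n`. -/
def coordL (n : ℕ) : EnergySpace →L[ℝ] ℝ := diagL energyWeight_one (unitVec n)

theorem coordL_apply (n : ℕ) (a : EnergySpace) : coordL n a = seq a n := by
  rw [coordL, diagL_apply, diagE_symm, diagE_unitVec, one_mul]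

theorem coordL_sq_le (n : ℕ) (a : EnergySpace) :
    coordL n a ^ 2 ≤ 1 * diagL energyWeight_one a a := by
  rw [coordL_apply, one_mul]; exact sq_seq_le_diagE a n

namespace GaugedState

variable {S : GaugedState}

theorem diagE_of_disjoint (w : ℕ → ℝ) {v : EnergySpace} (h : ∀ n, S.A n * seq v n = 0) :
    diagE w S.vec v = 0 := by
  rw [diagE]
  simp_rw [show ∀ n, seq S.vec n * seq v n = 0 from h]
  simp

theorem momentum_of_mem {v : EnergySpace} (h : v ∈ constraintSub S.vec) : S.momentum v = 0 := by
  obtain ⟨h1, h2⟩ := mem_constraintSub.1 h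
  have s1 := (diagE_bound energyWeight_charge S.vec v).1
  have s2 := (diagE_bound energyWeight_energy S.vec v).1
  have : S.momentum v = diagE (fun n => ((n : ℝ) + 1) ^ 2) S.vec v -
      diagE (fun n => (n : ℝ) + 1) S.vec v := by
    rw [momentum, diagE, diagE, diagE, ← s2.tsum_sub s1]
    exact tsum_congr fun n => by ring
  rw [this, h1, h2, sub_zero]

/-- The form of L₋ does not change when kernel vectors are subtracted, so it may be estimated on any
representative modulo A and MA, for instance one vanishing at 0 and ℓ. The bounded projection P
recovers a and turns the bound into one by the norm of a. -/
theorem negSub_coercive {ℓ : ℕ} (h0 : ℓ ≠ 0) (hℓ : S.A ℓ ≠ 0) {κ : ℝ} (κ0 : 0 < κ)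
    (p : EnergySpace → Prop) (hp : ∀ a ∈ S.negSub, p a → ∃ t u : ℝ,
      κ * ‖a - t • S.vec - u • S.mvec‖ ^ 2 ≤
        hessE (-1) S.vec S.ω (a - t • S.vec - u • S.mvec) (a - t • S.vec - u • S.mvec)) :
    ∃ κ > 0, ∀ a ∈ S.negSub, p a → κ * ‖a‖ ^ 2 ≤ hessE (-1) S.vec S.ω a a := by
  obtain ⟨P, -, hP, hA, hB, -⟩ := exists_deflation S.vec_ne_zero (S.mvec_ne h0 hℓ)
  refine ⟨κ / (‖P‖ ^ 2 + 1), by positivity, fun a ha hpa => ?_⟩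
  obtain ⟨t, u, h⟩ := hp a ha hpa
  rw [hessE_sub_span] at h
  refine le_trans ?_ h
  set z := a - t • S.vec - u • S.mvec with hz
  have e : P z = a := by rw [hz]; simp [hA, hB, hP a ha]
  have h1 : ‖a‖ ≤ ‖P‖ * ‖z‖ := by rw [← e]; exact P.le_opNorm z
  have h2 : ‖a‖ ^ 2 ≤ (‖P‖ ^ 2 + 1) * ‖z‖ ^ 2 := by
    calc ‖a‖ ^ 2 ≤ (‖P‖ * ‖z‖) ^ 2 := by gcongr
      _ ≤ _ := by rw [mul_pow]; nlinarith [sq_nonneg ‖z‖]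
  rw [div_mul_eq_mul_div, div_le_iff₀ (by positivity)]
  nlinarith

theorem posOn_negSub {ℓ : ℕ} (h0 : ℓ ≠ 0) (hℓ : S.A ℓ ≠ 0) (h : ∃ κ > 0, ∀ v : EnergySpace,
    (seq v 0 = 0 ∧ seq v ℓ = 0) → κ * ‖v‖ ^ 2 ≤ hessE (-1) S.vec S.ω v v) :
    PosOn (hessL (-1) S.vec S.ω) S.negSub := by
  obtain ⟨κ, κ0, h⟩ := h
  obtain ⟨κ', h1, h2⟩ := negSub_coercive h0 hℓ κ0 (fun _ => True) fun a _ _ => by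
    obtain ⟨t, u, htu⟩ := exists_reduce h0 hℓ a
    exact ⟨t, u, h _ htu⟩
  exact ⟨κ', h1, fun a ha => h2 a ha trivial⟩

/-- Since A k = 0, subtracting A and MA does not touch the coordinate k; so the condition that it
vanishes survives the passage to a representative without the modes 0 and ℓ. -/
theorem negOn_negSub {ℓ k : ℕ} (h0 : ℓ ≠ 0) (hℓ : S.A ℓ ≠ 0) (hk : S.A k = 0)
    (h : ∃ κ > 0, ∀ v : EnergySpace, (seq v 0 = 0 ∧ seq v ℓ = 0 ∧ seq v k = 0) →
      κ * ‖v‖ ^ 2 ≤ hessE (-1) S.vec S.ω v v) {w : EnergySpace}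
    (hw : hessE (-1) S.vec S.ω w w < 0) :
    NegOn (hessL (-1) S.vec S.ω) (diagL energyWeight_one) S.negSub := by
  obtain ⟨κ, κ0, h⟩ := h
  refine ⟨coordL k, ⟨1, one_pos, coordL_sq_le k⟩, ?_, ?_⟩
  · refine negSub_coercive h0 hℓ κ0 (fun a => coordL k a = 0) fun a _ ha => ?_
    obtain ⟨t, u, h1, h2⟩ := exists_reduce h0 hℓ a
    rw [coordL_apply] at ha
    refine ⟨t, u, h _ ⟨h1, h2, ?_⟩⟩
    rw [seq_sub, seq_sub, seq_smul, seq_smul, seq_mvec]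
    simp only [Pi.sub_apply, Pi.smul_apply, weighted, ha]
    rw [← A, hk]; simp
  · obtain ⟨P, hP, -, -, -, hd⟩ := exists_deflation S.vec_ne_zero (S.mvec_ne h0 hℓ)
    refine ⟨P w, hP w, ?_⟩
    obtain ⟨t, u, e⟩ := hd w
    have e' : P w = w - t • S.vec - u • S.mvec := by nth_rewrite 2 [e]; abel
    rw [e', hessL_apply, hessE_sub_span]
    exact hw

/-- The constrained form of `L₊` has one negative direction. -/
theorem negOn_constraintSub {k : ℕ} (h : ∃ κ > 0, ∀ v : EnergySpace,
    (S.momentum v = 0 ∧ seq v k = 0) → κ * ‖v‖ ^ 2 ≤ hessE 1 S.vec S.ω v v) {w : EnergySpace}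
    (hd : ∀ n, S.A n * seq w n = 0) (hw : hessE 1 S.vec S.ω w w < 0) :
    NegOn (hessL 1 S.vec S.ω) (diagL energyWeight_one) (constraintSub S.vec) := by
  obtain ⟨κ, κ0, h⟩ := h
  refine ⟨coordL k, ⟨1, one_pos, coordL_sq_le k⟩, ⟨κ, κ0, fun a ha hk => ?_⟩, w, ?_, hw⟩
  · rw [coordL_apply] at hk
    exact h a ⟨momentum_of_mem ha, hk⟩
  · exact mem_constraintSub.2 ⟨diagE_of_disjoint _ hd, diagE_of_disjoint _ hd⟩

/-- A direction along which the state can be perturbed with a correction of the modes `0` and `ℓ`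
alone to keep the constraints. -/
structure Free (S : GaugedState) (ℓ : ℕ) (v : EnergySpace) : Prop where
  zero : seq v 0 = 0
  mode : seq v ℓ = 0
  disjoint : ∀ n, S.A n * seq v n = 0

theorem A_eq_zero_of_χ {n : ℕ} (h : S.χ n = 0) : S.A n = 0 := by
  have := S.abs_A_le n
  rw [h, mul_zero, mul_zero] at this
  exact abs_nonpos_iff.1 this

theorem x_eq_zero (h : S.A 2 = 0) : S.x = 0 := by
  have h1 : |S.A 2| = rad / 4 * (S.s ^ 2 * S.x) := S.abs_two
  rw [h, abs_zero] at h1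
  have hr : 0 < rad / 4 := by norm_num [rad]
  have := S.s_pos
  have h2 := (mul_eq_zero.1 h1.symm).resolve_left hr.ne'
  exact (mul_eq_zero.1 h2).resolve_left (by positivity)

theorem y_eq_zero (h : S.A 3 = 0) : S.y = 0 := by
  have h1 : |S.A 3| = rad / 4 * (S.s ^ 3 * S.y) := S.abs_three
  rw [h, abs_zero] at h1
  have hr : 0 < rad / 4 := by norm_num [rad]
  have := S.s_pos
  have h2 := (mul_eq_zero.1 h1.symm).resolve_left hr.ne'
  exact (mul_eq_zero.1 h2).resolve_left (by positivity)

/-- With A₂ = 0 the class factor x is zero, so the gauge bound kills every mode not divisible by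
three. -/
theorem A_of_second {n : ℕ} (h : S.A 2 = 0) (hn : ¬3 ∣ n) : S.A n = 0 :=
  A_eq_zero_of_χ (by rw [χ, classWeight, x_eq_zero h, if_neg hn, zero_mul])

theorem A_of_third {n : ℕ} (h : S.A 3 = 0) (hn : ¬Even n) : S.A n = 0 :=
  A_eq_zero_of_χ (by rw [χ, classWeight, y_eq_zero h, if_neg hn, mul_zero])

theorem free_unitVec {ℓ k : ℕ} (h0 : k ≠ 0) (hk : k ≠ ℓ) (h : S.A k = 0) :
    Free S ℓ (unitVec k) := by
  refine ⟨?_, ?_, fun n => ?_⟩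
  · rw [seq_unitVec, unitSeq, if_neg h0.symm]
  · rw [seq_unitVec, unitSeq, if_neg hk.symm]
  · rw [seq_unitVec, unitSeq]
    split_ifs with hn
    · rw [hn, h, zero_mul]
    · rw [mul_zero]

/-- For A₂ = 0 the vector lives on the modes 1, 2, 5, none divisible by three, hence off the support
of A. Similarly `testThree` lives on 1, 3, 5 when A₃ = 0, off the even modes. -/
theorem free_testTwo (σ : ℝ) (h : S.A 2 = 0) : Free S 3 (testTwo σ S) := by
  have a1 := A_of_second (S := S) (n := 1) h (by norm_num)
  have a5 := A_of_second (S := S) (n := 5) h (by norm_num)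
  refine ⟨?_, ?_, fun n => ?_⟩
  · rw [seq_testTwo, h]; simp [unitSeq]
  · rw [seq_testTwo, h]; simp [unitSeq]
  · rw [seq_testTwo, h]
    simp only [unitSeq]
    split_ifs <;> simp_all

theorem free_testThree (σ : ℝ) (h : S.A 3 = 0) : Free S 2 (testThree σ S) := by
  have a1 := A_of_third (S := S) (n := 1) h (by decide)
  have a5 := A_of_third (S := S) (n := 5) h (by decide)
  refine ⟨?_, ?_, fun n => ?_⟩
  · rw [seq_testThree, h]; simp [unitSeq]
  · rw [seq_testThree, h]; simp [unitSeq]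
  · rw [seq_testThree, h]
    simp only [unitSeq]
    split_ifs <;> simp_all

theorem momentum_of_free {ℓ : ℕ} {v : EnergySpace} (h : Free S ℓ v) : S.momentum v = 0 :=
  diagE_of_disjoint _ h.disjoint

theorem norm_unitVec_pos (k : ℕ) : 0 < ‖unitVec k‖ ^ 2 := by
  have h := abs_seq_le (unitVec k) k
  rw [seq_unitVec, unitSeq, if_pos rfl, abs_one] at h
  positivity

/-! ### Signs of the forms on the branches -/

variable {C : ℝ}

/-- The indices and the degeneracy of a state. -/
structure Indices (S : GaugedState) (np nn : Cardinal) : Prop where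
  pos : constrainedNegIndex S.A 1 S.ω = np
  neg : negIndex (-1) S.A 1 S.ω = nn
  degenerate : DegenerateOnlyByPhases S.A 1 S.ω

/-- Directions of increase and of decrease of `H`, real or imaginary. -/
structure SaddleData (S : GaugedState) (ℓ : ℕ) : Prop where
  ne_zero : ℓ ≠ 0
  mode : S.A ℓ ≠ 0
  up : ∃ v, Free S ℓ v ∧ 0 < hessE 1 S.vec S.ω v v
  down : ∃ v, Free S ℓ v ∧ (hessE 1 S.vec S.ω v v < 0 ∨ hessE (-1) S.vec S.ω v v < 0)

theorem CaseOne.third_ne {m : ℝ} (h : CaseOne C S m) : S.A 3 ≠ 0 := by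
  rw [h.third]
  exact mul_ne_zero (fun h0 => by have := h.abs_m; rw [h0] at this; norm_num at this)
    (pow_pos S.s_pos 3).ne'

theorem CaseOne.indices {m : ℝ} (h : CaseOne C S m) : Indices S 1 1 := by
  have hne : ∀ a b, hessL 1 S.vec S.ω a b = hessL 1 S.vec S.ω b a := fun a b => hessE_symm _ _ _ _ _
  have hne' : ∀ a b, hessL (-1) S.vec S.ω a b = hessL (-1) S.vec S.ω b a :=
    fun a b => hessE_symm _ _ _ _ _
  have hp := negOn_constraintSub h.constrained (free_testTwo 1 h.second).disjoint
    (h.matTwo_neg (Or.inl rfl))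
  obtain ⟨κ, κ0, hκ⟩ := coercive_neg h.est
  have hn := negOn_negSub three_ne_zero h.third_ne h.second
    ⟨κ, κ0, fun v hv => hκ v ⟨hv.1, hv.2.2, hv.2.1⟩⟩ (h.matTwo_neg (σ := -1) (Or.inr rfl))
  exact ⟨constrainedNegIndex_eq_one three_ne_zero h.third_ne hp,
    negIndex_neg_eq_one three_ne_zero h.third_ne hn,
    degenerateOnlyByPhases three_ne_zero h.third_ne (fun v => h.kernel)
      (fun b hb => hp.nondegenerate hne hb) (fun b hb => hn.nondegenerate hne' hb)⟩

theorem CaseOne.saddleData {m : ℝ} (h : CaseOne C S m) : SaddleData S 3 := by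
  -- Mode 4 is noncritical and not divisible by three: a direction of increase disjoint from A.
  refine ⟨three_ne_zero, h.third_ne, ⟨unitVec 4, ?_, ?_⟩, testTwo 1 S, free_testTwo 1 h.second,
    Or.inl (h.matTwo_neg (Or.inl rfl))⟩
  · exact free_unitVec (by norm_num) (by norm_num) (A_of_second h.second (by norm_num))
  · obtain ⟨κ, κ0, hκ⟩ := h.constrained
    have := norm_unitVec_pos 4
    refine lt_of_lt_of_le (by positivity) (hκ (unitVec 4) ⟨momentum_of_free (ℓ := 3)
      (free_unitVec (by norm_num) (by norm_num) (A_of_second h.second (by norm_num))), ?_⟩)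
    rw [seq_unitVec, unitSeq, if_neg (by norm_num)]

/-- The data of a state with positive forms. -/
structure MinimizerData (S : GaugedState) (ℓ : ℕ) : Prop where
  ne_zero : ℓ ≠ 0
  mode : S.A ℓ ≠ 0
  pos : PosOn (hessL 1 S.vec S.ω) (constraintSub S.vec)
  neg : PosOn (hessL (-1) S.vec S.ω) S.negSub

theorem CaseTwo.posOn {e m d : ℝ} (h : CaseTwo C S e m d) (hd : 0 < d + 56 * m ^ 2) :
    PosOn (hessL 1 S.vec S.ω) (constraintSub S.vec) := by
  obtain ⟨κ, κ0, hκ⟩ := h.constrained hd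
  exact ⟨κ, κ0, fun a ha => hκ a (momentum_of_mem ha)⟩

theorem CaseTwo.minimizerData {e m d : ℝ} (h : CaseTwo C S e m d) (hd : 0 < d + 56 * m ^ 2)
    (h3 : 1 / 10 ^ 13 * S.s ^ 6 ≤ matThree (-1) S) : MinimizerData S 2 :=
  ⟨two_ne_zero, h.second_ne, h.posOn hd,
    posOn_negSub two_ne_zero h.second_ne (coercive_neg_third h.est h.small h3)⟩

theorem CaseTwo.indices {e m d : ℝ} (h : CaseTwo C S e m d) (hd : 0 < d + 56 * m ^ 2)
    (h3 : 1 / 10 ^ 13 * S.s ^ 6 ≤ matThree (-1) S) : Indices S 0 0 := by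
  obtain ⟨-, -, hp, hn⟩ := h.minimizerData hd h3
  exact ⟨constrainedNegIndex_eq_zero two_ne_zero h.second_ne hp,
    negIndex_neg_eq_zero two_ne_zero h.second_ne hn,
    degenerateOnlyByPhases two_ne_zero h.second_ne (fun v => h.kernel)
      (fun b hb => hp.eq_zero diagE_one_nonneg le_rfl hb)
      (fun b hb => hn.eq_zero diagE_one_nonneg le_rfl hb)⟩

/-- Mode 5 is noncritical and odd, hence disjoint from the even state A. -/
theorem CaseTwo.up {e m d : ℝ} (h : CaseTwo C S e m d) (h3 : S.A 3 = 0) :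
    ∃ v, Free S 2 v ∧ 0 < hessE 1 S.vec S.ω v v := by
  have hf : Free S 2 (unitVec 5) :=
    free_unitVec (by norm_num) (by norm_num) (A_of_third h3 (by decide))
  obtain ⟨κ, κ0, hκ⟩ := h.constrained_third
  have := norm_unitVec_pos 5
  refine ⟨unitVec 5, hf, lt_of_lt_of_le (by positivity) (hκ (unitVec 5) ⟨momentum_of_free hf, ?_⟩)⟩
  rw [seq_unitVec, unitSeq, if_neg (by norm_num)]

/-- The two signs of the second mode on the second branch. -/
theorem indices_second (hE : Est C S) (hs : C * S.s ≤ 1 / 10 ^ 26) (h3 : S.A 3 = 0) :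
    SaddleData S 2 ∧ (0 < S.A 2 → Indices S 0 1) ∧ (S.A 2 < 0 → Indices S 1 0) := by
  obtain ⟨h, h4⟩ := caseTwo_of hE hs h3
  have s0 := S.s_pos
  have p6 : 0 < S.s ^ 6 := by positivity
  have he := h.second
  have ae := h.abs_e
  have h5 := h.three
  generalize S.A 2 / S.s ^ 2 = e at *
  have hne : ∀ a b, hessL 1 S.vec S.ω a b = hessL 1 S.vec S.ω b a := fun a b => hessE_symm _ _ _ _ _
  have hne' : ∀ a b, hessL (-1) S.vec S.ω a b = hessL (-1) S.vec S.ω b a :=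
    fun a b => hessE_symm _ _ _ _ _
  have hCs : C * S.s * S.s ^ 6 ≤ 1 / 10 ^ 26 * S.s ^ 6 := by gcongr
  obtain ⟨κ, κ0, hκ⟩ := coercive_neg hE
  have hneg := negOn_negSub (w := testThree (-1) S) two_ne_zero h.second_ne h3
    ⟨κ, κ0, fun v hv => hκ v hv⟩
  have hpos := negOn_constraintSub (k := 3) h.constrained_third
    (free_testThree 1 h3).disjoint
  have e_pos : 0 < S.A 2 → e = 1 / 40000 := fun hp => by
    rw [he] at hp
    have : 0 < e := (mul_pos_iff_of_pos_right (by positivity)).1 hp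
    rwa [abs_of_pos this] at ae
  have e_neg : S.A 2 < 0 → e = -(1 / 40000) := fun hp => by
    rw [he] at hp
    have : e < 0 := by
      by_contra h0
      push Not at h0
      have : 0 ≤ e * S.s ^ 2 := by positivity
      linarith
    rw [abs_of_neg this] at ae
    linarith
  have n1 : 0 < S.A 2 → matThree (-1) S < 0 := fun hp => by
    rw [e_pos hp] at h4
    have := (abs_le.1 h4).2
    norm_num at *
    linarith
  have n2 : S.A 2 < 0 → matThree 1 S < 0 := fun hp => by
    rw [e_neg hp] at h5
    have := (abs_le.1 h5).2
    norm_num at *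
    linarith
  refine ⟨⟨two_ne_zero, h.second_ne, h.up h3, ?_⟩, fun hp => ?_, fun hp => ?_⟩
  · rcases lt_or_gt_of_ne h.second_ne with hp | hp
    · exact ⟨testThree 1 S, free_testThree 1 h3, Or.inl (n2 hp)⟩
    · exact ⟨testThree (-1) S, free_testThree (-1) h3, Or.inr (n1 hp)⟩
  · have hp' := h.posOn (by rw [e_pos hp]; norm_num)
    have hn' := hneg (n1 hp)
    exact ⟨constrainedNegIndex_eq_zero two_ne_zero h.second_ne hp',
      negIndex_neg_eq_one two_ne_zero h.second_ne hn',
      degenerateOnlyByPhases two_ne_zero h.second_ne (fun v => h.kernel)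
        (fun b hb => hp'.eq_zero diagE_one_nonneg le_rfl hb)
        (fun b hb => hn'.nondegenerate hne' hb)⟩
  · have hp' := hpos (n2 hp)
    have hn' := posOn_negSub two_ne_zero h.second_ne (coercive_neg_third hE hs (by
      rw [e_neg hp] at h4
      have := (abs_le.1 h4).1
      norm_num at *
      linarith))
    exact ⟨constrainedNegIndex_eq_one two_ne_zero h.second_ne hp',
      negIndex_neg_eq_zero two_ne_zero h.second_ne hn',
      degenerateOnlyByPhases two_ne_zero h.second_ne (fun v => h.kernel)
        (fun b hb => hp'.nondegenerate hne hb)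
        (fun b hb => hn'.eq_zero diagE_one_nonneg le_rfl hb)⟩

end GaugedState

end

end ConformalFlow

namespace ConformalFlow

noncomputable section

/-! ### The functionals on complex sequences -/

/-- The complex sequence with given real and imaginary parts. -/
def cvec (x y : EnergySpace) : ℕ → ℂ := fun n => ⟨seq x n, seq y n⟩

theorem cvec_zero (x : EnergySpace) : cvec x 0 = cplx (seq x) := by
  ext n
  rw [cvec, seq_zero]
  rfl

theorem finiteEnergy_iff (α : ℕ → ℂ) : FiniteEnergy α ↔ ∃ x y, α = cvec x y := by
  have hmem : FiniteEnergy α ↔ Summable fun n : ℕ => ‖((n : ℂ) + 1) * α n‖ ^ 2 := by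
    rw [FiniteEnergy, memℓp_gen_iff (by norm_num)]
    simp
  have hn : ∀ n : ℕ, ‖((n : ℂ) + 1) * α n‖ ^ 2 =
      (((n : ℝ) + 1) * (α n).re) ^ 2 + (((n : ℝ) + 1) * (α n).im) ^ 2 := fun n => by
    rw [show ((n : ℂ) + 1) = (((n : ℝ) + 1 : ℝ) : ℂ) by push_cast; rfl, norm_mul, mul_pow,
      Complex.norm_real, Complex.sq_norm, Complex.normSq_apply, Real.norm_eq_abs, sq_abs]
    ring
  rw [hmem]
  simp only [hn]
  constructor
  · intro h
    have h1 := Summable.of_nonneg_of_le (fun n : ℕ => sq_nonneg (((n : ℝ) + 1) * (α n).re))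
      (fun n : ℕ => le_add_of_nonneg_right (sq_nonneg (((n : ℝ) + 1) * (α n).im))) h
    have h2 := Summable.of_nonneg_of_le (fun n : ℕ => sq_nonneg (((n : ℝ) + 1) * (α n).im))
      (fun n : ℕ => le_add_of_nonneg_left (sq_nonneg (((n : ℝ) + 1) * (α n).re))) h
    refine ⟨ofSeq (fun n : ℕ => (α n).re) ((memlp_energy_iff _).2 h1),
      ofSeq (fun n : ℕ => (α n).im) ((memlp_energy_iff _).2 h2), ?_⟩
    ext n
    rw [cvec, seq_ofSeq, seq_ofSeq]
  · rintro ⟨x, y, rfl⟩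
    have h1 := (memlp_energy_iff (seq x)).1 (by simp only [succ_mul_seq]; exact lp.memℓp x)
    have h2 := (memlp_energy_iff (seq y)).1 (by simp only [succ_mul_seq]; exact lp.memℓp y)
    exact h1.add h2

theorem norm_sq_cvec (x y : EnergySpace) (n : ℕ) : ‖cvec x y n‖ ^ 2 = seq x n * seq x n + seq y n * seq y n := by
  rw [Complex.sq_norm, Complex.normSq_apply, cvec]

theorem tsum_weight_cvec {w : ℕ → ℝ} {C : ℝ} (hw : EnergyWeight w C) (x y : EnergySpace) :
    ∑' n, w n * ‖cvec x y n‖ ^ 2 = diagE w x x + diagE w y y := by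
  rw [diagE, diagE, ← (diagE_bound hw x x).1.tsum_add (diagE_bound hw y y).1]
  exact tsum_congr fun n => by rw [norm_sq_cvec]; ring

theorem charge_cvec (x y : EnergySpace) : charge (cvec x y) =
    diagE (fun n => (n : ℝ) + 1) x x + diagE (fun n => (n : ℝ) + 1) y y :=
  tsum_weight_cvec energyWeight_charge x y

theorem linEnergy_cvec (x y : EnergySpace) : linEnergy (cvec x y) =
    diagE (fun n => ((n : ℝ) + 1) ^ 2) x x + diagE (fun n => ((n : ℝ) + 1) ^ 2) y y :=
  tsum_weight_cvec energyWeight_energy x y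

theorem diagE_energy_self (x : EnergySpace) : diagE (fun n => ((n : ℝ) + 1) ^ 2) x x = ‖x‖ ^ 2 := by
  rw [(norm_sq_eq_energy x).2]
  exact tsum_congr fun n => by ring

theorem energyDist_cvec (x y x' y' : EnergySpace) :
    energyDist (cvec x y) (cvec x' y') = Real.sqrt (‖x - x'‖ ^ 2 + ‖y - y'‖ ^ 2) := by
  rw [energyDist, ← diagE_energy_self, ← diagE_energy_self, ← linEnergy_cvec]
  congr 2
  ext n
  simp only [cvec, seq_sub]
  rfl

/-- Of the sixteen products of real and imaginary parts, the eight with an odd number of imaginary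
factors form the imaginary part; the symmetries of the coupling collapse the other eight. -/
theorem hamiltonian_cvec (x y : EnergySpace) : hamiltonian (cvec x y) =
    quadE x x x x + quadE y y y y - 2 * quadE x x y y + 4 * quadE x y x y := by
  have hs := fun a b c d => quadE_summable a b c d
  have e : ∀ q : Quad, (coupling q.n q.j q.k q.m : ℂ) * conj (cvec x y q.n) * conj (cvec x y q.j) *
      cvec x y q.k * cvec x y q.m =
      ⟨(quadTerm (seq x) (seq x) (seq x) (seq x) q + quadTerm (seq y) (seq y) (seq y) (seq y) q -
          quadTerm (seq x) (seq x) (seq y) (seq y) q - quadTerm (seq y) (seq y) (seq x) (seq x) q) +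
        (quadTerm (seq x) (seq y) (seq x) (seq y) q + quadTerm (seq x) (seq y) (seq y) (seq x) q +
          quadTerm (seq y) (seq x) (seq x) (seq y) q + quadTerm (seq y) (seq x) (seq y) (seq x) q),
       (quadTerm (seq x) (seq x) (seq x) (seq y) q + quadTerm (seq x) (seq x) (seq y) (seq x) q -
          quadTerm (seq x) (seq y) (seq x) (seq x) q - quadTerm (seq y) (seq x) (seq x) (seq x) q) -
        (quadTerm (seq y) (seq y) (seq x) (seq y) q + quadTerm (seq y) (seq y) (seq y) (seq x) q -
          quadTerm (seq x) (seq y) (seq y) (seq y) q - quadTerm (seq y) (seq x) (seq y) (seq y) q)⟩ := by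
    intro q
    apply Complex.ext
    · simp [cvec, quadTerm]; ring
    · simp [cvec, quadTerm]; ring
  have hre := (((hs x x x x).add (hs y y y y)).sub (hs x x y y)).sub (hs y y x x) |>.add
    ((((hs x y x y).add (hs x y y x)).add (hs y x x y)).add (hs y x y x))
  have him := (((hs x x x y).add (hs x x y x)).sub (hs x y x x)).sub (hs y x x x) |>.sub
    ((((hs y y x y).add (hs y y y x)).sub (hs x y y y)).sub (hs y x y y))
  have hsum : Summable fun q : Quad => (coupling q.n q.j q.k q.m : ℂ) * conj (cvec x y q.n) *
      conj (cvec x y q.j) * cvec x y q.k * cvec x y q.m := by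
    simp only [e]
    exact ⟨⟨_, _⟩, (Complex.hasSum_iff _ _).2 ⟨hre.hasSum, him.hasSum⟩⟩
  have h1 := (quad_rows (G := fun n j k m => (coupling n j k m : ℂ) * conj (cvec x y n) *
      conj (cvec x y j) * cvec x y k * cvec x y m) hsum).2.2
  rw [hamiltonian, h1, Complex.re_tsum hsum]
  simp only [e]
  rw [(((hs x x x x).add (hs y y y y)).sub (hs x x y y)).sub (hs y y x x) |>.tsum_add
    ((((hs x y x y).add (hs x y y x)).add (hs y x x y)).add (hs y x y x)),
    (((hs x x x x).add (hs y y y y)).sub (hs x x y y)).tsum_sub (hs y y x x),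
    ((hs x x x x).add (hs y y y y)).tsum_sub (hs x x y y),
    (hs x x x x).tsum_add (hs y y y y),
    (((hs x y x y).add (hs x y y x)).add (hs y x x y)).tsum_add (hs y x y x),
    ((hs x y x y).add (hs x y y x)).tsum_add (hs y x x y),
    (hs x y x y).tsum_add (hs x y y x)]
  change quadE x x x x + quadE y y y y - quadE x x y y - quadE y y x x +
    (quadE x y x y + quadE x y y x + quadE y x x y + quadE y x y x) = _
  rw [quadE_swap_pairs x x y y, quadE_swap_right x y x y, quadE_swap_left x y x y,
    quadE_swap_left x y y x, quadE_swap_right x y x y]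
  ring

/-! ### Expansion at a state -/

theorem quadE_add_self (a u : EnergySpace) : quadE (a + u) (a + u) (a + u) (a + u) =
    quadE a a a a + 4 * quadE u a a a + (2 * quadE u u a a + 4 * quadE u a u a) +
      4 * quadE u u u a + quadE u u u u := by
  have l := quadE_swap_left
  have r := quadE_swap_right
  have p := quadE_swap_pairs
  simp only [quadE_add₁, quadE_add₂, quadE_add₃, quadE_add₄]
  linarith [l a u a a, p u a a a, r u a a a, p a u a a, r a a u a, l a u u a, l a u a u, r u a u a,
    p u u a a, l a u u u, p u a u u, r a u u u, p a u u u, r u u u a, p u u u a, l u a u u]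

theorem quadE_add_pairs (a u v : EnergySpace) : quadE (a + u) (a + u) v v =
    quadE v v a a + 2 * quadE a u v v + quadE u u v v := by
  simp only [quadE_add₁, quadE_add₂]
  rw [quadE_swap_pairs v v a a, quadE_swap_left a u v v]
  ring

theorem quadE_add_cross (a u v : EnergySpace) : quadE (a + u) v (a + u) v =
    quadE v a v a + 2 * quadE a v u v + quadE u v u v := by
  simp only [quadE_add₁, quadE_add₃]
  linarith [quadE_swap_left a v a v, quadE_swap_right v a a v, quadE_swap_pairs a v u v]

/-- The terms of order three and four of `H` at `A`. -/
def higher (a u v : EnergySpace) : ℝ := (4 * quadE u u u a - 4 * quadE a u v v + 8 * quadE a v u v) +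
  (quadE u u u u + quadE v v v v - 2 * quadE u u v v + 4 * quadE u v u v)

theorem abs_higher_le (a u v : EnergySpace) {N : ℝ} (hu : ‖u‖ ≤ N) (hv : ‖v‖ ≤ N) (h1 : N ≤ 1) :
    |higher a u v| ≤ (128 * ‖a‖ + 64) * N ^ 3 := by
  have N0 : 0 ≤ N := (norm_nonneg u).trans hu
  have key : ∀ b c d e : EnergySpace, ∀ B C D F : ℝ, ‖b‖ ≤ B → ‖c‖ ≤ C → ‖d‖ ≤ D → ‖e‖ ≤ F →
      |quadE b c d e| ≤ 8 * (B * C * D * F) := by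
    intro b c d e B C D F h1 h2 h3 h4
    refine (abs_quadE_le b c d e).trans ?_
    have := (norm_nonneg b).trans h1
    have := (norm_nonneg c).trans h2
    have := (norm_nonneg d).trans h3
    gcongr
  have k1 := abs_le.1 (key u u u a _ _ _ _ hu hu hu le_rfl)
  have k2 := abs_le.1 (key a u v v _ _ _ _ le_rfl hu hv hv)
  have k3 := abs_le.1 (key a v u v _ _ _ _ le_rfl hv hu hv)
  have k4 := abs_le.1 (key u u u u _ _ _ _ hu hu hu hu)
  have k5 := abs_le.1 (key v v v v _ _ _ _ hv hv hv hv)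
  have k6 := abs_le.1 (key u u v v _ _ _ _ hu hu hv hv)
  have k7 := abs_le.1 (key u v u v _ _ _ _ hu hv hu hv)
  have e1 : N * N * N * ‖a‖ = ‖a‖ * N ^ 3 := by ring
  have e2 : ‖a‖ * N * N * N = ‖a‖ * N ^ 3 := by ring
  have e3 : N * N * N * N ≤ N ^ 3 := by
    calc N * N * N * N = N ^ 3 * N := by ring
      _ ≤ N ^ 3 * 1 := by gcongr
      _ = _ := mul_one _
  rw [e1] at k1
  rw [e2] at k2 k3
  rw [higher, abs_le]
  constructor <;> nlinarith

theorem higher_smul (a u v : EnergySpace) (t : ℝ) : higher a (t • u) (t • v) =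
    t ^ 3 * (4 * quadE u u u a - 4 * quadE a u v v + 8 * quadE a v u v) +
    t ^ 4 * (quadE u u u u + quadE v v v v - 2 * quadE u u v v + 4 * quadE u v u v) := by
  simp only [higher, quadE_smul₁, quadE_smul₂, quadE_smul₃, quadE_smul₄]; ring

namespace GaugedState

variable (S : GaugedState)

/-- The weight (n+1)(1 - nω) is a combination of those of Q and E. So the stationary equation is
criticality of H with the multipliers 2(1+ω) for Q and -2ω for E. -/
theorem diagE_linear (a b : EnergySpace) : diagE (fun n => ((n : ℝ) + 1) * (1 - n * S.ω)) a b =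
    (1 + S.ω) * diagE (fun n => (n : ℝ) + 1) a b - S.ω * diagE (fun n => ((n : ℝ) + 1) ^ 2) a b := by
  have s1 := (diagE_bound energyWeight_charge a b).1
  have s2 := (diagE_bound energyWeight_energy a b).1
  rw [diagE, diagE, diagE, ← tsum_mul_left, ← tsum_mul_left,
    ← (s1.mul_left _).tsum_sub (s2.mul_left _)]
  exact tsum_congr fun n => by ring

/-- The second-order expansion of `H` at a stationary state. -/
theorem hamiltonian_expand (u v : EnergySpace) : hamiltonian (cvec (S.vec + u) v) =
    hamiltonian (cvec S.vec 0) + 2 * (1 + S.ω) * (charge (cvec (S.vec + u) v) - charge (cvec S.vec 0))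
      - 2 * S.ω * (linEnergy (cvec (S.vec + u) v) - linEnergy (cvec S.vec 0))
      + 2 * hessE 1 S.vec S.ω u u + 2 * hessE (-1) S.vec S.ω v v + higher S.vec u v := by
  have hz : ∀ w : ℕ → ℝ, diagE w 0 0 = 0 := fun w => by simp [diagE, seq_zero]
  have q0 : ∀ a b c, quadE 0 a b c = 0 := fun a b c => by
    rw [show (0 : EnergySpace) = (0 : ℝ) • 0 by simp, quadE_smul₁, zero_mul]
  have q1 : quadE S.vec 0 S.vec 0 = 0 := by rw [quadE_swap_left, q0]
  have q2 : quadE S.vec S.vec 0 0 = 0 := by rw [quadE_swap_pairs, q0]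
  have hd : ∀ {w : ℕ → ℝ} {C : ℝ} (hw : EnergyWeight w C), diagE w (S.vec + u) (S.vec + u) =
      diagE w S.vec S.vec + 2 * diagE w S.vec u + diagE w u u := fun hw => by
    rw [diagE_add hw, diagE_symm _ S.vec (_ + _), diagE_symm _ u (_ + _), diagE_add hw, diagE_add hw,
      diagE_symm _ u S.vec]
    ring
  rw [hamiltonian_cvec, hamiltonian_cvec, quadE_add_self, quadE_add_pairs, quadE_add_cross]
  simp only [charge_cvec, linEnergy_cvec, hd energyWeight_charge, hd energyWeight_energy, hz, q0, q1, q2, hessE, higher,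
    S.quadE_stationary u, S.diagE_linear]
  ring

end GaugedState

end

end ConformalFlow

/-! ### Critical points, and saddle points by curves in the level set -/

namespace ConformalFlow

noncomputable section

open Filter Topology

theorem diagE_perturb {w : ℕ → ℝ} {C : ℝ} (hw : EnergyWeight w C) (a u : EnergySpace) :
    diagE w (a + u) (a + u) = diagE w a a + 2 * diagE w a u + diagE w u u := by
  rw [diagE_add hw, diagE_symm _ a (_ + _), diagE_symm _ u (_ + _), diagE_add hw, diagE_add hw,
    diagE_symm _ u a]
  ring

theorem diagE_zero (w : ℕ → ℝ) (a : EnergySpace) : diagE w a 0 = 0 := by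
  simp [diagE, seq_zero]

theorem norm_modes_le (i j : ℕ) (α β : ℝ) :
    ‖α • unitVec i + β • unitVec j‖ ≤ (‖unitVec i‖ + ‖unitVec j‖) * (|α| + |β|) := by
  refine (norm_add_le _ _).trans ?_
  rw [norm_smul, norm_smul, Real.norm_eq_abs, Real.norm_eq_abs]
  have := abs_nonneg α
  have := abs_nonneg β
  have := norm_nonneg (unitVec i)
  have := norm_nonneg (unitVec j)
  nlinarith

theorem diagE_modes (w : ℕ → ℝ) {C : ℝ} (hw : EnergyWeight w C) (a : EnergySpace) (i j : ℕ) (α β : ℝ) :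
    diagE w a (α • unitVec i + β • unitVec j) = α * (w i * seq a i) + β * (w j * seq a j) := by
  rw [diagE_symm, diagE_add hw, diagE_smul, diagE_smul, diagE_symm _ (unitVec i),
    diagE_symm _ (unitVec j), diagE_unitVec, diagE_unitVec]

namespace GaugedState

variable (S : GaugedState)

theorem hessE_le (s : ℝ) : ∃ B ≥ 0, ∀ a b, |hessE s S.vec S.ω a b| ≤ B * ‖a‖ * ‖b‖ :=
  ⟨_, by positivity, hessE_bound s S.vec S.ω⟩

theorem cplx_A : cplx S.A = cvec S.vec 0 := (cvec_zero S.vec).symm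

/-- Stationary states are critical points. -/
theorem isConstrainedCritical : IsConstrainedCritical (cplx S.A) := by
  intro h hf hQ hE
  obtain ⟨u, v, rfl⟩ := (finiteEnergy_iff h).1 hf
  have e : ∀ t : ℝ, (fun n => cplx S.A n + t * cvec u v n) = cvec (S.vec + t • u) (t • v) := by
    intro t
    ext n
    apply Complex.ext <;> simp [cplx, cvec, seq_add, seq_smul, A]
  simp only [e] at hQ hE ⊢
  simp only [S.hamiltonian_expand]
  have hs : ∀ s : ℝ, ∀ t : ℝ, ∀ a : EnergySpace, hessE s S.vec S.ω (t • a) (t • a) =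
      t ^ 2 * hessE s S.vec S.ω a a := fun s t a => by
    rw [hessE_smul, hessE_symm, hessE_smul]; ring
  simp only [hs, higher_smul]
  have h2 : HasDerivAt (fun t : ℝ => t ^ 2) 0 0 := by simpa using hasDerivAt_pow 2 (0 : ℝ)
  have h3 : HasDerivAt (fun t : ℝ => t ^ 3) 0 0 := by simpa using hasDerivAt_pow 3 (0 : ℝ)
  have h4 : HasDerivAt (fun t : ℝ => t ^ 4) 0 0 := by simpa using hasDerivAt_pow 4 (0 : ℝ)
  have := ((((((hQ.sub_const (charge (cvec S.vec 0))).const_mul (2 * (1 + S.ω))).const_add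
    (hamiltonian (cvec S.vec 0))).sub ((hE.sub_const (linEnergy (cvec S.vec 0))).const_mul
    (2 * S.ω))).add ((h2.mul_const (hessE 1 S.vec S.ω u u)).const_mul 2)).add
    ((h2.mul_const (hessE (-1) S.vec S.ω v v)).const_mul 2)).add
    ((h3.mul_const (4 * quadE u u u S.vec - 4 * quadE S.vec u v v + 8 * quadE S.vec v u v)).add
      (h4.mul_const (quadE u u u u + quadE v v v v - 2 * quadE u u v v + 4 * quadE u v u v)))
  exact this.congr_deriv (by simp)

theorem hessE_perturb (s : ℝ) (a b : EnergySpace) : hessE s S.vec S.ω (a + b) (a + b) =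
    hessE s S.vec S.ω a a + 2 * hessE s S.vec S.ω a b + hessE s S.vec S.ω b b := by
  rw [hessE_add, hessE_symm _ _ _ a (a + b), hessE_symm _ _ _ b (a + b), hessE_add, hessE_add,
    hessE_symm _ _ _ b a]
  ring

variable {S}

/-- The two constraints are controlled by the modes `0` and `ℓ`. -/
theorem exists_modes {ℓ : ℕ} (h0 : ℓ ≠ 0) (hℓ : S.A ℓ ≠ 0) : ∃ C > 0, ∀ q e : ℝ, ∃ α β : ℝ,
    α * S.A 0 + β * (((ℓ : ℝ) + 1) * S.A ℓ) = q ∧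
    α * S.A 0 + β * (((ℓ : ℝ) + 1) ^ 2 * S.A ℓ) = e ∧ |α| + |β| ≤ C * (|q| + |e|) := by
  have hA : S.A 0 ≠ 0 := by linarith [S.A_zero_ge]
  have hl : (ℓ : ℝ) ≠ 0 := by exact_mod_cast h0
  have hl1 : (ℓ : ℝ) + 1 ≠ 0 := by positivity
  refine ⟨2 * |1 / S.A 0| + |1 / (ℓ * S.A 0)| + |1 / (ℓ * (((ℓ : ℝ) + 1) * S.A ℓ))|, by positivity,
    fun q e => ⟨q * (1 / S.A 0) - (e - q) * (1 / (ℓ * S.A 0)),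
      (e - q) * (1 / (ℓ * (((ℓ : ℝ) + 1) * S.A ℓ))), ?_, ?_, ?_⟩⟩
  · field_simp; ring
  · field_simp; ring
  · have h1 := abs_sub (q * (1 / S.A 0)) ((e - q) * (1 / (ℓ * S.A 0)))
    rw [abs_mul, abs_mul] at h1
    rw [abs_mul (e - q) (1 / (ℓ * (((ℓ : ℝ) + 1) * S.A ℓ)))]
    have h2 := abs_sub e q
    have k1 := mul_le_mul_of_nonneg_right h2 (abs_nonneg (1 / (ℓ * S.A 0)))
    have k2 := mul_le_mul_of_nonneg_right h2 (abs_nonneg (1 / (ℓ * (((ℓ : ℝ) + 1) * S.A ℓ))))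
    have k3 : |q| * |1 / S.A 0| ≤ (|q| + |e|) * (2 * |1 / S.A 0|) := by
      have := abs_nonneg q
      have := abs_nonneg e
      have := abs_nonneg (1 / S.A 0)
      nlinarith
    linarith

theorem abs_sqrt_sub_one_le {x : ℝ} (hx : -1 ≤ x) : |Real.sqrt (1 + x) - 1| ≤ |x| := by
  have h0 := Real.sqrt_nonneg (1 + x)
  have h : (Real.sqrt (1 + x) - 1) * (Real.sqrt (1 + x) + 1) = x := by
    have := Real.mul_self_sqrt (by linarith : 0 ≤ 1 + x)
    linarith
  calc |Real.sqrt (1 + x) - 1| ≤ |Real.sqrt (1 + x) - 1| * |Real.sqrt (1 + x) + 1| :=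
        le_mul_of_one_le_right (abs_nonneg _) (by rw [abs_of_pos (by linarith)]; linarith)
    _ = |x| := by rw [← abs_mul, h]

/-- The correction of the modes `0` and `ℓ` which restores the constraints along a free direction. -/
theorem Free.exists_correction {ℓ : ℕ} (h0 : ℓ ≠ 0) (hℓ : S.A ℓ ≠ 0) {v : EnergySpace}
    (hv : Free S ℓ v) : ∃ C > 0, ∃ t₀ > 0, ∀ t : ℝ, 0 < t → t < t₀ → ∃ w : EnergySpace,
      ‖w‖ ≤ C * t ^ 2 ∧
      diagE (fun n => (n : ℝ) + 1) (S.vec + w) (S.vec + w) + t ^ 2 * diagE (fun n => (n : ℝ) + 1) v v =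
        diagE (fun n => (n : ℝ) + 1) S.vec S.vec ∧
      diagE (fun n => ((n : ℝ) + 1) ^ 2) (S.vec + w) (S.vec + w) +
        t ^ 2 * diagE (fun n => ((n : ℝ) + 1) ^ 2) v v =
        diagE (fun n => ((n : ℝ) + 1) ^ 2) S.vec S.vec ∧
      diagE (fun n => (n : ℝ) + 1) (S.vec + w) v = 0 ∧
      diagE (fun n => ((n : ℝ) + 1) ^ 2) (S.vec + w) v = 0 := by
  have hA : S.A 0 ≠ 0 := by linarith [S.A_zero_ge]
  obtain ⟨_, _, hsol⟩ := exists_modes h0 hℓ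
  obtain ⟨α, β, e1, e2, -⟩ := hsol (-diagE (fun n => (n : ℝ) + 1) v v)
    (-diagE (fun n => ((n : ℝ) + 1) ^ 2) v v)
  set p := α / S.A 0 with hp
  set r := β / S.A ℓ with hr
  have hα : α = p * S.A 0 := by rw [hp]; field_simp
  have hβ : β = r * S.A ℓ := by rw [hr]; field_simp
  refine ⟨(‖unitVec 0‖ + ‖unitVec ℓ‖) * (|S.A 0| * |p| + |S.A ℓ| * |r|) + 1, by positivity,
    1 / (1 + |p| + |r|), by positivity, fun t t0 t1 => ?_⟩
  have t2 : t ^ 2 * (1 + |p| + |r|) ≤ 1 := by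
    have h1 : t * (1 + |p| + |r|) < 1 := by
      rw [lt_div_iff₀ (by positivity)] at t1; exact t1
    have h2 : t < 1 := by nlinarith [abs_nonneg p, abs_nonneg r]
    have : 0 < t * (1 + |p| + |r|) := by positivity
    nlinarith
  have hpt : -1 ≤ p * t ^ 2 := by nlinarith [neg_abs_le p, abs_nonneg r, sq_nonneg t]
  have hrt : -1 ≤ r * t ^ 2 := by nlinarith [neg_abs_le r, abs_nonneg p, sq_nonneg t]
  -- Scaling A₀ and A_ℓ by square roots makes their squares affine in t². Both constraints then hold
  -- exactly once the linear 2 × 2 system for α and β is solved.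
  set a := S.A 0 * (Real.sqrt (1 + p * t ^ 2) - 1) with ha
  set b := S.A ℓ * (Real.sqrt (1 + r * t ^ 2) - 1) with hb
  have h2a : 2 * a * S.A 0 + a ^ 2 = t ^ 2 * (α * S.A 0) := by
    have := Real.sq_sqrt (by linarith : 0 ≤ 1 + p * t ^ 2)
    rw [ha, hα]; linear_combination S.A 0 ^ 2 * this
  have h2b : 2 * b * S.A ℓ + b ^ 2 = t ^ 2 * (β * S.A ℓ) := by
    have := Real.sq_sqrt (by linarith : 0 ≤ 1 + r * t ^ 2)
    rw [hb, hβ]; linear_combination S.A ℓ ^ 2 * this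
  have key : ∀ (w : ℕ → ℝ) (C : ℝ) (hw : EnergyWeight w C),
      diagE w (S.vec + (a • unitVec 0 + b • unitVec ℓ)) (S.vec + (a • unitVec 0 + b • unitVec ℓ)) =
        diagE w S.vec S.vec + t ^ 2 * (α * (w 0 * S.A 0) + β * (w ℓ * S.A ℓ)) := by
    intro w C hw
    have h1 : seq (a • unitVec 0 + b • unitVec ℓ) 0 = a := by
      simp [seq_add, seq_smul, seq_unitVec, unitSeq, h0.symm]
    have h2 : seq (a • unitVec 0 + b • unitVec ℓ) ℓ = b := by
      simp [seq_add, seq_smul, seq_unitVec, unitSeq, h0]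
    rw [diagE_perturb hw, diagE_modes w hw, diagE_modes w hw, h1, h2, ← A]
    linear_combination w 0 * h2a + w ℓ * h2b
  have hdis : ∀ (w : ℕ → ℝ) (C : ℝ) (hw : EnergyWeight w C),
      diagE w (S.vec + (a • unitVec 0 + b • unitVec ℓ)) v = 0 := by
    intro w C hw
    rw [diagE_add hw, diagE_of_disjoint w hv.disjoint, diagE_symm, diagE_modes w hw, hv.zero, hv.mode]
    ring
  refine ⟨a • unitVec 0 + b • unitVec ℓ, ?_, ?_, ?_, hdis _ _ energyWeight_charge,
    hdis _ _ energyWeight_energy⟩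
  · have h1 : |a| ≤ |S.A 0| * |p| * t ^ 2 := by
      rw [ha, abs_mul]
      have := abs_sqrt_sub_one_le hpt
      rw [abs_mul p, abs_of_nonneg (sq_nonneg t)] at this
      calc _ ≤ |S.A 0| * (|p| * t ^ 2) := by gcongr
        _ = _ := by ring
    have h2 : |b| ≤ |S.A ℓ| * |r| * t ^ 2 := by
      rw [hb, abs_mul]
      have := abs_sqrt_sub_one_le hrt
      rw [abs_mul r, abs_of_nonneg (sq_nonneg t)] at this
      calc _ ≤ |S.A ℓ| * (|r| * t ^ 2) := by gcongr
        _ = _ := by ring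
    refine (norm_modes_le 0 ℓ a b).trans ?_
    have := norm_nonneg (unitVec 0)
    have := norm_nonneg (unitVec ℓ)
    calc _ ≤ (‖unitVec 0‖ + ‖unitVec ℓ‖) * (|S.A 0| * |p| * t ^ 2 + |S.A ℓ| * |r| * t ^ 2) := by gcongr
      _ ≤ _ := by nlinarith [sq_nonneg t]
  · rw [key _ _ energyWeight_charge]
    have : t ^ 2 * (α * S.A 0 + β * (((ℓ : ℝ) + 1) * S.A ℓ)) =
      t ^ 2 * -diagE (fun n => (n : ℝ) + 1) v v := by rw [e1]
    push_cast
    linarith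
  · rw [key _ _ energyWeight_energy]
    have : t ^ 2 * (α * S.A 0 + β * (((ℓ : ℝ) + 1) ^ 2 * S.A ℓ)) =
      t ^ 2 * -diagE (fun n => ((n : ℝ) + 1) ^ 2) v v := by rw [e2]
    push_cast
    linarith

theorem levelSet_cvec {x y : EnergySpace}
    (hQ : diagE (fun n => (n : ℝ) + 1) x x + diagE (fun n => (n : ℝ) + 1) y y =
      diagE (fun n => (n : ℝ) + 1) S.vec S.vec)
    (hE : diagE (fun n => ((n : ℝ) + 1) ^ 2) x x + diagE (fun n => ((n : ℝ) + 1) ^ 2) y y =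
      diagE (fun n => ((n : ℝ) + 1) ^ 2) S.vec S.vec) :
    cvec x y ∈ levelSet (cplx S.A) := by
  refine ⟨(finiteEnergy_iff _).2 ⟨x, y, rfl⟩, ?_, ?_⟩
  · rw [cplx_A, charge_cvec, charge_cvec, hQ, diagE_zero, add_zero]
  · rw [cplx_A, linEnergy_cvec, linEnergy_cvec, hE, diagE_zero, add_zero]

theorem hamiltonian_level {u v : EnergySpace} (h : cvec (S.vec + u) v ∈ levelSet (cplx S.A)) :
    hamiltonian (cvec (S.vec + u) v) = hamiltonian (cplx S.A) + 2 * hessE 1 S.vec S.ω u u +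
      2 * hessE (-1) S.vec S.ω v v + higher S.vec u v := by
  obtain ⟨-, hQ, hE⟩ := h
  rw [S.hamiltonian_expand, hQ, hE, cplx_A]
  ring

/-- The value of `H` along a curve on the level set tangent to a free direction. -/
theorem Free.exists_curve {ℓ : ℕ} (h0 : ℓ ≠ 0) (hℓ : S.A ℓ ≠ 0) {v : EnergySpace}
    (hv : Free S ℓ v) {σ : ℝ} (hσ : σ = 1 ∨ σ = -1) : ∃ C > 0, ∃ t₀ > 0, ∀ t : ℝ, 0 < t → t < t₀ →
      ∃ β ∈ levelSet (cplx S.A), energyDist β (cplx S.A) ≤ C * t ∧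
        |hamiltonian β - hamiltonian (cplx S.A) - 2 * t ^ 2 * hessE σ S.vec S.ω v v| ≤ C * t ^ 3 := by
  obtain ⟨C, C0, t₀, t₀0, hcor⟩ := hv.exists_correction h0 hℓ
  obtain ⟨B, B0, hB⟩ := S.hessE_le 1
  obtain ⟨L, hL⟩ : ∃ L, L = C + ‖v‖ := ⟨_, rfl⟩
  have L0 : 0 < L := by rw [hL]; positivity
  obtain ⟨D, hD⟩ : ∃ D, D = 2 * B * (2 * ‖v‖ * C + C ^ 2) + (128 * ‖S.vec‖ + 64) * L ^ 3 + 2 * L :=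
    ⟨_, rfl⟩
  have D0 : 0 < D := by rw [hD]; positivity
  refine ⟨D, D0, min t₀ (1 / (1 + L)), by positivity, fun t t0 t1 => ?_⟩
  obtain ⟨w, hw, c1, c2, c3, c4⟩ := hcor t t0 (t1.trans_le (min_le_left _ _))
  have t2 : t * (1 + L) < 1 := by
    have := t1.trans_le (min_le_right _ _)
    rwa [lt_div_iff₀ (by positivity)] at this
  have t1' : t ≤ 1 := by nlinarith
  -- The correction is O(t²), so its own contribution and its cross term with t v are of order t³ in
  -- H; only the form at v remains at order t².
  have hwt : ‖w‖ ≤ C * t := hw.trans (by nlinarith [mul_pos C0 t0])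
  have hLt : L * t ≤ 1 := by nlinarith
  have hvt : ‖t • v‖ = t * ‖v‖ := by rw [norm_smul, Real.norm_eq_abs, abs_of_pos t0]
  have hww : |hessE 1 S.vec S.ω w w| ≤ B * C ^ 2 * t ^ 3 := by
    calc _ ≤ B * ‖w‖ * ‖w‖ := hB _ _
      _ ≤ B * (C * t ^ 2) * (C * t) := by gcongr
      _ = _ := by ring
  have hdist : ∀ x y : EnergySpace, ‖x‖ ≤ L * t → ‖y‖ ≤ L * t →
      energyDist (cvec (S.vec + x) y) (cplx S.A) ≤ D * t := fun x y hx hy => by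
    rw [cplx_A, energyDist_cvec, add_sub_cancel_left, sub_zero]
    refine Real.sqrt_le_iff.2 ⟨by positivity, ?_⟩
    have h1 : ‖x‖ ^ 2 ≤ (L * t) ^ 2 := by gcongr
    have h2 : ‖y‖ ^ 2 ≤ (L * t) ^ 2 := by gcongr
    have h3 : 2 * L * t ≤ D * t := by
      refine mul_le_mul_of_nonneg_right ?_ t0.le
      rw [hD]
      have : 0 ≤ 2 * B * (2 * ‖v‖ * C + C ^ 2) + (128 * ‖S.vec‖ + 64) * L ^ 3 := by positivity
      linarith
    have h4 : (2 * L * t) ^ 2 ≤ (D * t) ^ 2 := by gcongr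
    nlinarith
  have hhi : ∀ x y : EnergySpace, ‖x‖ ≤ L * t → ‖y‖ ≤ L * t →
      |higher S.vec x y| ≤ (128 * ‖S.vec‖ + 64) * L ^ 3 * t ^ 3 := fun x y hx hy => by
    refine (abs_higher_le S.vec x y hx hy hLt).trans (le_of_eq (by ring))
  have hL3 : 0 ≤ 2 * L * t ^ 3 := by positivity
  have hv3 : 0 ≤ B * (2 * ‖v‖ * C) * t ^ 3 := by positivity
  rcases hσ with rfl | rfl
  · have hx : ‖w + t • v‖ ≤ L * t := by
      refine (norm_add_le _ _).trans ?_
      rw [hvt, hL, add_mul]; linarith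
    have hm : cvec (S.vec + (w + t • v)) 0 ∈ levelSet (cplx S.A) := by
      have e : S.vec + (w + t • v) = (S.vec + w) + t • v := by abel
      refine levelSet_cvec ?_ ?_
      · rw [e, diagE_perturb energyWeight_charge, diagE_symm _ (S.vec + w) (t • v), diagE_smul,
          diagE_symm _ v (S.vec + w), c3, diagE_smul, diagE_symm _ v (t • v), diagE_smul, diagE_zero,
          ← c1]
        ring
      · rw [e, diagE_perturb energyWeight_energy, diagE_symm _ (S.vec + w) (t • v), diagE_smul,
          diagE_symm _ v (S.vec + w), c4, diagE_smul, diagE_symm _ v (t • v), diagE_smul, diagE_zero,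
          ← c2]
        ring
    refine ⟨_, hm, hdist _ _ hx (by rw [norm_zero]; positivity), ?_⟩
    rw [hamiltonian_level hm]
    have e1 : hessE 1 S.vec S.ω (w + t • v) (w + t • v) = hessE 1 S.vec S.ω w w +
        2 * t * hessE 1 S.vec S.ω v w + t ^ 2 * hessE 1 S.vec S.ω v v := by
      rw [hessE_perturb, hessE_symm _ _ _ w (t • v), hessE_smul, hessE_smul, hessE_symm _ _ _ v (t • v),
        hessE_smul]
      ring
    have e2 : hessE (-1) S.vec S.ω 0 0 = 0 := by
      rw [← zero_smul ℝ (0 : EnergySpace), hessE_smul, zero_mul]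
    have h2 : |t * hessE 1 S.vec S.ω v w| ≤ B * (‖v‖ * C) * t ^ 3 := by
      rw [abs_mul, abs_of_pos t0]
      calc _ ≤ t * (B * ‖v‖ * ‖w‖) := by gcongr; exact hB _ _
        _ ≤ t * (B * ‖v‖ * (C * t ^ 2)) := by gcongr
        _ = _ := by ring
    have h3 := hhi _ 0 hx (by rw [norm_zero]; positivity)
    have h4 : D * t ^ 3 = 2 * (B * (2 * ‖v‖ * C) * t ^ 3) + 2 * (B * C ^ 2 * t ^ 3) +
        (128 * ‖S.vec‖ + 64) * L ^ 3 * t ^ 3 + 2 * L * t ^ 3 := by rw [hD]; ring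
    have h5 : B * (2 * ‖v‖ * C) * t ^ 3 = 2 * (B * (‖v‖ * C) * t ^ 3) := by ring
    rw [e1, e2, h4, h5]
    obtain ⟨a1, a2⟩ := abs_le.1 hww
    obtain ⟨b1, b2⟩ := abs_le.1 h2
    obtain ⟨d1, d2⟩ := abs_le.1 h3
    exact abs_le.2 ⟨by linarith, by linarith⟩
  · have hx : ‖w‖ ≤ L * t := hwt.trans (by
      have := mul_nonneg (norm_nonneg v) t0.le
      rw [hL, add_mul]; linarith)
    have hy : ‖t • v‖ ≤ L * t := by
      have := mul_pos C0 t0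
      rw [hvt, hL, add_mul]; linarith
    have hm : cvec (S.vec + w) (t • v) ∈ levelSet (cplx S.A) := by
      refine levelSet_cvec ?_ ?_
      · rw [diagE_smul, diagE_symm _ v (t • v), diagE_smul, ← c1]
        ring
      · rw [diagE_smul, diagE_symm _ v (t • v), diagE_smul, ← c2]
        ring
    refine ⟨_, hm, hdist _ _ hx hy, ?_⟩
    rw [hamiltonian_level hm]
    have e1 : hessE (-1) S.vec S.ω (t • v) (t • v) = t ^ 2 * hessE (-1) S.vec S.ω v v := by
      rw [hessE_smul, hessE_symm, hessE_smul]; ring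
    have h3 := hhi _ _ hx hy
    have h4 : D * t ^ 3 = 2 * (B * (2 * ‖v‖ * C) * t ^ 3) + 2 * (B * C ^ 2 * t ^ 3) +
        (128 * ‖S.vec‖ + 64) * L ^ 3 * t ^ 3 + 2 * L * t ^ 3 := by rw [hD]; ring
    rw [e1, h4]
    obtain ⟨a1, a2⟩ := abs_le.1 hww
    obtain ⟨d1, d2⟩ := abs_le.1 h3
    exact abs_le.2 ⟨by linarith, by linarith⟩

theorem exists_small_step {q C t₀ ρ : ℝ} (hq : 0 < q) (hC : 0 < C) (ht : 0 < t₀) (hρ : 0 < ρ) :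
    ∃ t, 0 < t ∧ t < t₀ ∧ C * t < ρ ∧ C * t ^ 3 < 2 * t ^ 2 * q := by
  set t := min (t₀ / 2) (min (ρ / (2 * C)) (q / C)) with htd
  have t0 : 0 < t := by positivity
  have h1 : t ≤ t₀ / 2 := min_le_left _ _
  have h2 : t ≤ ρ / (2 * C) := (min_le_right _ _).trans (min_le_left _ _)
  have h3 : t ≤ q / C := (min_le_right _ _).trans (min_le_right _ _)
  rw [le_div_iff₀ (by positivity)] at h2 h3
  refine ⟨t, t0, by linarith, by linarith, ?_⟩
  have : 0 < t ^ 2 := by positivity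
  nlinarith

theorem SaddleData.isConstrainedSaddle {ℓ : ℕ} (h : SaddleData S ℓ) :
    IsConstrainedSaddle (cplx S.A) := by
  refine ⟨S.isConstrainedCritical, fun ρ hρ => ⟨?_, ?_⟩⟩
  · obtain ⟨v, hv, hd⟩ := h.down
    obtain ⟨σ, hσ, hd⟩ : ∃ σ : ℝ, (σ = 1 ∨ σ = -1) ∧ hessE σ S.vec S.ω v v < 0 := by
      rcases hd with hd | hd
      · exact ⟨1, Or.inl rfl, hd⟩
      · exact ⟨-1, Or.inr rfl, hd⟩
    obtain ⟨C, C0, t₀, ht₀, hc⟩ := hv.exists_curve h.ne_zero h.mode hσ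
    obtain ⟨t, t0, t1, t2, t3⟩ := exists_small_step (neg_pos.2 hd) C0 ht₀ hρ
    obtain ⟨β, hβ, h1, h2⟩ := hc t t0 t1
    exact ⟨β, hβ, h1.trans_lt t2, by linarith [(abs_le.1 h2).2]⟩
  · obtain ⟨v, hv, hd⟩ := h.up
    obtain ⟨C, C0, t₀, ht₀, hc⟩ := hv.exists_curve h.ne_zero h.mode (Or.inl rfl)
    obtain ⟨t, t0, t1, t2, t3⟩ := exists_small_step hd C0 ht₀ hρ
    obtain ⟨β, hβ, h1, h2⟩ := hc t t0 t1
    exact ⟨β, hβ, h1.trans_lt t2, by linarith [(abs_le.1 h2).1]⟩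

end GaugedState

end

end ConformalFlow

namespace ConformalFlow

noncomputable section

/-! ### Fixing the phases -/

theorem exp_pow_mul_re (φ : ℝ) (k : ℕ) (z : ℂ) : ((Circle.exp φ : ℂ) ^ k * z).re =
    z.re * Real.cos (k * φ) - z.im * Real.sin (k * φ) := by
  have e : (Circle.exp φ : ℂ) ^ k = Complex.exp (((k * φ : ℝ) : ℂ) * Complex.I) := by
    rw [Circle.coe_exp, ← Complex.exp_nat_mul]; push_cast; ring_nf
  rw [e, Complex.mul_re, Complex.exp_ofReal_mul_I_re, Complex.exp_ofReal_mul_I_im]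
  ring

/-- The sum is the derivative at φ = 0, up to sign, of the real overlap under the rotation, and it
vanishes at a maximum. -/
theorem tsum_im_of_maximal {z : ℕ → ℂ} {k : ℕ → ℕ} (h0 : Summable fun n => ‖z n‖)
    (h1 : Summable fun n => (k n : ℝ) * ‖z n‖)
    (hmax : ∀ φ : ℝ, ∑' n, ((Circle.exp φ : ℂ) ^ k n * z n).re ≤ ∑' n, (z n).re) :
    ∑' n, (k n : ℝ) * (z n).im = 0 := by
  simp only [exp_pow_mul_re] at hmax
  set g : ℕ → ℝ → ℝ := fun n φ => (z n).re * Real.cos (k n * φ) - (z n).im * Real.sin (k n * φ) with hg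
  set g' : ℕ → ℝ → ℝ := fun n φ => (z n).re * (-Real.sin (k n * φ) * k n) -
    (z n).im * (Real.cos (k n * φ) * k n) with hg'
  have hd : ∀ n φ, HasDerivAt (g n) (g' n φ) φ := fun n φ => by
    have hl : HasDerivAt (fun φ : ℝ => (k n : ℝ) * φ) (k n) φ := by
      simpa using (hasDerivAt_id φ).const_mul (k n : ℝ)
    exact ((hl.cos).const_mul _).sub ((hl.sin).const_mul _)
  have hb : ∀ n φ, ‖g' n φ‖ ≤ 2 * ((k n : ℝ) * ‖z n‖) := fun n φ => by
    rw [Real.norm_eq_abs]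
    refine (abs_sub _ _).trans ?_
    rw [abs_mul, abs_mul, abs_mul, abs_mul, abs_neg, Nat.abs_cast]
    have r := Complex.abs_re_le_norm (z n)
    have i := Complex.abs_im_le_norm (z n)
    have s := Real.abs_sin_le_one (k n * φ)
    have c := Real.abs_cos_le_one (k n * φ)
    have e1 : |(z n).re| * (|Real.sin (k n * φ)| * k n) ≤ ‖z n‖ * (1 * k n) := by gcongr
    have e2 : |(z n).im| * (|Real.cos (k n * φ)| * k n) ≤ ‖z n‖ * (1 * k n) := by gcongr
    linarith
  have hs0 : Summable fun n => g n 0 := by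
    refine Summable.of_norm_bounded h0 fun n => ?_
    simp only [hg, mul_zero, Real.cos_zero, Real.sin_zero, mul_one, sub_zero, Real.norm_eq_abs]
    exact Complex.abs_re_le_norm (z n)
  have hD := hasDerivAt_tsum (h1.mul_left 2) hd hb hs0 0
  have h2 : ∑' n, g' n 0 = 0 := by
    refine IsLocalMax.hasDerivAt_eq_zero (Filter.Eventually.of_forall fun φ => ?_) hD
    refine (hmax φ).trans (le_of_eq (tsum_congr fun n => ?_))
    simp [hg]
  have h3 : ∑' n, g' n 0 = -∑' n, (k n : ℝ) * (z n).im := by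
    rw [← tsum_neg]
    refine tsum_congr fun n => ?_
    simp [hg']; ring
  linarith

/-- The real overlap is continuous on the compact torus of both rotations. At its maximum it is at
least the initial value, and both phase derivatives vanish. -/
theorem exists_phases {z : ℕ → ℂ} (h : Summable fun n : ℕ => ((n : ℝ) + 1) * ‖z n‖) :
    ∃ ζ η : Circle, ∑' n, (z n).re ≤ ∑' n, ((ζ : ℂ) * (η : ℂ) ^ n * z n).re ∧
      ∑' n, ((ζ : ℂ) * (η : ℂ) ^ n * z n).im = 0 ∧
      ∑' n : ℕ, (n : ℝ) * ((ζ : ℂ) * (η : ℂ) ^ n * z n).im = 0 := by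
  have h0 : Summable fun n => ‖z n‖ := Summable.of_nonneg_of_le (fun n => norm_nonneg _)
    (fun n => le_mul_of_one_le_left (norm_nonneg _) (by linarith [n.cast_nonneg (α := ℝ)])) h
  have h1 : Summable fun n : ℕ => (n : ℝ) * ‖z n‖ := Summable.of_nonneg_of_le
    (fun n => by positivity) (fun n => by gcongr; linarith) h
  have hn : ∀ (ζ η : Circle) n, ‖(ζ : ℂ) * (η : ℂ) ^ n * z n‖ = ‖z n‖ := fun ζ η n => by simp [Circle.norm_coe]
  have hc : Continuous fun p : Circle × Circle => ∑' n, ((p.1 : ℂ) * (p.2 : ℂ) ^ n * z n).re := by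
    refine continuous_tsum (fun n => ?_) h0 fun n p => ?_
    · refine Complex.continuous_re.comp ?_
      exact ((continuous_subtype_val.comp continuous_fst).mul
        ((continuous_subtype_val.comp continuous_snd).pow n)).mul continuous_const
    · rw [Real.norm_eq_abs, ← hn p.1 p.2 n]
      exact Complex.abs_re_le_norm _
  obtain ⟨⟨ζ, η⟩, -, hmax⟩ := isCompact_univ.exists_isMaxOn Set.univ_nonempty hc.continuousOn
  have hmax : ∀ ζ' η' : Circle, ∑' n, ((ζ' : ℂ) * (η' : ℂ) ^ n * z n).re ≤
      ∑' n, ((ζ : ℂ) * (η : ℂ) ^ n * z n).re := fun ζ' η' => hmax (Set.mem_univ (ζ', η'))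
  refine ⟨ζ, η, ?_, ?_, ?_⟩
  · simpa using hmax 1 1
  · have := tsum_im_of_maximal (z := fun n => (ζ : ℂ) * (η : ℂ) ^ n * z n) (k := fun _ => 1)
      (by simpa only [hn] using h0) (by simpa only [hn, Nat.cast_one, one_mul] using h0) (fun φ => by
        refine le_trans (le_of_eq (tsum_congr fun n => ?_)) (hmax (Circle.exp φ * ζ) η)
        rw [Circle.coe_mul]; ring_nf)
    simpa using this
  · exact tsum_im_of_maximal (z := fun n => (ζ : ℂ) * (η : ℂ) ^ n * z n) (k := fun n => n)
      (by simpa only [hn] using h0) (by simpa only [hn] using h1) (fun φ => by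
        refine le_trans (le_of_eq (tsum_congr fun n => ?_)) (hmax ζ (Circle.exp φ * η))
        rw [Circle.coe_mul, mul_pow]; ring_nf)

/-- The two phase rotations. -/
def rotate (ζ η : Circle) (α : ℕ → ℂ) : ℕ → ℂ := fun n => (ζ : ℂ) * (η : ℂ) ^ n * α n

theorem norm_rotate (ζ η : Circle) (α : ℕ → ℂ) (n : ℕ) : ‖rotate ζ η α n‖ = ‖α n‖ := by
  simp [rotate, Circle.norm_coe]

theorem charge_rotate (ζ η : Circle) (α : ℕ → ℂ) : charge (rotate ζ η α) = charge α := by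
  simp only [charge, norm_rotate]

theorem linEnergy_rotate (ζ η : Circle) (α : ℕ → ℂ) : linEnergy (rotate ζ η α) = linEnergy α := by
  simp only [linEnergy, norm_rotate]

theorem finiteEnergy_rotate {ζ η : Circle} {α : ℕ → ℂ} (h : FiniteEnergy α) :
    FiniteEnergy (rotate ζ η α) := by
  rw [FiniteEnergy, memℓp_gen_iff (by norm_num)] at *
  simpa only [norm_mul, norm_rotate] using h

/-- The first phase cancels between two conjugated and two plain factors, the second by the
resonance n + j = k + m. -/
theorem hamiltonian_rotate (ζ η : Circle) (α : ℕ → ℂ) :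
    hamiltonian (rotate ζ η α) = hamiltonian α := by
  rw [hamiltonian, hamiltonian]
  congr 1
  refine tsum_congr fun n => tsum_congr fun j => Finset.sum_congr rfl fun k hk => ?_
  have hk : n + j = k + (n + j - k) := by have := Finset.mem_range.1 hk; omega
  generalize n + j - k = m at *
  have h1 : conj (ζ : ℂ) * ζ = 1 := by
    rw [mul_comm, Complex.mul_conj, Complex.normSq_eq_norm_sq, Circle.norm_coe]; simp
  have h2 : conj (η : ℂ) * η = 1 := by
    rw [mul_comm, Complex.mul_conj, Complex.normSq_eq_norm_sq, Circle.norm_coe]; simp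
  have h3 : conj (η : ℂ) ^ n * conj (η : ℂ) ^ j * ((η : ℂ) ^ k * (η : ℂ) ^ m) = 1 := by
    rw [← pow_add, ← pow_add, hk, ← mul_pow, h2, one_pow]
  simp only [rotate, map_mul, map_pow]
  calc _ = (conj (ζ : ℂ) * ζ) ^ 2 * (conj (η : ℂ) ^ n * conj (η : ℂ) ^ j * ((η : ℂ) ^ k * (η : ℂ) ^ m)) *
        ((coupling n j k m : ℂ) * conj (α n) * conj (α j) * α k * α m) := by ring
    _ = _ := by rw [h1, h3]; ring

namespace GaugedState

variable {S : GaugedState}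

/-- Coercivity of the form of `L₊` up to the violation of the constraints. -/
theorem exists_pos_lower {ℓ : ℕ} (h0 : ℓ ≠ 0) (hℓ : S.A ℓ ≠ 0)
    (h : PosOn (hessL 1 S.vec S.ω) (constraintSub S.vec)) :
    ∃ κ > 0, ∃ C > 0, ∀ (u : EnergySpace) (N : ℝ), ‖u‖ ≤ N → N ≤ 1 →
      |diagE (fun n => (n : ℝ) + 1) S.vec u| ≤ N ^ 2 →
      |diagE (fun n => ((n : ℝ) + 1) ^ 2) S.vec u| ≤ N ^ 2 →
      κ * ‖u‖ ^ 2 - C * N ^ 3 ≤ hessE 1 S.vec S.ω u u := by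
  obtain ⟨κ, κ0, hκ⟩ := h
  obtain ⟨C, C0, hC⟩ := exists_modes h0 hℓ
  obtain ⟨B, B0, hB⟩ := S.hessE_le 1
  obtain ⟨D, hD⟩ : ∃ D, D = (‖unitVec 0‖ + ‖unitVec ℓ‖) * (C * 2) := ⟨_, rfl⟩
  have D0 : 0 ≤ D := by rw [hD]; positivity
  refine ⟨κ / 2, by positivity, κ * D ^ 2 + 2 * B * (1 + D) * D + B * D ^ 2 + 1, by positivity,
    fun u N hu hN hq he => ?_⟩
  have N0 : 0 ≤ N := (norm_nonneg u).trans hu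
  obtain ⟨α, β, e1, e2, e3⟩ := hC (diagE (fun n => (n : ℝ) + 1) S.vec u)
    (diagE (fun n => ((n : ℝ) + 1) ^ 2) S.vec u)
  -- The constraints are violated only to order N², so the correction w into the constraint space is
  -- O(N²), and coercivity of u - w transfers to u up to O(N³).
  obtain ⟨w, hw⟩ : ∃ w, w = α • unitVec 0 + β • unitVec ℓ := ⟨_, rfl⟩
  have nw : ‖w‖ ≤ D * N ^ 2 := by
    rw [hw]
    refine (norm_modes_le 0 ℓ α β).trans ?_
    have := norm_nonneg (unitVec 0)
    have := norm_nonneg (unitVec ℓ)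
    calc _ ≤ (‖unitVec 0‖ + ‖unitVec ℓ‖) * (C * (N ^ 2 + N ^ 2)) := by
          gcongr; exact e3.trans (by gcongr)
      _ = _ := by rw [hD]; ring
  have hmem : u - w ∈ constraintSub S.vec := by
    have k : ∀ (f : ℕ → ℝ) (C : ℝ) (hf : EnergyWeight f C), diagE f S.vec (u - w) =
        diagE f S.vec u - (α * (f 0 * S.A 0) + β * (f ℓ * S.A ℓ)) := fun f C hf => by
      rw [← diagL_apply hf, map_sub, diagL_apply, diagL_apply, hw, diagE_modes f hf]; rfl
    refine mem_constraintSub.2 ⟨?_, ?_⟩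
    · rw [k _ _ energyWeight_charge, ← e1]; push_cast; ring
    · rw [k _ _ energyWeight_energy, ← e2]; push_cast; ring
  have h1 := hκ _ hmem
  rw [hessL_apply] at h1
  have h2 : hessE 1 S.vec S.ω u u = hessE 1 S.vec S.ω (u - w) (u - w) +
      2 * hessE 1 S.vec S.ω (u - w) w + hessE 1 S.vec S.ω w w := by
    rw [← hessE_perturb, sub_add_cancel]
  have ng : ‖u - w‖ ≤ (1 + D) * N := by
    refine (norm_sub_le _ _).trans ?_
    have : D * N ^ 2 ≤ D * N := by
      have : N ^ 2 ≤ N := by nlinarith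
      gcongr
    linarith
  have N3 : N ^ 2 * N ^ 2 ≤ N ^ 3 := by
    calc N ^ 2 * N ^ 2 = N ^ 3 * N := by ring
      _ ≤ N ^ 3 * 1 := by gcongr
      _ = _ := mul_one _
  have h3 : |hessE 1 S.vec S.ω (u - w) w| ≤ B * (1 + D) * D * N ^ 3 := by
    calc _ ≤ B * ‖u - w‖ * ‖w‖ := hB _ _
      _ ≤ B * ((1 + D) * N) * (D * N ^ 2) := by gcongr
      _ = _ := by ring
  have h4 : |hessE 1 S.vec S.ω w w| ≤ B * D ^ 2 * N ^ 3 := by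
    calc _ ≤ B * ‖w‖ * ‖w‖ := hB _ _
      _ ≤ B * (D * N ^ 2) * (D * N ^ 2) := by gcongr
      _ = B * D ^ 2 * (N ^ 2 * N ^ 2) := by ring
      _ ≤ _ := by gcongr
  have h5 : ‖w‖ ^ 2 ≤ D ^ 2 * N ^ 3 := by
    calc ‖w‖ ^ 2 ≤ (D * N ^ 2) ^ 2 := by gcongr
      _ = D ^ 2 * (N ^ 2 * N ^ 2) := by ring
      _ ≤ _ := by gcongr
  have h6 : ‖u‖ ^ 2 ≤ 2 * ‖u - w‖ ^ 2 + 2 * ‖w‖ ^ 2 := by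
    have : ‖u‖ ≤ ‖u - w‖ + ‖w‖ := by
      calc ‖u‖ = ‖(u - w) + w‖ := by rw [sub_add_cancel]
        _ ≤ _ := norm_add_le _ _
    calc ‖u‖ ^ 2 ≤ (‖u - w‖ + ‖w‖) ^ 2 := by gcongr
      _ ≤ _ := by nlinarith [sq_nonneg (‖u - w‖ - ‖w‖)]
  have h7 : κ / 2 * ‖u‖ ^ 2 ≤ κ * ‖u - w‖ ^ 2 + κ * (D ^ 2 * N ^ 3) := by
    calc κ / 2 * ‖u‖ ^ 2 ≤ κ / 2 * (2 * ‖u - w‖ ^ 2 + 2 * (D ^ 2 * N ^ 3)) := by gcongr; linarith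
      _ = _ := by ring
  have h8 : 0 ≤ N ^ 3 := by positivity
  have e9 : (κ * D ^ 2 + 2 * B * (1 + D) * D + B * D ^ 2 + 1) * N ^ 3 = κ * (D ^ 2 * N ^ 3) +
    2 * (B * (1 + D) * D * N ^ 3) + B * D ^ 2 * N ^ 3 + N ^ 3 := by ring
  rw [e9, h2]
  linarith [(abs_le.1 h3).1, (abs_le.1 h4).1]

/-- Values of `H` on the level set at perturbations orthogonal to the phase rotations. -/
theorem MinimizerData.exists_lower {ℓ : ℕ} (h : MinimizerData S ℓ) : ∃ ν > 0, ∀ u v : EnergySpace,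
    ‖u‖ ^ 2 + ‖v‖ ^ 2 ≤ ν → v ∈ S.negSub → cvec (S.vec + u) v ∈ levelSet (cplx S.A) →
      hamiltonian (cplx S.A) ≤ hamiltonian (cvec (S.vec + u) v) := by
  obtain ⟨κ, κ0, C, C0, hC⟩ := exists_pos_lower h.ne_zero h.mode h.pos
  obtain ⟨κ', κ0', hneg⟩ := h.neg
  obtain ⟨k, hk⟩ : ∃ k, k = min κ κ' := ⟨_, rfl⟩
  have k0 : 0 < k := by rw [hk]; positivity
  have k1 : k ≤ κ := hk ▸ min_le_left _ _
  have k2 : k ≤ κ' := hk ▸ min_le_right _ _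
  obtain ⟨D, hD⟩ : ∃ D, D = 2 * C + (128 * ‖S.vec‖ + 64) := ⟨_, rfl⟩
  have D0 : 0 < D := by rw [hD]; positivity
  refine ⟨min 1 ((2 * k / D) ^ 2), by positivity, fun u v hN hv hm => ?_⟩
  rw [hamiltonian_level hm]
  obtain ⟨N, hNd⟩ : ∃ N, N = Real.sqrt (‖u‖ ^ 2 + ‖v‖ ^ 2) := ⟨_, rfl⟩
  have N0 : 0 ≤ N := hNd ▸ Real.sqrt_nonneg _
  have N2 : N ^ 2 = ‖u‖ ^ 2 + ‖v‖ ^ 2 := by rw [hNd, Real.sq_sqrt (by positivity)]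
  rw [← N2] at hN
  have hN1 : N ≤ 1 := by
    have := hN.trans (min_le_left _ _)
    nlinarith
  have hN2 : N ≤ 2 * k / D := abs_le_of_sq_le_sq' (hN.trans (min_le_right _ _)) (by positivity) |>.2
  rw [le_div_iff₀ D0] at hN2
  have hu : ‖u‖ ≤ N := abs_le_of_sq_le_sq' (by rw [N2]; linarith [sq_nonneg ‖v‖]) N0 |>.2
  have hv' : ‖v‖ ≤ N := abs_le_of_sq_le_sq' (by rw [N2]; linarith [sq_nonneg ‖u‖]) N0 |>.2
  -- On the level set the linear part of each constraint equals minus half the quadratic part, so it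
  -- is of size N².
  have hcon : ∀ (f : ℕ → ℝ) (hf : EnergyWeight f 1), (∀ n, 0 ≤ f n) →
      diagE f (S.vec + u) (S.vec + u) + diagE f v v = diagE f S.vec S.vec →
      |diagE f S.vec u| ≤ N ^ 2 := by
    intro f hf f0 he
    rw [diagE_perturb hf] at he
    have b1 := (diagE_bound hf u u).2
    have b2 := (diagE_bound hf v v).2
    have c1 : 0 ≤ diagE f u u := tsum_nonneg fun n => mul_nonneg (f0 n) (mul_self_nonneg _)
    have c2 : 0 ≤ diagE f v v := tsum_nonneg fun n => mul_nonneg (f0 n) (mul_self_nonneg _)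
    rw [abs_of_nonneg c1] at b1
    rw [abs_of_nonneg c2] at b2
    rw [abs_le]
    constructor <;> nlinarith
  obtain ⟨-, hQ, hE⟩ := hm
  rw [cplx_A, charge_cvec, charge_cvec, diagE_zero, add_zero] at hQ
  rw [cplx_A, linEnergy_cvec, linEnergy_cvec, diagE_zero, add_zero] at hE
  have h1 := hC u N hu hN1 (hcon _ energyWeight_charge (fun n => by positivity) hQ)
    (hcon _ energyWeight_energy (fun n => by positivity) hE)
  have h2 : κ' * ‖v‖ ^ 2 ≤ hessE (-1) S.vec S.ω v v := hneg v hv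
  have h3 := (abs_le.1 (abs_higher_le S.vec u v hu hv' hN1)).1
  have h4 : k * ‖u‖ ^ 2 ≤ κ * ‖u‖ ^ 2 := by gcongr
  have h5 : k * ‖v‖ ^ 2 ≤ κ' * ‖v‖ ^ 2 := by gcongr
  have h6 : D * N ^ 3 ≤ 2 * k * N ^ 2 := by
    calc D * N ^ 3 = N * D * N ^ 2 := by ring
      _ ≤ _ := by gcongr
  have e6 : D * N ^ 3 = 2 * (C * N ^ 3) + (128 * ‖S.vec‖ + 64) * N ^ 3 := by rw [hD]; ring
  have e7 : 2 * k * N ^ 2 = 2 * (k * ‖u‖ ^ 2) + 2 * (k * ‖v‖ ^ 2) := by rw [N2]; ring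
  linarith

theorem cvec_mul_A (x y : EnergySpace) (n : ℕ) : cvec x y n * (S.A n : ℂ) =
    ⟨seq S.vec n * seq x n, seq S.vec n * seq y n⟩ := by
  apply Complex.ext <;> simp [cvec, A, mul_comm]

theorem abs_diagE_le_tsum (w : ℕ → ℝ) (a u : EnergySpace) {r : ℝ} (hr : ∀ n, |seq u n| ≤ r)
    (hs : Summable fun n => |w n| * |seq a n|) :
    |diagE w a u| ≤ (∑' n, |w n| * |seq a n|) * r := by
  have hle : ∀ n : ℕ, |w n * (seq a n * seq u n)| ≤ |w n| * |seq a n| * r := fun n => by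
    rw [abs_mul, abs_mul, ← mul_assoc]
    exact mul_le_mul_of_nonneg_left (hr n) (by positivity)
  have hsb := hs.mul_right r
  have hsa : Summable fun n => |w n * (seq a n * seq u n)| :=
    Summable.of_nonneg_of_le (fun n => abs_nonneg _) hle hsb
  have h1 : |diagE w a u| ≤ ∑' n, |w n * (seq a n * seq u n)| := by
    simpa [diagE] using norm_tsum_le_tsum_norm (f := fun n => w n * (seq a n * seq u n)) hsa
  refine h1.trans ((hsa.tsum_le_tsum hle hsb).trans (le_of_eq ?_))
  rw [tsum_mul_right]

theorem abs_diagE_energy_le (S : GaugedState) {u : EnergySpace} {r : ℝ} (hr : ∀ n, |seq u n| ≤ r) :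
    |diagE (fun n => ((n : ℝ) + 1) ^ 2) S.vec u| ≤ (∑' n : ℕ, ((n : ℝ) + 1) ^ 2 * |S.A n|) * r := by
  have e : (fun n : ℕ => |((n : ℝ) + 1) ^ 2| * |seq S.vec n|) =
      fun n : ℕ => ((n : ℝ) + 1) ^ 2 * |S.A n| := by
    ext n
    rw [abs_of_nonneg (by positivity : (0 : ℝ) ≤ ((n : ℝ) + 1) ^ 2), A]
  have h := abs_diagE_le_tsum (fun n : ℕ => ((n : ℝ) + 1) ^ 2) S.vec u hr
    (by rw [e]; exact S.summable_pow_mul 2)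
  rwa [e] at h

/-- Rotating a competitor to maximal overlap with A leaves H, Q, E unchanged, puts its imaginary
part in `negSub`, and does not increase the ℓ² distance to A. Closeness in the energy norm is
regained from E being fixed, and then the lower bound on the level set applies. -/
theorem MinimizerData.isConstrainedMinimizer {ℓ : ℕ} (h : MinimizerData S ℓ) :
    IsConstrainedMinimizer (cplx S.A) := by
  refine ⟨S.isConstrainedCritical, ?_⟩
  obtain ⟨ν, ν0, hν⟩ := h.exists_lower
  obtain ⟨M, hM⟩ : ∃ M, M = ∑' n : ℕ, ((n : ℝ) + 1) ^ 2 * |S.A n| := ⟨_, rfl⟩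
  have M0 : 0 ≤ M := hM ▸ tsum_nonneg fun n => by positivity
  obtain ⟨r, r0, hr⟩ : ∃ r > 0, r * (2 * M + 1) = ν := ⟨ν / (2 * M + 1), by positivity, by field_simp⟩
  refine ⟨r, r0, fun β hβ hd => ?_⟩
  obtain ⟨xb, yb, rfl⟩ := (finiteEnergy_iff β).1 hβ.1
  have hz : Summable fun n : ℕ => ((n : ℝ) + 1) * ‖cvec xb yb n * (S.A n : ℂ)‖ := by
    have hb : ∀ n, ‖cvec xb yb n‖ ≤ ‖xb‖ + ‖yb‖ := fun n =>
      (Complex.norm_le_abs_re_add_abs_im _).trans (add_le_add (abs_seq_le xb n) (abs_seq_le yb n))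
    refine Summable.of_nonneg_of_le (fun n => by positivity) (fun n => ?_)
      ((S.summable_pow_mul 1).mul_left (‖xb‖ + ‖yb‖))
    rw [norm_mul, Complex.norm_real, Real.norm_eq_abs, pow_one]
    calc _ ≤ ((n : ℝ) + 1) * ((‖xb‖ + ‖yb‖) * |S.A n|) := by gcongr; exact hb n
      _ = _ := by ring
  obtain ⟨ζ, η, p1, p2, p3⟩ := exists_phases hz
  have hg : rotate ζ η (cvec xb yb) ∈ levelSet (cplx S.A) :=
    ⟨finiteEnergy_rotate hβ.1, by rw [charge_rotate, hβ.2.1], by rw [linEnergy_rotate, hβ.2.2]⟩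
  rw [← hamiltonian_rotate ζ η (cvec xb yb)]
  obtain ⟨x, y, hxy⟩ := (finiteEnergy_iff _).1 hg.1
  have hn : ∀ n, ‖cvec x y n‖ = ‖cvec xb yb n‖ := fun n => by rw [← hxy, norm_rotate]
  have hrot : ∀ n, (ζ : ℂ) * (η : ℂ) ^ n * (cvec xb yb n * (S.A n : ℂ)) =
      ⟨seq S.vec n * seq x n, seq S.vec n * seq y n⟩ := fun n => by
    rw [← cvec_mul_A, ← hxy, rotate]; ring
  simp only [hrot] at p1 p2 p3
  simp only [cvec_mul_A] at p1
  rw [hxy] at hg ⊢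
  have d1 : ∀ a b : EnergySpace, ∑' n, seq a n * seq b n = diagE (fun _ => 1) a b :=
    fun a b => tsum_congr fun n => by rw [one_mul]
  rw [d1, d1] at p1
  rw [d1] at p2
  have hneg : y ∈ S.negSub := by
    refine mem_orthSub.2 ⟨p2, ?_⟩
    have s1 := (diagE_bound energyWeight_charge S.vec y).1
    have s0 := (diagE_bound energyWeight_one S.vec y).1
    have e : (fun n : ℕ => (n : ℝ) * (seq S.vec n * seq y n)) = fun n : ℕ =>
        ((n : ℝ) + 1) * (seq S.vec n * seq y n) - 1 * (seq S.vec n * seq y n) := by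
      ext n; ring
    rw [e, s1.tsum_sub s0] at p3
    have e2 : diagE (fun _ => 1) S.mvec y = ∑' n : ℕ, ((n : ℝ) + 1) * (seq S.vec n * seq y n) :=
      tsum_congr fun n => by rw [seq_mvec, weighted, A]; ring
    rw [diagE] at p2
    rw [e2]; linarith
  obtain ⟨u, hu⟩ : ∃ u, u = x - S.vec := ⟨_, rfl⟩
  have hx : x = S.vec + u := by rw [hu]; abel
  have hsq : diagE (fun _ => 1) x x + diagE (fun _ => 1) y y =
      diagE (fun _ => 1) xb xb + diagE (fun _ => 1) yb yb := by
    rw [← tsum_weight_cvec energyWeight_one, ← tsum_weight_cvec energyWeight_one]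
    simp only [hn]
  have hexp : ∀ (f : ℕ → ℝ) (C : ℝ) (hf : EnergyWeight f C) (a : EnergySpace),
      diagE f (a - S.vec) (a - S.vec) = diagE f a a - 2 * diagE f S.vec a + diagE f S.vec S.vec := by
    intro f C hf a
    have := diagE_perturb hf S.vec (a - S.vec)
    rw [add_sub_cancel] at this
    have h2 : diagE f S.vec (a - S.vec) = diagE f S.vec a - diagE f S.vec S.vec := by
      rw [← diagL_apply hf, map_sub, diagL_apply, diagL_apply]
    rw [h2] at this
    linarith
  have hdist : ‖xb - S.vec‖ ^ 2 + ‖yb‖ ^ 2 < (r) ^ 2 := by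
    rw [cplx_A, energyDist_cvec, sub_zero, Real.sqrt_lt' (by positivity)] at hd
    exact hd
  have hl2 : ∀ a : EnergySpace, diagE (fun _ => 1) a a ≤ ‖a‖ ^ 2 := fun a => by
    have := (le_abs_self _).trans (diagE_bound energyWeight_one a a).2
    linarith
  have hsmall : diagE (fun _ => 1) u u ≤ (r) ^ 2 := by
    have e1 := hexp _ _ energyWeight_one x
    have e2 := hexp _ _ energyWeight_one xb
    have e3 := hl2 (xb - S.vec)
    have e4 := hl2 yb
    have e5 := diagE_one_nonneg y
    rw [hu]
    linarith
  have hun : ∀ n, |seq u n| ≤ r := fun n =>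
    abs_le_of_sq_le_sq ((sq_seq_le_diagE u n).trans hsmall) (by positivity)
  -- Equality of E turns the energy distance into a linear functional of u with the rapidly decaying
  -- coefficients of M²A; the sup bound by r makes it small.
  have hE : ‖u‖ ^ 2 + ‖y‖ ^ 2 = -2 * diagE (fun n => ((n : ℝ) + 1) ^ 2) S.vec u := by
    have e1 := hg.2.2
    rw [cplx_A, linEnergy_cvec, linEnergy_cvec, diagE_zero, add_zero, hx,
      diagE_perturb energyWeight_energy] at e1
    rw [← diagE_energy_self, ← diagE_energy_self]
    linarith
  have hb := S.abs_diagE_energy_le hun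
  rw [← hM] at hb
  have hfin : 2 * (M * (r)) ≤ ν := by
    rw [show 2 * (M * r) = 2 * M * r by ring]
    linarith
  rw [hx] at hg ⊢
  exact hν u y (by rw [hE]; linarith [(abs_le.1 hb).1]) hneg hg

end GaugedState

end

end ConformalFlow

/-! ### Local states as gauged states, and the variational characterization -/

namespace ConformalFlow

noncomputable section

open Filter Topology

/-- Local states are real vectors of the energy space close to the lowest mode. -/
theorem mem_localStates_iff {r ω : ℝ} {A : ℕ → ℝ} : A ∈ localStates r ω ↔
    ∃ v : EnergySpace, A = seq v ∧ IsStationary 1 ω A ∧ ‖v - unitVec 0‖ < r := by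
  have hd : ∀ v : EnergySpace, energyDist (cplx (seq v)) (cplx lowestMode) = ‖v - unitVec 0‖ := by
    intro v
    rw [lowestMode_eq, ← seq_unitVec, ← cvec_zero, ← cvec_zero, energyDist_cvec]
    simp
  constructor
  · rintro ⟨h1, h2, h3⟩
    obtain ⟨x, y, e⟩ := (finiteEnergy_iff _).1 h1
    have : A = seq x := by
      ext n
      have := congrArg Complex.re (congrFun e n)
      simpa [cplx, cvec] using this
    refine ⟨x, this, h2, ?_⟩
    rwa [← hd, ← this]
  · rintro ⟨v, rfl, h2, h3⟩
    exact ⟨(finiteEnergy_iff _).2 ⟨v, 0, (cvec_zero v).symm⟩, h2, by rwa [hd]⟩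

theorem abs_seq_le_norm (v : EnergySpace) (n : ℕ) : |seq v n| ≤ ‖v‖ := by
  obtain ⟨s, e⟩ := norm_sq_eq_energy v
  have h := s.le_tsum n fun i _ => by positivity
  rw [← e] at h
  refine abs_le_of_sq_le_sq ?_ (norm_nonneg v)
  have : (1 : ℝ) ≤ ((n : ℝ) + 1) ^ 2 := by
    have : (0 : ℝ) ≤ n := n.cast_nonneg
    nlinarith
  nlinarith [sq_nonneg (seq v n)]

/-- The scale of a pair of amplitudes. -/
theorem exists_scale {a b s₀ : ℝ} (ha : 0 ≤ a) (hb : 0 ≤ b) (h : 0 < a ∨ 0 < b) (hs0 : 0 < s₀)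
    (hs1 : s₀ ≤ 1) (ha' : a < s₀ ^ 3) (hb' : b < s₀ ^ 3) :
    ∃ s x y : ℝ, 0 < s ∧ s < s₀ ∧ 0 ≤ x ∧ x ≤ 1 ∧ 0 ≤ y ∧ y ≤ 1 ∧ (x = 1 ∨ y = 1) ∧
      a = s ^ 2 * x ∧ b = s ^ 3 * y := by
  obtain ⟨u, u0, rfl⟩ : ∃ u : ℝ, 0 ≤ u ∧ u ^ 2 = a :=
    ⟨a ^ ((2 : ℕ) : ℝ)⁻¹, Real.rpow_nonneg ha _, Real.rpow_inv_natCast_pow ha two_ne_zero⟩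
  obtain ⟨v, v0, rfl⟩ : ∃ v : ℝ, 0 ≤ v ∧ v ^ 3 = b :=
    ⟨b ^ ((3 : ℕ) : ℝ)⁻¹, Real.rpow_nonneg hb _, Real.rpow_inv_natCast_pow hb three_ne_zero⟩
  have hv : v < s₀ := lt_of_pow_lt_pow_left₀ 3 hs0.le hb'
  have hu : u < s₀ := lt_of_pow_lt_pow_left₀ 2 hs0.le (ha'.trans_le (by
    exact pow_le_pow_of_le_one hs0.le hs1 (by norm_num)))
  rcases le_total v u with hle | hle
  · have hu0 : 0 < u := by
      rcases u0.lt_or_eq with h' | h'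
      · exact h'
      · subst h'
        have : v = 0 := le_antisymm hle v0
        subst this
        norm_num at h
    refine ⟨u, 1, v ^ 3 / u ^ 3, hu0, hu, zero_le_one, le_rfl, by positivity, ?_, Or.inl rfl,
      (mul_one _).symm, by field_simp⟩
    rw [div_le_one (by positivity)]
    gcongr
  · have hv0 : 0 < v := by
      rcases v0.lt_or_eq with h' | h'
      · exact h'
      · subst h'
        have : u = 0 := le_antisymm hle u0
        subst this
        norm_num at h
    refine ⟨v, u ^ 2 / v ^ 2, 1, hv0, hv, by positivity, ?_, zero_le_one, le_rfl, Or.inr rfl,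
      by field_simp, (mul_one _).symm⟩
    rw [div_le_one (by positivity)]
    gcongr

/-- Local states other than the lowest mode are gauged states of small scale. -/
theorem exists_gaugedState {s₀ : ℝ} (hs0 : 0 < s₀) (hs1 : s₀ ≤ 1 / 2) : ∃ r₁ > 0, ∀ r ≤ r₁, ∀ ω : ℝ,
    |ω - 1 / 6| ≤ 1 / 1000 → ∀ A ∈ localStates r ω, (A 2 ≠ 0 ∨ A 3 ≠ 0) →
      ∃ S : GaugedState, S.A = A ∧ S.ω = ω ∧ S.s < s₀ := by
  have hr : 0 < rad := by norm_num [rad]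
  refine ⟨rad / 4 * s₀ ^ 3, by positivity, fun r hr1 ω hω A hA h => ?_⟩
  obtain ⟨v, rfl, hst, hd⟩ := mem_localStates_iff.1 hA
  have hlow : seq v - lowestMode = seq (v - unitVec 0) := by
    rw [lowestMode_eq, ← seq_unitVec, seq_sub]
  have habs : ∀ n, n ≠ 0 → |seq v n| < rad / 4 * s₀ ^ 3 := fun n hn => by
    have e : seq v n = seq (v - unitVec 0) n := by
      rw [← hlow]; simp [lowestMode, hn]
    rw [e]
    exact (abs_seq_le_norm _ n).trans_lt (hd.trans_le hr1)
  obtain ⟨s, x, y, s0, ss, x0, x1, y0, y1, hxy, e2, e3⟩ := exists_scale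
    (a := |seq v 2| / (rad / 4)) (b := |seq v 3| / (rad / 4)) (by positivity) (by positivity)
    (h.imp (fun h => div_pos (abs_pos.2 h) (by positivity))
      (fun h => div_pos (abs_pos.2 h) (by positivity))) hs0 (by linarith)
    (by rw [div_lt_iff₀ (by positivity), mul_comm]; exact habs 2 (by norm_num))
    (by rw [div_lt_iff₀ (by positivity), mul_comm]; exact habs 3 (by norm_num))
  rw [div_eq_iff (by positivity), mul_comm] at e2 e3
  have g2 : stateGauge s x y 2 = s ^ 2 * x := by simp [stateGauge, gaugeExp, classWeight]
  have g3 : stateGauge s x y 3 = s ^ 3 * y := by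
    simp [stateGauge, gaugeExp, classWeight, show ¬ Even 3 by decide]
  have hl := summable_abs_seq (v - unitVec 0)
  have hl' : ∑' n, |(seq v - lowestMode) n| ≤ rad := by
    rw [hlow]
    refine hl.2.trans ?_
    have : s₀ ^ 3 ≤ 1 := pow_le_one₀ hs0.le (by linarith)
    nlinarith
  obtain ⟨β, m, t, d⟩ := reduced_dom (gauge_stateGauge s0.le (by linarith) x0 x1 y0 y1) hω
    (A := seq v) (by rw [hlow]; exact hl.1) hl' (fun n _ _ => rowEq_of_stationary hst n)
    (by rw [g2, e2, mul_comm]) (by rw [g3, e3, mul_comm])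
  exact ⟨⟨v, ω, s, x, y, β, s0, by linarith, x0, x1, y0, y1, hxy, hω, hst, e2, e3, m, t, d⟩,
    rfl, rfl, ss⟩

/-- Local states other than the lowest mode satisfy uniform estimates. -/
theorem exists_local_est : ∃ C r₁ : ℝ, 0 < r₁ ∧ ∀ r ≤ r₁, ∀ ω : ℝ, |ω - 1 / 6| ≤ 1 / 1000 →
    ∀ A ∈ localStates r ω, (A 2 ≠ 0 ∨ A 3 ≠ 0) →
      ∃ S : GaugedState, S.A = A ∧ S.ω = ω ∧ GaugedState.Est C S ∧ C * S.s ≤ 1 / 10 ^ 26 := by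
  obtain ⟨C, C1, hC⟩ := GaugedState.exists_est
  rw [GaugedState.small, eventually_comap, Metric.eventually_nhds_iff] at hC
  obtain ⟨e, e0, he⟩ := hC
  -- With amplitudes normalized to rad/4 = 1/40000, the reduced determinants are bounded below by
  -- numbers larger than 10⁻²¹; C s ≤ 10⁻²⁶ makes all errors negligible against them.
  obtain ⟨s₀, h⟩ : ∃ s₀, s₀ = min e (min (1 / 2) (1 / (10 ^ 26 * C))) := ⟨_, rfl⟩
  have s0 : 0 < s₀ := by rw [h]; positivity
  obtain ⟨r₁, r0, hr⟩ := exists_gaugedState s0 (by rw [h]; exact (min_le_right _ _).trans (min_le_left _ _))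
  refine ⟨C, r₁, r0, fun r hr' ω hω A hA h2 => ?_⟩
  obtain ⟨S, a, b, c⟩ := hr r hr' ω hω A hA h2
  have c1 : S.s < e := c.trans_le (by rw [h]; exact min_le_left _ _)
  have c2 : S.s < 1 / (10 ^ 26 * C) :=
    c.trans_le (by rw [h]; exact (min_le_right _ _).trans (min_le_right _ _))
  refine ⟨S, a, b, he (y := S.s) ?_ S rfl, ?_⟩
  · rw [Real.dist_eq, sub_zero, abs_of_pos S.s_pos]; exact c1
  · rw [lt_div_iff₀ (by positivity)] at c2
    rw [le_div_iff₀ (by positivity)]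
    linarith

namespace GaugedState

variable {C : ℝ} {S : GaugedState}

/-- From 6Ω ≈ 7 A₂² + 14 A₃²: whichever of A₂, A₃ sets the scale, its square outweighs the error s⁸,
and Ω exceeds A₂²/2. -/
theorem omega_ge_of_second (hE : Est C S) (hs : C * S.s ≤ 1 / 10 ^ 26) (h2 : S.A 2 ≠ 0) :
    S.A 2 ^ 2 / 2 < S.Ω := by
  have r2 := (abs_le.1 (hE.reduced_two h2)).1
  have s0 := S.s_pos
  have s1 := S.s_le
  have p2 : 0 < S.A 2 ^ 2 := by positivity
  have e8 : C * S.s ^ 8 ≤ 1 / 10 ^ 26 * S.s ^ 6 := by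
    have : S.s ^ 7 ≤ S.s ^ 6 := pow_le_pow_of_le_one s0.le (by linarith) (by norm_num)
    have p : 0 < S.s ^ 7 := by positivity
    calc _ = C * S.s * S.s ^ 7 := by ring
      _ ≤ 1 / 10 ^ 26 * S.s ^ 7 := by gcongr
      _ ≤ _ := by gcongr
  have p6 : 0 < S.s ^ 6 := by positivity
  have a2 : |S.A 2| = rad / 4 * (S.s ^ 2 * S.x) := S.abs_two
  have a3 : |S.A 3| = rad / 4 * (S.s ^ 3 * S.y) := S.abs_three
  rcases S.xy with hx | hy
  · have e : S.A 2 ^ 2 = (rad / 4) ^ 2 * S.s ^ 4 := by rw [← sq_abs, a2, hx]; ring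
    have : S.s ^ 6 ≤ S.s ^ 4 := pow_le_pow_of_le_one s0.le (by linarith) (by norm_num)
    have e' : 1 / 10 ^ 26 * S.s ^ 6 ≤ S.A 2 ^ 2 := by rw [e]; unfold rad; linarith
    nlinarith [sq_nonneg (S.A 3)]
  · have e : S.A 3 ^ 2 = (rad / 4) ^ 2 * S.s ^ 6 := by rw [← sq_abs, a3, hy]; ring
    have e' : 1 / 10 ^ 26 * S.s ^ 6 ≤ S.A 3 ^ 2 := by rw [e]; unfold rad; linarith
    nlinarith

/-- From Ω ≈ A₃²/12, of which half is kept. -/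
theorem omega_ge_of_third (hE : Est C S) (hs : C * S.s ≤ 1 / 10 ^ 26) (h2 : S.A 2 = 0)
    (h3 : S.A 3 ≠ 0) : S.A 3 ^ 2 / 24 < S.Ω := by
  have r3 := (abs_le.1 (hE.reduced_three h3)).1
  have s0 := S.s_pos
  have s1 := S.s_le
  have p3 : 0 < S.A 3 ^ 2 := by positivity
  have m := caseOne_of hE hs h2
  have e : S.A 3 ^ 2 = 1 / 40000 ^ 2 * S.s ^ 6 := by
    rw [m.third, mul_pow, ← sq_abs (S.A 3 / S.s ^ 3), m.abs_m]; ring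
  have e8 : C * S.s ^ 8 ≤ 1 / 10 ^ 26 * S.s ^ 6 := by
    have : S.s ^ 7 ≤ S.s ^ 6 := pow_le_pow_of_le_one s0.le (by linarith) (by norm_num)
    have p : 0 < S.s ^ 7 := by positivity
    calc _ = C * S.s * S.s ^ 7 := by ring
      _ ≤ 1 / 10 ^ 26 * S.s ^ 7 := by gcongr
      _ ≤ _ := by gcongr
  rw [h2] at r3
  have p6 : 0 < S.s ^ 6 := by positivity
  nlinarith

end GaugedState

/-- Nontrivial local states have frequency above `1/6`. -/
theorem exists_omega_lower : ∃ r₁ > 0, ∀ r ≤ r₁, ∀ ω : ℝ, |ω - 1 / 6| ≤ 1 / 1000 →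
    ∀ A ∈ localStates r ω, (A 2 ≠ 0 → A 2 ^ 2 / 24 < ω - 1 / 6) ∧
      (A 2 = 0 → A 3 ≠ 0 → A 3 ^ 2 / 24 < ω - 1 / 6) := by
  obtain ⟨C, r₁, r0, h⟩ := exists_local_est
  refine ⟨r₁, r0, fun r hr ω hω A hA => ⟨fun h2 => ?_, fun h2 h3 => ?_⟩⟩
  · obtain ⟨S, rfl, rfl, hE, hs⟩ := h r hr ω hω A hA (Or.inl h2)
    have := GaugedState.omega_ge_of_second hE hs h2
    rw [GaugedState.Ω] at this
    nlinarith [sq_nonneg (S.A 2)]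
  · obtain ⟨S, rfl, rfl, hE, hs⟩ := h r hr ω hω A hA (Or.inr h3)
    exact GaugedState.omega_ge_of_third hE hs h2 h3

/-- The variational character of the local states. -/
theorem exists_variational : ∃ r₁ > 0, ∀ r ≤ r₁, ∀ ω : ℝ, |ω - 1 / 6| ≤ 1 / 1000 →
    (∀ A ∈ branchOne r ω, IsConstrainedSaddle (cplx A) ∧ constrainedNegIndex A 1 ω = 1 ∧
      negIndex (-1) A 1 ω = 1 ∧ DegenerateOnlyByPhases A 1 ω) ∧
    (∀ A ∈ branchTwo r ω, IsConstrainedSaddle (cplx A) ∧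
      (0 < A 2 → constrainedNegIndex A 1 ω = 0 ∧ negIndex (-1) A 1 ω = 1) ∧
      (A 2 < 0 → constrainedNegIndex A 1 ω = 1 ∧ negIndex (-1) A 1 ω = 0) ∧
      DegenerateOnlyByPhases A 1 ω) ∧
    (∀ A ∈ branchThree r ω, IsConstrainedMinimizer (cplx A) ∧ constrainedNegIndex A 1 ω = 0 ∧
      negIndex (-1) A 1 ω = 0 ∧ DegenerateOnlyByPhases A 1 ω) := by
  obtain ⟨C, r₁, r0, h⟩ := exists_local_est
  refine ⟨r₁, r0, fun r hr ω hω => ⟨?_, ?_, ?_⟩⟩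
  · rintro A ⟨hA, h2, h3⟩
    obtain ⟨S, rfl, rfl, hE, hs⟩ := h r hr ω hω A hA (Or.inr h3)
    have hc := GaugedState.caseOne_of hE hs h2
    obtain ⟨i1, i2, i3⟩ := hc.indices
    exact ⟨hc.saddleData.isConstrainedSaddle, i1, i2, i3⟩
  · rintro A ⟨hA, h2, h3⟩
    obtain ⟨S, rfl, rfl, hE, hs⟩ := h r hr ω hω A hA (Or.inl h2)
    obtain ⟨hd, hp, hn⟩ := GaugedState.indices_second hE hs h3
    refine ⟨hd.isConstrainedSaddle, fun h0 => ⟨(hp h0).pos, (hp h0).neg⟩,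
      fun h0 => ⟨(hn h0).pos, (hn h0).neg⟩, ?_⟩
    rcases lt_or_gt_of_ne h2 with h0 | h0
    · exact (hn h0).degenerate
    · exact (hp h0).degenerate
  · rintro A ⟨hA, h2, h3⟩
    obtain ⟨S, rfl, rfl, hE, hs⟩ := h r hr ω hω A hA (Or.inl h2)
    obtain ⟨e, m, hc, hm, ht⟩ := GaugedState.caseThree_of hE hs h2 h3
    have hd : 0 < -2 * m ^ 2 + 56 * m ^ 2 := by linarith
    obtain ⟨i1, i2, i3⟩ := hc.indices hd ht
    exact ⟨(hc.minimizerData hd ht).isConstrainedMinimizer, i1, i2, i3⟩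

end

end ConformalFlow

/-! ### Existence of the branches (i) and (ii) -/

namespace ConformalFlow

noncomputable section

/-- Small solutions of all the stationary equations but that of mode `k`, which is prescribed. -/
structure Reduced (k : ℕ) (ω t : ℝ) (A : ℕ → ℝ) : Prop where
  l1 : L1 (A - lowestMode)
  sum_le : ∑' n, |(A - lowestMode) n| ≤ rad
  row : ∀ n, n ≠ k → RowEq ω A n
  mode : A k = t
  other : ∀ i, i = 2 ∨ i = 3 → i ≠ k → A i = 0

/-- A gauge with x = 0 or y = 0 confines the solution to multiples of three or to even modes. In
that class the row of the other critical mode holds trivially, both sides being zero, so only the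
equation of mode k is left open. -/
theorem exists_reduced_mode {k : ℕ} (hk : k = 2 ∨ k = 3) {ω t : ℝ} (hω : |ω - 1 / 6| ≤ 1 / 1000)
    (ht : |t| ≤ rad / 4) : ∃ A, Reduced k ω t A := by
  have r0 : 0 ≤ rad := by norm_num [rad]
  obtain ⟨W, hW, w2, w3⟩ : ∃ W : ℕ → ℝ, Gauge W ∧ W 2 = (if k = 2 then 1 else 0) ∧
      W 3 = (if k = 3 then 1 else 0) := by
    rcases hk with rfl | rfl
    · refine ⟨stateGauge 1 1 0, gauge_stateGauge zero_le_one le_rfl zero_le_one le_rfl le_rfl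
        zero_le_one, ?_, ?_⟩ <;> simp [stateGauge, classWeight, show ¬ Even 3 by decide]
    · refine ⟨stateGauge 1 0 1, gauge_stateGauge zero_le_one le_rfl le_rfl zero_le_one zero_le_one
        le_rfl, ?_, ?_⟩ <;> simp [stateGauge, classWeight]
  obtain ⟨A, β, m, s, d, e2, e3, hA⟩ := exists_reduced hW hω (ε := if k = 2 then t else 0)
    (μ := if k = 3 then t else 0) (by rw [w2]; split_ifs <;> simp [ht])
    (by rw [w3]; split_ifs <;> simp [ht])
  have lA := d.l1 hW m
  have dA : DomBy W (fun n => unitSeq 0 n + β n) A := fun n => by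
    have e : A n = lowestMode n + (A - lowestMode) n := by simp
    rw [e, mul_add]
    exact (abs_add_le _ _).trans (add_le_add (lowestMode_dom hW n) (d n))
  have hother : ∀ i, i = 2 ∨ i = 3 → i ≠ k → A i = 0 ∧ W i = 0 := by
    rintro i (rfl | rfl) hi
    · rw [e2, w2, if_neg hi.symm, if_neg hi.symm]; simp
    · rw [e3, w3, if_neg hi.symm, if_neg hi.symm]; simp
  refine ⟨A, lA, (lA.tsum_le_tsum (fun n => (d n).trans
    (mul_le_of_le_one_left (m.1 n) (hW.le_one n))) m.2).trans s, fun n hn => ?_, ?_,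
    fun i h h' => (hother i h h').1⟩
  · by_cases h : n = 2 ∨ n = 3
    · obtain ⟨a0, w0⟩ := hother n h hn
      have mm : Majorant (fun n => unitSeq 0 n + β n) := (majorant_unitSeq 0).add m
      have := (interaction_bound hW mm mm mm dA dA dA n).2
      rw [w0, mul_zero, zero_mul] at this
      rw [RowEq, a0, mul_zero, abs_nonpos_iff.1 this]
    · rw [not_or] at h
      exact hA n h.1 h.2
  · rcases hk with rfl | rfl
    · simpa using e2
    · simpa using e3

theorem linEig_sub (ω ω' : ℝ) (n : ℕ) :
    linEig ω n - linEig ω' n = n * ((n : ℝ) + 1) * (ω - ω') := by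
  rw [linEig, linEig]
  split_ifs with h
  · simp [h]
  · ring

/-- Changing ω shifts the eigenvalue by n (n+1) times the change. The quadratic growth of the
eigenvalue just absorbs a factor (n+1)². -/
theorem abs_le_of_linEig_sq {ω : ℝ} (hω : |ω - 1 / 6| ≤ 1 / 1000) {n : ℕ} (h2 : n ≠ 2) (h3 : n ≠ 3)
    {x y θ : ℝ} (h : linEig ω n * x = y) (hy : |y| ≤ ((n : ℝ) + 1) ^ 2 * θ) : |x| ≤ 100 * θ := by
  have hl := linEig_lower hω h2 h3
  have hn : (0 : ℝ) < ((n : ℝ) + 1) ^ 2 := by positivity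
  have h1 : 0 < linEig ω n := lt_of_lt_of_le (by positivity) hl
  rw [← h, abs_mul, abs_of_pos h1] at hy
  have h4 : ((n : ℝ) + 1) ^ 2 / 100 * |x| ≤ ((n : ℝ) + 1) ^ 2 * θ :=
    (mul_le_mul_of_nonneg_right hl (abs_nonneg x)).trans hy
  have h5 : ((n : ℝ) + 1) ^ 2 * |x| ≤ ((n : ℝ) + 1) ^ 2 * (100 * θ) := by linarith
  exact le_of_mul_le_mul_left h5 hn

theorem Reduced.lowestMode {k : ℕ} (hk : k = 2 ∨ k = 3) (ω : ℝ) : Reduced k ω 0 lowestMode := by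
  have e : ConformalFlow.lowestMode - ConformalFlow.lowestMode = 0 := sub_self _
  refine ⟨?_, ?_, fun n _ => ?_, ?_, ?_⟩
  · rw [e]; simp [L1, summable_zero]
  · rw [e]; simp [rad]
  · rw [rowEq_iff, nonlin_lowestMode, sub_self, mul_zero, neg_zero]
  · rcases hk with rfl | rfl <;> simp [ConformalFlow.lowestMode]
  · rintro i (rfl | rfl) _ <;> simp [ConformalFlow.lowestMode]

section

variable {k : ℕ} {ω ω' t t' : ℝ} {A A' : ℕ → ℝ}

theorem Reduced.l1_sub (h : Reduced k ω t A) (h' : Reduced k ω' t' A') : L1 (A - A') := by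
  have := h.l1.sub h'.l1
  simpa using this

/-- Joint Lipschitz dependence on the amplitude and the frequency; the latter counts only in
proportion to the distance from the lowest mode, which solves the equations for every ω. -/
theorem Reduced.tsum_sub_le (hk : k = 2 ∨ k = 3) (hω : |ω - 1 / 6| ≤ 1 / 1000)
    (h : Reduced k ω t A) (h' : Reduced k ω' t' A') :
    ∑' n, |(A - A') n| ≤ 2 * |t - t'| + 200 * |ω - ω'| * ∑' n, |(A' - ConformalFlow.lowestMode) n| := by
  have lh := h.l1_sub h'
  obtain ⟨θ, mθ, tθ, hθ⟩ := nonlin_diff (by norm_num [rad]) gauge_one h.l1.majorant h'.l1.majorant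
    lh.majorant h.sum_le h'.sum_le (domBy_one_abs _) (domBy_one_abs _) (domBy_one_abs _)
  have key : ∀ n, |(A - A') n| ≤ |t - t'| * unitSeq k n +
      100 * (θ n + |ω - ω'| * |(A' - ConformalFlow.lowestMode) n|) := by
    intro n
    have h0 := mθ.1 n
    have h1 : 0 ≤ |ω - ω'| * |(A' - ConformalFlow.lowestMode) n| := by positivity
    by_cases hn : n = k
    · subst hn
      simp only [Pi.sub_apply, h.mode, h'.mode, unitSeq, if_true, mul_one] at *
      linarith
    have e0 : |t - t'| * unitSeq k n = 0 := by simp [unitSeq, hn]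
    rw [e0, zero_add]
    by_cases hi : n = 2 ∨ n = 3
    · rw [Pi.sub_apply, h.other n hi hn, h'.other n hi hn, sub_self, abs_zero]
      positivity
    rw [not_or] at hi
    have e1 := (rowEq_iff ω A n).1 (h.row n hn)
    have e2 := (rowEq_iff ω' A' n).1 (h'.row n hn)
    have e3 := linEig_sub ω ω' n
    refine abs_le_of_linEig_sq hω hi.1 hi.2 (y := -(nonlin A n - nonlin A' n) -
      n * ((n : ℝ) + 1) * (ω - ω') * (A' - ConformalFlow.lowestMode) n) ?_ ?_
    · simp only [Pi.sub_apply]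
      linear_combination e1 - e2 - (A' n - ConformalFlow.lowestMode n) * e3
    · have c0 : (0 : ℝ) ≤ n := n.cast_nonneg
      have b1 : |nonlin A n - nonlin A' n| ≤ ((n : ℝ) + 1) ^ 2 * θ n :=
        (hθ n).trans (by
          have : ((n : ℝ) + 1) * 1 ≤ ((n : ℝ) + 1) ^ 2 := by nlinarith
          gcongr)
      have b2 : |n * ((n : ℝ) + 1) * (ω - ω') * (A' - ConformalFlow.lowestMode) n| ≤
          ((n : ℝ) + 1) ^ 2 * (|ω - ω'| * |(A' - ConformalFlow.lowestMode) n|) := by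
        rw [abs_mul, abs_mul, abs_of_nonneg (by positivity : (0 : ℝ) ≤ n * ((n : ℝ) + 1)), mul_assoc]
        gcongr
        nlinarith
      calc _ ≤ |nonlin A n - nonlin A' n| +
          |n * ((n : ℝ) + 1) * (ω - ω') * (A' - ConformalFlow.lowestMode) n| := by
            refine (abs_sub _ _).trans ?_
            rw [abs_neg]
        _ ≤ _ := (add_le_add b1 b2).trans (mul_add _ _ _).ge
  have s1 := (summable_unitSeq k).mul_left |t - t'|
  have s2 : Summable fun n => |(A' - ConformalFlow.lowestMode) n| := h'.l1
  have s3 := (mθ.2.add (s2.mul_left |ω - ω'|)).mul_left 100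
  have := Summable.tsum_le_tsum key lh (s1.add s3)
  rw [s1.tsum_add s3, tsum_mul_left, tsum_mul_left, tsum_unitSeq, mθ.2.tsum_add (s2.mul_left _),
    tsum_mul_left] at this
  have h0 : 0 ≤ ∑' n, |(A - A') n| := tsum_nonneg fun n => abs_nonneg _
  unfold rad at tθ
  linarith

theorem Reduced.tsum_le (hk : k = 2 ∨ k = 3) (hω : |ω - 1 / 6| ≤ 1 / 1000) (h : Reduced k ω t A) :
    ∑' n, |(A - ConformalFlow.lowestMode) n| ≤ 2 * |t| := by
  have := h.tsum_sub_le hk hω (Reduced.lowestMode hk ω)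
  simpa using this

theorem Reduced.abs_nonlin_sub_le (hk : k = 2 ∨ k = 3) {ρ : ℝ} (hρ : ρ ≤ 1 / 3)
    (h : Reduced k ω t A) (h' : Reduced k ω' t' A')
    (s : ∑' n, |(A - ConformalFlow.lowestMode) n| ≤ ρ)
    (s' : ∑' n, |(A' - ConformalFlow.lowestMode) n| ≤ ρ) :
    |nonlin A k - nonlin A' k| ≤ 28 * ρ * ∑' n, |(A - A') n| := by
  obtain ⟨θ, mθ, tθ, hθ⟩ := nonlin_diff hρ gauge_one h.l1.majorant h'.l1.majorant
    (h.l1_sub h').majorant s s' (domBy_one_abs _) (domBy_one_abs _) (domBy_one_abs _)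
  have h1 := hθ k
  have h2 := mθ.2.le_tsum k fun i _ => mθ.1 i
  have h3 : (k : ℝ) ≤ 3 := by rcases hk with rfl | rfl <;> norm_num
  have := mθ.1 k
  rw [mul_one] at h1
  nlinarith

theorem Reduced.abs_nonlin_le (hk : k = 2 ∨ k = 3) (hω : |ω - 1 / 6| ≤ 1 / 1000) (ht : |t| ≤ rad / 4)
    (h : Reduced k ω t A) : |nonlin A k| ≤ 112 * t ^ 2 := by
  have h1 := h.tsum_le hk hω
  have h2 := h.abs_nonlin_sub_le hk (ρ := 2 * |t|) (by unfold rad at ht; linarith)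
    (Reduced.lowestMode hk ω) h1 (by simp)
  rw [nonlin_lowestMode, sub_zero] at h2
  rw [← sq_abs t]
  nlinarith [abs_nonneg t]

/-- The defect of the stationary equation of mode `k`. -/
def defect (k : ℕ) (ω : ℝ) (A : ℕ → ℝ) : ℝ := linEig ω k * A k + nonlin A k

theorem linEig_mode (hk : k = 2 ∨ k = 3) (ω : ℝ) :
    linEig ω k = k * ((k : ℝ) + 1) * (ω - 1 / 6) := by
  rcases hk with rfl | rfl <;> simp [linEig] <;> ring

theorem Reduced.abs_defect_sub_le (hk : k = 2 ∨ k = 3) (hω : |ω - 1 / 6| ≤ 1 / 1000)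
    (ht' : |t'| ≤ rad / 4) (h : Reduced k ω t A) (h' : Reduced k ω' t' A') :
    |defect k ω A - defect k ω' A'| ≤ |t - t'| + 12 * |ω - ω'| := by
  have b1 := h.abs_nonlin_sub_le hk (by norm_num [rad]) h' h.sum_le h'.sum_le
  have b2 := h.tsum_sub_le hk hω h'
  have b3 := h'.sum_le
  have e : defect k ω A - defect k ω' A' = linEig ω k * (t - t') +
      k * ((k : ℝ) + 1) * (ω - ω') * t' + (nonlin A k - nonlin A' k) := by
    rw [defect, defect, h.mode, h'.mode, ← linEig_sub]; ring
  rw [e]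
  have h3 : (k : ℝ) * (k + 1) ≤ 12 := by rcases hk with rfl | rfl <;> norm_num
  have h4 : (0 : ℝ) ≤ (k : ℝ) * (k + 1) := by positivity
  have c1 : |linEig ω k * (t - t')| ≤ 12 / 1000 * |t - t'| := by
    rw [abs_mul, linEig_mode hk, abs_mul, abs_of_nonneg h4]
    gcongr
    calc _ ≤ (12 : ℝ) * (1 / 1000) := by gcongr
      _ = _ := by norm_num
  have c2 : |k * ((k : ℝ) + 1) * (ω - ω') * t'| ≤ 12 * |ω - ω'| * (rad / 4) := by
    rw [abs_mul, abs_mul, abs_of_nonneg h4]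
    gcongr
  refine (abs_add_le _ _).trans ((add_le_add ((abs_add_le _ _).trans (add_le_add c1 c2)) b1).trans ?_)
  have := abs_nonneg (t - t')
  have := abs_nonneg (ω - ω')
  have b4 : |ω - ω'| * ∑' n, |(A' - ConformalFlow.lowestMode) n| ≤ |ω - ω'| * rad := by gcongr
  unfold rad at *
  linarith

/-- A vanishing defect is the one missing row. The inversion of the linearization leaves a factor n
+ 1 to spare, so even ∑ (n+1) |A_n - δ_n0| is at most 5 |t|: 4 |t| from the prescribed mode and the
rest from the nonlinear part. This sum dominates the energy norm. -/
theorem Reduced.mem_localStates (hk : k = 2 ∨ k = 3) (hω : |ω - 1 / 6| ≤ 1 / 1000)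
    (h : Reduced k ω t A) (h0 : defect k ω A = 0) {r : ℝ} (hr : 5 * |t| < r) :
    A ∈ localStates r ω := by
  have hlow : ConformalFlow.lowestMode k = 0 := (Reduced.lowestMode hk ω).mode
  have hst : IsStationary 1 ω A := fun n => by
    by_cases hn : n = k
    · subst hn
      refine (rowEq_iff ω A n).2 ?_
      rw [defect] at h0
      rw [hlow, sub_zero]
      linarith
    · exact h.row n hn
  obtain ⟨θ, mθ, tθ, hθ⟩ := nonlin_diff (by norm_num [rad]) gauge_one h.l1.majorant
    (Reduced.lowestMode hk ω).l1.majorant h.l1.majorant h.sum_le (Reduced.lowestMode hk ω).sum_le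
    (domBy_one_abs _) (domBy_one_abs _) (domBy_one_abs _)
  have key : ∀ n : ℕ, ((n : ℝ) + 1) * |(A - ConformalFlow.lowestMode) n| ≤
      4 * |t| * unitSeq k n + 100 * θ n := by
    intro n
    have t0 := mθ.1 n
    by_cases hn : n = k
    · subst hn
      have h3 : (n : ℝ) + 1 ≤ 4 := by rcases hk with rfl | rfl <;> norm_num
      rw [Pi.sub_apply, h.mode, hlow, sub_zero, unitSeq, if_pos rfl, mul_one]
      nlinarith [abs_nonneg t]
    have e0 : 4 * |t| * unitSeq k n = 0 := by simp [unitSeq, hn]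
    rw [e0, zero_add]
    by_cases hi : n = 2 ∨ n = 3
    · rw [Pi.sub_apply, h.other n hi hn, (Reduced.lowestMode hk ω).other n hi hn, sub_self, abs_zero]
      linarith
    rw [not_or] at hi
    have h1 := hθ n
    rw [nonlin_lowestMode, sub_zero, mul_one] at h1
    have e1 := (rowEq_iff ω A n).1 (h.row n hn)
    have hp : (0 : ℝ) < (n : ℝ) + 1 := by positivity
    have := abs_le_of_linEig_sq hω hi.1 hi.2 (θ := θ n / ((n : ℝ) + 1)) e1
      (by rw [abs_neg]; refine h1.trans (le_of_eq ?_); field_simp)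
    rw [Pi.sub_apply]
    calc _ ≤ ((n : ℝ) + 1) * (100 * (θ n / ((n : ℝ) + 1))) := by gcongr
      _ = _ := by field_simp
  have s1 := (summable_unitSeq k).mul_left (4 * |t|)
  have s2 := mθ.2.mul_left 100
  have s3 : Summable fun n : ℕ => ((n : ℝ) + 1) * |(A - ConformalFlow.lowestMode) n| :=
    Summable.of_nonneg_of_le (fun n => by positivity) key (s1.add s2)
  have hsum := s3.tsum_le_tsum key (s1.add s2)
  rw [s1.tsum_add s2, tsum_mul_left, tsum_mul_left, tsum_unitSeq] at hsum
  have ht := h.tsum_le hk hω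
  have hsum' : ∑' n : ℕ, ((n : ℝ) + 1) * |(A - ConformalFlow.lowestMode) n| ≤ 5 * |t| := by
    unfold rad at tθ
    linarith [abs_nonneg t]
  have hle : ∀ n : ℕ, (((n : ℝ) + 1) * (A - ConformalFlow.lowestMode) n) ^ 2 ≤
      5 * |t| * (((n : ℝ) + 1) * |(A - ConformalFlow.lowestMode) n|) := fun n => by
    have h1 := s3.le_tsum n fun i _ => by positivity
    have h2 : 0 ≤ ((n : ℝ) + 1) * |(A - ConformalFlow.lowestMode) n| := by positivity
    rw [mul_pow, ← sq_abs ((A - ConformalFlow.lowestMode) n), ← mul_pow, sq]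
    exact mul_le_mul_of_nonneg_right (h1.trans hsum') h2
  have s4 : Summable fun n : ℕ => (((n : ℝ) + 1) * (A - ConformalFlow.lowestMode) n) ^ 2 :=
    Summable.of_nonneg_of_le (fun n => sq_nonneg _) hle (s3.mul_left _)
  obtain ⟨u, hu⟩ : ∃ u : EnergySpace, seq u = A - ConformalFlow.lowestMode :=
    ⟨ofSeq _ ((memlp_energy_iff _).2 s4), seq_ofSeq _ _⟩
  refine mem_localStates_iff.2 ⟨u + unitVec 0, ?_, hst, ?_⟩
  · rw [seq_add, hu, seq_unitVec, lowestMode_eq, sub_add_cancel]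
  · rw [add_sub_cancel_right]
    refine lt_of_le_of_lt ?_ hr
    refine abs_le_of_sq_le_sq' ?_ (by positivity) |>.2
    rw [(norm_sq_eq_energy u).2, hu]
    simp only [← mul_pow]
    refine (s4.tsum_le_tsum hle (s3.mul_left _)).trans ?_
    rw [tsum_mul_left, sq]
    gcongr

end

theorem continuousOn_of_abs_sub_le {f : ℝ → ℝ} {s : Set ℝ} {K : ℝ} (hK : 0 ≤ K)
    (h : ∀ x ∈ s, ∀ y ∈ s, |f x - f y| ≤ K * |x - y|) : ContinuousOn f s :=
  (LipschitzOnWith.of_dist_le_mul (K := ⟨K, hK⟩) fun x hx y hy => h x hx y hy).continuousOn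

/-- The branches with one vanishing bifurcating amplitude. -/
theorem exists_pure_states : ∃ r₁ > 0, ∀ r > 0, r ≤ r₁ → ∃ δ > 0, ∀ ω : ℝ, 1 / 6 < ω → ω < 1 / 6 + δ →
    ∀ k, k = 2 ∨ k = 3 → ∀ τ : ℝ, τ = 1 ∨ τ = -1 → ∃ A ∈ localStates r ω, 0 < τ * A k ∧
      ∀ i, i = 2 ∨ i = 3 → i ≠ k → A i = 0 := by
  obtain ⟨r₁, r0, hlow⟩ := exists_omega_lower
  refine ⟨r₁, r0, fun r hr hr1 => ?_⟩
  obtain ⟨e₁, he⟩ : ∃ e₁, e₁ = min (r / 10) (1 / 10 ^ 5) := ⟨_, rfl⟩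
  have e0 : 0 < e₁ := by rw [he]; positivity
  have e1 : e₁ ≤ r / 10 := by rw [he]; exact min_le_left _ _
  have e2 : e₁ ≤ 1 / 10 ^ 5 := by rw [he]; exact min_le_right _ _
  have δ1 : e₁ ^ 2 / 24 ≤ 1 / 1000 := by nlinarith
  refine ⟨e₁ ^ 2 / 24, by positivity, fun ω h1 h2 k hk τ hτ => ?_⟩
  have τ2 : τ * τ = 1 := by rcases hτ with rfl | rfl <;> norm_num
  have τa : |τ| = 1 := by rcases hτ with rfl | rfl <;> norm_num
  have hF : ∀ ω t : ℝ, ∃ A, |ω - 1 / 6| ≤ 1 / 1000 → |t| ≤ rad / 4 → Reduced k ω t A := by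
    intro ω t
    by_cases h : |ω - 1 / 6| ≤ 1 / 1000 ∧ |t| ≤ rad / 4
    · obtain ⟨A, hA⟩ := exists_reduced_mode hk h.1 h.2
      exact ⟨A, fun _ _ => hA⟩
    -- A default value outside the admissible range, so that a function of all ω and t can be
    -- chosen.
    · exact ⟨0, fun h1 h2 => absurd ⟨h1, h2⟩ h⟩
  choose F hF using hF
  -- The signed defect at amplitude τ e behaves like k(k+1)(ω - 1/6) e for either sign τ.
  obtain ⟨g, hg⟩ : ∃ g : ℝ → ℝ → ℝ, ∀ ω e, g ω e = τ * defect k ω (F ω (τ * e)) :=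
    ⟨fun ω e => τ * defect k ω (F ω (τ * e)), fun _ _ => rfl⟩
  have hte : ∀ e, 0 ≤ e → |τ * e| = e := fun e h => by rw [abs_mul, τa, one_mul, abs_of_nonneg h]
  have hrad : ∀ e, 0 ≤ e → e ≤ e₁ → |τ * e| ≤ rad / 4 := fun e h h' => by
    rw [hte e h, rad]; linarith
  have hlip : ∀ ω ω' e e' : ℝ, |ω - 1 / 6| ≤ 1 / 1000 → |ω' - 1 / 6| ≤ 1 / 1000 → 0 ≤ e → e ≤ e₁ →
      0 ≤ e' → e' ≤ e₁ → |g ω e - g ω' e'| ≤ |e - e'| + 12 * |ω - ω'| := by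
    intro ω ω' e e' a a' b c b' c'
    have := (hF ω _ a (hrad e b c)).abs_defect_sub_le hk a (hrad e' b' c')
      (hF ω' _ a' (hrad e' b' c'))
    rw [hg, hg, ← mul_sub, abs_mul, τa, one_mul]
    rwa [← mul_sub, abs_mul, τa, one_mul] at this
  have hval : ∀ ω e : ℝ, |ω - 1 / 6| ≤ 1 / 1000 → 0 ≤ e → e ≤ e₁ →
      |g ω e - k * ((k : ℝ) + 1) * (ω - 1 / 6) * e| ≤ 112 * e ^ 2 := by
    intro ω e a b c
    have hR := hF ω _ a (hrad e b c)
    have := hR.abs_nonlin_le hk a (hrad e b c)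
    have e' : g ω e - k * ((k : ℝ) + 1) * (ω - 1 / 6) * e = τ * nonlin (F ω (τ * e)) k := by
      rw [hg, defect, hR.mode, linEig_mode hk]
      linear_combination (k * ((k : ℝ) + 1) * (ω - 1 / 6) * e) * τ2
    rw [e', abs_mul, τa, one_mul]
    calc _ ≤ _ := this
      _ = 112 * (τ * τ) * e ^ 2 := by ring
      _ = _ := by rw [τ2, mul_one]
  have hzero : ∀ ω e : ℝ, |ω - 1 / 6| ≤ 1 / 1000 → 0 ≤ e → e ≤ e₁ → g ω e = 0 →
      F ω (τ * e) ∈ localStates r ω := by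
    intro ω e a b c h
    rw [hg] at h
    have τ0 : τ ≠ 0 := fun h => by rw [h] at τ2; norm_num at τ2
    refine (hF ω _ a (hrad e b c)).mem_localStates hk a ((mul_eq_zero.1 h).resolve_left τ0) ?_
    rw [hte e b]; linarith
  have k6 : (6 : ℝ) ≤ k * ((k : ℝ) + 1) := by rcases hk with rfl | rfl <;> norm_num
  -- A zero would be a local state of amplitude e₁, whose frequency exceeds 1/6 + e₁²/24 by
  -- `exists_omega_lower`. So no expansion of the defect beyond first order is needed here.
  have hne : ∀ ω : ℝ, |ω - 1 / 6| ≤ 1 / 1000 → ω ≤ 1 / 6 + e₁ ^ 2 / 24 → g ω e₁ ≠ 0 := by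
    intro ω a b h
    have hA := hzero ω e₁ a e0.le le_rfl h
    have hR := hF ω _ a (hrad e₁ e0.le le_rfl)
    have hm := hR.mode
    have hl := hlow r hr1 ω a _ hA
    have τ0 : τ * e₁ ≠ 0 := fun h => by
      have := hte e₁ e0.le
      rw [h, abs_zero] at this
      exact e0.ne this
    have sq : (τ * e₁) ^ 2 = e₁ ^ 2 := by linear_combination e₁ ^ 2 * τ2
    rcases hk with rfl | rfl
    · have := hl.1 (by rwa [hm])
      rw [hm, sq] at this
      linarith
    · have := hl.2 (hR.other 2 (Or.inl rfl) (by norm_num)) (by rwa [hm])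
      rw [hm, sq] at this
      linarith
  have hω : |ω - 1 / 6| ≤ 1 / 1000 := by rw [abs_le]; constructor <;> linarith
  -- At amplitude e₁ the defect is negative for ω = 1/6 - 1/1000 and has no zero up to ω, so it
  -- stays negative.
  have hneg : g ω e₁ < 0 := by
    by_contra hcon
    have hr : ∀ x ∈ Set.Icc (1 / 6 - 1 / 1000) ω, |x - 1 / 6| ≤ 1 / 1000 := fun x hx => by
      rw [abs_le]; constructor <;> linarith [hx.1, hx.2]
    have hc : ContinuousOn (fun x => g x e₁) (Set.Icc (1 / 6 - 1 / 1000) ω) := by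
      refine continuousOn_of_abs_sub_le (K := 12) (by norm_num) fun x hx y hy => ?_
      have := hlip x y e₁ e₁ (hr x hx) (hr y hy) e0.le le_rfl e0.le le_rfl
      rwa [sub_self, abs_zero, zero_add] at this
    have hleft : g (1 / 6 - 1 / 1000) e₁ < 0 := by
      have := (abs_le.1 (hval (1 / 6 - 1 / 1000) e₁ (by norm_num) e0.le le_rfl)).2
      nlinarith
    obtain ⟨x, hx, h0⟩ := intermediate_value_Icc (by linarith) hc ⟨hleft.le, not_lt.1 hcon⟩
    exact hne x (hr x hx) (by linarith [hx.2]) h0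
  -- At an amplitude well below ω - 1/6 the linear term, at least 600 e₂², beats the bound 112 e₂²
  -- on the nonlinear part, so the defect is nonnegative there; a zero lies between e₂ and e₁.
  obtain ⟨e₂, he₂⟩ : ∃ e₂, e₂ = min e₁ ((ω - 1 / 6) / 100) := ⟨_, rfl⟩
  have f0 : 0 < e₂ := by rw [he₂]; exact lt_min e0 (by linarith)
  have f1 : e₂ ≤ e₁ := by rw [he₂]; exact min_le_left _ _
  have f2 : e₂ ≤ (ω - 1 / 6) / 100 := by rw [he₂]; exact min_le_right _ _
  have hpos : 0 ≤ g ω e₂ := by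
    have := (abs_le.1 (hval ω e₂ hω f0.le f1)).1
    have h6 : 6 * (100 * e₂) * e₂ ≤ k * ((k : ℝ) + 1) * (ω - 1 / 6) * e₂ := by
      gcongr; linarith
    nlinarith
  have hc : ContinuousOn (g ω) (Set.Icc e₂ e₁) := by
    refine continuousOn_of_abs_sub_le (K := 1) zero_le_one fun x hx y hy => ?_
    have := hlip ω ω x y hω hω (f0.le.trans hx.1) hx.2 (f0.le.trans hy.1) hy.2
    rwa [sub_self, abs_zero, mul_zero, add_zero, ← one_mul |x - y|] at this
  obtain ⟨e, he, h0⟩ := intermediate_value_Icc' f1 hc ⟨hneg.le, hpos⟩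
  have g0 : 0 < e := f0.trans_le he.1
  have hR := hF ω _ hω (hrad e g0.le he.2)
  refine ⟨F ω (τ * e), hzero ω e hω g0.le he.2 h0, ?_, hR.other⟩
  rw [hR.mode, ← mul_assoc, τ2, one_mul]
  exact g0

end

end ConformalFlow

/-! ### The explicit pair states -/

namespace ConformalFlow

noncomputable section

open Filter Topology

/-- The coupling counts the ways to write k = x + y with x ≤ n and y ≤ j. -/
theorem coupling_eq_card {n j k : ℕ} (hk : k < n + j + 1) :
    coupling n j k (n + j - k) =
      ((Finset.range (n + 1)).filter fun x => x ≤ k ∧ k < x + (j + 1)).card := by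
  have : (Finset.range (n + 1)).filter (fun x => x ≤ k ∧ k < x + (j + 1)) =
      Finset.Ico (k - j) (min n k + 1) := by
    ext x
    simp only [Finset.mem_filter, Finset.mem_range, Finset.mem_Ico]
    omega
  rw [this, Nat.card_Ico, coupling]
  omega

/-- Sums against the interaction coefficients are sums over a rectangle. -/
theorem sum_coupling_mul (n j : ℕ) (f : ℕ → ℝ) :
    ∑ k ∈ Finset.range (n + j + 1), (coupling n j k (n + j - k) : ℝ) * f k =
      ∑ x ∈ Finset.range (n + 1), ∑ y ∈ Finset.range (j + 1), f (x + y) := by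
  have h1 : ∀ k ∈ Finset.range (n + j + 1), (coupling n j k (n + j - k) : ℝ) * f k =
      ∑ x ∈ Finset.range (n + 1), if x ≤ k ∧ k < x + (j + 1) then f k else 0 := fun k hk => by
    rw [coupling_eq_card (Finset.mem_range.1 hk), ← Finset.sum_filter, Finset.sum_const,
      nsmul_eq_mul]
  rw [Finset.sum_congr rfl h1, Finset.sum_comm]
  refine Finset.sum_congr rfl fun x hx => ?_
  rw [← Finset.sum_filter]
  have : (Finset.range (n + j + 1)).filter (fun k => x ≤ k ∧ k < x + (j + 1)) =
      Finset.Ico x (x + (j + 1)) := by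
    ext k
    simp only [Finset.mem_filter, Finset.mem_range, Finset.mem_Ico] at *
    omega
  rw [this, Finset.sum_Ico_eq_sum_range, Nat.add_sub_cancel_left]

theorem sum_range_quadratic (α β γ : ℝ) (m : ℕ) :
    ∑ y ∈ Finset.range m, (α + β * y + γ * (y : ℝ) ^ 2) =
      α * m + β * (m * (m - 1) / 2) + γ * (m * (m - 1) * (2 * m - 1) / 6) := by
  induction m with
  | zero => simp
  | succ m ih => rw [Finset.sum_range_succ, ih]; push_cast; ring

/-- For A_n = (b + a n) p^n the product A_k A_(n+j-k) is p^(n+j) times the quadratic in k summed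
here. Over the rectangle it sums to (n+1)(j+1) times a polynomial, and this is why the ansatz
closes. -/
theorem sum_coupling_pair (a b : ℝ) (n j : ℕ) :
    ∑ k ∈ Finset.range (n + j + 1), (coupling n j k (n + j - k) : ℝ) *
      (b ^ 2 + a * b * (n + j) + a ^ 2 * (k * (n + j - k))) =
      ((n : ℝ) + 1) * (j + 1) * (b ^ 2 + a * b * (n + j) +
        a ^ 2 / 6 * ((n : ℝ) ^ 2 + j ^ 2 + 3 * n * j - n - j)) := by
  rw [sum_coupling_mul n j fun k : ℕ => b ^ 2 + a * b * (n + j) + a ^ 2 * (k * (n + j - k))]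
  have h1 : ∀ x ∈ Finset.range (n + 1), ∑ y ∈ Finset.range (j + 1),
      (b ^ 2 + a * b * (n + j) + a ^ 2 * (((x + y : ℕ) : ℝ) * (n + j - (x + y : ℕ)))) =
      ((b ^ 2 + a * b * (n + j)) * (j + 1) + a ^ 2 * (n + j) * (j * (j + 1) / 2)
        - a ^ 2 * (j * (j + 1) * (2 * j + 1) / 6)) +
      (a ^ 2 * (n + j) * (j + 1) - a ^ 2 * (j * (j + 1))) * x + (-a ^ 2 * (j + 1)) * (x : ℝ) ^ 2 := by
    intro x _
    have := sum_range_quadratic (b ^ 2 + a * b * (n + j) + a ^ 2 * (x * (n + j - x)))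
      (a ^ 2 * (n + j - 2 * x)) (-a ^ 2) (j + 1)
    push_cast at this ⊢
    rw [show ∑ y ∈ Finset.range (j + 1),
      (b ^ 2 + a * b * (n + j) + a ^ 2 * (((x : ℝ) + y) * (n + j - (x + y)))) = _ from
      (Finset.sum_congr rfl fun y _ => by ring).trans this]
    ring
  rw [Finset.sum_congr rfl h1, sum_range_quadratic]
  push_cast
  ring

/-- Expand j + 1 times the cubic in rising factorials, that is in binomials (j + k choose k), whose
generating functions are 1/(1-q)^(k+1). -/
theorem hasSum_cubic {q : ℝ} (h0 : 0 ≤ q) (h1 : q < 1) (p₀ p₁ p₂ p₃ : ℝ) :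
    HasSum (fun j : ℕ => ((j : ℝ) + 1) * (p₀ + p₁ * j + p₂ * (j : ℝ) ^ 2 + p₃ * (j : ℝ) ^ 3) * q ^ j)
      ((p₀ - 24 * p₃ - 6 * (p₂ - 9 * p₃) - 2 * (p₁ - 26 * p₃ - 5 * (p₂ - 9 * p₃))) / (1 - q) ^ 2 +
        2 * (p₁ - 26 * p₃ - 5 * (p₂ - 9 * p₃)) / (1 - q) ^ 3 + 6 * (p₂ - 9 * p₃) / (1 - q) ^ 4 +
        24 * p₃ / (1 - q) ^ 5) := by
  have hq : ‖q‖ < 1 := by rwa [Real.norm_of_nonneg h0]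
  have hs := fun k => hasSum_choose_mul_geometric_of_norm_lt_one k hq
  have hc : ∀ j k : ℕ, (k.factorial : ℝ) * ((j + k).choose k : ℕ) = ((j + 1).ascFactorial k : ℕ) := by
    intro j k
    rw [Nat.ascFactorial_eq_factorial_mul_choose]
    push_cast
    rfl
  have h := ((((hs 1).mul_left (p₀ - 24 * p₃ - 6 * (p₂ - 9 * p₃) -
    2 * (p₁ - 26 * p₃ - 5 * (p₂ - 9 * p₃)))).add ((hs 2).mul_left
    (2 * (p₁ - 26 * p₃ - 5 * (p₂ - 9 * p₃))))).add ((hs 3).mul_left (6 * (p₂ - 9 * p₃)))).add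
    ((hs 4).mul_left (24 * p₃))
  norm_num only [mul_one_div] at h
  refine Eq.subst (motive := fun f => HasSum f _) (funext fun j => ?_) h
  have c1 := hc j 1
  have c2 := hc j 2
  have c3 := hc j 3
  have c4 := hc j 4
  simp only [Nat.ascFactorial_succ, Nat.ascFactorial_zero, Nat.factorial] at c1 c2 c3 c4
  push_cast at c1 c2 c3 c4
  linear_combination (q ^ j * (p₀ - 24 * p₃ - 6 * (p₂ - 9 * p₃) -
    2 * (p₁ - 26 * p₃ - 5 * (p₂ - 9 * p₃)))) * c1 + q ^ j * (p₁ - 26 * p₃ - 5 * (p₂ - 9 * p₃)) * c2 +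
    q ^ j * (p₂ - 9 * p₃) * c3 + q ^ j * p₃ * c4

/-- With the denominators cleared by (1-q)⁵, the two sides differ by a multiple of R² - (1 - 14 q +
q²). -/
theorem pair_identity {c q R lam ω a b : ℝ} (n : ℝ) (hu : 1 - q ≠ 0) (hR : R ^ 2 = 1 - 14 * q + q ^ 2)
    (hl : lam = c ^ 2 / 6 * ((3 - 4 * q) / (1 - q) + (3 + 4 * q) * R / (1 - q) ^ 2))
    (ho : ω = c ^ 2 / 12 * ((1 + q + R) / (1 - q))) (ha : a = c * (1 - q))
    (hb : b = -c / 2 * (1 + 5 * q + R)) {c₀ c₁ c₂ p₀ p₁ p₂ p₃ : ℝ}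
    (h0 : c₀ = b ^ 2 + a * b * n + a ^ 2 / 6 * (n ^ 2 - n)) (h1 : c₁ = a * b + a ^ 2 / 6 * (3 * n - 1))
    (h2 : c₂ = a ^ 2 / 6) (hp0 : p₀ = b * c₀) (hp1 : p₁ = a * c₀ + b * c₁) (hp2 : p₂ = a * c₁ + b * c₂)
    (hp3 : p₃ = a * c₂) :
    (p₀ - 24 * p₃ - 6 * (p₂ - 9 * p₃) - 2 * (p₁ - 26 * p₃ - 5 * (p₂ - 9 * p₃))) / (1 - q) ^ 2 +
        2 * (p₁ - 26 * p₃ - 5 * (p₂ - 9 * p₃)) / (1 - q) ^ 3 + 6 * (p₂ - 9 * p₃) / (1 - q) ^ 4 +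
        24 * p₃ / (1 - q) ^ 5 = (lam - n * ω) * (b + a * n) := by
  have hl' : lam * (1 - q) ^ 2 = c ^ 2 / 6 * ((3 - 4 * q) * (1 - q) + (3 + 4 * q) * R) := by
    rw [hl]; field_simp
  have ho' : ω * (1 - q) = c ^ 2 / 12 * (1 + q + R) := by rw [ho]; field_simp
  refine mul_right_cancel₀ (pow_ne_zero 5 hu) ?_
  have hs : ∀ x y z w : ℝ, (x / (1 - q) ^ 2 + y / (1 - q) ^ 3 + z / (1 - q) ^ 4 + w / (1 - q) ^ 5) *
      (1 - q) ^ 5 = x * (1 - q) ^ 3 + y * (1 - q) ^ 2 + z * (1 - q) + w := fun x y z w => by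
    field_simp
  rw [hs]
  have e : (lam - n * ω) * (b + a * n) * (1 - q) ^ 5 = ((1 - q) ^ 3 *
      (c ^ 2 / 6 * ((3 - 4 * q) * (1 - q) + (3 + 4 * q) * R)) - n * (1 - q) ^ 4 *
      (c ^ 2 / 12 * (1 + q + R))) * (b + a * n) := by
    rw [← hl', ← ho']; ring
  rw [e]
  subst hp0 hp1 hp2 hp3 h0 h1 h2 ha hb
  linear_combination (-(c ^ 3 * (1 - q) ^ 3 * (1 / 8 * R + 1 / 8 + 13 / 24 * q -
    5 / 24 * n * (1 - q)))) * hR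

/-- The explicit pair states are stationary. -/
theorem isStationary_pairState (c : ℝ) {p : ℝ} (h0 : 0 ≤ p) (h1 : p ≤ 1 / 4) :
    IsStationary (pairLambda c p) (pairOmega c p) (pairState c p) := by
  have hq0 : 0 ≤ p ^ 2 := sq_nonneg p
  have hq1 : p ^ 2 ≤ 1 / 16 := by nlinarith
  have hu : 1 - p ^ 2 ≠ 0 := by linarith
  have hR : pairRoot p ^ 2 = 1 - 14 * p ^ 2 + (p ^ 2) ^ 2 := by
    rw [pairRoot, Real.sq_sqrt] <;> nlinarith
  obtain ⟨a, ha⟩ : ∃ a, a = c * (1 - p ^ 2) := ⟨_, rfl⟩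
  obtain ⟨b, hb⟩ : ∃ b, b = -c / 2 * (1 + 5 * p ^ 2 + pairRoot p) := ⟨_, rfl⟩
  have hA : ∀ n, pairState c p n = (b + a * n) * p ^ n := fun n => by
    rw [pairState, ha, hb]; ring
  intro n
  obtain ⟨c₀, hc0⟩ : ∃ c₀, c₀ = b ^ 2 + a * b * n + a ^ 2 / 6 * ((n : ℝ) ^ 2 - n) := ⟨_, rfl⟩
  obtain ⟨c₁, hc1⟩ : ∃ c₁, c₁ = a * b + a ^ 2 / 6 * (3 * (n : ℝ) - 1) := ⟨_, rfl⟩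
  have hid := pair_identity (n : ℝ) hu hR (lam := pairLambda c p) (ω := pairOmega c p) rfl rfl ha hb
    hc0 hc1 rfl rfl rfl rfl rfl
  have hsum := (hasSum_cubic hq0 (by linarith : p ^ 2 < 1) (b * c₀) (a * c₀ + b * c₁)
    (a * c₁ + b * (a ^ 2 / 6)) (a * (a ^ 2 / 6))).mul_left (((n : ℝ) + 1) * p ^ n)
  rw [hid] at hsum
  have hrow : ∀ j : ℕ, ∑ k ∈ Finset.range (n + j + 1), (coupling n j k (n + j - k) : ℝ) *
      pairState c p j * pairState c p k * pairState c p (n + j - k) =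
      (b + a * j) * p ^ j * p ^ (n + j) * (((n : ℝ) + 1) * (j + 1) * (b ^ 2 + a * b * (n + j) +
        a ^ 2 / 6 * ((n : ℝ) ^ 2 + j ^ 2 + 3 * n * j - n - j))) := by
    intro j
    rw [← sum_coupling_pair, Finset.mul_sum]
    refine Finset.sum_congr rfl fun k hk => ?_
    have hk' : k ≤ n + j := Nat.lt_succ_iff.1 (Finset.mem_range.1 hk)
    rw [hA, hA, hA, Nat.cast_sub hk']
    have e : p ^ (n + j) = p ^ k * p ^ (n + j - k) := by rw [← pow_add, Nat.add_sub_cancel' hk']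
    rw [e]
    push_cast
    ring
  rw [tsum_congr hrow, hA]
  refine Eq.trans ?_ (Eq.trans hsum.tsum_eq.symm (tsum_congr fun j => ?_))
  · ring
  · rw [pow_add, hc0, hc1]; ring

/-- The pair states with `λ = 1`. -/
def pairScale (p : ℝ) : ℝ := -(1 / Real.sqrt (pairLambda 1 p))

theorem pairLambda_one_pos {p : ℝ} (h0 : 0 ≤ p) (h1 : p ≤ 1 / 4) : 0 < pairLambda 1 p := by
  have hq : p ^ 2 ≤ 1 / 16 := by nlinarith
  have hR : 0 ≤ pairRoot p := Real.sqrt_nonneg _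
  have hu : 0 < 1 - p ^ 2 := by linarith
  have hv : 0 < 3 - 4 * p ^ 2 := by linarith
  rw [pairLambda]
  positivity

theorem pairScale_sq {p : ℝ} (h0 : 0 ≤ p) (h1 : p ≤ 1 / 4) : pairScale p ^ 2 = 1 / pairLambda 1 p := by
  rw [pairScale, neg_sq, div_pow, Real.sq_sqrt (pairLambda_one_pos h0 h1).le, one_pow]

theorem pairScale_neg {p : ℝ} (h0 : 0 ≤ p) (h1 : p ≤ 1 / 4) : pairScale p < 0 := by
  have := Real.sqrt_pos.2 (pairLambda_one_pos h0 h1)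
  rw [pairScale, neg_lt_zero]
  positivity

theorem pairLambda_pairScale {p : ℝ} (h0 : 0 ≤ p) (h1 : p ≤ 1 / 4) :
    pairLambda (pairScale p) p = 1 := by
  have e : pairLambda (pairScale p) p = pairScale p ^ 2 * pairLambda 1 p := by
    rw [pairLambda, pairLambda]; ring
  rw [e, pairScale_sq h0 h1, one_div_mul_cancel (pairLambda_one_pos h0 h1).ne']

theorem pairRoot_zero : pairRoot 0 = 1 := by simp [pairRoot]

/-- The factor c is taken negative because the bracket of the pair state tends to -1 in mode 0, so
that A₀ tends to +1. -/
theorem pairScale_zero : pairScale 0 = -1 := by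
  simp [pairScale, pairLambda, pairRoot_zero]; norm_num

theorem pairOmega_zero : pairOmega (pairScale 0) 0 = 1 / 6 := by
  simp [pairOmega, pairScale_zero, pairRoot_zero]; norm_num

theorem continuous_pairRoot : Continuous pairRoot := by
  unfold pairRoot
  fun_prop

theorem continuousOn_pairScale : ContinuousOn pairScale (Set.Icc 0 (1 / 4)) := by
  have hu : ∀ p ∈ Set.Icc (0 : ℝ) (1 / 4), 1 - p ^ 2 ≠ 0 := fun p hp => by nlinarith [hp.1, hp.2]
  have hc := continuous_pairRoot.continuousOn (s := Set.Icc (0 : ℝ) (1 / 4))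
  have hl : ContinuousOn (fun p => pairLambda 1 p) (Set.Icc 0 (1 / 4)) := by
    unfold pairLambda
    refine continuousOn_const.mul (ContinuousOn.add (ContinuousOn.div (by fun_prop) (by fun_prop) hu)
      (ContinuousOn.div (ContinuousOn.mul (by fun_prop) hc) (by fun_prop)
        fun p hp => pow_ne_zero 2 (hu p hp)))
  unfold pairScale
  exact (ContinuousOn.div continuousOn_const hl.sqrt fun p hp =>
    (Real.sqrt_pos.2 (pairLambda_one_pos hp.1 hp.2)).ne').neg

theorem continuousOn_pairOmega :
    ContinuousOn (fun p => pairOmega (pairScale p) p) (Set.Icc 0 (1 / 4)) := by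
  have hu : ∀ p ∈ Set.Icc (0 : ℝ) (1 / 4), 1 - p ^ 2 ≠ 0 := fun p hp => by nlinarith [hp.1, hp.2]
  have hc := continuous_pairRoot.continuousOn (s := Set.Icc (0 : ℝ) (1 / 4))
  unfold pairOmega
  exact ((continuousOn_pairScale.pow 2).div_const 12).mul
    (ContinuousOn.div (ContinuousOn.add (by fun_prop) hc) (by fun_prop) hu)

theorem tendsto_of_continuousOn {f : ℝ → ℝ} (hf : ContinuousOn f (Set.Icc 0 (1 / 4))) :
    Tendsto f (𝓝[>] 0) (𝓝 (f 0)) := by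
  have h := hf 0 (by norm_num)
  refine h.tendsto.mono_left ?_
  rw [← nhdsWithin_Ioc_eq_nhdsGT (show (0 : ℝ) < 1 / 4 by norm_num)]
  exact nhdsWithin_mono _ Set.Ioc_subset_Icc_self

/-- The factor of `p^n` in the pair state. -/
def pairFactor (p : ℝ) (n : ℕ) : ℝ :=
  pairScale p * ((1 - p ^ 2) * n - 1 / 2 * (1 + 5 * p ^ 2 + pairRoot p))

theorem pairState_eq (p : ℝ) (n : ℕ) : pairState (pairScale p) p n = pairFactor p n * p ^ n := rfl

/-- In particular A₂ ≈ -p² and A₃ ≈ -2p³: both are nonzero, and A₃² ≈ -4 A₂³ as branch (iii)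
requires. -/
theorem tendsto_pairFactor (n : ℕ) : Tendsto (fun p => pairFactor p n) (𝓝[>] 0) (𝓝 (1 - n)) := by
  have hc := continuous_pairRoot.continuousOn (s := Set.Icc (0 : ℝ) (1 / 4))
  have h : ContinuousOn (fun p => pairFactor p n) (Set.Icc 0 (1 / 4)) :=
    continuousOn_pairScale.mul (ContinuousOn.sub (by fun_prop)
      (continuousOn_const.mul (ContinuousOn.add (by fun_prop) hc)))
  have := tendsto_of_continuousOn h
  convert this using 2
  rw [pairFactor, pairScale_zero, pairRoot_zero]
  ring

theorem abs_pairFactor_le {p : ℝ} (h0 : 0 ≤ p) (h1 : p ≤ 1 / 4) (hs : |pairScale p| ≤ 2) (n : ℕ) :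
    |pairFactor p n| ≤ 4 * ((n : ℝ) + 1) := by
  have hq : p ^ 2 ≤ 1 / 16 := by nlinarith
  have hq0 := sq_nonneg p
  have hR : 0 ≤ pairRoot p := Real.sqrt_nonneg _
  have hR1 : pairRoot p ≤ 1 := by
    rw [pairRoot, Real.sqrt_le_iff]
    exact ⟨zero_le_one, by nlinarith⟩
  have hn : (0 : ℝ) ≤ n := n.cast_nonneg
  rw [pairFactor, abs_mul]
  have : |(1 - p ^ 2) * n - 1 / 2 * (1 + 5 * p ^ 2 + pairRoot p)| ≤ 2 * ((n : ℝ) + 1) := by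
    rw [abs_le]
    constructor <;> nlinarith
  calc _ ≤ 2 * (2 * ((n : ℝ) + 1)) := by gcongr
    _ = _ := by ring

theorem summable_pairMajorant : Summable fun n : ℕ => (16 * ((n : ℝ) + 1) ^ 2 * (1 / 4) ^ n) ^ 2 := by
  have h := (summable_nat_add_iff 1).2 (summable_pow_mul_geometric_of_norm_lt_one 4
    (r := (1 / 16 : ℝ)) (by norm_num))
  refine (h.mul_left (256 * 16)).congr fun n => ?_
  push_cast
  rw [mul_pow, mul_pow, ← pow_mul, ← pow_mul, mul_comm n 2, pow_mul (1 / 4 : ℝ), pow_succ]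
  norm_num
  ring

/-- The pair states approach the lowest mode. -/
theorem eventually_pairState_near {r : ℝ} (hr : 0 < r) : ∀ᶠ p in 𝓝[>] (0 : ℝ),
    pairState (pairScale p) p ∈ localStates r (pairOmega (pairScale p) p) := by
  obtain ⟨G, hG⟩ : ∃ G, G = ∑' n : ℕ, (16 * ((n : ℝ) + 1) ^ 2 * (1 / 4) ^ n) ^ 2 := ⟨_, rfl⟩
  have hlim : Tendsto (fun p => (pairFactor p 0 - 1) ^ 2 + p ^ 2 * G) (𝓝[>] 0) (𝓝 0) := by
    have h1 := ((tendsto_pairFactor 0).sub_const 1).pow 2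
    have h2 : Tendsto (fun p : ℝ => p ^ 2 * G) (𝓝[>] 0) (𝓝 (0 ^ 2 * G)) :=
      (Continuous.tendsto (by fun_prop) 0).mono_left nhdsWithin_le_nhds
    simpa using h1.add h2
  have hsc : Tendsto pairScale (𝓝[>] 0) (𝓝 (-1)) := by
    simpa [pairScale_zero] using tendsto_of_continuousOn continuousOn_pairScale
  have hp : ∀ᶠ p in 𝓝[>] (0 : ℝ), p ∈ Set.Ioc (0 : ℝ) (1 / 4) := Ioc_mem_nhdsGT (by norm_num)
  filter_upwards [hlim.eventually_lt_const (show 0 < r ^ 2 by positivity),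
    hsc.abs.eventually_lt_const (show |(-1 : ℝ)| < 2 by norm_num), hp] with p b1 b2 b3
  have p0 := b3.1.le
  have hle : ∀ n : ℕ, (((n : ℝ) + 1) * (pairState (pairScale p) p - lowestMode) n) ^ 2 ≤
      (pairFactor p 0 - 1) ^ 2 * unitSeq 0 n + p ^ 2 * (16 * ((n : ℝ) + 1) ^ 2 * (1 / 4) ^ n) ^ 2 := by
    intro n
    rw [Pi.sub_apply, pairState_eq]
    rcases n with _ | m
    · simp [unitSeq, lowestMode]
      positivity
    · have hf := abs_pairFactor_le p0 b3.2 b2.le (m + 1)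
      have hpm : p ^ (m + 1) ≤ p * (4 * (1 / 4) ^ (m + 1)) := by
        rw [pow_succ', pow_succ (1 / 4 : ℝ) m]
        have : p ^ m ≤ (1 / 4) ^ m := pow_le_pow_left₀ p0 b3.2 m
        nlinarith
      have hp0 : 0 ≤ p ^ (m + 1) := pow_nonneg p0 _
      simp only [unitSeq, lowestMode, Nat.succ_ne_zero, if_false, mul_zero, zero_add, sub_zero]
      rw [← mul_pow, sq_le_sq, abs_mul, abs_mul, abs_of_nonneg hp0,
        abs_of_nonneg (by positivity : (0 : ℝ) ≤ ((m + 1 : ℕ) : ℝ) + 1),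
        abs_of_nonneg (by positivity : 0 ≤ p * (16 * (((m + 1 : ℕ) : ℝ) + 1) ^ 2 * (1 / 4) ^ (m + 1)))]
      calc _ ≤ (((m + 1 : ℕ) : ℝ) + 1) * (4 * (((m + 1 : ℕ) : ℝ) + 1) * (p * (4 * (1 / 4) ^ (m + 1)))) := by
            gcongr
        _ = _ := by ring
  have s1 := (summable_unitSeq 0).mul_left ((pairFactor p 0 - 1) ^ 2)
  have s2 := summable_pairMajorant.mul_left (p ^ 2)
  have s3 : Summable fun n : ℕ => (((n : ℝ) + 1) * (pairState (pairScale p) p - lowestMode) n) ^ 2 :=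
    Summable.of_nonneg_of_le (fun n => sq_nonneg _) hle (s1.add s2)
  have hsum := s3.tsum_le_tsum hle (s1.add s2)
  rw [s1.tsum_add s2, tsum_mul_left, tsum_mul_left, tsum_unitSeq, mul_one, ← hG] at hsum
  obtain ⟨u, hu⟩ : ∃ u : EnergySpace, seq u = pairState (pairScale p) p - lowestMode :=
    ⟨ofSeq _ ((memlp_energy_iff _).2 s3), seq_ofSeq _ _⟩
  have hst := isStationary_pairState (pairScale p) p0 b3.2
  rw [pairLambda_pairScale p0 b3.2] at hst
  refine mem_localStates_iff.2 ⟨u + unitVec 0, ?_, hst, ?_⟩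
  · rw [seq_add, hu, seq_unitVec, lowestMode_eq, sub_add_cancel]
  · rw [add_sub_cancel_right]
    refine lt_of_pow_lt_pow_left₀ 2 hr.le (lt_of_le_of_lt ?_ b1)
    rw [(norm_sq_eq_energy u).2, hu]
    simp only [← mul_pow]
    exact hsum

/-- The explicit pair states belong to the third branch. -/
theorem eventually_pairState_mem {r : ℝ} (hr : 0 < r) : ∀ᶠ p in 𝓝[>] (0 : ℝ),
    pairState (pairScale p) p ∈ branchThree r (pairOmega (pairScale p) p) := by
  have h2 := tendsto_pairFactor 2
  have h3 := tendsto_pairFactor 3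
  filter_upwards [eventually_pairState_near hr, h2.eventually_ne (by norm_num : (1 - (2 : ℕ) : ℝ) ≠ 0),
    h3.eventually_ne (by norm_num : (1 - (3 : ℕ) : ℝ) ≠ 0), self_mem_nhdsWithin] with p a b c d
  have : p ≠ 0 := ne_of_gt d
  exact ⟨a, mul_ne_zero b (pow_ne_zero _ this), mul_ne_zero c (pow_ne_zero _ this)⟩

/-- The frequency of the pair states stays within `d` of `1/6`, and they fill the third branch. -/
theorem exists_pair_states : ∃ r₁ > 0, ∀ r > 0, r ≤ r₁ → (∀ d > 0, ∃ p₀ > 0, ∀ p, 0 < p → p < p₀ →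
      ∃ c < 0, pairLambda c p = 1 ∧ pairOmega c p ≠ 1 / 6 ∧ |pairOmega c p - 1 / 6| < d ∧
        pairState c p ∈ branchThree r (pairOmega c p)) ∧
    ∃ δ > 0, ∀ ω, 1 / 6 < ω → ω < 1 / 6 + δ → (branchThree r ω).Nonempty := by
  obtain ⟨r₁, r0, hlow⟩ := exists_omega_lower
  have hω := tendsto_of_continuousOn continuousOn_pairOmega
  rw [pairOmega_zero] at hω
  have key : ∀ r > 0, r ≤ r₁ → ∀ d > 0, ∃ p₀ > 0, p₀ ≤ 1 / 4 ∧ ∀ p, 0 < p → p < p₀ →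
      1 / 6 < pairOmega (pairScale p) p ∧ |pairOmega (pairScale p) p - 1 / 6| < d ∧
        pairState (pairScale p) p ∈ branchThree r (pairOmega (pairScale p) p) := by
    intro r hr hr1 d hd
    have h1 : ∀ᶠ p in 𝓝[>] (0 : ℝ), |pairOmega (pairScale p) p - 1 / 6| < min d (1 / 1000) := by
      have := (hω.sub_const (1 / 6)).abs
      rw [sub_self, abs_zero] at this
      exact this.eventually_lt_const (by positivity)
    obtain ⟨p₀, q0, hq⟩ := mem_nhdsGT_iff_exists_Ioo_subset.1 (h1.and (eventually_pairState_mem hr))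
    refine ⟨min p₀ (1 / 4), lt_min q0 (by norm_num), min_le_right _ _, fun p hp hp' => ?_⟩
    obtain ⟨b1, b2⟩ := hq ⟨hp, hp'.trans_le (min_le_left _ _)⟩
    refine ⟨?_, b1.trans_le (min_le_left _ _), b2⟩
    -- That the frequency lies above 1/6 comes from the general lower bound for local states with A₂
    -- ≠ 0, not from expanding the formula in p.
    have := (hlow r hr1 _ (b1.le.trans (min_le_right _ _)) _ b2.1).1 b2.2.1
    linarith [sq_nonneg (pairState (pairScale p) p 2)]
  refine ⟨r₁, r0, fun r hr hr1 => ⟨fun d hd => ?_, ?_⟩⟩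
  · obtain ⟨p₀, q0, q1, hq⟩ := key r hr hr1 d hd
    refine ⟨p₀, q0, fun p hp hp' => ?_⟩
    obtain ⟨b1, b2, b3⟩ := hq p hp hp'
    have hp4 : p ≤ 1 / 4 := hp'.le.trans q1
    exact ⟨pairScale p, pairScale_neg hp.le hp4, pairLambda_pairScale hp.le hp4, b1.ne', b2, b3⟩
  · obtain ⟨p₀, q0, q1, hq⟩ := key r hr hr1 1 one_pos
    refine ⟨pairOmega (pairScale (p₀ / 2)) (p₀ / 2) - 1 / 6,
      sub_pos.2 (hq (p₀ / 2) (by linarith) (by linarith)).1, fun ω h1 h2 => ?_⟩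
    have hc : ContinuousOn (fun p => pairOmega (pairScale p) p) (Set.Icc 0 (p₀ / 2)) :=
      continuousOn_pairOmega.mono (Set.Icc_subset_Icc_right (by linarith))
    -- The frequency is continuous in p and equals 1/6 at p = 0, so it takes every value up to that
    -- at p₀/2. The endpoint p = 0 is excluded afterwards because ω > 1/6.
    obtain ⟨p, hp, rfl⟩ := intermediate_value_Icc (by linarith) hc
      (⟨by rw [pairOmega_zero]; exact h1.le, by linarith⟩ : ω ∈ Set.Icc _ _)
    have hp0 : 0 < p := by
      rcases hp.1.lt_or_eq with h | h
      · exact h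
      · subst h
        exact absurd pairOmega_zero h1.ne'
    exact ⟨_, (hq p hp0 (by linarith [hp.2])).2.2⟩

end

end ConformalFlow

/-! ### Assembly of existence, the pair states and the variational characterization -/

theorem mainTheorem3 :
    ∃ r₀ : ℝ, 0 < r₀ ∧ ∀ r : ℝ, 0 < r → r ≤ r₀ → ∃ δ : ℝ, 0 < δ ∧
      -- the branches are there
      (∀ ω : ℝ, 1 / 6 < ω → ω < 1 / 6 + δ →
        (ConformalFlow.branchOne r ω).Nonempty ∧
        (∃ A ∈ ConformalFlow.branchTwo r ω, 0 < A 2) ∧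
        (∃ A ∈ ConformalFlow.branchTwo r ω, A 2 < 0) ∧
        (ConformalFlow.branchThree r ω).Nonempty) ∧
      -- the explicit pair state with the upper sign, normalized by `λ = 1`, is on branch (iii)
      (∃ p₀ : ℝ, 0 < p₀ ∧ ∀ p : ℝ, 0 < p → p < p₀ →
        ∃ c : ℝ, c < 0 ∧ ConformalFlow.pairLambda c p = 1 ∧
          ConformalFlow.pairOmega c p ≠ 1 / 6 ∧ |ConformalFlow.pairOmega c p - 1 / 6| < δ ∧
          ConformalFlow.pairState c p ∈
            ConformalFlow.branchThree r (ConformalFlow.pairOmega c p)) ∧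
      -- variational characterization
      ∀ ω : ℝ, ω ≠ 1 / 6 → |ω - 1 / 6| < δ →
        (∀ A ∈ ConformalFlow.branchOne r ω,
          ConformalFlow.IsConstrainedSaddle (ConformalFlow.cplx A) ∧
          ConformalFlow.constrainedNegIndex A 1 ω = 1 ∧
          ConformalFlow.negIndex (-1) A 1 ω = 1 ∧
          ConformalFlow.DegenerateOnlyByPhases A 1 ω) ∧
        (∀ A ∈ ConformalFlow.branchTwo r ω,
          ConformalFlow.IsConstrainedSaddle (ConformalFlow.cplx A) ∧
          (0 < A 2 → ConformalFlow.constrainedNegIndex A 1 ω = 0 ∧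
            ConformalFlow.negIndex (-1) A 1 ω = 1) ∧
          (A 2 < 0 → ConformalFlow.constrainedNegIndex A 1 ω = 1 ∧
            ConformalFlow.negIndex (-1) A 1 ω = 0) ∧
          ConformalFlow.DegenerateOnlyByPhases A 1 ω) ∧
        (∀ A ∈ ConformalFlow.branchThree r ω,
          ConformalFlow.IsConstrainedMinimizer (ConformalFlow.cplx A) ∧
          ConformalFlow.constrainedNegIndex A 1 ω = 0 ∧
          ConformalFlow.negIndex (-1) A 1 ω = 0 ∧
          ConformalFlow.DegenerateOnlyByPhases A 1 ω) := by
  obtain ⟨r₁, p₁, h₁⟩ := ConformalFlow.exists_variational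
  obtain ⟨r₂, p₂, h₂⟩ := ConformalFlow.exists_pure_states
  obtain ⟨r₃, p₃, h₃⟩ := ConformalFlow.exists_pair_states
  refine ⟨min r₁ (min r₂ r₃), by positivity, fun r hr hr' => ?_⟩
  obtain ⟨hr1, hr'⟩ := le_min_iff.1 hr'
  obtain ⟨hr2, hr3⟩ := le_min_iff.1 hr'
  obtain ⟨δ₂, q₂, g₂⟩ := h₂ r hr hr2
  obtain ⟨h₃, δ₃, q₃, g₃⟩ := h₃ r hr hr3
  -- 1/1000 is the window around 1/6 in which the noncritical eigenvalues are bounded below.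
  refine ⟨min (1 / 1000) (min δ₂ δ₃), by positivity, fun ω a b => ?_, h₃ _ (by positivity),
    fun ω _ hω => h₁ r hr1 ω (hω.le.trans (min_le_left _ _))⟩
  have b₂ : ω < 1 / 6 + δ₂ := b.trans_le (by gcongr; exact (min_le_right _ _).trans (min_le_left _ _))
  have b₃ : ω < 1 / 6 + δ₃ := b.trans_le (by gcongr; exact (min_le_right _ _).trans (min_le_right _ _))
  refine ⟨?_, ?_, ?_, g₃ ω a b₃⟩
  · obtain ⟨A, hA, h3, hi⟩ := g₂ ω a b₂ 3 (Or.inr rfl) 1 (Or.inl rfl)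
    rw [one_mul] at h3
    exact ⟨A, hA, hi 2 (Or.inl rfl) (by norm_num), h3.ne'⟩
  · obtain ⟨A, hA, h2, hi⟩ := g₂ ω a b₂ 2 (Or.inl rfl) 1 (Or.inl rfl)
    rw [one_mul] at h2
    exact ⟨A, ⟨hA, h2.ne', hi 3 (Or.inr rfl) (by norm_num)⟩, h2⟩
  · obtain ⟨A, hA, h2, hi⟩ := g₂ ω a b₂ 2 (Or.inl rfl) (-1) (Or.inr rfl)
    have h2' : A 2 < 0 := by linarith
    exact ⟨A, ⟨hA, h2'.ne, hi 3 (Or.inr rfl) (by norm_num)⟩, h2'⟩
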